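/- Let $R$ be a commutative ring with identity and a fixed invertible element $q^{1/2}$; put $\overline q=q^{-1}$ and $\alpha=q+\overline q$. Let $\Sigma=\Sigma_{0,5}=\mathbb{C}\setminus\{1,2,3,4\}$ be the $5$-punctured sphere, with punctures $\mathsf p_i=i$ for $1\le i\le 4$ and the fifth puncture at infinity. Let $\mathcal S_4$ be its Kauffman bracket skein algebra over $R$: the $R$-module generated by the isotopy classes of framed links in $\Sigma\times[0,1]$ (including the empty link, which is the unit $1$), modulo the skein relations $$L=q^{1/2}L_A+q^{-1/2}L_B,\qquad L\sqcup\bigcirc=-(q+q^{-1})\,L .$$ Here $L, L_A,L_B$ are vertically framed in a box and agree outside it; in the box $L$ is a single crossing seen from above, $L_A$ is the smoothing that merges the two regions swept out when the upper strand is rotated counterclockwise, and $L_B$ is the other smoothing; $\bigcirc$ is a small circle bounding a disk disjoint from $L$, framed vertically. The product $L_1L_2$ is $L_1$ stacked above $L_2$. For a nonempty $\{i_1<\dots<i_r\}\subseteq\{1,2,3,4\}$ let $t_{i_1\cdots i_r}\in\mathcal S_4$ be represented by the simple closed curve in $\Sigma\times\{\tfrac12\}$, with vertical framing, which encircles exactly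 $\mathsf p_{i_1},\dots,\mathsf p_{i_r}$ and passes below the other punctures; that is, it meets the vertical ray $\mathsf p_j+i\,\mathbb{R}_{>0}$ exactly once if $j\in\{i_1,\dots,i_r\}$, and not at all otherwise. Let $t_0=t_{1234}$. Then the following relations hold in $\mathcal S_4$: \begin{align*} t_{13}t_{24}&=\alpha t_0+t_1t_{234}+t_2t_{134}+t_3t_{124}+t_4t_{123}+q^2t_{12}t_{34}+\overline{q}^2t_{14}t_{23}\\ &\quad+qt_3t_4t_{12}+\overline{q}t_1t_4t_{23}+qt_1t_2t_{34}+\overline{q}t_2t_3t_{14}+t_1t_2t_3t_4,\\ t_{24}t_{134}&=q^2t_{14}t_{234}+\overline{q}^2t_{34}t_{124}+(1-q^2-\overline{q}^2)t_4t_0-(q^3+\overline{q}^3)t_{123}-q^2t_1t_{23}\\ &\quad-\overline{q}^2t_3t_{12}+t_2(qt_{14}t_{34}-q^2t_{13}-qt_4t_{134})-qt_1t_2t_3,\\ t_{123}^2&=\overline{q}t_{12}t_{23}t_{13}-(t_1t_2t_3+qt_1t_{23}+\overline{q}t_2t_{13}+\overline{q}t_3t_{12})t_{123}-(t_1^2+t_2^2+t_3^2)\\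 &\quad+\alpha^2-(qt_2t_3t_{23}+\overline{q}t_1t_3t_{13}+\overline{q}t_1t_2t_{12})-(q^2t_{23}^2+\overline{q}^2t_{13}^2+\overline{q}^2t_{12}^2),\\ t_{123}t_{234}&=(t_{23}+qt_2t_3)t_0+\overline{q}t_{12}t_{23}t_{34}-\overline{q}t_3t_{12}t_{234}-qt_2t_{34}t_{123}+q^2t_2t_{124}\\ &\quad+\overline{q}^2t_3t_{134}-\overline{q}^2t_{12}t_{24}-\overline{q}^2t_{13}t_{34}+(q-\overline{q})t_2t_4t_{12}+\overline{q}^2(\alpha t_{14}+t_1t_4),\\ t_{123}t_{134}&=t_{13}t_0+t_{12}t_{14}+t_{23}t_{34}-t_1t_{124}-t_3t_{234}-\alpha t_{24}-t_2t_4,\\ t_{23}t_{34}t_{124}&=(qt_{234}+q^2t_2t_{34}+t_3t_{24}+t_4t_{23}+qt_2t_3t_4)t_0\\ &\quad+(t_2t_4+\overline{q}t_{24})t_{124}+q^3t_{34}t_{134}+\overline{q}t_{23}t_{123}+t_3t_{23}t_{12}+q^2t_3t_{14}t_{34}\\ &\quad+qt_2t_{12}-q^3t_3t_{13}+qt_4t_{14}-q^2t_1t_3^2+q\alpha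 t_1,\\ t_{14}t_{12}t_{23}t_{34}&=q^2t_0^2+q^2(\overline{q}t_1t_{234}+qt_4t_{123}+t_1t_4t_{23}-t_2t_3t_{14})t_0+t_{234}^2+q^4t_{123}^2\\ &\quad+t_3t_{14}t_{12}t_{234}+q^2t_2t_{14}t_{34}t_{123}+qt_4t_{23}t_{234}-\overline{q}t_3t_{14}t_{134}+q^3t_1t_{23}t_{123}\\ &\quad-q^3t_2t_{14}t_{124}+\overline{q}t_{14}t_{12}t_{24}+\overline{q}t_{14}t_{13}t_{34}+(1-q^2)t_2t_4t_{14}t_{12}\\ &\quad-\overline{q}^2t_{14}^2+q^2t_{23}^2+(q-\overline{q})t_1t_4t_{14}+q^2(t_1^2+t_4^2-\alpha^2). \end{align*} -/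

import Mathlib

noncomputable section

namespace Skein

open Set

/-! ### The thickened five-punctured sphere

`Σ` is the plane `ℂ` without the four points `1, 2, 3, 4` (the fifth puncture is at infinity), and
`Σ × [0,1]` is regarded as a subset of `ℂ × ℝ`. -/

/-- The four finite punctures. -/
def punctures : Set ℂ := {1, 2, 3, 4}

/-- The interior `Σ × (0,1)` of the thickened surface. -/
def thickened : Set (ℂ × ℝ) := {p | p.1 ∉ punctures ∧ 0 < p.2 ∧ p.2 < 1}

/-! ### Framed links and ambient isotopy -/

/-- A (tame) framed link in `Σ × (0,1)`: finitely many disjoint circles (the core), each running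
along the middle of an embedded annulus (the band) which records the framing.  Tameness: the
annuli extend to disjoint embedded solid tori `Circle × [-2,2] × [-2,2]`, in which the core is
`Circle × 0 × 0` and the band is `Circle × [-1,1] × 0`. -/
def IsFramedLink (core band : Set (ℂ × ℝ)) : Prop :=
  ∃ (ι : Type) (_ : Finite ι) (f : ι → Circle × ℝ × ℝ → ℂ × ℝ),
    (∀ i, ContinuousOn (f i) {p | |p.2.1| ≤ 2 ∧ |p.2.2| ≤ 2}) ∧
    (∀ i j p p', |p.2.1| ≤ 2 → |p.2.2| ≤ 2 → |p'.2.1| ≤ 2 → |p'.2.2| ≤ 2 →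
      f i p = f j p' → i = j ∧ p = p') ∧
    (∀ i p, |p.2.1| ≤ 2 → |p.2.2| ≤ 2 → f i p ∈ thickened) ∧
    core = ⋃ i, f i '' {p | p.2.1 = 0 ∧ p.2.2 = 0} ∧
    band = ⋃ i, f i '' {p | |p.2.1| ≤ 1 ∧ p.2.2 = 0}

/-- Framed links in `Σ × (0,1)`. -/
structure FramedLink where
  core : Set (ℂ × ℝ)
  band : Set (ℂ × ℝ)
  isFramedLink : IsFramedLink core band

/-- `φ` is the end of an ambient isotopy of `Σ × [0,1]` relative to `Σ × {0,1}`.  The isotopies are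
written as isotopies of `ℂ × ℝ` that preserve each line over a puncture and fix every point whose
height is not in `(0,1)`; they include all isotopies with compact support in `Σ × (0,1)`. -/
def IsotopicToId (φ : ℂ × ℝ ≃ₜ ℂ × ℝ) : Prop :=
  ∃ H : unitInterval → (ℂ × ℝ ≃ₜ ℂ × ℝ),
    Continuous (fun x : unitInterval × (ℂ × ℝ) => H x.1 x.2) ∧
    (∀ t p, ¬ (0 < p.2 ∧ p.2 < 1) → H t p = p) ∧
    (∀ t p, ∀ w ∈ punctures, (H t p).1 = w ↔ p.1 = w) ∧
    H 0 = Homeomorph.refl _ ∧ H 1 = φ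

/-- Ambient isotopy of framed links. -/
def Isotopic (L L' : FramedLink) : Prop :=
  ∃ φ, IsotopicToId φ ∧ φ '' L.core = L'.core ∧ φ '' L.band = L'.band

theorem IsotopicToId.refl : IsotopicToId (Homeomorph.refl _) :=
  ⟨fun _ => Homeomorph.refl _, continuous_snd, fun _ _ _ => rfl, fun _ _ _ _ => Iff.rfl, rfl, rfl⟩

theorem IsotopicToId.trans {φ ψ : ℂ × ℝ ≃ₜ ℂ × ℝ} (hφ : IsotopicToId φ) (hψ : IsotopicToId ψ) :
    IsotopicToId (φ.trans ψ) := by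
  obtain ⟨H, hc, hf, hp, h0, h1⟩ := hφ
  obtain ⟨G, gc, gf, gp, g0, g1⟩ := hψ
  refine ⟨fun t => (H t).trans (G t), ?_, ?_, ?_, ?_, ?_⟩
  · exact gc.comp (continuous_fst.prodMk hc)
  · intro t p h
    simp only [Homeomorph.trans_apply]
    rw [hf t p h, gf t p h]
  · intro t p w hw
    simp only [Homeomorph.trans_apply]
    rw [gp t _ w hw, hp t p w hw]
  · simp only [h0, g0]; rfl
  · simp only [h1, g1]

theorem IsotopicToId.symm {φ : ℂ × ℝ ≃ₜ ℂ × ℝ} (hφ : IsotopicToId φ) : IsotopicToId φ.symm := by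
  obtain ⟨H, hc, hf, hp, h0, h1⟩ := hφ
  have hf' : ∀ p : ℂ × ℝ, ¬ (0 < p.2 ∧ p.2 < 1) → φ.symm p = p := by
    intro p h
    rw [Homeomorph.symm_apply_eq, ← h1, hf 1 p h]
  have hp' : ∀ p : ℂ × ℝ, ∀ w ∈ punctures, (φ.symm p).1 = w ↔ p.1 = w := by
    intro p w hw
    rw [← hp 1 (φ.symm p) w hw, h1, Homeomorph.apply_symm_apply]
  refine ⟨fun t => φ.symm.trans (H (unitInterval.symm t)), ?_, ?_, ?_, ?_, ?_⟩
  · exact hc.comp ((unitInterval.continuous_symm.comp continuous_fst).prodMk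
      (φ.symm.continuous.comp continuous_snd))
  · intro t p h
    simp only [Homeomorph.trans_apply]
    rw [hf' p h, hf _ p h]
  · intro t p w hw
    simp only [Homeomorph.trans_apply]
    rw [hp _ _ w hw, hp' p w hw]
  · ext1 p
    simp [h1]
  · ext1 p
    simp [h0]

theorem isotopic_refl (L : FramedLink) : Isotopic L L :=
  ⟨_, IsotopicToId.refl, by simp, by simp⟩

theorem isotopic_symm {L L' : FramedLink} (h : Isotopic L L') : Isotopic L' L := by
  obtain ⟨φ, hφ, hc, hb⟩ := h
  refine ⟨φ.symm, hφ.symm, ?_, ?_⟩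
  · rw [← hc, ← image_comp]; simp
  · rw [← hb, ← image_comp]; simp

theorem isotopic_trans {L L' L'' : FramedLink} (h : Isotopic L L') (h' : Isotopic L' L'') :
    Isotopic L L'' := by
  obtain ⟨φ, hφ, hc, hb⟩ := h
  obtain ⟨ψ, hψ, hc', hb'⟩ := h'
  refine ⟨φ.trans ψ, hφ.trans hψ, ?_, ?_⟩
  · rw [← hc', ← hc, ← image_comp]; rfl
  · rw [← hb', ← hb, ← image_comp]; rfl

instance linkSetoid : Setoid FramedLink :=
  ⟨Isotopic, isotopic_refl, isotopic_symm, isotopic_trans⟩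

/-! ### Stacking -/

/-- The affine map `(w, z) ↦ (w, (z + k) / 2)`; for `k = 1` and `k = 0` it maps `Σ × (0,1)` onto its
upper and lower half. -/
def squeeze (k : ℝ) : ℂ × ℝ ≃ₜ ℂ × ℝ where
  toFun p := (p.1, (p.2 + k) / 2)
  invFun p := (p.1, 2 * p.2 - k)
  left_inv p := by ext <;> simp; ring
  right_inv p := by ext <;> simp
  continuous_toFun := by fun_prop
  continuous_invFun := by fun_prop

@[simp] theorem squeeze_apply (k : ℝ) (p : ℂ × ℝ) : squeeze k p = (p.1, (p.2 + k) / 2) := rfl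

@[simp] theorem squeeze_symm_apply (k : ℝ) (p : ℂ × ℝ) :
    (squeeze k).symm p = (p.1, 2 * p.2 - k) := rfl

theorem isFramedLink_stack (L L' : FramedLink) :
    IsFramedLink (squeeze 1 '' L.core ∪ squeeze 0 '' L'.core)
      (squeeze 1 '' L.band ∪ squeeze 0 '' L'.band) := by
  obtain ⟨ι, _, f, fc, fi, fm, hc, hb⟩ := L.isFramedLink
  obtain ⟨ι', _, f', fc', fi', fm', hc', hb'⟩ := L'.isFramedLink
  refine ⟨ι ⊕ ι', inferInstance,
    Sum.elim (fun i => squeeze 1 ∘ f i) (fun i => squeeze 0 ∘ f' i), ?_, ?_, ?_, ?_, ?_⟩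
  · rintro (i | i)
    · exact (squeeze 1).continuous.comp_continuousOn (fc i)
    · exact (squeeze 0).continuous.comp_continuousOn (fc' i)
  · rintro (i | i) (j | j) p p' h1 h2 h3 h4 h
    · have := fi i j p p' h1 h2 h3 h4 ((squeeze 1).injective h)
      exact ⟨congrArg _ this.1, this.2⟩
    · have a := (fm i p h1 h2).2.1
      have b := (fm' j p' h3 h4).2.2
      have c := congrArg Prod.snd h
      simp at c
      linarith
    · have a := (fm' i p h1 h2).2.2
      have b := (fm j p' h3 h4).2.1
      have c := congrArg Prod.snd h
      simp at c
      linarith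
    · have := fi' i j p p' h1 h2 h3 h4 ((squeeze 0).injective h)
      exact ⟨congrArg _ this.1, this.2⟩
  · rintro (i | i) p h1 h2
    · obtain ⟨a, b, c⟩ := fm i p h1 h2
      refine ⟨a, ?_, ?_⟩ <;> simp <;> linarith
    · obtain ⟨a, b, c⟩ := fm' i p h1 h2
      refine ⟨a, ?_, ?_⟩ <;> simp <;> linarith
  · rw [iUnion_sum, hc, hc', image_iUnion, image_iUnion]
    simp only [Sum.elim_inl, Sum.elim_inr, image_comp]
  · rw [iUnion_sum, hb, hb', image_iUnion, image_iUnion]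
    simp only [Sum.elim_inl, Sum.elim_inr, image_comp]

/-- `stack L L'` puts `L` above `L'`. -/
def stack (L L' : FramedLink) : FramedLink where
  core := squeeze 1 '' L.core ∪ squeeze 0 '' L'.core
  band := squeeze 1 '' L.band ∪ squeeze 0 '' L'.band
  isFramedLink := isFramedLink_stack L L'

/-- The empty link. -/
def emptyLink : FramedLink where
  core := ∅
  band := ∅
  isFramedLink := ⟨Empty, inferInstance, fun i => i.elim, fun i => i.elim, fun i => i.elim,
    fun i => i.elim, by simp, by simp⟩

theorem FramedLink.core_subset (L : FramedLink) : L.core ⊆ L.band := by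
  obtain ⟨ι, _, f, fc, fi, fm, hc, hb⟩ := L.isFramedLink
  rw [hc, hb]
  refine iUnion_mono fun i => image_mono ?_
  rintro p ⟨h1, h2⟩
  exact ⟨by simp [h1], h2⟩

theorem FramedLink.band_subset (L : FramedLink) : L.band ⊆ thickened := by
  obtain ⟨ι, _, f, fc, fi, fm, hc, hb⟩ := L.isFramedLink
  rw [hb]
  refine iUnion_subset fun i => ?_
  rintro _ ⟨p, ⟨h1, h2⟩, rfl⟩
  exact fm i p (by linarith) (by simp [h2])

theorem FramedLink.isCompact_band (L : FramedLink) : IsCompact L.band := by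
  obtain ⟨ι, _, f, fc, fi, fm, hc, hb⟩ := L.isFramedLink
  rw [hb]
  refine isCompact_iUnion fun i => IsCompact.image_of_continuousOn ?_ ((fc i).mono ?_)
  · have : {p : Circle × ℝ × ℝ | |p.2.1| ≤ 1 ∧ p.2.2 = 0} =
        univ ×ˢ (Icc (-1) 1 ×ˢ {0}) := by
      ext p; simp [abs_le]
    rw [this]
    exact isCompact_univ.prod (isCompact_Icc.prod isCompact_singleton)
  · rintro p ⟨h1, h2⟩
    exact ⟨by linarith, by simp [h2]⟩

theorem FramedLink.exists_height (L : FramedLink) :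
    ∃ ε : ℝ, 0 < ε ∧ ε < 1 ∧ ∀ p ∈ L.band, ε ≤ p.2 ∧ p.2 ≤ 1 - ε := by
  rcases L.band.eq_empty_or_nonempty with h | h
  · exact ⟨1 / 2, by norm_num, by norm_num, by simp [h]⟩
  · obtain ⟨a, ha, ha'⟩ := L.isCompact_band.exists_isMinOn h continuous_snd.continuousOn
    obtain ⟨b, hb, hb'⟩ := L.isCompact_band.exists_isMaxOn h continuous_snd.continuousOn
    have h1 := L.band_subset ha
    have h2 := L.band_subset hb
    refine ⟨min a.2 (1 - b.2), lt_min h1.2.1 (by linarith [h2.2.2]),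
      lt_of_le_of_lt (min_le_left _ _) h1.2.2, fun p hp => ⟨?_, ?_⟩⟩
    · exact (min_le_left _ _).trans (ha' hp)
    · have : p.2 ≤ b.2 := hb' hp
      linarith [min_le_right a.2 (1 - b.2)]

theorem isotopicToId_squeeze {φ : ℂ × ℝ ≃ₜ ℂ × ℝ} (hφ : IsotopicToId φ) {k : ℝ}
    (hk : k = 0 ∨ k = 1) :
    IsotopicToId (((squeeze k).symm.trans φ).trans (squeeze k)) := by
  obtain ⟨H, hc, hf, hp, h0, h1⟩ := hφ
  refine ⟨fun t => ((squeeze k).symm.trans (H t)).trans (squeeze k), ?_, ?_, ?_, ?_, ?_⟩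
  · exact (squeeze k).continuous.comp
      (hc.comp (continuous_fst.prodMk ((squeeze k).symm.continuous.comp continuous_snd)))
  · intro t p h
    have : ¬ (0 < ((squeeze k).symm p).2 ∧ ((squeeze k).symm p).2 < 1) := by
      rintro ⟨a, b⟩
      simp at a b
      apply h
      rcases hk with rfl | rfl <;> constructor <;> linarith
    simp only [Homeomorph.trans_apply]
    rw [hf t _ this, Homeomorph.apply_symm_apply]
  · intro t p w hw
    simpa using hp t ((squeeze k).symm p) w hw
  · ext1 p
    simp only [h0, Homeomorph.trans_apply]
    exact (squeeze k).apply_symm_apply p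
  · simp only [h1]

theorem isotopicToId_squeeze_fix {φ : ℂ × ℝ ≃ₜ ℂ × ℝ} (hφ : IsotopicToId φ) {k : ℝ} {p : ℂ × ℝ}
    (hp : ¬ (k < 2 * p.2 ∧ 2 * p.2 < k + 1)) :
    ((squeeze k).symm.trans φ).trans (squeeze k) p = p := by
  obtain ⟨H, -, hf, -, -, h1⟩ := hφ
  have : ¬ (0 < ((squeeze k).symm p).2 ∧ ((squeeze k).symm p).2 < 1) := by
    rintro ⟨a, b⟩
    simp at a b
    exact hp ⟨by linarith, by linarith⟩
  simp only [Homeomorph.trans_apply]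
  rw [← h1, hf 1 _ this, Homeomorph.apply_symm_apply]

theorem stack_congr {L₁ L₁' L₂ L₂' : FramedLink} (h₁ : Isotopic L₁ L₁') (h₂ : Isotopic L₂ L₂') :
    Isotopic (stack L₁ L₂) (stack L₁' L₂') := by
  have key1 : Isotopic (stack L₁ L₂) (stack L₁' L₂) := by
    obtain ⟨φ, hφ, hc, hb⟩ := h₁
    have e1 : ∀ S : Set (ℂ × ℝ), (((squeeze 1).symm.trans φ).trans (squeeze 1)) ''
        (squeeze 1 '' S) = squeeze 1 '' (φ '' S) := by
      intro S
      simp only [← image_comp]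
      refine image_congr fun p _ => ?_
      simp only [Function.comp, Homeomorph.trans_apply, Homeomorph.symm_apply_apply]
    have e2 : ∀ S ⊆ thickened, (((squeeze 1).symm.trans φ).trans (squeeze 1)) ''
        (squeeze 0 '' S) = squeeze 0 '' S := by
      intro S hS
      rw [← image_comp]
      refine image_congr fun p hp => ?_
      apply isotopicToId_squeeze_fix hφ
      have := (hS hp).2.2
      simp only [squeeze_apply]
      rintro ⟨a, b⟩
      linarith
    refine ⟨_, isotopicToId_squeeze hφ (Or.inr rfl), ?_, ?_⟩
    · simp only [stack, image_union]
      rw [e1, e2 _ (L₂.core_subset.trans L₂.band_subset), hc]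
    · simp only [stack, image_union]
      rw [e1, e2 _ L₂.band_subset, hb]
  have key2 : Isotopic (stack L₁' L₂) (stack L₁' L₂') := by
    obtain ⟨φ, hφ, hc, hb⟩ := h₂
    have e1 : ∀ S : Set (ℂ × ℝ), (((squeeze 0).symm.trans φ).trans (squeeze 0)) ''
        (squeeze 0 '' S) = squeeze 0 '' (φ '' S) := by
      intro S
      simp only [← image_comp]
      refine image_congr fun p _ => ?_
      simp only [Function.comp, Homeomorph.trans_apply, Homeomorph.symm_apply_apply]
    have e2 : ∀ S ⊆ thickened, (((squeeze 0).symm.trans φ).trans (squeeze 0)) ''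
        (squeeze 1 '' S) = squeeze 1 '' S := by
      intro S hS
      rw [← image_comp]
      refine image_congr fun p hp => ?_
      apply isotopicToId_squeeze_fix hφ
      have := (hS hp).2.1
      simp only [squeeze_apply]
      rintro ⟨a, b⟩
      linarith
    refine ⟨_, isotopicToId_squeeze hφ (Or.inl rfl), ?_, ?_⟩
    · simp only [stack, image_union]
      rw [e1, e2 _ (L₁'.core_subset.trans L₁'.band_subset), hc]
    · simp only [stack, image_union]
      rw [e1, e2 _ L₁'.band_subset, hb]
  exact isotopic_trans key1 key2

theorem strictMono_max {f g : ℝ → ℝ} (hf : StrictMono f) (hg : StrictMono g) :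
    StrictMono (fun x => max (f x) (g x)) := fun _ _ h => max_lt_max (hf h) (hg h)

theorem strictMono_min {f g : ℝ → ℝ} (hf : StrictMono f) (hg : StrictMono g) :
    StrictMono (fun x => min (f x) (g x)) := fun _ _ h => min_lt_min (hf h) (hg h)

/-- A change of the height coordinate that fixes all heights outside `(0,1)` is isotopic to the
identity, through convex combinations. -/
theorem exists_height_isotopy (g : ℝ → ℝ) (hg : StrictMono g) (hc : Continuous g)
    (hfix : ∀ x, ¬ (0 < x ∧ x < 1) → g x = x) :
    ∃ φ, IsotopicToId φ ∧ ∀ p, φ p = (p.1, g p.2) := by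
  have mono : ∀ t : unitInterval, StrictMono (fun x => (1 - (t : ℝ)) * x + t * g x) := by
    intro t x y hxy
    have h1 := t.2.1
    have h2 := t.2.2
    have h3 := hg hxy
    rcases h1.lt_or_eq with h | h
    · have := mul_lt_mul_of_pos_left h3 h
      have := mul_le_mul_of_nonneg_left hxy.le (sub_nonneg.2 h2)
      simp only
      linarith
    · simp only [← h]
      linarith
  have cont : ∀ t : unitInterval, Continuous (fun x => (1 - (t : ℝ)) * x + t * g x) := by
    intro t; fun_prop
  have fix : ∀ (t : unitInterval) (x : ℝ), ¬ (0 < x ∧ x < 1) →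
      (1 - (t : ℝ)) * x + t * g x = x := by
    intro t x hx
    rw [hfix x hx]; ring
  have surj : ∀ t : unitInterval,
      Function.Surjective (fun x => (1 - (t : ℝ)) * x + t * g x) := by
    intro t
    apply (cont t).surjective
    · refine Filter.tendsto_id.congr' ?_
      filter_upwards [Filter.eventually_ge_atTop 1] with x hx
      exact (fix t x (fun h => by linarith [h.2])).symm
    · refine Filter.tendsto_id.congr' ?_
      filter_upwards [Filter.eventually_le_atBot 0] with x hx
      exact (fix t x (fun h => by linarith [h.1])).symm
  let G : unitInterval → (ℂ × ℝ ≃ₜ ℂ × ℝ) := fun t =>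
    (Homeomorph.refl ℂ).prodCongr
      ((mono t).orderIsoOfSurjective _ (surj t)).toHomeomorph
  have hG : ∀ t p, G t p = (p.1, (1 - (t : ℝ)) * p.2 + t * g p.2) := fun t p => rfl
  refine ⟨G 1, ⟨G, ?_, ?_, ?_, ?_, rfl⟩, ?_⟩
  · simp only [hG]
    fun_prop
  · intro t p h
    rw [hG, fix t _ h]
  · intro t p w _
    rw [hG]
  · ext1 p
    rw [hG]; simp
  · intro p
    rw [hG]; simp

theorem stack_assoc (L₁ L₂ L₃ : FramedLink) :
    Isotopic (stack (stack L₁ L₂) L₃) (stack L₁ (stack L₂ L₃)) := by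
  let g : ℝ → ℝ := fun x => max (min x (x / 2)) (max (min x (x - 1 / 4)) (min x (2 * x - 1)))
  have hmono : StrictMono g := by
    refine strictMono_max ?_ (strictMono_max ?_ ?_) <;>
    · refine strictMono_min strictMono_id ?_
      intro x y h
      simp only
      linarith
  have hcont : Continuous g := by fun_prop
  have hfix : ∀ x, ¬ (0 < x ∧ x < 1) → g x = x := by
    intro x hx
    simp only [g]
    rcases le_or_gt x 0 with h | h
    · rw [min_eq_left (by linarith), max_eq_left]
      exact max_le (min_le_left _ _) (min_le_left _ _)
    · have h1 : 1 ≤ x := by by_contra h'; exact hx ⟨h, by linarith⟩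
      rw [min_eq_left (b := 2 * x - 1) (by linarith), max_eq_right (a := min x (x - 1 / 4)),
        max_eq_right]
      · exact min_le_left _ _
      · exact min_le_left _ _
  have g1 : ∀ x, 0 < x → x < 1 → g ((x + 0) / 2) = ((x + 0) / 2 + 0) / 2 := by
    intro x h h'
    simp only [g, max_def, min_def]
    split_ifs <;> linarith
  have g2 : ∀ x, 0 < x → x < 1 → g (((x + 0) / 2 + 1) / 2) = ((x + 1) / 2 + 0) / 2 := by
    intro x h h'
    simp only [g, max_def, min_def]
    split_ifs <;> linarith
  have g3 : ∀ x, 0 < x → x < 1 → g (((x + 1) / 2 + 1) / 2) = (x + 1) / 2 := by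
    intro x h h'
    simp only [g, max_def, min_def]
    split_ifs <;> linarith
  obtain ⟨φ, hφ, hφg⟩ := exists_height_isotopy g hmono hcont hfix
  have main : ∀ S₁ ⊆ thickened, ∀ S₂ ⊆ thickened, ∀ S₃ ⊆ thickened,
      φ '' (squeeze 1 '' (squeeze 1 '' S₁ ∪ squeeze 0 '' S₂) ∪ squeeze 0 '' S₃) =
      squeeze 1 '' S₁ ∪ squeeze 0 '' (squeeze 1 '' S₂ ∪ squeeze 0 '' S₃) := by
    intro S₁ h₁ S₂ h₂ S₃ h₃
    simp only [image_union, ← image_comp, union_assoc]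
    congr 1
    · refine image_congr fun p hp => ?_
      simp only [Function.comp, hφg, squeeze_apply]
      rw [g3 _ (h₁ hp).2.1 (h₁ hp).2.2]
    congr 1
    · refine image_congr fun p hp => ?_
      simp only [Function.comp, hφg, squeeze_apply]
      rw [g2 _ (h₂ hp).2.1 (h₂ hp).2.2]
    · refine image_congr fun p hp => ?_
      simp only [Function.comp, hφg, squeeze_apply]
      rw [g1 _ (h₃ hp).2.1 (h₃ hp).2.2]
  exact ⟨φ, hφ, main _ (L₁.core_subset.trans L₁.band_subset) _
    (L₂.core_subset.trans L₂.band_subset) _ (L₃.core_subset.trans L₃.band_subset),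
    main _ L₁.band_subset _ L₂.band_subset _ L₃.band_subset⟩

theorem empty_stack (L : FramedLink) : Isotopic (stack emptyLink L) L := by
  obtain ⟨ε, h0, h1, hε⟩ := L.exists_height
  apply isotopic_symm
  let g : ℝ → ℝ := fun x => max (min x (x / 2)) (min x (1 - (1 + ε) / (2 * ε) * (1 - x)))
  have hk : 1 < (1 + ε) / (2 * ε) := by rw [lt_div_iff₀ (by linarith)]; linarith
  have hkε : (1 + ε) / (2 * ε) * ε = (1 + ε) / 2 := by field_simp
  have hmono : StrictMono g := by
    refine strictMono_max ?_ ?_ <;> refine strictMono_min strictMono_id ?_ <;>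
      intro x y h <;> simp only
    · linarith
    · have := mul_lt_mul_of_pos_left h (by linarith : 0 < (1 + ε) / (2 * ε))
      linarith
  have hcont : Continuous g := by fun_prop
  have hfix : ∀ x, ¬ (0 < x ∧ x < 1) → g x = x := by
    intro x hx
    simp only [g]
    rcases le_or_gt x 0 with h | h
    · rw [min_eq_left (by linarith), max_eq_left]
      exact min_le_left _ _
    · have h1 : 1 ≤ x := by by_contra h'; exact hx ⟨h, by linarith⟩
      rw [min_eq_left (b := 1 - (1 + ε) / (2 * ε) * (1 - x)) (by nlinarith), max_eq_right]
      exact min_le_left _ _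
  have hgx : ∀ x, ε ≤ x → x ≤ 1 - ε → g x = (x + 0) / 2 := by
    intro x hx hx'
    simp only [g]
    rw [min_eq_right (b := x / 2) (by linarith), max_eq_left]
    · ring
    · refine (min_le_right _ _).trans ?_
      have e : (1 + ε) / (2 * ε) * (1 - x) =
        (1 + ε) / 2 + (1 + ε) / (2 * ε) * (1 - ε - x) := by rw [← hkε]; ring
      rw [e]
      nlinarith
  obtain ⟨φ, hφ, hφg⟩ := exists_height_isotopy g hmono hcont hfix
  have main : ∀ S ⊆ L.band, φ '' S = squeeze 1 '' ∅ ∪ squeeze 0 '' S := by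
    intro S hS
    rw [image_empty, empty_union]
    refine image_congr fun p hp => ?_
    rw [hφg, squeeze_apply, hgx _ (hε p (hS hp)).1 (hε p (hS hp)).2]
  exact ⟨φ, hφ, main _ L.core_subset, main _ subset_rfl⟩

theorem stack_empty (L : FramedLink) : Isotopic (stack L emptyLink) L := by
  obtain ⟨ε, h0, h1, hε⟩ := L.exists_height
  apply isotopic_symm
  let g : ℝ → ℝ := fun x => min (max x ((x + 1) / 2)) (max x ((1 + ε) / (2 * ε) * x))
  have hk : 1 < (1 + ε) / (2 * ε) := by rw [lt_div_iff₀ (by linarith)]; linarith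
  have hkε : (1 + ε) / (2 * ε) * ε = (1 + ε) / 2 := by field_simp
  have hmono : StrictMono g := by
    refine strictMono_min ?_ ?_ <;> refine strictMono_max strictMono_id ?_ <;>
      intro x y h
    · simp only
      linarith
    · exact mul_lt_mul_of_pos_left h (by linarith : 0 < (1 + ε) / (2 * ε))
  have hcont : Continuous g := by fun_prop
  have hfix : ∀ x, ¬ (0 < x ∧ x < 1) → g x = x := by
    intro x hx
    simp only [g]
    rcases le_or_gt x 0 with h | h
    · rw [max_eq_left (b := (1 + ε) / (2 * ε) * x) (by nlinarith), min_eq_right]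
      exact le_max_left _ _
    · have h1 : 1 ≤ x := by by_contra h'; exact hx ⟨h, by linarith⟩
      rw [max_eq_left (b := (x + 1) / 2) (by linarith), min_eq_left]
      exact le_max_left _ _
  have hgx : ∀ x, ε ≤ x → x ≤ 1 - ε → g x = (x + 1) / 2 := by
    intro x hx hx'
    simp only [g]
    rw [max_eq_right (b := (x + 1) / 2) (by linarith), min_eq_left]
    refine le_trans ?_ (le_max_right _ _)
    have e : (1 + ε) / (2 * ε) * x = (1 + ε) / 2 + (1 + ε) / (2 * ε) * (x - ε) := by
      rw [← hkε]; ring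
    rw [e]
    nlinarith
  obtain ⟨φ, hφ, hφg⟩ := exists_height_isotopy g hmono hcont hfix
  have main : ∀ S ⊆ L.band, φ '' S = squeeze 1 '' S ∪ squeeze 0 '' ∅ := by
    intro S hS
    rw [image_empty, union_empty]
    refine image_congr fun p hp => ?_
    rw [hφg, squeeze_apply, hgx _ (hε p (hS hp)).1 (hε p (hS hp)).2]
  exact ⟨φ, hφ, main _ L.core_subset, main _ subset_rfl⟩

/-- Isotopy classes of framed links in the thickened five-punctured sphere. -/
def LinkClass : Type := Quotient linkSetoid

/-- The isotopy class of a framed link. -/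
def FramedLink.cls (L : FramedLink) : LinkClass := Quotient.mk linkSetoid L

/-- Isotopy classes of framed links form a monoid: the product `L L'` is `L` stacked above `L'`,
and the unit is the empty link. -/
instance : Monoid LinkClass where
  mul := Quotient.map₂ stack fun _ _ h _ _ h' => stack_congr h h'
  one := emptyLink.cls
  mul_assoc := by
    rintro ⟨a⟩ ⟨b⟩ ⟨c⟩
    exact Quotient.sound (stack_assoc a b c)
  one_mul := by
    rintro ⟨a⟩
    exact Quotient.sound (empty_stack a)
  mul_one := by
    rintro ⟨a⟩
    exact Quotient.sound (stack_empty a)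

/-! ### The skein relations -/

/-- The cube `[-k,k]³` in `ℂ × ℝ`. -/
def cube (k : ℝ) : Set (ℂ × ℝ) := {p | |p.1.re| ≤ k ∧ |p.1.im| ≤ k ∧ |p.2| ≤ k}

/-- An orientation-preserving chart: a similarity in the direction of the surface (for `a ≠ 0`), and
an increasing affine map in the direction of the height (for `0 < r`). -/
def chart (c a : ℂ) (h r : ℝ) (p : ℂ × ℝ) : ℂ × ℝ := (c + a * p.1, h + r * p.2)

/-- The standard crossing, seen from above: the strand along the real axis, at height `1/2`, passes
over the strand along the imaginary axis, at height `-1/2`.  In this picture and the next ones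
`r = 0` gives the core and `r = 1/4` the band, with the framing pointing vertically. -/
def crossing (r : ℝ) : Set (ℂ × ℝ) :=
  {p ∈ cube 2 | (p.1.im = 0 ∧ |p.2 - 1 / 2| ≤ r) ∨ (p.1.re = 0 ∧ |p.2 + 1 / 2| ≤ r)}

/-- The smoothing of the crossing that merges the two regions swept out when the upper strand is
rotated counterclockwise (the first and the third quadrant): it joins the end `-1` of the upper
strand to the end `i` of the lower strand, and the end `1` to the end `-i`. -/
def smoothingA (r : ℝ) : Set (ℂ × ℝ) :=
  {p | |p.1.re| + |p.1.im| = 1 ∧ p.1.re * p.1.im ≤ 0 ∧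
    |p.2 - (|p.1.re| - |p.1.im|) / 2| ≤ r}

/-- The other smoothing: it joins the end `1` to the end `i`, and the end `-1` to the end `-i`. -/
def smoothingB (r : ℝ) : Set (ℂ × ℝ) :=
  {p | |p.1.re| + |p.1.im| = 1 ∧ 0 ≤ p.1.re * p.1.im ∧
    |p.2 - (|p.1.re| - |p.1.im|) / 2| ≤ r}

/-- A small round circle in a horizontal plane, with the vertical framing. -/
def smallCircle (r : ℝ) : Set (ℂ × ℝ) := {p | ‖p.1‖ = 1 / 2 ∧ |p.2| ≤ r}

/-- In the cube `e '' cube k` the framed link `L` is the standard picture `T`. -/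
def LooksLike (L : FramedLink) (e : ℂ × ℝ → ℂ × ℝ) (k : ℝ) (T : ℝ → Set (ℂ × ℝ)) : Prop :=
  L.core ∩ e '' cube k = e '' T 0 ∧ L.band ∩ e '' cube k = e '' T (1 / 4)

/-- The framed links `L` and `L'` agree outside `B`. -/
def AgreeOutside (B : Set (ℂ × ℝ)) (L L' : FramedLink) : Prop :=
  L.core \ B = L'.core \ B ∧ L.band \ B = L'.band \ B

/-- `L` has a crossing in some box, and `LA` and `LB` arise from `L` by the two smoothings of this
crossing. -/
def IsKauffmanTriple (L LA LB : FramedLink) : Prop :=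
  ∃ (c a : ℂ) (h r : ℝ), a ≠ 0 ∧ 0 < r ∧ chart c a h r '' cube 2 ⊆ thickened ∧
    LooksLike L (chart c a h r) 2 crossing ∧
    AgreeOutside (chart c a h r '' cube 1) L LA ∧ LooksLike LA (chart c a h r) 1 smoothingA ∧
    AgreeOutside (chart c a h r '' cube 1) L LB ∧ LooksLike LB (chart c a h r) 1 smoothingB

/-- `L'` consists of `L` and a small circle that lies in some box disjoint from `L`. -/
def IsLoopPair (L' L : FramedLink) : Prop :=
  ∃ (c a : ℂ) (h r : ℝ), a ≠ 0 ∧ 0 < r ∧ chart c a h r '' cube 1 ⊆ thickened ∧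
    LooksLike L' (chart c a h r) 1 smallCircle ∧
    LooksLike L (chart c a h r) 1 (fun _ => ∅) ∧
    AgreeOutside (chart c a h r '' cube 1) L' L

/-- The skein relations, with `s = q^{1/2}`. -/
inductive SkeinRel (R : Type*) [CommRing R] (s : Rˣ) :
    MonoidAlgebra R LinkClass → MonoidAlgebra R LinkClass → Prop
  | crossing (L LA LB : FramedLink) (h : IsKauffmanTriple L LA LB) :
      SkeinRel R s (MonoidAlgebra.of R LinkClass L.cls)
        ((s : R) • MonoidAlgebra.of R LinkClass LA.cls +
          ((s⁻¹ : Rˣ) : R) • MonoidAlgebra.of R LinkClass LB.cls)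
  | loop (L' L : FramedLink) (h : IsLoopPair L' L) :
      SkeinRel R s (MonoidAlgebra.of R LinkClass L'.cls)
        (-((s : R) ^ 2 + ((s⁻¹ : Rˣ) : R) ^ 2) • MonoidAlgebra.of R LinkClass L.cls)

/-- The Kauffman bracket skein algebra of the five-punctured sphere over `R`, with `s = q^{1/2}`: the
free `R`-module on the isotopy classes of framed links, with the product given by stacking, modulo
the skein relations.  (A link stacked above or below the links of a skein relation gives again a
skein relation, so the `R`-span of the relations is the two-sided ideal that they generate.) -/
abbrev SkeinAlgebra (R : Type*) [CommRing R] (s : Rˣ) : Type _ := RingQuot (SkeinRel R s)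

/-- The element of the skein algebra represented by a framed link. -/
def FramedLink.toSkein (R : Type*) [CommRing R] (s : Rˣ) (L : FramedLink) : SkeinAlgebra R s :=
  RingQuot.mkAlgHom R (SkeinRel R s) (MonoidAlgebra.of R LinkClass L.cls)

/-! ### The generators -/

/-- A piecewise linear function with value `-1` at the points `j ∈ {1,2,3,4}` that are not in `I`, and
`0` at those in `I`. -/
def dip (I : Finset ℕ) (x : ℝ) : ℝ :=
  -∑ j ∈ Finset.Icc 1 4 \ I, max 0 (1 - |x - (j : ℝ)|)

/-- The simple closed curve encircling exactly the punctures `i ∈ I`.  It is the image of the boundary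
of the rectangle `[1/2, 9/2] × [-1/2, 1/2]` under the shear `(x, y) ↦ (x, y + dip I x)`.  So it passes
below the punctures that are not in `I`, and among the vertical rays going up from the punctures it
meets exactly those of the punctures in `I`, once each. -/
def curve (I : Finset ℕ) : Set ℂ :=
  {w | max (|w.re - 5 / 2| / 2) (|w.im - dip I w.re| * 2) = 1}

theorem continuous_dip (I : Finset ℕ) : Continuous (dip I) := by
  unfold dip
  fun_prop

theorem dip_of_mem {I : Finset ℕ} {i : ℕ} (hi : i ∈ I) : dip I i = 0 := by
  unfold dip
  rw [neg_eq_zero]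
  refine Finset.sum_eq_zero fun j hj => ?_
  have hne : i ≠ j := by
    rintro rfl
    exact (Finset.mem_sdiff.1 hj).2 hi
  have h : (1 : ℤ) ≤ |(i : ℤ) - j| := Int.one_le_abs (by omega)
  have h' : (1 : ℝ) ≤ |(i : ℝ) - j| := by exact_mod_cast h
  exact max_eq_left (by linarith)

theorem dip_of_notMem {I : Finset ℕ} {i : ℕ} (h1 : 1 ≤ i) (h4 : i ≤ 4) (hi : i ∉ I) :
    dip I i = -1 := by
  unfold dip
  have hmem : i ∈ Finset.Icc 1 4 \ I := by simp [h1, h4, hi]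
  rw [Finset.sum_eq_single_of_mem i hmem]
  · simp
  · intro j _ hne
    have h : (1 : ℤ) ≤ |(i : ℤ) - j| := Int.one_le_abs (by omega)
    have h' : (1 : ℝ) ≤ |(i : ℝ) - j| := by exact_mod_cast h
    exact max_eq_left (by linarith)

/-- The gauge of the sheared rectangle. -/
def gauge (I : Finset ℕ) (w : ℂ) : ℝ := max (|w.re - 5 / 2| / 2) (|w.im - dip I w.re| * 2)

theorem gauge_puncture (I : Finset ℕ) {w : ℂ} (hw : w ∈ punctures) :
    gauge I w ≤ 3 / 4 ∨ 2 ≤ gauge I w := by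
  have key : ∀ i : ℕ, 1 ≤ i → i ≤ 4 → gauge I (i : ℂ) ≤ 3 / 4 ∨ 2 ≤ gauge I (i : ℂ) := by
    intro i h1 h4
    by_cases hi : i ∈ I
    · left
      simp only [gauge, Complex.natCast_re, Complex.natCast_im, dip_of_mem hi]
      have a : (1 : ℝ) ≤ i := by exact_mod_cast h1
      have b : (i : ℝ) ≤ 4 := by exact_mod_cast h4
      have c : |(i : ℝ) - 5 / 2| ≤ 3 / 2 := abs_le.2 ⟨by linarith, by linarith⟩
      exact max_le (by linarith) (by norm_num)
    · right
      simp only [gauge, Complex.natCast_re, Complex.natCast_im, dip_of_notMem h1 h4 hi]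
      exact le_max_of_le_right (by norm_num)
  rcases hw with rfl | rfl | rfl | rfl
  · simpa using key 1 (by norm_num) (by norm_num)
  · simpa using key 2 (by norm_num) (by norm_num)
  · simpa using key 3 (by norm_num) (by norm_num)
  · simpa using key 4 (by norm_num) (by norm_num)

/-- The sup norm on the unit circle. -/
def supNorm (θ : Circle) : ℝ := max |(θ : ℂ).re| |(θ : ℂ).im|

theorem supNorm_pos (θ : Circle) : 0 < supNorm θ := by
  by_contra h
  have h1 : |(θ : ℂ).re| ≤ 0 := (le_max_left _ _).trans (not_lt.1 h)
  have h2 : |(θ : ℂ).im| ≤ 0 := (le_max_right _ _).trans (not_lt.1 h)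
  have h3 : (θ : ℂ) = 0 := Complex.ext (abs_nonpos_iff.1 h1) (abs_nonpos_iff.1 h2)
  exact θ.coe_ne_zero h3

theorem continuous_supNorm : Continuous supNorm := by
  unfold supNorm
  fun_prop

/-- A point of the sheared rectangle of scale `ρ`. -/
def rectPoint (I : Finset ℕ) (θ : Circle) (ρ : ℝ) : ℂ :=
  ⟨5 / 2 + 2 * ρ * ((θ : ℂ).re / supNorm θ),
    ρ / 2 * ((θ : ℂ).im / supNorm θ) + dip I (5 / 2 + 2 * ρ * ((θ : ℂ).re / supNorm θ))⟩

theorem continuous_rectPoint (I : Finset ℕ) :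
    Continuous (fun x : Circle × ℝ => rectPoint I x.1 x.2) := by
  have h1 : Continuous (fun x : Circle × ℝ => supNorm x.1) := continuous_supNorm.comp continuous_fst
  have h0 : ∀ x : Circle × ℝ, supNorm x.1 ≠ 0 := fun x => (supNorm_pos _).ne'
  have hr : Continuous (fun x : Circle × ℝ => (x.1 : ℂ).re / supNorm x.1) :=
    Continuous.div (by fun_prop) h1 h0
  have hi : Continuous (fun x : Circle × ℝ => (x.1 : ℂ).im / supNorm x.1) :=
    Continuous.div (by fun_prop) h1 h0
  have hx : Continuous (fun x : Circle × ℝ => 5 / 2 + 2 * x.2 * ((x.1 : ℂ).re / supNorm x.1)) := by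
    fun_prop
  have hy : Continuous (fun x : Circle × ℝ => x.2 / 2 * ((x.1 : ℂ).im / supNorm x.1) +
      dip I (5 / 2 + 2 * x.2 * ((x.1 : ℂ).re / supNorm x.1))) := by
    have := (continuous_dip I).comp hx
    simp only [Function.comp_def] at this
    fun_prop
  exact Complex.equivRealProdCLM.symm.continuous.comp (hx.prodMk hy)

theorem gauge_rectPoint (I : Finset ℕ) (θ : Circle) {ρ : ℝ} (hρ : 0 < ρ) :
    gauge I (rectPoint I θ ρ) = ρ := by
  have h := supNorm_pos θ
  have e1 : |5 / 2 + 2 * ρ * ((θ : ℂ).re / supNorm θ) - 5 / 2| / 2 =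
      ρ / supNorm θ * |(θ : ℂ).re| := by
    rw [add_sub_cancel_left, abs_mul, abs_div, abs_of_pos h, abs_of_pos (by linarith : 0 < 2 * ρ)]
    ring
  have e2 : |ρ / 2 * ((θ : ℂ).im / supNorm θ) +
      dip I (5 / 2 + 2 * ρ * ((θ : ℂ).re / supNorm θ)) -
      dip I (5 / 2 + 2 * ρ * ((θ : ℂ).re / supNorm θ))| * 2 = ρ / supNorm θ * |(θ : ℂ).im| := by
    rw [add_sub_cancel_right, abs_mul, abs_of_pos (by linarith : 0 < ρ / 2), abs_div, abs_of_pos h]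
    ring
  simp only [gauge, rectPoint]
  rw [e1, e2, ← mul_max_of_nonneg _ _ (by positivity)]
  change ρ / supNorm θ * supNorm θ = ρ
  field_simp

theorem circle_eq_of_mul {θ θ' : Circle} {k : ℝ} (hk : 0 < k) (h : (θ : ℂ) = k * (θ' : ℂ)) :
    θ = θ' := by
  have h1 := congrArg (fun z : ℂ => ‖z‖) h
  simp only [Circle.norm_coe, norm_mul, Complex.norm_real, Real.norm_eq_abs, mul_one,
    abs_of_pos hk] at h1
  rw [← h1, Complex.ofReal_one, one_mul] at h
  exact Circle.ext h

theorem rectPoint_injective (I : Finset ℕ) {θ θ' : Circle} {ρ ρ' : ℝ} (hρ : 0 < ρ) (hρ' : 0 < ρ')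
    (h : rectPoint I θ ρ = rectPoint I θ' ρ') : θ = θ' ∧ ρ = ρ' := by
  have hh : ρ = ρ' := by
    rw [← gauge_rectPoint I θ hρ, h, gauge_rectPoint I θ' hρ']
  subst hh
  refine ⟨?_, rfl⟩
  have hs := supNorm_pos θ
  have hs' := supNorm_pos θ'
  have hre : (θ : ℂ).re / supNorm θ = (θ' : ℂ).re / supNorm θ' := by
    have := congrArg Complex.re h
    simp only [rectPoint] at this
    have h2 := add_left_cancel this
    exact mul_left_cancel₀ (by positivity) h2
  have him : (θ : ℂ).im / supNorm θ = (θ' : ℂ).im / supNorm θ' := by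
    have := congrArg Complex.im h
    simp only [rectPoint] at this
    rw [hre] at this
    have h2 := add_right_cancel this
    exact mul_left_cancel₀ (by positivity) h2
  apply circle_eq_of_mul (div_pos hs hs')
  rw [div_eq_iff hs.ne'] at hre him
  apply Complex.ext
  · rw [Complex.re_ofReal_mul, hre]; ring
  · rw [Complex.im_ofReal_mul, him]; ring

theorem exists_rectPoint (I : Finset ℕ) {w : ℂ} (hw : w ∈ curve I) : ∃ θ, rectPoint I θ 1 = w := by
  have hw' : max (|w.re - 5 / 2| / 2) (|w.im - dip I w.re| * 2) = 1 := hw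
  set v : ℂ := ⟨(w.re - 5 / 2) / 2, (w.im - dip I w.re) * 2⟩ with hv
  have hmax : max |v.re| |v.im| = 1 := by
    simp only [hv, abs_div, abs_mul, abs_two]
    exact hw'
  have hv0 : v ≠ 0 := by
    intro h
    rw [h] at hmax
    simp at hmax
  have hn : 0 < ‖v‖ := norm_pos_iff.2 hv0
  let θ : Circle := ⟨(((‖v‖⁻¹ : ℝ)) : ℂ) * v, by
    rw [Submonoid.unitSphere, Submonoid.mem_mk]
    simp [hn.ne']⟩
  have hre : (θ : ℂ).re = ‖v‖⁻¹ * v.re := Complex.re_ofReal_mul _ _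
  have him : (θ : ℂ).im = ‖v‖⁻¹ * v.im := Complex.im_ofReal_mul _ _
  have hs : supNorm θ = ‖v‖⁻¹ := by
    unfold supNorm
    rw [hre, him, abs_mul, abs_mul, abs_of_pos (inv_pos.2 hn),
      ← mul_max_of_nonneg _ _ (inv_pos.2 hn).le, hmax, mul_one]
  have h1 : (θ : ℂ).re / supNorm θ = v.re := by rw [hre, hs]; field_simp
  have h2 : (θ : ℂ).im / supNorm θ = v.im := by rw [him, hs]; field_simp
  have hx : 5 / 2 + 2 * 1 * v.re = w.re := by simp only [hv]; ring
  refine ⟨θ, ?_⟩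
  apply Complex.ext
  · simp only [rectPoint]
    rw [h1, hx]
  · simp only [rectPoint]
    rw [h1, h2, hx]
    simp only [hv]
    ring

theorem rectPoint_mem_curve (I : Finset ℕ) (θ : Circle) : rectPoint I θ 1 ∈ curve I :=
  gauge_rectPoint I θ one_pos

theorem isFramedLink_curve (I : Finset ℕ) :
    IsFramedLink {p | p.1 ∈ curve I ∧ p.2 = 1 / 2} {p | p.1 ∈ curve I ∧ |p.2 - 1 / 2| ≤ 1 / 8} := by
  refine ⟨Unit, inferInstance,
    fun _ p => (rectPoint I p.1 (1 + p.2.2 / 16), 1 / 2 + p.2.1 / 8), ?_, ?_, ?_, ?_, ?_⟩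
  · intro _
    refine Continuous.continuousOn ?_
    have := (continuous_rectPoint I).comp
      (f := fun p : Circle × ℝ × ℝ => (p.1, 1 + p.2.2 / 16)) (by fun_prop)
    simp only [Function.comp_def] at this
    fun_prop
  · rintro _ _ ⟨θ, u, v⟩ ⟨θ', u', v'⟩ h1 h2 h3 h4 h
    simp only [abs_le, Prod.mk.injEq] at h1 h2 h3 h4 h
    obtain ⟨a, b⟩ := rectPoint_injective I (by linarith) (by linarith) h.1
    refine ⟨rfl, ?_⟩
    simp only [Prod.mk.injEq]
    exact ⟨a, by linarith [h.2], by linarith⟩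
  · rintro _ ⟨θ, u, v⟩ h1 h2
    simp only [abs_le] at h1 h2
    refine ⟨fun hw => ?_, ?_, ?_⟩
    · have := gauge_puncture I hw
      simp only at this
      rw [gauge_rectPoint I θ (by linarith)] at this
      rcases this with h | h <;> linarith
    · simp only; linarith
    · simp only; linarith
  · ext ⟨w, z⟩
    simp only [mem_ofPred_eq, mem_iUnion, mem_image, Prod.mk.injEq]
    constructor
    · rintro ⟨hw, hz⟩
      obtain ⟨θ, hθ⟩ := exists_rectPoint I hw
      exact ⟨(), (θ, 0, 0), ⟨rfl, rfl⟩, by simpa using hθ, by simp [hz]⟩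
    · rintro ⟨_, ⟨θ, u, v⟩, ⟨hu, hv⟩, h1, h2⟩
      simp only at hu hv h1 h2
      subst hu hv
      refine ⟨?_, by simpa using h2.symm⟩
      rw [← h1]
      simpa using rectPoint_mem_curve I θ
  · ext ⟨w, z⟩
    simp only [mem_ofPred_eq, mem_iUnion, mem_image, Prod.mk.injEq]
    constructor
    · rintro ⟨hw, hz⟩
      obtain ⟨θ, hθ⟩ := exists_rectPoint I hw
      refine ⟨(), (θ, 8 * (z - 1 / 2), 0), ⟨?_, rfl⟩, by simpa using hθ, by simp only; ring⟩
      simp only [abs_mul]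
      rw [abs_of_pos (by norm_num : (0 : ℝ) < 8)]
      linarith
    · rintro ⟨_, ⟨θ, u, v⟩, ⟨hu, hv⟩, h1, h2⟩
      simp only at hu hv h1 h2
      subst hv
      refine ⟨?_, ?_⟩
      · rw [← h1]
        simpa using rectPoint_mem_curve I θ
      · rw [← h2, add_sub_cancel_left, abs_div, abs_of_pos (by norm_num : (0 : ℝ) < 8)]
        linarith

/-- The curve encircling the punctures in `I`, at height `1/2`, with the vertical framing. -/
def curveLink (I : Finset ℕ) : FramedLink where
  core := {p | p.1 ∈ curve I ∧ p.2 = 1 / 2}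
  band := {p | p.1 ∈ curve I ∧ |p.2 - 1 / 2| ≤ 1 / 8}
  isFramedLink := isFramedLink_curve I

/-- The generator `t_I` of the skein algebra. -/
def gen (R : Type*) [CommRing R] (s : Rˣ) (I : Finset ℕ) : SkeinAlgebra R s :=
  (curveLink I).toSkein R s

end Skein

end

noncomputable section
namespace Skein
open Set Topology



open scoped NNReal

/-- The space in which links live, with the height as last coordinate. -/
notation "𝕊" => ℂ × ℝ

/-- The unit interval as a set of real numbers. -/
notation "𝕀" => Icc (0 : ℝ) 1

/-- A list of chords, each given by its ends on the axis. -/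
abbrev Chords := List (ℕ × ℕ)

/-- The chords below (`false`) and above (`true`) the axis. -/
abbrev Diagram := Bool → Chords

/-! ### Isotopies from Lipschitz displacements -/

theorem isOpen_thickened : IsOpen thickened := by
  have h : IsClosed punctures := by
    unfold punctures; exact (Set.toFinite _).isClosed
  have h1 : IsOpen {p : 𝕊 | p.1 ∉ punctures} := h.isOpen_compl.preimage continuous_fst
  have h2 : IsOpen {p : 𝕊 | 0 < p.2} := isOpen_lt continuous_const continuous_snd
  have h3 : IsOpen {p : 𝕊 | p.2 < 1} := isOpen_lt continuous_snd continuous_const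
  have : thickened = {p : 𝕊 | p.1 ∉ punctures} ∩ ({p | 0 < p.2} ∩ {p | p.2 < 1}) := by
    ext p; rfl
  rw [this]; exact h1.inter (h2.inter h3)

/-- The identity plus a contraction is a homeomorphism. -/
def addContraction (V : 𝕊 → 𝕊) (c : ℝ≥0) (hc : c < 1) (hV : LipschitzWith c V) :
    𝕊 ≃ₜ 𝕊 :=
  ApproximatesLinearOn.toHomeomorph (fun p => p + V p)
    (f' := ContinuousLinearEquiv.refl ℝ 𝕊) (c := c)
    (fun x _ y _ => by
      have := hV.norm_sub_le x y
      simpa [add_sub_add_comm] using this)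
    (.inr (by
      have : ‖(ContinuousLinearMap.id ℝ 𝕊)‖₊ = 1 := by
        ext; simp
      simp [this, hc]))

theorem exists_isotopy_of_contraction (V : 𝕊 → 𝕊) (c : ℝ≥0) (hc : c < 1)
    (hV : LipschitzWith c V) (h0 : ∀ p ∉ thickened, V p = 0) :
    ∃ φ, IsotopicToId φ ∧ ∀ p, φ p = p + V p := by
  have lip : ∀ t : unitInterval, LipschitzWith c (fun p => (t : ℝ) • V p) := by
    intro t; refine LipschitzWith.of_dist_le_mul fun x y => ?_
    rw [dist_smul₀, Real.norm_of_nonneg t.2.1]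
    refine (mul_le_of_le_one_left dist_nonneg t.2.2).trans (hV.dist_le_mul x y)
  let H : unitInterval → (𝕊 ≃ₜ 𝕊) := fun t => addContraction _ c hc (lip t)
  have hH : ∀ t p, H t p = p + (t : ℝ) • V p := fun t p => rfl
  have fix : ∀ t, ∀ p ∉ thickened, H t p = p := by
    intro t p hp; rw [hH, h0 p hp]; simp
  refine ⟨H 1, ⟨H, ?_, ?_, ?_, ?_, rfl⟩, ?_⟩
  · simp only [hH]; have := hV.continuous; fun_prop
  · intro t p hp; exact fix t p fun h => hp h.2
  · intro t p w hw; constructor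
    · intro h; have h' := fix t (H t p) fun h' => h'.1 (by rw [h]; exact hw)
      rw [← (H t).injective h', h]
    · intro h; rw [fix t p fun h' => h'.1 (by rw [h]; exact hw), h]
  · ext1 p
    simp [hH]
  · intro p; simp [hH]

/-- Linear isotopy extension: if the displacement is controlled by the distances at every time, a
linear motion of a compact set is induced by an ambient isotopy. -/
theorem exists_linear_isotopy {X : Type*} [TopologicalSpace X] [CompactSpace X]
    (F G : X → 𝕊) (hF : Continuous F) (hG : Continuous G)
    (hlip : ∀ τ ∈ 𝕀, ∃ C : ℝ, ∀ a b, ‖G a - G b‖ ≤ C * ‖(F a + τ • G a) - (F b + τ • G b)‖)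
    (hin : ∀ τ ∈ 𝕀, ∀ a, F a + τ • G a ∈ thickened) :
    ∃ φ, IsotopicToId φ ∧ ∀ a, φ (F a) = F a + G a := by
  obtain ⟨M, hM0, hM⟩ : ∃ M : ℝ, 0 ≤ M ∧ ∀ a, ‖G a‖ ≤ M := by
    obtain ⟨M, hM⟩ := (isCompact_range hG).isBounded.exists_norm_le
    exact ⟨max M 0, le_max_right _ _, fun a => (hM _ ⟨a, rfl⟩).trans (le_max_left _ _)⟩
  let P : ℝ → ℝ → Prop := fun σ τ =>
    ∃ φ, IsotopicToId φ ∧ ∀ a, φ (F a + σ • G a) = F a + τ • G a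
  have hP : P 0 1 := by
    refine isPreconnected_Icc.induction₂ P (s := 𝕀) ?_ ?_ ?_ (by simp) (by simp)
    · intro σ hσ; obtain ⟨C, hC⟩ := hlip σ hσ
      have hcont : Continuous fun a => F a + σ • G a := by fun_prop
      obtain ⟨η, hη, hη'⟩ : ∃ η : ℝ, 0 < η ∧ ∀ a, ∀ q ∉ thickened,
          η ≤ ‖(F a + σ • G a) - q‖ := by
        have hsub : range (fun a => F a + σ • G a) ⊆ thickened := by
          rintro _ ⟨a, rfl⟩; exact hin σ hσ a
        obtain ⟨η, hη, h⟩ := (isCompact_range hcont).exists_thickening_subset_open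
          isOpen_thickened hsub
        refine ⟨η, hη, fun a q hq => ?_⟩; by_contra hlt
        refine hq (h (Metric.mem_thickening_iff.2 ⟨_, ⟨a, rfl⟩, ?_⟩)); rw [dist_comm, dist_eq_norm]
        exact not_le.1 hlt
      let A : Set 𝕊 := range (fun a => F a + σ • G a) ∪ thickenedᶜ
      let κ : ℝ≥0 := lipschitzExtensionConstant 𝕊
      let D : ℝ := max C (M / η)
      have hD : 0 ≤ D := le_max_of_le_right (by positivity)
      -- the velocity field
      have hvel : ∃ v : 𝕊 → 𝕊, (∀ a, v (F a + σ • G a) = G a) ∧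
          (∀ q ∉ thickened, v q = 0) := by
        classical
        refine ⟨fun p => if h : ∃ a, F a + σ • G a = p then G h.choose else 0, ?_, ?_⟩
        · intro a; have h : ∃ b, F b + σ • G b = F a + σ • G a := ⟨a, rfl⟩
          simp only [dif_pos h]; have := hC h.choose a
          rw [h.choose_spec, sub_self, norm_zero, mul_zero] at this
          exact sub_eq_zero.1 (norm_le_zero_iff.1 this)
        · intro q hq; apply dif_neg; rintro ⟨a, rfl⟩; exact hq (hin σ hσ a)
      obtain ⟨v, hv, hv0⟩ := hvel
      have hvlip : ∀ p ∈ A, ∀ q ∈ A, ‖v p - v q‖ ≤ D * ‖p - q‖ := by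
        have aux : ∀ a, ∀ q ∉ thickened,
            ‖G a‖ ≤ D * ‖(F a + σ • G a) - q‖ := by
          intro a q hq
          calc ‖G a‖ ≤ M := hM a
            _ = M / η * η := by field_simp
            _ ≤ D * ‖(F a + σ • G a) - q‖ :=
              mul_le_mul (le_max_right _ _) (hη' a q hq) hη.le hD
        rintro p (⟨a, rfl⟩ | hp) q (⟨b, rfl⟩ | hq)
        · simp only [hv]
          exact (hC a b).trans (mul_le_mul_of_nonneg_right (le_max_left _ _) (norm_nonneg _))
        · simp only [hv, hv0 q hq, sub_zero]; exact aux a q hq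
        · simp only [hv, hv0 p hp, zero_sub, norm_neg]; rw [norm_sub_rev]; exact aux b p hp
        · rw [hv0 p hp, hv0 q hq, sub_self, norm_zero]; positivity
      have hlim : Filter.Tendsto (fun τ : ℝ => (κ : ℝ) * (|τ - σ| * D)) (𝓝 σ) (𝓝 0) := by
        have : Continuous fun τ : ℝ => (κ : ℝ) * (|τ - σ| * D) := by fun_prop
        simpa using this.tendsto σ
      have hev : ∀ᶠ τ in 𝓝 σ, (κ : ℝ) * (|τ - σ| * D) < 1 :=
        hlim.eventually (gt_mem_nhds one_pos)
      refine (hev.filter_mono nhdsWithin_le_nhds).mono fun τ hτ => ?_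
      have hlipon : LipschitzOnWith (Real.toNNReal (|τ - σ| * D))
          (fun p => (τ - σ) • v p) A := by
        refine LipschitzOnWith.of_dist_le_mul fun p hp q hq => ?_
        rw [Real.coe_toNNReal _ (by positivity), dist_eq_norm, dist_eq_norm, ← smul_sub,
          norm_smul, Real.norm_eq_abs, mul_assoc]
        exact mul_le_mul_of_nonneg_left (hvlip p hp q hq) (abs_nonneg _)
      obtain ⟨V, hV, hVA⟩ := hlipon.extend_finite_dimension
      obtain ⟨φ, hφ, hφV⟩ := exists_isotopy_of_contraction V _ (by
          rw [← NNReal.coe_lt_coe, NNReal.coe_mul, Real.coe_toNNReal _ (by positivity)]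
          exact hτ) hV (fun p hp => by
            rw [← hVA (.inr hp)]
            simp [hv0 p hp])
      refine ⟨φ, hφ, fun a => ?_⟩; rw [hφV, ← hVA (.inl ⟨a, rfl⟩)]; simp only [hv, sub_smul]; abel
    · rintro σ τ υ - - - ⟨φ, hφ, h⟩ ⟨ψ, hψ, h'⟩; refine ⟨φ.trans ψ, hφ.trans hψ, fun a => ?_⟩
      rw [Homeomorph.trans_apply, h, h']
    · rintro σ τ - - ⟨φ, hφ, h⟩; refine ⟨φ.symm, hφ.symm, fun a => ?_⟩
      rw [← h, Homeomorph.symm_apply_apply]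
  obtain ⟨φ, hφ, h⟩ := hP; exact ⟨φ, hφ, fun a => by simpa using h a⟩

/-! ### Transport of framed links -/

theorem IsotopicToId.mem_thickened_iff {φ : 𝕊 ≃ₜ 𝕊} (hφ : IsotopicToId φ) (p : 𝕊) :
    φ p ∈ thickened ↔ p ∈ thickened := by
  obtain ⟨H, -, hf, hp, -, h1⟩ := hφ; subst h1
  have hpun : (H 1 p).1 ∈ punctures ↔ p.1 ∈ punctures :=
    ⟨fun h => by rw [(hp 1 p _ h).1 rfl]; exact h, fun h => by rw [(hp 1 p _ h).2 rfl]; exact h⟩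
  have hht : (0 < (H 1 p).2 ∧ (H 1 p).2 < 1) ↔ (0 < p.2 ∧ p.2 < 1) := by
    constructor
    · intro h; by_contra h'; rw [hf 1 p h'] at h; exact h' h
    · intro h; by_contra h'; rw [← (H 1).injective (hf 1 _ h')] at h; exact h' h
  exact and_congr (not_congr hpun) hht

theorem IsFramedLink.image {core band : Set 𝕊} (h : IsFramedLink core band)
    {φ : 𝕊 ≃ₜ 𝕊} (hφ : IsotopicToId φ) : IsFramedLink (φ '' core) (φ '' band) := by
  obtain ⟨ι, hι, f, fc, fi, fm, hc, hb⟩ := h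
  refine ⟨ι, hι, fun i => φ ∘ f i, fun i => φ.continuous.comp_continuousOn (fc i), ?_, ?_, ?_, ?_⟩
  · intro i j p p' h1 h2 h3 h4 h; exact fi i j p p' h1 h2 h3 h4 (φ.injective h)
  · intro i p h1 h2; exact (hφ.mem_thickened_iff _).2 (fm i p h1 h2)
  · rw [hc, image_iUnion]; simp only [image_comp]
  · rw [hb, image_iUnion]; simp only [image_comp]

theorem Isotopic.toSkein_eq {L L' : FramedLink} (h : Isotopic L L') (R : Type*) [CommRing R]
    (s : Rˣ) : L.toSkein R s = L'.toSkein R s := by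
  unfold FramedLink.toSkein FramedLink.cls; rw [Quotient.sound (s := linkSetoid) h]




/-! ### Moving walls

A wall is the vertical thickening of a segment. -/

/-- The point with parameters `t` (along the segment) and `u` (in the vertical direction) of the wall
of half-width `w` over the segment from `P` to `Q`. -/
def wallPt (P Q : 𝕊) (w t u : ℝ) : 𝕊 :=
  ((1 - t) • P.1 + t • Q.1, (1 - t) * P.2 + t * Q.2 + u * w)

/-- The wall of half-width `w` over the segment from `P` to `Q`. -/
def wall (P Q : 𝕊) (w : ℝ) : Set 𝕊 :=
  {p | ∃ t ∈ 𝕀, ∃ u ∈ Icc (-1 : ℝ) 1, p = wallPt P Q w t u}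

theorem wallPt_swap (P Q : 𝕊) (w t u : ℝ) : wallPt Q P w (1 - t) u = wallPt P Q w t u := by
  unfold wallPt; rw [sub_sub_cancel, add_comm (t • Q.1), add_comm (t * Q.2)]

theorem wall_symm (P Q : 𝕊) (w : ℝ) : wall P Q w = wall Q P w := by
  have h : ∀ P Q : 𝕊, wall P Q w ⊆ wall Q P w := by
    rintro P Q _ ⟨t, ht, u, hu, rfl⟩
    exact ⟨1 - t, ⟨by linarith [ht.2], by linarith [ht.1]⟩, u, hu, (wallPt_swap P Q w t u).symm⟩
  exact (h P Q).antisymm (h Q P)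

/-- The segments from `p` to `q` and to `q'` leave `p` in different directions. -/
def Transv (p q q' : ℂ) : Prop :=
  ∀ t t' : ℝ, 0 ≤ t → 0 ≤ t' → t • (q - p) = t' • (q' - p) → t = 0 ∧ t' = 0

/-- The walls over two edges `ab` and `a'b'` of a graph with vertices at `pos` are disjoint, or equal,
or they meet exactly over a common vertex. -/
def EdgeOK {V : Type*} (pos : V → 𝕊) (w : ℝ) (a b a' b' : V) : Prop :=
  Disjoint (wall (pos a) (pos b) w) (wall (pos a') (pos b') w) ∨
  ((a = a' ∧ b = b' ∨ a = b' ∧ b = a') ∧ (pos a).1 ≠ (pos b).1) ∨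
  (a = a' ∧ Transv (pos a).1 (pos b).1 (pos b').1) ∨
  (a = b' ∧ Transv (pos a).1 (pos b).1 (pos a').1) ∨
  (b = a' ∧ Transv (pos b).1 (pos a).1 (pos b').1) ∨
  (b = b' ∧ Transv (pos b).1 (pos a).1 (pos a').1)

/-- Linear motion from `P` to `P'`. -/
def mov (P P' : 𝕊) (τ : ℝ) : 𝕊 := P + τ • (P' - P)

theorem continuous_wallPt (P Q : 𝕊) (w : ℝ) :
    Continuous fun x : ℝ × ℝ => wallPt P Q w x.1 x.2 := by
  unfold wallPt; fun_prop

theorem isCompact_wall (P Q : 𝕊) (w : ℝ) : IsCompact (wall P Q w) := by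
  have : wall P Q w = (fun x : ℝ × ℝ => wallPt P Q w x.1 x.2) ''
      (𝕀 ×ˢ Icc (-1 : ℝ) 1) := by
    ext p; constructor
    · rintro ⟨t, ht, u, hu, rfl⟩; exact ⟨(t, u), ⟨ht, hu⟩, rfl⟩
    · rintro ⟨⟨t, u⟩, ⟨ht, hu⟩, rfl⟩; exact ⟨t, ht, u, hu, rfl⟩
  rw [this]; exact (isCompact_Icc.prod isCompact_Icc).image (continuous_wallPt P Q w)

theorem wallPt_mov (P P' Q Q' : 𝕊) (w w' τ t u : ℝ) :
    wallPt (mov P P' τ) (mov Q Q' τ) (w + τ * (w' - w)) t u =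
      wallPt P Q w t u + τ • wallPt (P' - P) (Q' - Q) (w' - w) t u := by
  unfold wallPt mov; apply Prod.ext
  · simp only [Prod.fst_add, Prod.smul_fst, Prod.fst_sub, Complex.real_smul]; push_cast; ring
  · simp only [Prod.snd_add, Prod.smul_snd, Prod.snd_sub, smul_eq_mul]; ring

theorem wallPt_sub_wallPt (P P' Q Q' : 𝕊) (w w' t u : ℝ) :
    wallPt P Q w t u + wallPt (P' - P) (Q' - Q) (w' - w) t u = wallPt P' Q' w' t u := by
  have := wallPt_mov P P' Q Q' w w' 1 t u; simpa [mov] using this.symm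

theorem norm_le_fst_add_snd (p : 𝕊) : ‖p‖ ≤ ‖p.1‖ + |p.2| := by
  rw [Prod.norm_def]
  exact max_le (le_add_of_nonneg_right (abs_nonneg _)) (le_add_of_nonneg_left (norm_nonneg _))

theorem Transv.exists_le {p q q' : ℂ} (h : Transv p q q') :
    ∃ c > 0, ∀ t t' : ℝ, 0 ≤ t → 0 ≤ t' → c * (t + t') ≤ ‖t • (q - p) - t' • (q' - p)‖ := by
  obtain ⟨m, hm, hmin⟩ := isCompact_Icc.exists_isMinOn (s := 𝕀)
    ⟨0, by simp⟩ (f := fun x : ℝ => ‖x • (q - p) - (1 - x) • (q' - p)‖) (by fun_prop)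
  have hpos : 0 < ‖m • (q - p) - (1 - m) • (q' - p)‖ := by
    rw [norm_pos_iff, sub_ne_zero]; intro h'
    obtain ⟨h1, h2⟩ := h m (1 - m) hm.1 (by linarith [hm.2]) h'; linarith
  refine ⟨_, hpos, fun t t' ht ht' => ?_⟩; rcases (add_nonneg ht ht').eq_or_lt with h0 | h0
  · rw [← h0, mul_zero]; exact norm_nonneg _
  · have h1 : ‖m • (q - p) - (1 - m) • (q' - p)‖ ≤
        ‖(t / (t + t')) • (q - p) - (1 - t / (t + t')) • (q' - p)‖ :=
      hmin ⟨by positivity, (div_le_one h0).2 (by linarith)⟩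
    have h2 : t • (q - p) - t' • (q' - p) =
        (t + t') • ((t / (t + t')) • (q - p) - (1 - t / (t + t')) • (q' - p)) := by
      have hC : ((t : ℂ) + t') ≠ 0 := by exact_mod_cast h0.ne'
      simp only [Complex.real_smul]; push_cast; field_simp; ring
    rw [h2, norm_smul, Real.norm_of_nonneg h0.le, mul_comm]
    exact mul_le_mul_of_nonneg_left h1 h0.le

/-- The displacements of the points of two walls are bounded by the distances of the points. -/
def Controlled (P Q P' Q' dP dQ dP' dQ' : 𝕊) (w dw : ℝ) : Prop :=
  ∃ C : ℝ, ∀ t ∈ 𝕀, ∀ t' ∈ 𝕀, ∀ u ∈ Icc (-1 : ℝ) 1, ∀ u' ∈ Icc (-1 : ℝ) 1,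
    ‖wallPt dP dQ dw t u - wallPt dP' dQ' dw t' u'‖ ≤
      C * ‖wallPt P Q w t u - wallPt P' Q' w t' u'‖

theorem Controlled.swap_left {P Q P' Q' dP dQ dP' dQ' : 𝕊} {w dw : ℝ}
    (h : Controlled P Q P' Q' dP dQ dP' dQ' w dw) :
    Controlled Q P P' Q' dQ dP dP' dQ' w dw := by
  obtain ⟨C, hC⟩ := h; refine ⟨C, fun t ht t' ht' u hu u' hu' => ?_⟩
  rw [← wallPt_swap dQ, ← wallPt_swap Q]
  exact hC (1 - t) ⟨by linarith [ht.2], by linarith [ht.1]⟩ t' ht' u hu u' hu'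

theorem Controlled.swap_right {P Q P' Q' dP dQ dP' dQ' : 𝕊} {w dw : ℝ}
    (h : Controlled P Q P' Q' dP dQ dP' dQ' w dw) :
    Controlled P Q Q' P' dP dQ dQ' dP' w dw := by
  obtain ⟨C, hC⟩ := h; refine ⟨C, fun t ht t' ht' u hu u' hu' => ?_⟩
  rw [← wallPt_swap dQ', ← wallPt_swap Q']
  exact hC t ht (1 - t') ⟨by linarith [ht'.2], by linarith [ht'.1]⟩ u hu u' hu'

theorem controlled_of_eq {P Q : 𝕊} (dP dQ : 𝕊) {w : ℝ} (dw : ℝ) (hw : 0 < w)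
    (h : P.1 ≠ Q.1) : Controlled P Q P Q dP dQ dP dQ w dw := by
  have hc : 0 < ‖Q.1 - P.1‖ := norm_pos_iff.2 (sub_ne_zero.2 h.symm)
  refine ⟨‖dQ.1 - dP.1‖ / ‖Q.1 - P.1‖ + |dQ.2 - dP.2| / ‖Q.1 - P.1‖ +
    (1 + |Q.2 - P.2| / ‖Q.1 - P.1‖) / w * |dw|, ?_⟩
  intro t _ t' _ u _ u' _; set N := ‖wallPt P Q w t u - wallPt P Q w t' u'‖
  have e1 : (wallPt P Q w t u - wallPt P Q w t' u').1 = (t - t') • (Q.1 - P.1) := by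
    simp only [wallPt, Prod.fst_sub, Complex.real_smul]; push_cast; ring
  have e2 : (wallPt P Q w t u - wallPt P Q w t' u').2 = (t - t') * (Q.2 - P.2) + (u - u') * w := by
    simp only [wallPt, Prod.snd_sub]; ring
  have d1 : (wallPt dP dQ dw t u - wallPt dP dQ dw t' u').1 = (t - t') • (dQ.1 - dP.1) := by
    simp only [wallPt, Prod.fst_sub, Complex.real_smul]; push_cast; ring
  have d2 : (wallPt dP dQ dw t u - wallPt dP dQ dw t' u').2 =
      (t - t') * (dQ.2 - dP.2) + (u - u') * dw := by
    simp only [wallPt, Prod.snd_sub]; ring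
  have n1 : |t - t'| * ‖Q.1 - P.1‖ ≤ N := by
    rw [← Real.norm_eq_abs, ← norm_smul, ← e1]; exact norm_fst_le (_ : 𝕊)
  have n2 : |(t - t') * (Q.2 - P.2) + (u - u') * w| ≤ N := by
    rw [← e2]; exact norm_snd_le (_ : 𝕊)
  have ht : |t - t'| ≤ N / ‖Q.1 - P.1‖ := (le_div_iff₀ hc).2 n1
  have hu : |u - u'| ≤ (N + N / ‖Q.1 - P.1‖ * |Q.2 - P.2|) / w := by
    rw [le_div_iff₀ hw]
    have : |u - u'| * w = |((t - t') * (Q.2 - P.2) + (u - u') * w) - (t - t') * (Q.2 - P.2)| := by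
      rw [add_sub_cancel_left, abs_mul, abs_of_pos hw]
    rw [this]; refine (abs_sub _ _).trans (add_le_add n2 ?_); rw [abs_mul]
    exact mul_le_mul_of_nonneg_right ht (abs_nonneg _)
  calc ‖wallPt dP dQ dw t u - wallPt dP dQ dw t' u'‖
      ≤ ‖(t - t') • (dQ.1 - dP.1)‖ + |(t - t') * (dQ.2 - dP.2) + (u - u') * dw| := by
        rw [← d1, ← d2]; exact norm_le_fst_add_snd _
    _ ≤ |t - t'| * ‖dQ.1 - dP.1‖ + (|t - t'| * |dQ.2 - dP.2| + |u - u'| * |dw|) := by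
        rw [norm_smul, Real.norm_eq_abs, ← abs_mul, ← abs_mul]
        exact add_le_add le_rfl (abs_add_le _ _)
    _ ≤ N / ‖Q.1 - P.1‖ * ‖dQ.1 - dP.1‖ + (N / ‖Q.1 - P.1‖ * |dQ.2 - dP.2| +
        (N + N / ‖Q.1 - P.1‖ * |Q.2 - P.2|) / w * |dw|) := by gcongr
    _ = _ := by ring

theorem controlled_of_transv {P Q Q' : 𝕊} (dP dQ dQ' : 𝕊) {w : ℝ} (dw : ℝ) (hw : 0 < w)
    (h : Transv P.1 Q.1 Q'.1) : Controlled P Q P Q' dP dQ dP dQ' w dw := by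
  obtain ⟨c, hc, hle⟩ := h.exists_le
  let M := ‖dQ.1 - dP.1‖ + ‖dQ'.1 - dP.1‖ + |dQ.2 - dP.2| + |dQ'.2 - dP.2|
  let B := |Q.2 - P.2| + |Q'.2 - P.2|
  have hB1 : |Q.2 - P.2| ≤ B := le_add_of_nonneg_right (abs_nonneg _)
  have hB2 : |Q'.2 - P.2| ≤ B := le_add_of_nonneg_left (abs_nonneg _)
  refine ⟨M / c + (1 + B / c) / w * |dw|, ?_⟩; intro t ht0 t' ht0' u _ u' _; have t0 := ht0.1
  have t0' := ht0'.1; set N := ‖wallPt P Q w t u - wallPt P Q' w t' u'‖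
  have e1 : (wallPt P Q w t u - wallPt P Q' w t' u').1 =
      t • (Q.1 - P.1) - t' • (Q'.1 - P.1) := by
    simp only [wallPt, Prod.fst_sub, Complex.real_smul]; push_cast; ring
  have e2 : (wallPt P Q w t u - wallPt P Q' w t' u').2 =
      t * (Q.2 - P.2) - t' * (Q'.2 - P.2) + (u - u') * w := by
    simp only [wallPt, Prod.snd_sub]; ring
  have d1 : (wallPt dP dQ dw t u - wallPt dP dQ' dw t' u').1 =
      t • (dQ.1 - dP.1) - t' • (dQ'.1 - dP.1) := by
    simp only [wallPt, Prod.fst_sub, Complex.real_smul]; push_cast; ring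
  have d2 : (wallPt dP dQ dw t u - wallPt dP dQ' dw t' u').2 =
      t * (dQ.2 - dP.2) - t' * (dQ'.2 - dP.2) + (u - u') * dw := by
    simp only [wallPt, Prod.snd_sub]; ring
  have n1 : c * (t + t') ≤ N := by
    refine (hle t t' t0 t0').trans ?_; rw [← e1]; exact norm_fst_le (_ : 𝕊)
  have n2 : |t * (Q.2 - P.2) - t' * (Q'.2 - P.2) + (u - u') * w| ≤ N := by
    rw [← e2]; exact norm_snd_le (_ : 𝕊)
  have ht : t + t' ≤ N / c := (le_div_iff₀ hc).2 (by linarith)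
  have hcross : ∀ a b X : ℝ, |a| ≤ X → |b| ≤ X → |t * a - t' * b| ≤ (t + t') * X := by
    intro a b X ha hb; refine (abs_sub _ _).trans ?_
    rw [abs_mul, abs_mul, abs_of_nonneg t0, abs_of_nonneg t0', add_mul]; gcongr
  have hu : |u - u'| ≤ (N + N / c * B) / w := by
    rw [le_div_iff₀ hw]
    have : |u - u'| * w = |(t * (Q.2 - P.2) - t' * (Q'.2 - P.2) + (u - u') * w) -
        (t * (Q.2 - P.2) - t' * (Q'.2 - P.2))| := by
      rw [add_sub_cancel_left, abs_mul, abs_of_pos hw]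
    rw [this]; refine (abs_sub _ _).trans (add_le_add n2 ((hcross _ _ _ hB1 hB2).trans ?_))
    exact mul_le_mul_of_nonneg_right ht (by positivity)
  calc ‖wallPt dP dQ dw t u - wallPt dP dQ' dw t' u'‖
      ≤ ‖t • (dQ.1 - dP.1) - t' • (dQ'.1 - dP.1)‖ +
        |t * (dQ.2 - dP.2) - t' * (dQ'.2 - dP.2) + (u - u') * dw| := by
        rw [← d1, ← d2]; exact norm_le_fst_add_snd _
    _ ≤ (t * ‖dQ.1 - dP.1‖ + t' * ‖dQ'.1 - dP.1‖) +
        ((t * |dQ.2 - dP.2| + t' * |dQ'.2 - dP.2|) + |u - u'| * |dw|) := by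
        gcongr
        · refine (norm_sub_le _ _).trans ?_
          rw [norm_smul, norm_smul, Real.norm_of_nonneg t0, Real.norm_of_nonneg t0']
        · refine (abs_add_le _ _).trans (add_le_add ((abs_sub _ _).trans ?_) (abs_mul _ _).le)
          rw [abs_mul, abs_mul, abs_of_nonneg t0, abs_of_nonneg t0']
    _ ≤ (t + t') * M + |u - u'| * |dw| := by
        have h1 := norm_nonneg (dQ.1 - dP.1); have h2 := norm_nonneg (dQ'.1 - dP.1)
        have h3 := abs_nonneg (dQ.2 - dP.2); have h4 := abs_nonneg (dQ'.2 - dP.2)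
        have : 0 ≤ t * ‖dQ'.1 - dP.1‖ + t * |dQ'.2 - dP.2| + t' * ‖dQ.1 - dP.1‖ +
          t' * |dQ.2 - dP.2| := by positivity
        simp only [M]; linarith
    _ ≤ N / c * M + (N + N / c * B) / w * |dw| := by
        gcongr
    _ = _ := by ring

/-- Bounded displacements of disjoint compact sets are controlled. -/
theorem exists_control_of_disjoint {X Y : Type*} [TopologicalSpace X] [TopologicalSpace Y]
    [CompactSpace X] [CompactSpace Y] (f g : X → 𝕊) (f' g' : Y → 𝕊) (hf : Continuous f)
    (hg : Continuous g) (hf' : Continuous f') (hg' : Continuous g') (h : ∀ a b, f a ≠ f' b) :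
    ∃ C : ℝ, ∀ a b, ‖g a - g' b‖ ≤ C * ‖f a - f' b‖ := by
  have hd : Disjoint (range f) (range f') := by
    rw [Set.disjoint_left]; rintro _ ⟨a, rfl⟩ ⟨b, hb⟩; exact h a b hb.symm
  obtain ⟨η, hη, hη'⟩ := hd.exists_thickenings (isCompact_range hf) (isCompact_range hf').isClosed
  obtain ⟨M, hM⟩ := (isCompact_range hg).isBounded.exists_norm_le
  obtain ⟨M', hM'⟩ := (isCompact_range hg').isBounded.exists_norm_le
  refine ⟨(M + M') / η, fun a b => ?_⟩
  have h1 : ‖g a - g' b‖ ≤ M + M' :=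
    (norm_sub_le _ _).trans (add_le_add (hM _ ⟨a, rfl⟩) (hM' _ ⟨b, rfl⟩))
  have h2 : η ≤ ‖f a - f' b‖ := by
    by_contra hlt
    have m1 : f' b ∈ Metric.thickening η (range f) := Metric.mem_thickening_iff.2
      ⟨f a, ⟨a, rfl⟩, by rw [dist_comm, dist_eq_norm]; exact not_le.1 hlt⟩
    have m2 : f' b ∈ Metric.thickening η (range f') :=
      Metric.self_subset_thickening hη _ ⟨b, rfl⟩
    exact Set.disjoint_left.1 hη' m1 m2
  have h0 : 0 ≤ M + M' := (norm_nonneg _).trans h1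
  calc _ ≤ M + M' := h1
    _ = (M + M') / η * η := by field_simp
    _ ≤ _ := by gcongr

theorem EdgeOK.controlled {V : Type*} {pos : V → 𝕊} {w : ℝ} {a b a' b' : V}
    (h : EdgeOK pos w a b a' b') (d : V → 𝕊) (dw : ℝ) (hw : 0 < w) :
    Controlled (pos a) (pos b) (pos a') (pos b') (d a) (d b) (d a') (d b') w dw := by
  rcases h with h | ⟨(⟨rfl, rfl⟩ | ⟨rfl, rfl⟩), h⟩ | ⟨rfl, h⟩ | ⟨rfl, h⟩ | ⟨rfl, h⟩ | ⟨rfl, h⟩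
  · have hc : ∀ P Q v, Continuous fun x : 𝕀 × Icc (-1 : ℝ) 1 =>
        wallPt P Q v x.1 x.2 := by
      intro P Q v
      exact (continuous_wallPt P Q v).comp
        (f := fun x : 𝕀 × Icc (-1 : ℝ) 1 => ((x.1 : ℝ), (x.2 : ℝ))) (by fun_prop)
    obtain ⟨C, hC⟩ := exists_control_of_disjoint _ _ _ _ (hc (pos a) (pos b) w)
      (hc (d a) (d b) dw) (hc (pos a') (pos b') w) (hc (d a') (d b') dw) (by
        rintro ⟨t, u⟩ ⟨t', u'⟩ heq
        exact Set.disjoint_left.1 h ⟨t, t.2, u, u.2, rfl⟩ ⟨t', t'.2, u', u'.2, heq⟩)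
    exact ⟨C, fun t ht t' ht' u hu u' hu' => hC (⟨t, ht⟩, ⟨u, hu⟩) (⟨t', ht'⟩, ⟨u', hu'⟩)⟩
  · exact controlled_of_eq _ _ _ hw h
  · exact (controlled_of_eq _ _ _ hw h).swap_right
  · exact controlled_of_transv _ _ _ _ hw h
  · exact (controlled_of_transv _ _ _ _ hw h).swap_right
  · exact (controlled_of_transv _ _ _ _ hw h).swap_left
  · exact (controlled_of_transv _ _ _ _ hw h).swap_left.swap_right

/-- A linear motion of walls over the edges of a graph, in the complement of a set `K` that stays at
rest, is induced by an ambient isotopy. -/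
theorem exists_wall_isotopy {V E : Type*} [Finite E] (src tgt : E → V) (P P' : V → 𝕊) (w w' : ℝ)
    (hw : 0 < w) (hw' : 0 < w') (K : Set 𝕊) (hKc : IsCompact K) (hK : K ⊆ thickened)
    (hok : ∀ τ ∈ 𝕀, ∀ e e', EdgeOK (fun v => mov (P v) (P' v) τ) (w + τ * (w' - w))
      (src e) (tgt e) (src e') (tgt e'))
    (hstat : ∀ e, (P (src e) = P' (src e) ∧ P (tgt e) = P' (tgt e) ∧ w = w') ∨
      ∀ τ ∈ 𝕀, Disjoint (wall (mov (P (src e)) (P' (src e)) τ)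
        (mov (P (tgt e)) (P' (tgt e)) τ) (w + τ * (w' - w))) K)
    (hin : ∀ τ ∈ 𝕀, ∀ e, wall (mov (P (src e)) (P' (src e)) τ)
        (mov (P (tgt e)) (P' (tgt e)) τ) (w + τ * (w' - w)) ⊆ thickened) :
    ∃ φ, IsotopicToId φ ∧ (∀ p ∈ K, φ p = p) ∧ ∀ e, ∀ t ∈ 𝕀, ∀ u ∈ Icc (-1 : ℝ) 1,
      φ (wallPt (P (src e)) (P (tgt e)) w t u) = wallPt (P' (src e)) (P' (tgt e)) w' t u := by
  have : CompactSpace K := isCompact_iff_compactSpace.1 hKc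
  let W := Σ _ : E, 𝕀 × Icc (-1 : ℝ) 1
  let F : K ⊕ W → 𝕊 := Sum.elim (fun p => p)
    (fun x => wallPt (P (src x.1)) (P (tgt x.1)) w x.2.1 x.2.2)
  let G : K ⊕ W → 𝕊 := Sum.elim (fun _ => 0)
    (fun x => wallPt (P' (src x.1) - P (src x.1)) (P' (tgt x.1) - P (tgt x.1)) (w' - w)
      x.2.1 x.2.2)
  have hc : ∀ P Q v, Continuous fun x : 𝕀 × Icc (-1 : ℝ) 1 =>
      wallPt P Q v x.1 x.2 := by
    intro P Q v
    exact (continuous_wallPt P Q v).comp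
      (f := fun x : 𝕀 × Icc (-1 : ℝ) 1 => ((x.1 : ℝ), (x.2 : ℝ))) (by fun_prop)
  have hF : Continuous F := continuous_sum_dom.2
    ⟨continuous_subtype_val, continuous_sigma fun e => hc (P (src e)) (P (tgt e)) w⟩
  have hG : Continuous G := continuous_sum_dom.2
    ⟨continuous_const, continuous_sigma fun e =>
      hc (P' (src e) - P (src e)) (P' (tgt e) - P (tgt e)) (w' - w)⟩
  have hFG : ∀ τ e (x : 𝕀 × Icc (-1 : ℝ) 1), F (Sum.inr ⟨e, x⟩) +
      τ • G (Sum.inr ⟨e, x⟩) = wallPt (mov (P (src e)) (P' (src e)) τ)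
        (mov (P (tgt e)) (P' (tgt e)) τ) (w + τ * (w' - w)) x.1 x.2 := by
    intro τ e x; exact (wallPt_mov _ _ _ _ _ _ _ _ _).symm
  have hlip : ∀ τ ∈ 𝕀, ∃ C : ℝ, ∀ a b,
      ‖G a - G b‖ ≤ C * ‖(F a + τ • G a) - (F b + τ • G b)‖ := by
    intro τ hτ
    have hwτ : 0 < w + τ * (w' - w) := by
      have h1 := hτ.1; have h2 := hτ.2; rcases h2.lt_or_eq with h3 | h3
      · nlinarith [mul_nonneg h1 hw'.le, mul_pos (sub_pos.2 h3) hw]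
      · rw [h3]; linarith
    have h1 : ∀ e e', ∃ C : ℝ, ∀ x y,
        ‖G (Sum.inr ⟨e, x⟩) - G (Sum.inr ⟨e', y⟩)‖ ≤ C * ‖(F (Sum.inr ⟨e, x⟩) +
          τ • G (Sum.inr ⟨e, x⟩)) - (F (Sum.inr ⟨e', y⟩) + τ • G (Sum.inr ⟨e', y⟩))‖ := by
      intro e e'; obtain ⟨C, hC⟩ := (hok τ hτ e e').controlled (fun v => P' v - P v) (w' - w) hwτ
      refine ⟨C, fun x y => ?_⟩; simp only [hFG]; exact hC x.1 x.1.2 y.1 y.1.2 x.2 x.2.2 y.2 y.2.2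
    have h2 : ∀ e, ∃ C : ℝ, ∀ x (p : K),
        ‖G (Sum.inr ⟨e, x⟩) - G (Sum.inl p)‖ ≤ C * ‖(F (Sum.inr ⟨e, x⟩) +
          τ • G (Sum.inr ⟨e, x⟩)) - (F (Sum.inl p) + τ • G (Sum.inl p))‖ := by
      intro e; rcases hstat e with ⟨e1, e2, e3⟩ | hd
      · refine ⟨0, fun x p => ?_⟩; simp [G, e1, e2, e3, wallPt]
      · have cin : Continuous fun x : 𝕀 × Icc (-1 : ℝ) 1 => (Sum.inr ⟨e, x⟩ : K ⊕ W) :=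
          continuous_inr.comp continuous_sigmaMk
        obtain ⟨C, hC⟩ := exists_control_of_disjoint (Y := K)
          (fun x => F (Sum.inr ⟨e, x⟩) + τ • G (Sum.inr ⟨e, x⟩)) (fun x => G (Sum.inr ⟨e, x⟩))
          (fun p => F (Sum.inl p) + τ • G (Sum.inl p)) (fun p => G (Sum.inl p))
          ((hF.comp cin).add ((hG.comp cin).const_smul τ)) (hG.comp cin)
          ((hF.comp continuous_inl).add ((hG.comp continuous_inl).const_smul τ))
          (hG.comp continuous_inl) (by
            rintro x p heq; rw [hFG] at heq
            refine Set.disjoint_left.1 (hd τ hτ) ⟨x.1, x.1.2, x.2, x.2.2, rfl⟩ ?_; rw [heq]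
            simp [F, G])
        exact ⟨C, fun x p => hC x p⟩
    choose C1 hC1 using h1
    choose C2 hC2 using h2
    have : Fintype E := Fintype.ofFinite E
    let C := ∑ e, ∑ e', |C1 e e'| + ∑ e, |C2 e|
    have hle1 : ∀ e e', C1 e e' ≤ C := by
      intro e e'; refine (le_abs_self _).trans ?_
      have a1 : |C1 e e'| ≤ ∑ e', |C1 e e'| :=
        Finset.single_le_sum (f := fun e' => |C1 e e'|) (fun _ _ => abs_nonneg _)
          (Finset.mem_univ e')
      have a2 : ∑ e', |C1 e e'| ≤ ∑ e, ∑ e', |C1 e e'| :=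
        Finset.single_le_sum (f := fun e => ∑ e', |C1 e e'|)
          (fun _ _ => Finset.sum_nonneg fun _ _ => abs_nonneg _) (Finset.mem_univ e)
      have a3 : 0 ≤ ∑ e, |C2 e| := Finset.sum_nonneg fun _ _ => abs_nonneg _; linarith
    have hle2 : ∀ e, C2 e ≤ C := by
      intro e; refine (le_abs_self _).trans ?_
      have a1 : |C2 e| ≤ ∑ e, |C2 e| :=
        Finset.single_le_sum (f := fun e => |C2 e|) (fun _ _ => abs_nonneg _) (Finset.mem_univ e)
      have a3 : 0 ≤ ∑ e, ∑ e', |C1 e e'| :=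
        Finset.sum_nonneg fun _ _ => Finset.sum_nonneg fun _ _ => abs_nonneg _
      linarith
    refine ⟨C, ?_⟩; rintro (p | ⟨e, x⟩) (p' | ⟨e', y⟩)
    · have : 0 ≤ C := add_nonneg
        (Finset.sum_nonneg fun _ _ => Finset.sum_nonneg fun _ _ => abs_nonneg _)
        (Finset.sum_nonneg fun _ _ => abs_nonneg _)
      simp only [G, Sum.elim_inl, sub_self, norm_zero]; positivity
    · rw [norm_sub_rev, norm_sub_rev (F _ + _)]
      exact (hC2 e' y p).trans (mul_le_mul_of_nonneg_right (hle2 e') (norm_nonneg _))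
    · exact (hC2 e x p').trans (mul_le_mul_of_nonneg_right (hle2 e) (norm_nonneg _))
    · exact (hC1 e e' x y).trans (mul_le_mul_of_nonneg_right (hle1 e e') (norm_nonneg _))
  have hin' : ∀ τ ∈ 𝕀, ∀ a, F a + τ • G a ∈ thickened := by
    rintro τ hτ (p | ⟨e, x⟩)
    · simpa [F, G] using hK p.2
    · rw [hFG]; exact hin τ hτ e ⟨x.1, x.1.2, x.2, x.2.2, rfl⟩
  obtain ⟨φ, hφ, h⟩ := exists_linear_isotopy F G hF hG hlip hin'
  refine ⟨φ, hφ, fun p hp => ?_, fun e t ht u hu => ?_⟩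
  · simpa [F, G] using h (Sum.inl ⟨p, hp⟩)
  · have := h (Sum.inr ⟨e, ⟨t, ht⟩, ⟨u, hu⟩⟩); simp only [F, G, Sum.elim_inr] at this
    rw [this, wallPt_sub_wallPt]




/-! ### Framed links made of pieces -/

/-- Pieces of solid tori that are glued along a permutation form a framed link. -/
theorem isFramedLink_of_pieces {J : Type} [Finite J] (σ : Equiv.Perm J)
    (E : J → ℝ × ℝ × ℝ → 𝕊) (hE : ∀ j, Continuous (E j))
    (glue : ∀ j y, E j (1, y) = E (σ j) (0, y))
    (inj : ∀ j j' t t' u u' v v', t ∈ Ico (0 : ℝ) 1 → t' ∈ Ico (0 : ℝ) 1 → |u| ≤ 2 → |v| ≤ 2 →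
      |u'| ≤ 2 → |v'| ≤ 2 → E j (t, u, v) = E j' (t', u', v') → j = j' ∧ t = t' ∧ u = u' ∧ v = v')
    (inside : ∀ j, ∀ t ∈ 𝕀, ∀ u v, |u| ≤ 2 → |v| ≤ 2 → E j (t, u, v) ∈ thickened) :
    IsFramedLink (⋃ j, E j '' {p | p.1 ∈ Icc 0 1 ∧ p.2.1 = 0 ∧ p.2.2 = 0})
      (⋃ j, E j '' {p | p.1 ∈ Icc 0 1 ∧ |p.2.1| ≤ 1 ∧ p.2.2 = 0}) := by
  let ι := Quotient (Equiv.Perm.SameCycle.setoid σ)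
  let per : ι → ℕ := fun i => Function.minimalPeriod (σ • ·) i.out
  have hper : ∀ i, 0 < per i := by
    intro i; refine Function.minimalPeriod_pos_of_mem_periodicPts ?_
    have : Function.Injective (fun j : J => σ • j) := MulAction.injective σ
    exact this.mem_periodicPts _
  let g : ι → ℝ × ℝ × ℝ → 𝕊 := fun i x => E ((σ ^ ⌊x.1⌋) i.out) (Int.fract x.1, x.2)
  have gIcc : ∀ i (k : ℤ) (t : ℝ) y, t ∈ 𝕀 →
      g i (k + t, y) = E ((σ ^ k) i.out) (t, y) := by
    intro i k t y ht; rcases ht.2.lt_or_eq with h | rfl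
    · have hf : ⌊(k : ℝ) + t⌋ = k := by
        rw [Int.floor_eq_iff]; exact ⟨by linarith [ht.1], by linarith⟩
      simp only [g, hf, Int.fract]; rw [add_sub_cancel_left]
    · have hf : ⌊(k : ℝ) + 1⌋ = k + 1 := by simp
      simp only [g, hf, Int.fract]; rw [glue]; push_cast
      rw [sub_self, add_comm k, zpow_add, zpow_one, Equiv.Perm.mul_apply]
  have gcont : ∀ i, Continuous (g i) := by
    intro i
    have lf : LocallyFinite fun k : ℤ => Icc (k : ℝ) (k + 1) :=
      locallyFinite_Icc_of_tendsto tendsto_intCast_atTop_atTop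
        (Filter.tendsto_atBot_add_const_right _ _ (tendsto_intCast_atBot_iff.2 Filter.tendsto_id))
    have lf' := lf.preimage_continuous (g := (Prod.fst : ℝ × ℝ × ℝ → ℝ)) continuous_fst
    refine lf'.continuous ?_ (fun k => isClosed_Icc.preimage continuous_fst) ?_
    · rw [eq_univ_iff_forall]; intro x
      exact mem_iUnion.2 ⟨⌊x.1⌋, Int.floor_le _, (Int.lt_floor_add_one _).le⟩
    · intro k
      have hc : Continuous fun x : ℝ × ℝ × ℝ => E ((σ ^ k) i.out) (x.1 - k, x.2) :=
        (hE _).comp (by fun_prop)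
      refine hc.continuousOn.congr fun x hx => ?_
      have := gIcc i k (x.1 - k) x.2 ⟨by linarith [hx.1], by linarith [hx.2]⟩
      rw [add_sub_cancel] at this; exact this
  have gper : ∀ i x y, g i (x + per i, y) = g i (x, y) := by
    intro i x y; simp only [g]
    rw [← Int.cast_natCast, Int.floor_add_intCast, Int.fract_add_intCast, zpow_add,
      Equiv.Perm.mul_apply]
    congr 2
    have := (MulAction.zpow_smul_eq_iff_minimalPeriod_dvd (a := σ) (b := i.out)
      (n := (per i : ℤ))).2 dvd_rfl
    exact this
  have gper' : ∀ i (k : ℤ) x y, g i (x + k * per i, y) = g i (x, y) := by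
    intro i k x y; have hp : Function.Periodic (fun x => g i (x, y)) (per i) := fun x => gper i x y
    exact hp.int_mul k x
  have hT : ∀ i, ((per i : ℕ) : ℝ) ≠ 0 := fun i => Nat.cast_ne_zero.2 (hper i).ne'
  let e : ∀ i, AddCircle ((per i : ℕ) : ℝ) ≃ₜ Circle := fun i => AddCircle.homeomorphCircle (hT i)
  let q : ∀ i, ℝ → Circle := fun i x => e i (x : AddCircle ((per i : ℕ) : ℝ))
  have qsurj : ∀ i θ, ∃ x, q i x = θ := by
    intro i θ; obtain ⟨x, hx⟩ := QuotientAddGroup.mk_surjective ((e i).symm θ)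
    exact ⟨x, by simp only [q]; rw [hx]; exact (e i).apply_symm_apply θ⟩
  have qeq : ∀ i x x', q i x = q i x' ↔ ∃ k : ℤ, x' = x + k * per i := by
    intro i x x'; simp only [q, EmbeddingLike.apply_eq_iff_eq]
    rw [eq_comm, ← sub_eq_zero, ← AddCircle.coe_sub, AddCircle.coe_eq_zero_iff]
    simp only [zsmul_eq_mul]
    exact exists_congr fun k => ⟨fun h => by linarith, fun h => by linarith⟩
  have qquot : ∀ i, IsOpenQuotientMap (q i) := fun i =>
    (e i).isOpenQuotientMap.comp QuotientAddGroup.isOpenQuotientMap_mk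
  let f : ι → Circle × ℝ × ℝ → 𝕊 := fun i p => g i ((qsurj i p.1).choose, p.2)
  have hf : ∀ i x y, f i (q i x, y) = g i (x, y) := by
    intro i x y
    obtain ⟨k, hk⟩ := (qeq i x (qsurj i (q i x)).choose).1 (qsurj i (q i x)).choose_spec.symm
    simp only [f]; rw [hk, gper']
  refine ⟨ι, inferInstance, f, ?_, ?_, ?_, ?_, ?_⟩
  · intro i; refine Continuous.continuousOn ?_
    have hq := ((qquot i).prodMap (IsOpenQuotientMap.id (X := ℝ × ℝ))).isQuotientMap
    rw [hq.continuous_iff]; refine (gcont i).congr fun x => ?_; exact (hf i x.1 x.2).symm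
  · rintro i i' ⟨θ, u, v⟩ ⟨θ', u', v'⟩ h1 h2 h3 h4 h; obtain ⟨x, rfl⟩ := qsurj i θ
    obtain ⟨x', rfl⟩ := qsurj i' θ'; rw [hf, hf] at h
    obtain ⟨hj, ht, hu, hv⟩ := inj _ _ _ _ _ _ _ _ ⟨Int.fract_nonneg _, Int.fract_lt_one _⟩
      ⟨Int.fract_nonneg _, Int.fract_lt_one _⟩ h1 h2 h3 h4 h
    have hi : i = i' := by
      rw [← i.out_eq, ← i'.out_eq]; refine Quotient.sound (s := Equiv.Perm.SameCycle.setoid σ) ?_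
      refine ⟨-⌊x'⌋ + ⌊x⌋, ?_⟩
      rw [zpow_add, Equiv.Perm.mul_apply, hj, ← Equiv.Perm.mul_apply, ← zpow_add]; simp
    subst hi; refine ⟨rfl, ?_⟩
    have hdvd : (per i : ℤ) ∣ ⌊x'⌋ - ⌊x⌋ := by
      refine (MulAction.zpow_smul_eq_iff_minimalPeriod_dvd (a := σ) (b := i.out)).1 ?_
      rw [Equiv.Perm.smul_def, sub_eq_neg_add, zpow_add, Equiv.Perm.mul_apply]; simp only at hj
      rw [← hj, ← Equiv.Perm.mul_apply, ← zpow_add]; simp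
    obtain ⟨k, hk⟩ := hdvd; simp only [Prod.mk.injEq]; refine ⟨(qeq i x x').2 ⟨k, ?_⟩, hu, hv⟩
    have hk' : (⌊x'⌋ : ℝ) - ⌊x⌋ = per i * k := by exact_mod_cast hk
    have e1 := Int.floor_add_fract x; have e2 := Int.floor_add_fract x'; simp only at ht; linarith
  · rintro i ⟨θ, u, v⟩ h1 h2; obtain ⟨x, rfl⟩ := qsurj i θ; rw [hf]
    exact inside _ _ ⟨Int.fract_nonneg _, (Int.fract_lt_one _).le⟩ _ _ h1 h2
  all_goals
    ext p; simp only [mem_iUnion, mem_image]; constructor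
    · rintro ⟨j, ⟨t, y⟩, ⟨ht, hy⟩, rfl⟩
      let i : ι := Quotient.mk _ j
      have hsc : σ.SameCycle i.out j := Quotient.exact (s := Equiv.Perm.SameCycle.setoid σ) i.out_eq
      obtain ⟨k, hk⟩ := hsc; refine ⟨i, (q i (k + t), y), hy, ?_⟩; rw [hf, gIcc i k t y ht, hk]
    · rintro ⟨i, ⟨θ, y⟩, hy, rfl⟩; obtain ⟨x, rfl⟩ := qsurj i θ
      exact ⟨_, (Int.fract x, y), ⟨⟨Int.fract_nonneg _, (Int.fract_lt_one _).le⟩, hy⟩,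
        (hf i x y).symm⟩

/-! ### Polygons -/

/-- A closed polygon (or a union of such) with vertices `V j` and edges from `V j` to `V (σ j)` is
embedded, even when its edges are replaced by walls of half-width `w`. -/
structure PolyOK {J : Type} (σ : Equiv.Perm J) (V : J → 𝕊) (w : ℝ) : Prop where
  ne : ∀ j, (V j).1 ≠ (V (σ j)).1
  transv : ∀ j, Transv (V (σ j)).1 (V j).1 (V (σ (σ j))).1
  disj : ∀ j j', j' ≠ j → j' ≠ σ j → j ≠ σ j' →
    Disjoint (wall (V j) (V (σ j)) w) (wall (V j') (V (σ j')) w)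
  inside : ∀ j, wall (V j) (V (σ j)) w ⊆ thickened

theorem PolyOK.edgeOK {J : Type} {σ : Equiv.Perm J} {V : J → 𝕊} {w : ℝ} (h : PolyOK σ V w)
    (j j' : J) : EdgeOK V w j (σ j) j' (σ j') := by
  by_cases h1 : j' = j
  · subst h1; exact .inr (.inl ⟨.inl ⟨rfl, rfl⟩, h.ne _⟩)
  by_cases h2 : j' = σ j
  · subst h2; exact .inr (.inr (.inr (.inr (.inl ⟨rfl, h.transv j⟩))))
  by_cases h3 : j = σ j'
  · subst h3; refine .inr (.inr (.inr (.inl ⟨rfl, ?_⟩))); intro t t' ht ht' heq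
    exact (h.transv j' t' t ht' ht heq.symm).symm
  · exact .inl (h.disj j j' h1 h2 h3)

/-- The cross product. -/
def cr (a b : ℂ) : ℝ := a.re * b.im - a.im * b.re

theorem exists_normal {p q r : ℂ} (h : Transv q p r) (h1 : p ≠ q) (h2 : q ≠ r) :
    ∃ m, 0 < cr (q - p) m ∧ 0 < cr (r - q) m := by
  set a := q - p with ha; set b := r - q with hb
  have na : 0 < ‖a‖ := norm_pos_iff.2 (sub_ne_zero.2 h1.symm)
  have nb : 0 < ‖b‖ := norm_pos_iff.2 (sub_ne_zero.2 h2.symm)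
  have sa : ‖a‖ ^ 2 = a.re ^ 2 + a.im ^ 2 := by
    rw [Complex.sq_norm, Complex.normSq_apply]; ring
  have sb : ‖b‖ ^ 2 = b.re ^ 2 + b.im ^ 2 := by
    rw [Complex.sq_norm, Complex.normSq_apply]; ring
  have key : 0 < ‖a‖ * ‖b‖ + (a.re * b.re + a.im * b.im) := by
    by_contra hle
    have h3 : ‖b‖ • a + ‖a‖ • b = 0 := by
      rw [← norm_eq_zero, ← sq_eq_zero_iff]; refine le_antisymm ?_ (sq_nonneg _)
      rw [Complex.sq_norm, Complex.normSq_apply]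
      simp only [Complex.add_re, Complex.add_im, Complex.smul_re, Complex.smul_im, smul_eq_mul]
      have : (‖b‖ * a.re + ‖a‖ * b.re) * (‖b‖ * a.re + ‖a‖ * b.re) +
          (‖b‖ * a.im + ‖a‖ * b.im) * (‖b‖ * a.im + ‖a‖ * b.im) =
          ‖b‖ ^ 2 * (a.re ^ 2 + a.im ^ 2) + ‖a‖ ^ 2 * (b.re ^ 2 + b.im ^ 2) +
          2 * (‖a‖ * ‖b‖) * (a.re * b.re + a.im * b.im) := by ring
      rw [this, ← sa, ← sb]; nlinarith [mul_pos na nb]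
    have h4 := h ‖b‖ ‖a‖ nb.le na.le (by
      have : p - q = -a := by rw [ha]; ring
      rw [this, smul_neg, neg_eq_iff_add_eq_zero]
      exact h3)
    exact na.ne' h4.2
  refine ⟨⟨-(‖b‖ * a.im + ‖a‖ * b.im), ‖b‖ * a.re + ‖a‖ * b.re⟩, ?_, ?_⟩
  · have : cr a ⟨-(‖b‖ * a.im + ‖a‖ * b.im), ‖b‖ * a.re + ‖a‖ * b.re⟩ =
        ‖a‖ * (‖a‖ * ‖b‖ + (a.re * b.re + a.im * b.im)) := by
      simp only [cr]; linear_combination -‖b‖ * sa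
    rw [this]; positivity
  · have : cr b ⟨-(‖b‖ * a.im + ‖a‖ * b.im), ‖b‖ * a.re + ‖a‖ * b.re⟩ =
        ‖b‖ * (‖a‖ * ‖b‖ + (a.re * b.re + a.im * b.im)) := by
      simp only [cr]; linear_combination -‖a‖ * sb
    rw [this]; positivity

theorem eventually_mul_lt (C : ℝ) {c : ℝ} (hc : 0 < c) :
    ∀ᶠ ε in 𝓝[>] (0 : ℝ), 2 * ε * C < c := by
  have : Continuous fun ε : ℝ => 2 * ε * C := by fun_prop
  have h := this.tendsto 0; simp only [mul_zero, zero_mul] at h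
  exact (h.eventually (gt_mem_nhds hc)).filter_mono nhdsWithin_le_nhds

theorem abs_mul_mul_le {ε v C : ℝ} (hε : 0 < ε) (hv : |v| ≤ 2) : |ε * v * C| ≤ 2 * ε * |C| := by
  rw [abs_mul, abs_mul, abs_of_pos hε]; have := mul_le_mul_of_nonneg_left hv hε.le
  nlinarith [abs_nonneg C]

/-- The point over `(t, v)` of the strip along the segment `PQ`, spanned by the normals `n`, `n'`. -/
def stripPt (P Q n n' : ℂ) (ε t v : ℝ) : ℂ :=
  (1 - t) • (P + (ε * v) • n) + t • (Q + (ε * v) • n')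

theorem eventually_strip_inj (P Q n n' : ℂ) (h1 : 0 < cr (Q - P) n) (h2 : 0 < cr (Q - P) n') :
    ∀ᶠ ε in 𝓝[>] (0 : ℝ), ∀ t t' v v' : ℝ, t ∈ 𝕀 → t' ∈ 𝕀 → |v| ≤ 2 →
      |v'| ≤ 2 → stripPt P Q n n' ε t v = stripPt P Q n n' ε t' v' → t = t' ∧ v = v' := by
  filter_upwards [eventually_mul_lt |cr n' n| (lt_min h1 h2), self_mem_nhdsWithin] with ε hε hε0
  intro t t' v v' ht ht' hv hv' heq; have hε0 : 0 < ε := hε0; have e1 := congrArg Complex.re heq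
  have e2 := congrArg Complex.im heq
  simp only [stripPt, Complex.add_re, Complex.add_im, Complex.smul_re, Complex.smul_im,
    smul_eq_mul] at e1 e2
  have hm : min (cr (Q - P) n) (cr (Q - P) n') ≤ (1 - t) * cr (Q - P) n + t * cr (Q - P) n' := by
    have a1 := min_le_left (cr (Q - P) n) (cr (Q - P) n')
    have a2 := min_le_right (cr (Q - P) n) (cr (Q - P) n'); nlinarith [ht.1, ht.2]
  have hkey : (t - t') * ((1 - t) * cr (Q - P) n + t * cr (Q - P) n' + ε * v' * cr n' n) = 0 := by
    simp only [cr, Complex.sub_re, Complex.sub_im]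
    linear_combination ((1 - t) * n.im + t * n'.im) * e1 - ((1 - t) * n.re + t * n'.re) * e2
  have hb := abs_le.1 (abs_mul_mul_le (C := cr n' n) hε0 hv')
  have htt : t = t' := by
    rcases mul_eq_zero.1 hkey with h | h
    · linarith
    · linarith
  subst htt; refine ⟨rfl, ?_⟩
  have h3 : (v - v') * (ε * ((1 - t) * cr (Q - P) n + t * cr (Q - P) n')) = 0 := by
    simp only [cr, Complex.sub_re, Complex.sub_im]
    linear_combination -(Q.im - P.im) * e1 + (Q.re - P.re) * e2
  rcases mul_eq_zero.1 h3 with h | h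
  · linarith
  · have := lt_min h1 h2
    have : 0 < ε * ((1 - t) * cr (Q - P) n + t * cr (Q - P) n') := mul_pos hε0 (by linarith)
    linarith

theorem eventually_strip_ne (P Q R n n' n'' : ℂ) (h1 : 0 < cr (Q - P) n') (h2 : 0 < cr (R - Q) n') :
    ∀ᶠ ε in 𝓝[>] (0 : ℝ), ∀ t t' v v' : ℝ, t ∈ Ico (0 : ℝ) 1 → t' ∈ 𝕀 → |v| ≤ 2 →
      |v'| ≤ 2 → stripPt P Q n n' ε t v ≠ stripPt Q R n' n'' ε t' v' := by
  filter_upwards [eventually_mul_lt |cr n n'| h1, eventually_mul_lt |cr n'' n'| h2,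
    self_mem_nhdsWithin] with ε hε hε' hε0
  intro t t' v v' ht ht' hv hv' heq; have hε0 : 0 < ε := hε0; have e1 := congrArg Complex.re heq
  have e2 := congrArg Complex.im heq
  simp only [stripPt, Complex.add_re, Complex.add_im, Complex.smul_re, Complex.smul_im,
    smul_eq_mul] at e1 e2
  have hb := abs_le.1 (abs_mul_mul_le (C := cr n n') hε0 hv)
  have hb' := abs_le.1 (abs_mul_mul_le (C := cr n'' n') hε0 hv')
  have hkey : (1 - t) * (cr (Q - P) n' - ε * v * cr n n') +
      t' * (cr (R - Q) n' + ε * v' * cr n'' n') = 0 := by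
    simp only [cr, Complex.sub_re, Complex.sub_im]
    linear_combination -n'.im * e1 + n'.re * e2
  have a1 : 0 < (1 - t) * (cr (Q - P) n' - ε * v * cr n n') :=
    mul_pos (by linarith [ht.2]) (by linarith)
  have a2 : 0 ≤ t' * (cr (R - Q) n' + ε * v' * cr n'' n') := mul_nonneg ht'.1 (by linarith)
  linarith

/-- A strictly increasing function on `[-2,2]` that is the identity on `[-1,1]`. -/
def flatten (u : ℝ) : ℝ := (u + max (-1) (min 1 u)) / 2

theorem flatten_of_le {u : ℝ} (h : |u| ≤ 1) : flatten u = u := by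
  obtain ⟨h1, h2⟩ := abs_le.1 h; unfold flatten; rw [min_eq_right h2, max_eq_right h1]; ring

theorem flatten_strictMono : StrictMono flatten := by
  intro a b h; unfold flatten
  have : max (-1) (min 1 a) ≤ max (-1) (min 1 b) := max_le_max_left _ (min_le_min_left _ h.le)
  linarith

theorem abs_flatten_le {u : ℝ} (h : |u| ≤ 2) : |flatten u| ≤ 3 / 2 := by
  obtain ⟨h1, h2⟩ := abs_le.1 h
  have a : max (-1) (min 1 u) ≤ 1 := max_le (by norm_num) (min_le_left _ _)
  have b : -1 ≤ max (-1) (min 1 u) := le_max_left _ _; unfold flatten; rw [abs_le]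
  constructor <;> linarith

theorem PolyOK.isFramedLink {J : Type} [Finite J] {σ : Equiv.Perm J} {V : J → 𝕊} {w : ℝ}
    (hw : 0 < w) (h : PolyOK σ V (3 / 2 * w)) :
    IsFramedLink (⋃ j, wall (V j) (V (σ j)) 0) (⋃ j, wall (V j) (V (σ j)) w) := by
  have hn : ∀ j, ∃ m, 0 < cr ((V j).1 - (V (σ.symm j)).1) m ∧
      0 < cr ((V (σ j)).1 - (V j).1) m := by
    intro j; have h1 := h.transv (σ.symm j); have h2 := h.ne (σ.symm j)
    rw [Equiv.apply_symm_apply] at h1 h2; exact exists_normal h1 h2 (h.ne j)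
  choose n hn1 hn2 using hn
  have hn1' : ∀ j, 0 < cr ((V (σ j)).1 - (V j).1) (n (σ j)) := by
    intro j; have := hn1 (σ j); rwa [Equiv.symm_apply_apply] at this
  let E : ℝ → J → ℝ × ℝ × ℝ → 𝕊 := fun ε j x =>
    (stripPt (V j).1 (V (σ j)).1 (n j) (n (σ j)) ε x.1 x.2.2,
      (1 - x.1) * (V j).2 + x.1 * (V (σ j)).2 + flatten x.2.1 * w)
  -- comparison with the walls
  have hcl : ∀ j, ∃ M : ℝ, 0 ≤ M ∧ ∀ ε t u v, 0 < ε → t ∈ 𝕀 → |u| ≤ 2 → |v| ≤ 2 →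
      ∃ p ∈ wall (V j) (V (σ j)) (3 / 2 * w), ‖E ε j (t, u, v) - p‖ ≤ 2 * ε * M := by
    intro j; refine ⟨‖n j‖ + ‖n (σ j)‖, by positivity, fun ε t u v hε ht hu hv => ?_⟩
    refine ⟨wallPt (V j) (V (σ j)) (3 / 2 * w) t (flatten u / (3 / 2)), ⟨t, ht, _, ?_, rfl⟩, ?_⟩
    · have := abs_le.1 (abs_flatten_le hu); constructor <;> linarith
    · have e : E ε j (t, u, v) - wallPt (V j) (V (σ j)) (3 / 2 * w) t (flatten u / (3 / 2)) =
          ((ε * v) • ((1 - t) • n j + t • n (σ j)), 0) := by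
        apply Prod.ext
        · simp only [E, stripPt, wallPt, Prod.fst_sub, Complex.real_smul]; push_cast; ring
        · simp only [E, wallPt, Prod.snd_sub]; ring
      rw [e, Prod.norm_def, norm_zero, max_eq_left (norm_nonneg _), norm_smul, Real.norm_eq_abs,
        abs_mul, abs_of_pos hε]
      have b1 : ‖(1 - t) • n j + t • n (σ j)‖ ≤ ‖n j‖ + ‖n (σ j)‖ := by
        refine (norm_add_le _ _).trans (add_le_add ?_ ?_)
        · rw [norm_smul, Real.norm_of_nonneg (by linarith [ht.2])]
          exact mul_le_of_le_one_left (norm_nonneg _) (by linarith [ht.1])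
        · rw [norm_smul, Real.norm_of_nonneg ht.1]; exact mul_le_of_le_one_left (norm_nonneg _) ht.2
      have b2 : ε * |v| ≤ 2 * ε := by nlinarith
      exact mul_le_mul b2 b1 (norm_nonneg _) (by positivity)
  choose M hM0 hM using hcl
  have ev1 : ∀ j j', ∀ᶠ ε in 𝓝[>] (0 : ℝ), ∀ t t' u u' v v' : ℝ, t ∈ Ico (0 : ℝ) 1 →
      t' ∈ Ico (0 : ℝ) 1 → |u| ≤ 2 → |v| ≤ 2 → |u'| ≤ 2 → |v'| ≤ 2 →
      E ε j (t, u, v) = E ε j' (t', u', v') → j = j' ∧ t = t' ∧ u = u' ∧ v = v' := by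
    intro j j'; by_cases h1 : j' = j
    · subst h1
      filter_upwards [eventually_strip_inj (V j').1 (V (σ j')).1 _ _ (hn2 j') (hn1' j')] with ε hε
      intro t t' u u' v v' ht ht' hu hv hu' hv' heq
      obtain ⟨rfl, rfl⟩ := hε t t' v v' ⟨ht.1, ht.2.le⟩ ⟨ht'.1, ht'.2.le⟩ hv hv'
        (congrArg Prod.fst heq)
      have h3 := congrArg Prod.snd heq; simp only [E] at h3
      have h4 := mul_right_cancel₀ hw.ne' (add_left_cancel h3)
      exact ⟨rfl, rfl, flatten_strictMono.injective h4, rfl⟩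
    by_cases h2 : j' = σ j
    · subst h2
      filter_upwards [eventually_strip_ne (V j).1 (V (σ j)).1 (V (σ (σ j))).1 (n j) (n (σ j))
        (n (σ (σ j))) (hn1' j) (hn2 (σ j))] with ε hε
      intro t t' u u' v v' ht ht' hu hv hu' hv' heq
      exact (hε t t' v v' ht ⟨ht'.1, ht'.2.le⟩ hv hv' (congrArg Prod.fst heq)).elim
    by_cases h3 : j = σ j'
    · subst h3
      filter_upwards [eventually_strip_ne (V j').1 (V (σ j')).1 (V (σ (σ j'))).1 (n j') (n (σ j'))
        (n (σ (σ j'))) (hn1' j') (hn2 (σ j'))] with ε hε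
      intro t t' u u' v v' ht ht' hu hv hu' hv' heq
      exact (hε t' t v' v ht' ⟨ht.1, ht.2.le⟩ hv' hv (congrArg Prod.fst heq).symm).elim
    · obtain ⟨η, hη, hη'⟩ := (h.disj j j' h1 h2 h3).exists_thickenings (isCompact_wall _ _ _)
        (isCompact_wall _ _ _).isClosed
      filter_upwards [eventually_mul_lt (M j) hη, eventually_mul_lt (M j') hη,
        self_mem_nhdsWithin] with ε hε hε' hε0
      intro t t' u u' v v' ht ht' hu hv hu' hv' heq
      obtain ⟨p, hp, hp'⟩ := hM j ε t u v hε0 ⟨ht.1, ht.2.le⟩ hu hv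
      obtain ⟨p', hp1, hp1'⟩ := hM j' ε t' u' v' hε0 ⟨ht'.1, ht'.2.le⟩ hu' hv'
      have m1 : E ε j (t, u, v) ∈ Metric.thickening η (wall (V j) (V (σ j)) (3 / 2 * w)) :=
        Metric.mem_thickening_iff.2 ⟨p, hp, by rw [dist_eq_norm]; linarith⟩
      have m2 : E ε j (t, u, v) ∈ Metric.thickening η (wall (V j') (V (σ j')) (3 / 2 * w)) :=
        Metric.mem_thickening_iff.2 ⟨p', hp1, by rw [heq, dist_eq_norm]; linarith⟩
      exact (Set.disjoint_left.1 hη' m1 m2).elim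
  have ev2 : ∀ j, ∀ᶠ ε in 𝓝[>] (0 : ℝ), ∀ t ∈ 𝕀, ∀ u v, |u| ≤ 2 → |v| ≤ 2 →
      E ε j (t, u, v) ∈ thickened := by
    intro j
    obtain ⟨η, hη, hsub⟩ := (isCompact_wall _ _ _).exists_thickening_subset_open isOpen_thickened
      (h.inside j)
    filter_upwards [eventually_mul_lt (M j) hη, self_mem_nhdsWithin] with ε hε hε0
    intro t ht u v hu hv; obtain ⟨p, hp, hp'⟩ := hM j ε t u v hε0 ht hu hv
    exact hsub (Metric.mem_thickening_iff.2 ⟨p, hp, by rw [dist_eq_norm]; linarith⟩)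
  have ev := (Filter.eventually_all.2 fun j => Filter.eventually_all.2 (ev1 j)).and
    (Filter.eventually_all.2 ev2)
  obtain ⟨ε, hε1, hε2⟩ := ev.exists
  have hcont : ∀ j, Continuous (E ε j) := by
    intro j; simp only [E, stripPt, flatten]; fun_prop
  have := isFramedLink_of_pieces σ (E ε) hcont (by
    rintro j ⟨u, v⟩; apply Prod.ext
    · simp [E, stripPt]
    · simp [E]) (fun j j' t t' u u' v v' => hε1 j j' t t' u u' v v') hε2
  convert this using 1
  · refine iUnion_congr fun j => ?_; ext p; constructor
    · rintro ⟨t, ht, u, hu, rfl⟩; refine ⟨(t, 0, 0), ⟨ht, rfl, rfl⟩, ?_⟩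
      simp [E, wallPt, stripPt, flatten]
    · rintro ⟨⟨t, u, v⟩, ⟨ht, hu, hv⟩, rfl⟩; simp only at ht hu hv; subst hu hv
      refine ⟨t, ht, 0, by simp, ?_⟩; simp [E, wallPt, stripPt, flatten]
  · refine iUnion_congr fun j => ?_; ext p; constructor
    · rintro ⟨t, ht, u, hu, rfl⟩; refine ⟨(t, u, 0), ⟨ht, abs_le.2 hu, rfl⟩, ?_⟩
      simp [E, wallPt, stripPt, flatten_of_le (abs_le.2 hu)]
    · rintro ⟨⟨t, u, v⟩, ⟨ht, hu, hv⟩, rfl⟩; simp only at ht hu hv; subst hv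
      refine ⟨t, ht, u, abs_le.1 hu, ?_⟩; simp [E, wallPt, stripPt, flatten_of_le hu]




/-! ### Configurations

A configuration consists of vertical strands over the points of a finite set `N` on the real axis,
which are joined by arcs below (`false`) and above (`true`) the axis.  The arcs have the shape of a
`V` with slopes `±1`. -/

theorem mem_wall {P Q : 𝕊} {w : ℝ} (hw : 0 ≤ w) {p : 𝕊} : p ∈ wall P Q w ↔
    ∃ t ∈ 𝕀, p.1.re = (1 - t) * P.1.re + t * Q.1.re ∧
      p.1.im = (1 - t) * P.1.im + t * Q.1.im ∧ |p.2 - ((1 - t) * P.2 + t * Q.2)| ≤ w := by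
  constructor
  · rintro ⟨t, ht, u, hu, rfl⟩; refine ⟨t, ht, by simp [wallPt], by simp [wallPt], ?_⟩
    simp only [wallPt, add_sub_cancel_left, abs_mul, abs_of_nonneg hw]
    exact mul_le_of_le_one_left hw (abs_le.2 hu)
  · rintro ⟨t, ht, h1, h2, h3⟩; rcases hw.eq_or_lt with rfl | hw
    · refine ⟨t, ht, 0, by simp, Prod.ext (Complex.ext ?_ ?_) ?_⟩
      · simp [wallPt, h1]
      · simp [wallPt, h2]
      · have := abs_nonpos_iff.1 h3; simp only [wallPt]; linarith
    · refine ⟨t, ht, (p.2 - ((1 - t) * P.2 + t * Q.2)) / w, ?_, Prod.ext (Complex.ext ?_ ?_) ?_⟩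
      · rw [mem_Icc, ← abs_le, abs_div, abs_of_pos hw]; exact (div_le_one hw).2 h3
      · simp [wallPt, h1]
      · simp [wallPt, h2]
      · simp only [wallPt]; field_simp; ring

theorem transv_of_linear {p q q' : ℂ} (a b : ℝ) (h1 : 0 < a * (q - p).re + b * (q - p).im)
    (h2 : a * (q' - p).re + b * (q' - p).im < 0) : Transv p q q' := by
  intro t t' ht ht' heq; have e1 := congrArg Complex.re heq; have e2 := congrArg Complex.im heq
  simp only [Complex.smul_re, Complex.smul_im, smul_eq_mul] at e1 e2
  have e3 : t * (a * (q - p).re + b * (q - p).im) = t' * (a * (q' - p).re + b * (q' - p).im) := by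
    linear_combination a * e1 + b * e2
  have a1 : 0 ≤ t * (a * (q - p).re + b * (q - p).im) := mul_nonneg ht h1.le
  have a2 : t' * (a * (q' - p).re + b * (q' - p).im) ≤ 0 :=
    mul_nonpos_of_nonneg_of_nonpos ht' h2.le
  constructor
  · exact (mul_eq_zero.1 (le_antisymm (by linarith) a1)).resolve_right h1.ne'
  · exact (mul_eq_zero.1 (le_antisymm a2 (by linarith))).resolve_right h2.ne

theorem Transv.symm {p q q' : ℂ} (h : Transv p q q') : Transv p q' q := by
  intro t t' ht ht' heq; exact (h t' t ht' ht heq.symm).symm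

theorem mem_thickened_of_im {p : 𝕊} (h : p.1.im ≠ 0) (h1 : 0 < p.2) (h2 : p.2 < 1) :
    p ∈ thickened := by
  refine ⟨?_, h1, h2⟩; intro hp; apply h; rcases hp with hp | hp | hp | hp <;> rw [hp] <;> simp

theorem mem_thickened_of_re {p : 𝕊} (h : ∀ k : ℕ, 1 ≤ k → k ≤ 4 → p.1.re ≠ k) (h1 : 0 < p.2)
    (h2 : p.2 < 1) : p ∈ thickened := by
  refine ⟨?_, h1, h2⟩; intro hp; rcases hp with hp | hp | hp | hp
  · exact h 1 (by norm_num) (by norm_num) (by rw [hp]; simp)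
  · exact h 2 (by norm_num) (by norm_num) (by rw [hp]; simp)
  · exact h 3 (by norm_num) (by norm_num) (by rw [hp]; simp)
  · exact h 4 (by norm_num) (by norm_num) (by rw [hp]; simp)

theorem wall_scale {r : ℝ} (hr : r ∈ 𝕀) (P Q : 𝕊) (w : ℝ) : wall P Q (r * w) =
    {p | ∃ t ∈ 𝕀, ∃ u ∈ Icc (-r) r, p = wallPt P Q w t u} := by
  ext p; constructor
  · rintro ⟨t, ht, u, hu, rfl⟩
    refine ⟨t, ht, u * r, ⟨by nlinarith [hu.1, hr.1], by nlinarith [hu.2, hr.1]⟩, ?_⟩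
    simp only [wallPt, mul_assoc]
  · rintro ⟨t, ht, u, hu, rfl⟩; rcases hr.1.eq_or_lt with rfl | h0
    · have : u = 0 := le_antisymm hu.2 (by simpa using hu.1)
      exact ⟨t, ht, 0, by simp, by simp [wallPt, this]⟩
    · refine ⟨t, ht, u / r, ?_, ?_⟩
      · rw [mem_Icc, le_div_iff₀ h0, div_le_iff₀ h0]; exact ⟨by linarith [hu.1], by linarith [hu.2]⟩
      · simp only [wallPt]; congr 2; field_simp

theorem lt_convex {a x y t : ℝ} (h1 : a < x) (h2 : a < y) (t0 : 0 ≤ t) (t1 : t ≤ 1) :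
    a < (1 - t) * x + t * y := by
  rcases t0.eq_or_lt with rfl | h
  · simpa using h1
  · have a1 := mul_lt_mul_of_pos_left h2 h
    have a2 := mul_le_mul_of_nonneg_left h1.le (sub_nonneg.2 t1); linarith

theorem convex_lt {a x y t : ℝ} (h1 : x < a) (h2 : y < a) (t0 : 0 ≤ t) (t1 : t ≤ 1) :
    (1 - t) * x + t * y < a := by
  have := lt_convex (neg_lt_neg h1) (neg_lt_neg h2) t0 t1; linarith

/-- The sign of a side. -/
def sg : Bool → ℝ
  | true => 1
  | false => -1

theorem sg_not (s : Bool) : sg (!s) = -sg s := by cases s <;> simp [sg]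

theorem sg_mul_self (s : Bool) : sg s * sg s = 1 := by cases s <;> simp [sg]

/-- Vertical strands over the points of `N`, joined by arcs below and above the axis. -/
structure Config where
  N : Finset ℕ
  mate : Bool → ℕ → ℕ
  x : Bool → ℕ → ℝ
  lev : Bool → ℕ → ℝ
  w : ℝ

namespace Config

/-- The end of the strand `n` on the side `s`. -/
def knee (c : Config) (s : Bool) (n : ℕ) : 𝕊 := (⟨c.x s n, sg s⟩, c.lev s n)

/-- The lowest (or highest) point of the arc on the side `s` with end `n`. -/
def apex (c : Config) (s : Bool) (n : ℕ) : 𝕊 :=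
  (⟨(c.x s n + c.x s (c.mate s n)) / 2, sg s * (1 + |c.x s n - c.x s (c.mate s n)| / 2)⟩,
    (c.lev s n + c.lev s (c.mate s n)) / 2)

/-- The strand over `n`, and the halves of the arcs ending there. -/
def piece (c : Config) : Option Bool → ℕ → ℝ → Set 𝕊
  | none, n, w => wall (c.knee false n) (c.knee true n) w
  | some s, n, w => wall (c.knee s n) (c.apex s n) w

/-- The union of all the strands and arcs. -/
def body (c : Config) (w : ℝ) : Set 𝕊 := ⋃ k, ⋃ n ∈ c.N, c.piece k n w

/-- The arc with end `n` lies above the arc with end `n'`. -/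
def Above (c : Config) (s : Bool) (n n' : ℕ) : Prop :=
  c.lev s n' + 3 * c.w < c.lev s n ∧ c.lev s (c.mate s n') + 3 * c.w < c.lev s n ∧
  c.lev s n' + 3 * c.w < c.lev s (c.mate s n) ∧
  c.lev s (c.mate s n') + 3 * c.w < c.lev s (c.mate s n)

/-- The arcs with ends `n` and `n'` on the side `s` cross, where the left half of the first one meets the
right half of the second one. -/
def Crosses (c : Config) (s : Bool) (n n' : ℕ) : Prop :=
  c.x s (c.mate s n') < c.x s n ∧ c.x s n < c.x s n' ∧ c.x s n' < c.x s (c.mate s n)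

/-- The strands and arcs of the configuration form a framed link. -/
structure Valid (c : Config) : Prop where
  w_pos : 0 < c.w
  mate_mem : ∀ s, ∀ n ∈ c.N, c.mate s n ∈ c.N
  mate_mate : ∀ s, ∀ n ∈ c.N, c.mate s (c.mate s n) = n
  mate_ne : ∀ s, ∀ n ∈ c.N, c.mate s n ≠ n
  x_lt : ∀ n ∈ c.N, ∀ n' ∈ c.N, n ≠ n' → (∀ s, c.x s n < c.x s n') ∨ ∀ s, c.x s n' < c.x s n
  gap : ∀ n ∈ c.N, ∀ k : ℕ, 1 ≤ k → k ≤ 4 → c.x false n + c.x true n ≠ 2 * k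
  lev_mem : ∀ s, ∀ n ∈ c.N, 3 / 2 * c.w < c.lev s n ∧ c.lev s n < 1 - 3 / 2 * c.w
  sep : ∀ s, ∀ n ∈ c.N, ∀ n' ∈ c.N, n' ≠ n → n' ≠ c.mate s n →
    c.Above s n n' ∨ c.Above s n' n ∨ ¬ c.Crosses s n n'

variable {c : Config}

theorem Valid.x_ne (h : c.Valid) {n n' : ℕ} (hn : n ∈ c.N) (hn' : n' ∈ c.N) (hne : n ≠ n')
    (s : Bool) : c.x s n ≠ c.x s n' := by
  rcases h.x_lt n hn n' hn' hne with h | h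
  · exact (h s).ne
  · exact (h s).ne'

theorem Valid.x_mate_ne (h : c.Valid) {n : ℕ} (hn : n ∈ c.N) (s : Bool) :
    c.x s n ≠ c.x s (c.mate s n) :=
  h.x_ne hn (h.mate_mem s n hn) (h.mate_ne s n hn).symm s

theorem Valid.apex_mate (h : c.Valid) {n : ℕ} (hn : n ∈ c.N) (s : Bool) :
    c.apex s (c.mate s n) = c.apex s n := by
  unfold apex; rw [h.mate_mate s n hn, abs_sub_comm, add_comm (c.x s _), add_comm (c.lev s _)]

theorem mem_ramp {n : ℕ} {W : ℝ} (hW : 0 ≤ W) {p : 𝕊} : p ∈ c.piece none n W ↔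
    ∃ t ∈ 𝕀, p.1.re = (1 - t) * c.x false n + t * c.x true n ∧
      p.1.im = 2 * t - 1 ∧ |p.2 - ((1 - t) * c.lev false n + t * c.lev true n)| ≤ W := by
  have e : ∀ t : ℝ, (1 - t) * -1 + t * 1 = 2 * t - 1 := fun t => by ring
  simp only [piece, mem_wall hW, knee, sg, e]

theorem mem_arm {s : Bool} {n : ℕ} {W : ℝ} (hW : 0 ≤ W) {p : 𝕊} :
    p ∈ c.piece (some s) n W ↔ ∃ t ∈ 𝕀,
      p.1.re = c.x s n + t * ((c.x s (c.mate s n) - c.x s n) / 2) ∧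
      p.1.im = sg s * (1 + t * (|c.x s n - c.x s (c.mate s n)| / 2)) ∧
      |p.2 - (c.lev s n + t * ((c.lev s (c.mate s n) - c.lev s n) / 2))| ≤ W := by
  have e : ∀ t a b : ℝ, (1 - t) * a + t * ((a + b) / 2) = a + t * ((b - a) / 2) :=
    fun t a b => by ring
  have e' : ∀ t a : ℝ, (1 - t) * sg s + t * (sg s * (1 + a)) = sg s * (1 + t * a) :=
    fun t a => by ring
  simp only [piece, mem_wall hW, knee, apex, e, e']

theorem abs_im_of_mem_ramp {n : ℕ} {W : ℝ} (hW : 0 ≤ W) {p : 𝕊} (hp : p ∈ c.piece none n W) :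
    |p.1.im| ≤ 1 := by
  obtain ⟨t, ht, -, h2, -⟩ := (mem_ramp hW).1 hp; rw [h2, abs_le]
  constructor <;> linarith [ht.1, ht.2]

theorem im_of_mem_arm {s : Bool} {n : ℕ} {W : ℝ} (hW : 0 ≤ W) {p : 𝕊}
    (hp : p ∈ c.piece (some s) n W) : 1 ≤ sg s * p.1.im := by
  obtain ⟨t, ht, -, h2, -⟩ := (mem_arm hW).1 hp; rw [h2, ← mul_assoc, sg_mul_self, one_mul]
  have := mul_nonneg ht.1 (by positivity : 0 ≤ |c.x s n - c.x s (c.mate s n)| / 2); linarith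

theorem Valid.ramp_disjoint (h : c.Valid) {W : ℝ} (hW : 0 ≤ W) {n n' : ℕ} (hn : n ∈ c.N)
    (hn' : n' ∈ c.N) (hne : n ≠ n') : Disjoint (c.piece none n W) (c.piece none n' W) := by
  rw [Set.disjoint_left]; intro p hp hp'; obtain ⟨t, ht, h1, h2, -⟩ := (mem_ramp hW).1 hp
  obtain ⟨t', ht', h1', h2', -⟩ := (mem_ramp hW).1 hp'; have : t = t' := by linarith
  subst this; have a := ht.1; have b := ht.2; rcases h.x_lt n hn n' hn' hne with h | h <;>
  · have i1 := h false; have i2 := h true; rcases a.eq_or_lt with rfl | a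
    · simp at h1 h1'; linarith
    · nlinarith

theorem Valid.ramp_arm_disjoint (h : c.Valid) {W : ℝ} (hW : 0 ≤ W) {n n' : ℕ} (hn : n ∈ c.N)
    (hn' : n' ∈ c.N) (hne : n ≠ n') (s : Bool) :
    Disjoint (c.piece none n W) (c.piece (some s) n' W) := by
  rw [Set.disjoint_left]; intro p hp hp'; obtain ⟨t, ht, h1, h2, -⟩ := (mem_ramp hW).1 hp
  obtain ⟨t', ht', h1', h2', -⟩ := (mem_arm hW).1 hp'; have hx := h.x_mate_ne hn' s
  have hpos : 0 < |c.x s n' - c.x s (c.mate s n')| / 2 :=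
    half_pos (abs_pos.2 (sub_ne_zero.2 hx))
  have hxx := h.x_ne hn hn' hne s
  have ht'0 : t' = 0 := by
    by_contra h0; have : 0 < t' := lt_of_le_of_ne ht'.1 (Ne.symm h0); have := mul_pos this hpos
    have b1 := ht.1; have b2 := ht.2; cases s <;> simp only [sg] at h2' <;> linarith
  subst ht'0; rw [zero_mul, add_zero] at h1' h2'; cases s <;> simp only [sg] at h2'
  · have : t = 0 := by linarith
    subst this; apply hxx; linarith
  · have : t = 1 := by linarith
    subst this; apply hxx; linarith

theorem arm_disjoint_of_ne {W : ℝ} (hW : 0 ≤ W) {s s' : Bool} (hs : s ≠ s') (n n' : ℕ) :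
    Disjoint (c.piece (some s) n W) (c.piece (some s') n' W) := by
  rw [Set.disjoint_left]; intro p hp hp'; have h1 := im_of_mem_arm hW hp
  have h2 := im_of_mem_arm hW hp'; cases s <;> cases s' <;> simp [sg] at h1 h2 hs <;> linarith

theorem Above.disjoint {W : ℝ} (hW : 0 ≤ W) {s : Bool} {n n' : ℕ} (h : c.Above s n n')
    (hWc : W ≤ 3 / 2 * c.w) : Disjoint (c.piece (some s) n W) (c.piece (some s) n' W) := by
  rw [Set.disjoint_left]; intro p hp hp'; obtain ⟨t, ht, -, -, h3⟩ := (mem_arm hW).1 hp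
  obtain ⟨t', ht', -, -, h3'⟩ := (mem_arm hW).1 hp'; obtain ⟨a1, a2, a3, a4⟩ := h
  have b := (abs_le.1 h3).1; have b' := (abs_le.1 h3').2; obtain ⟨t0, t1⟩ := ht
  obtain ⟨t0', t1'⟩ := ht'; set A := c.lev s n; set A' := c.lev s (c.mate s n); set B := c.lev s n'
  set B' := c.lev s (c.mate s n')
  have k1 : max B B' + 3 * c.w < min A A' := by
    rw [← max_add_add_right]; exact max_lt (lt_min a1 a3) (lt_min a2 a4)
  have k2 : min A A' ≤ A + t * ((A' - A) / 2) := by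
    have := min_le_left A A'; have := min_le_right A A'; nlinarith
  have k3 : B + t' * ((B' - B) / 2) ≤ max B B' := by
    have := le_max_left B B'; have := le_max_right B B'; nlinarith
  linarith

/-- Different halves of arcs on one side that are not separated by heights meet only if the arcs cross. -/
theorem arm_disjoint_of_not_crosses {W : ℝ} (hW : 0 ≤ W) {s : Bool} {n n' : ℕ}
    (h0 : c.x s n ≠ c.x s n') (h1 : c.x s n ≠ c.x s (c.mate s n'))
    (h2 : c.x s n' ≠ c.x s (c.mate s n))
    (h : ¬ c.Crosses s n n') (h' : ¬ c.Crosses s n' n) :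
    Disjoint (c.piece (some s) n W) (c.piece (some s) n' W) := by
  rw [Set.disjoint_left]; intro p hp hp'; obtain ⟨t, ⟨t0, t1⟩, e1, e2, -⟩ := (mem_arm hW).1 hp
  obtain ⟨t', ⟨t0', t1'⟩, e1', e2', -⟩ := (mem_arm hW).1 hp'
  have e3 : t * (|c.x s n - c.x s (c.mate s n)| / 2) =
      t' * (|c.x s n' - c.x s (c.mate s n')| / 2) := by
    rw [e2] at e2'; have hs : sg s ≠ 0 := by cases s <;> simp [sg]
    have := mul_left_cancel₀ hs e2'; linarith
  rw [e1] at e1'; simp only [Crosses, not_and] at h h'; set A := c.x s n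
  set B := c.x s (c.mate s n); set A' := c.x s n'; set B' := c.x s (c.mate s n')
  rcases le_total A B with i | i <;> rcases le_total A' B' with i' | i'
  · rw [abs_of_nonpos (by linarith), abs_of_nonpos (by linarith)] at e3; exact h0 (by linarith)
  · rw [abs_of_nonpos (by linarith), abs_of_nonneg (by linarith)] at e3
    have k1 : A ≤ A' := by nlinarith
    have k2 : B' ≤ A := by nlinarith
    have k3 : A' ≤ B := by nlinarith
    exact h (lt_of_le_of_ne k2 h1.symm) (lt_of_le_of_ne k1 h0) (lt_of_le_of_ne k3 h2)
  · rw [abs_of_nonneg (by linarith), abs_of_nonpos (by linarith)] at e3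
    have k1 : A' ≤ A := by nlinarith
    have k2 : B ≤ A' := by nlinarith
    have k3 : A ≤ B' := by nlinarith
    exact h' (lt_of_le_of_ne k2 h2.symm) (lt_of_le_of_ne k1 h0.symm) (lt_of_le_of_ne k3 h1)
  · rw [abs_of_nonneg (by linarith), abs_of_nonneg (by linarith)] at e3; exact h0 (by linarith)

theorem Valid.arm_disjoint (h : c.Valid) {W : ℝ} (hW : 0 ≤ W) (hWc : W ≤ 3 / 2 * c.w) {n n' : ℕ}
    (hn : n ∈ c.N) (hn' : n' ∈ c.N) (s : Bool) (hne : n' ≠ n) (hm : n' ≠ c.mate s n) :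
    Disjoint (c.piece (some s) n W) (c.piece (some s) n' W) := by
  have hm' : n ≠ c.mate s n' := by
    intro e; apply hm; rw [e, h.mate_mate s n' hn']
  rcases h.sep s n hn n' hn' hne hm with h1 | h1 | h1
  · exact h1.disjoint hW hWc
  · exact (h1.disjoint hW hWc).symm
  rcases h.sep s n' hn' n hn hne.symm hm' with h2 | h2 | h2
  · exact (h2.disjoint hW hWc).symm
  · exact h2.disjoint hW hWc
  exact arm_disjoint_of_not_crosses hW (h.x_ne hn hn' hne.symm s)
    (h.x_ne hn (h.mate_mem s n' hn') hm' s) (h.x_ne hn' (h.mate_mem s n hn) hm s) h1 h2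

theorem Valid.piece_subset (h : c.Valid) {W : ℝ} (hW : 0 ≤ W) (hWc : W ≤ 3 / 2 * c.w) {n : ℕ}
    (hn : n ∈ c.N) (k : Option Bool) : c.piece k n W ⊆ thickened := by
  intro p hp; rcases k with _ | s
  · obtain ⟨t, ⟨t0, t1⟩, e1, e2, e3⟩ := (mem_ramp hW).1 hp; obtain ⟨a1, a2⟩ := h.lev_mem false n hn
    obtain ⟨b1, b2⟩ := h.lev_mem true n hn; obtain ⟨e4, e5⟩ := abs_le.1 e3
    have l1 : 0 < p.2 := by linarith [lt_convex a1 b1 t0 t1]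
    have l2 : p.2 < 1 := by linarith [convex_lt a2 b2 t0 t1]
    by_cases hi : p.1.im = 0
    · refine mem_thickened_of_re (fun k hk hk' hre => h.gap n hn k hk hk' ?_) l1 l2
      have : t = 1 / 2 := by linarith
      subst this; linarith
    · exact mem_thickened_of_im hi l1 l2
  · have him := im_of_mem_arm hW hp; obtain ⟨t, ⟨t0, t1⟩, e1, e2, e3⟩ := (mem_arm hW).1 hp
    obtain ⟨a1, a2⟩ := h.lev_mem s n hn; obtain ⟨b1, b2⟩ := h.lev_mem s _ (h.mate_mem s n hn)
    obtain ⟨e4, e5⟩ := abs_le.1 e3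
    refine mem_thickened_of_im (fun h0 => ?_) (by nlinarith) (by nlinarith); rw [h0] at him
    linarith

/-! ### Configurations as polygons -/

/-- The union of two perfect matchings is a bipartite graph. -/
theorem exists_coloring {N : Type*} (l u : N → N) (hl : Function.Involutive l)
    (hu : Function.Involutive u) (hl' : ∀ n, l n ≠ n) (hu' : ∀ n, u n ≠ n) :
    ∃ col : N → Bool, ∀ n, col (l n) = !col n ∧ col (u n) = !col n := by
  classical
  let L : Equiv.Perm N := hl.toPerm
  let U : Equiv.Perm N := hu.toPerm
  let ρ : Equiv.Perm N := U * L
  have hLL : L * L = 1 := by ext n; exact hl n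
  have hUU : U * U = 1 := by ext n; exact hu n
  have hinv : ρ⁻¹ = L * U := by
    rw [inv_eq_iff_mul_eq_one]
    calc U * L * (L * U) = U * (L * L) * U := by group
      _ = 1 := by rw [hLL, mul_one, hUU]
  have hconj : ∀ i : ℤ, L * ρ ^ i = ρ ^ (-i) * L := by
    intro i
    have h1 : L * ρ * L⁻¹ = ρ⁻¹ := by
      rw [hinv, mul_inv_eq_iff_eq_mul]; simp only [ρ]; group
    have h2 : (L * ρ * L⁻¹) ^ i = L * ρ ^ i * L⁻¹ := conj_zpow; rw [h1, inv_zpow, ← zpow_neg] at h2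
    rw [h2]; group
  have hne : ∀ n, ¬ ρ.SameCycle n (l n) := by
    rintro n ⟨k, hk⟩
    have hkey : ∀ i : ℤ, L ((ρ ^ i) n) = (ρ ^ (k - i)) n := by
      intro i
      rw [← Equiv.Perm.mul_apply, hconj, Equiv.Perm.mul_apply, sub_eq_neg_add, zpow_add,
        Equiv.Perm.mul_apply, hk]
      rfl
    rcases Int.even_or_odd' k with ⟨i, rfl | rfl⟩
    · refine hl' ((ρ ^ i) n) ?_; have := hkey i; rw [show 2 * i - i = i by ring] at this; exact this
    · refine hu' (L ((ρ ^ i) n)) ?_; have := hkey i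
      rw [show 2 * i + 1 - i = 1 + i by ring, zpow_add, zpow_one, Equiv.Perm.mul_apply] at this
      exact this.symm
  let cyc : N → Quotient (Equiv.Perm.SameCycle.setoid ρ) := Quotient.mk _
  have hcyc : ∀ n, cyc (u n) = cyc (l n) := by
    intro n; refine Quotient.sound (s := Equiv.Perm.SameCycle.setoid ρ) ?_; refine ⟨-1, ?_⟩
    rw [zpow_neg_one, hinv, Equiv.Perm.mul_apply]; change l (u (u n)) = l n; rw [hu]
  have hcyc' : ∀ n, cyc n ≠ cyc (l n) := fun n h =>
    hne n (Quotient.exact (s := Equiv.Perm.SameCycle.setoid ρ) h)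
  let r : LinearOrder (Quotient (Equiv.Perm.SameCycle.setoid ρ)) := IsWellOrder.linearOrder WellOrderingRel
  have hdec : ∀ n m, cyc m = cyc (l n) → cyc (l m) = cyc n →
      decide (cyc m < cyc (l m)) = !decide (cyc n < cyc (l n)) := by
    intro n m h1 h2; rw [h1, h2]; rcases lt_or_gt_of_ne (hcyc' n) with h | h
    · simp [h, h.le]
    · simp [h, h.le]
  refine ⟨fun n => decide (cyc n < cyc (l n)), fun n => ⟨?_, ?_⟩⟩
  · exact hdec n (l n) rfl (by rw [hl])
  · refine hdec n (u n) (hcyc n) ?_; rw [← hcyc (u n), hu]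

/-- A consistent orientation of the strands. -/
def IsColoring (c : Config) (col : ℕ → Bool) : Prop :=
  ∀ s, ∀ n ∈ c.N, col (c.mate s n) = !col n

theorem Valid.exists_coloring (h : c.Valid) : ∃ col, c.IsColoring col := by
  have inv : ∀ s, Function.Involutive
      (fun n : c.N => (⟨c.mate s n, h.mate_mem s n n.2⟩ : c.N)) := fun s n =>
    Subtype.ext (h.mate_mate s n n.2)
  obtain ⟨col, hcol⟩ := Config.exists_coloring _ _ (inv false) (inv true)
    (fun n e => h.mate_ne false n n.2 (congrArg Subtype.val e))
    (fun n e => h.mate_ne true n n.2 (congrArg Subtype.val e))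
  refine ⟨fun n => if hn : n ∈ c.N then col ⟨n, hn⟩ else false, fun s n hn => ?_⟩
  simp only [dif_pos hn, dif_pos (h.mate_mem s n hn)]; cases s
  · exact (hcol ⟨n, hn⟩).1
  · exact (hcol ⟨n, hn⟩).2

/-- The permutation of the edges of the polygon. -/
def next (c : Config) (h : c.Valid) (col : ℕ → Bool) (hcol : c.IsColoring col) :
    Equiv.Perm (c.N × Fin 3) where
  toFun
    | (n, 0) => (n, 1)
    | (n, 1) => (n, 2)
    | (n, 2) => (⟨c.mate (col n) n, h.mate_mem _ n n.2⟩, 0)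
  invFun
    | (n, 0) => (⟨c.mate (!col n) n, h.mate_mem _ n n.2⟩, 2)
    | (n, 1) => (n, 0)
    | (n, 2) => (n, 1)
  left_inv := by
    rintro ⟨n, k⟩; fin_cases k
    · rfl
    · rfl
    · refine Prod.ext (Subtype.ext ?_) rfl
      simp only [hcol (col n) n n.2, Bool.not_not, h.mate_mate (col n) n n.2]
  right_inv := by
    rintro ⟨n, k⟩; fin_cases k
    · refine Prod.ext (Subtype.ext ?_) rfl
      simp only [hcol (!col n) n n.2, h.mate_mate (!col n) n n.2]
    · rfl
    · rfl

/-- The vertices of the polygon. -/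
def vert (c : Config) (col : ℕ → Bool) : c.N × Fin 3 → 𝕊
  | (n, 0) => c.apex (!col n) n
  | (n, 1) => c.knee (!col n) n
  | (n, 2) => c.knee (col n) n

/-- The piece of the configuration that is an edge of the polygon. -/
def kind (col : ℕ → Bool) (n : ℕ) : Fin 3 → Option Bool
  | 0 => some (!col n)
  | 1 => none
  | 2 => some (col n)

theorem Valid.wall_vert (h : c.Valid) {col : ℕ → Bool} (hcol : c.IsColoring col) (W : ℝ)
    (n : c.N) (k : Fin 3) : wall (c.vert col (n, k)) (c.vert col (c.next h col hcol (n, k))) W =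
      c.piece (kind col n k) n W := by
  fin_cases k
  · exact wall_symm _ _ _
  · change wall (c.knee (!col n) n) (c.knee (col n) n) W = wall _ _ _; cases col n
    · exact wall_symm _ _ _
    · rfl
  · change wall (c.knee (col n) n) (c.apex (!col (c.mate (col n) n)) (c.mate (col n) n)) W =
      wall _ _ _
    rw [hcol _ n n.2, Bool.not_not, h.apex_mate n.2]

theorem Valid.transv_knee (h : c.Valid) {n : ℕ} (hn : n ∈ c.N) (s : Bool) :
    Transv (c.knee s n).1 (c.apex s n).1 (c.knee (!s) n).1 := by
  have hpos : 0 < |c.x s n - c.x s (c.mate s n)| / 2 :=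
    half_pos (abs_pos.2 (sub_ne_zero.2 (h.x_mate_ne hn s)))
  refine transv_of_linear 0 (sg s) ?_ ?_
  · simp only [apex, knee, Complex.sub_im, zero_mul, zero_add]; have := sg_mul_self s; nlinarith
  · simp only [knee, Complex.sub_im, zero_mul, zero_add, sg_not]; have := sg_mul_self s; nlinarith

theorem Valid.transv_apex (h : c.Valid) {n : ℕ} (hn : n ∈ c.N) (s : Bool) :
    Transv (c.apex s n).1 (c.knee s n).1 (c.knee s (c.mate s n)).1 := by
  rcases lt_or_gt_of_ne (h.x_mate_ne hn s) with h | h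
  · refine transv_of_linear (-1) 0 ?_ ?_ <;>
    · simp only [apex, knee, Complex.sub_re]; linarith
  · refine transv_of_linear 1 0 ?_ ?_ <;>
    · simp only [apex, knee, Complex.sub_re]; linarith

theorem Valid.knee_ne_apex (h : c.Valid) {n : ℕ} (hn : n ∈ c.N) (s : Bool) :
    (c.knee s n).1 ≠ (c.apex s n).1 := by
  intro e; have := congrArg Complex.re e; simp only [apex, knee] at this
  exact h.x_mate_ne hn s (by linarith)

theorem knee_ne_knee (n : ℕ) (s : Bool) : (c.knee s n).1 ≠ (c.knee (!s) n).1 := by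
  intro e; have := congrArg Complex.im e; simp only [knee, sg_not] at this; have := sg_mul_self s
  nlinarith

theorem Valid.polyOK (h : c.Valid) {col : ℕ → Bool} (hcol : c.IsColoring col) {W : ℝ}
    (hW : 0 ≤ W) (hWc : W ≤ 3 / 2 * c.w) : PolyOK (c.next h col hcol) (c.vert col) W where
  ne := by
    rintro ⟨n, k⟩; fin_cases k
    · exact (h.knee_ne_apex n.2 _).symm
    · have := knee_ne_knee (c := c) n (!col n); rwa [Bool.not_not] at this
    · change (c.knee (col n) n).1 ≠ (c.apex (!col (c.mate (col n) n)) (c.mate (col n) n)).1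
      rw [hcol _ n n.2, Bool.not_not, h.apex_mate n.2]; exact h.knee_ne_apex n.2 _
  transv := by
    rintro ⟨n, k⟩; fin_cases k
    · have := h.transv_knee n.2 (!col n); rwa [Bool.not_not] at this
    · change Transv (c.knee (col n) n).1 (c.knee (!col n) n).1
        (c.apex (!col (c.mate (col n) n)) (c.mate (col n) n)).1
      rw [hcol _ n n.2, Bool.not_not, h.apex_mate n.2]; exact (h.transv_knee n.2 (col n)).symm
    · change Transv (c.apex (!col (c.mate (col n) n)) (c.mate (col n) n)).1 (c.knee (col n) n).1
        (c.knee (!col (c.mate (col n) n)) (c.mate (col n) n)).1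
      rw [hcol _ n n.2, Bool.not_not, h.apex_mate n.2]; exact h.transv_apex n.2 (col n)
  disj := by
    rintro ⟨n, k⟩ ⟨n', k'⟩ h1 h2 h3; rw [h.wall_vert hcol, h.wall_vert hcol]
    have e1 : n' ≠ n → (n' : ℕ) ≠ n := fun e e' => e (Subtype.ext e')
    have arm : ∀ s s', (s = s' → n' ≠ n ∧ (n' : ℕ) ≠ c.mate s n) →
        Disjoint (c.piece (some s) n W) (c.piece (some s') n' W) := by
      intro s s' hs; by_cases hss : s = s'
      · subst hss; exact h.arm_disjoint hW hWc n.2 n'.2 s (e1 (hs rfl).1) (hs rfl).2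
      · exact arm_disjoint_of_ne hW hss _ _
    have colm : ∀ s, (n' : ℕ) = c.mate s n → col n' = !col n := by
      intro s e; rw [e, hcol s n n.2]
    fin_cases k <;> fin_cases k'
    · refine arm _ _ fun e => ⟨fun e' => h1 (by rw [e']), fun e' => ?_⟩
      have := colm _ e'; rw [this] at e; simp at e
    · refine (h.ramp_arm_disjoint hW n'.2 n.2 (e1 fun e' => h2 ?_) _).symm; rw [e']; rfl
    · refine arm _ _ fun e => ⟨fun e' => ?_, fun e' => h3 ?_⟩
      · subst e'; simp at e
      · refine Prod.ext (Subtype.ext ?_) rfl; change (n : ℕ) = c.mate (col n') n'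
        rw [colm _ e', e', h.mate_mate _ n n.2]
    · refine h.ramp_arm_disjoint hW n.2 n'.2 (e1 fun e' => h3 ?_).symm _; rw [e']; rfl
    · exact h.ramp_disjoint hW n.2 n'.2 (e1 fun e' => h1 (by rw [e'])).symm
    · refine h.ramp_arm_disjoint hW n.2 n'.2 (e1 fun e' => h2 ?_).symm _; rw [e']; rfl
    · refine arm _ _ fun e => ⟨fun e' => ?_, fun e' => h2 ?_⟩
      · subst e'; simp at e
      · exact Prod.ext (Subtype.ext e') rfl
    · refine (h.ramp_arm_disjoint hW n'.2 n.2 (e1 fun e' => h3 ?_) _).symm; rw [e']; rfl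
    · refine arm _ _ fun e => ⟨fun e' => h1 (by rw [e']), fun e' => ?_⟩
      have := colm _ e'; rw [this] at e; simp at e
  inside := by
    rintro ⟨n, k⟩; rw [h.wall_vert hcol]; exact h.piece_subset hW hWc n.2 _

theorem Valid.iUnion_wall (h : c.Valid) {col : ℕ → Bool} (hcol : c.IsColoring col) (W : ℝ) :
    ⋃ j, wall (c.vert col j) (c.vert col (c.next h col hcol j)) W = c.body W := by
  ext p; simp only [mem_iUnion, body, Prod.exists, h.wall_vert hcol]; constructor
  · rintro ⟨n, k, hp⟩; exact ⟨_, n, n.2, hp⟩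
  · rintro ⟨k, n, hn, hp⟩; rcases k with _ | s
    · exact ⟨⟨n, hn⟩, 1, hp⟩
    · by_cases hs : s = col n
      · exact ⟨⟨n, hn⟩, 2, by rw [hs] at hp; exact hp⟩
      · have : s = !col n := by cases s <;> cases hc : col n <;> simp_all
        exact ⟨⟨n, hn⟩, 0, by rw [this] at hp; exact hp⟩

/-- The framed link of a configuration. -/
def link (c : Config) (h : c.Valid) : FramedLink where
  core := c.body 0
  band := c.body c.w
  isFramedLink := by
    obtain ⟨col, hcol⟩ := h.exists_coloring
    have := (h.polyOK hcol (W := 3 / 2 * c.w) (by linarith [h.w_pos]) le_rfl).isFramedLink h.w_pos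
    rwa [h.iUnion_wall, h.iUnion_wall] at this

end Config




/-! ### Isotopies of configurations -/

namespace Config

/-- The linear interpolation of two configurations. -/
def lerp (c c' : Config) (τ : ℝ) : Config where
  N := c.N
  mate := c.mate
  x s n := (1 - τ) * c.x s n + τ * c'.x s n
  lev s n := (1 - τ) * c.lev s n + τ * c'.lev s n
  w := (1 - τ) * c.w + τ * c'.w

theorem abs_convex {a b τ : ℝ} (h : (0 ≤ a ∧ 0 ≤ b) ∨ (a ≤ 0 ∧ b ≤ 0)) (h0 : 0 ≤ τ) (h1 : τ ≤ 1) :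
    |(1 - τ) * a + τ * b| = (1 - τ) * |a| + τ * |b| := by
  rcases h with ⟨ha, hb⟩ | ⟨ha, hb⟩
  · rw [abs_of_nonneg ha, abs_of_nonneg hb, abs_of_nonneg (by positivity)]
  · rw [abs_of_nonpos ha, abs_of_nonpos hb, abs_of_nonpos]
    · ring
    · nlinarith

theorem mov_eq (P P' : 𝕊) (τ : ℝ) : mov P P' τ =
    (⟨(1 - τ) * P.1.re + τ * P'.1.re, (1 - τ) * P.1.im + τ * P'.1.im⟩,
      (1 - τ) * P.2 + τ * P'.2) := by
  unfold mov; refine Prod.ext (Complex.ext ?_ ?_) ?_ <;> simp <;> ring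

theorem knee_lerp (c c' : Config) (τ : ℝ) (s : Bool) (n : ℕ) :
    (lerp c c' τ).knee s n = mov (c.knee s n) (c'.knee s n) τ := by
  rw [mov_eq]; simp only [knee, lerp]; refine Prod.ext (Complex.ext rfl ?_) rfl; simp only; ring

theorem apex_lerp {c c' : Config} {τ : ℝ} (h0 : 0 ≤ τ) (h1 : τ ≤ 1) {s : Bool} {n : ℕ}
    (hm : c'.mate s n = c.mate s n)
    (hx : c.x s n < c.x s (c.mate s n) ∧ c'.x s n < c'.x s (c.mate s n) ∨
      c.x s (c.mate s n) < c.x s n ∧ c'.x s (c.mate s n) < c'.x s n) :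
    (lerp c c' τ).apex s n = mov (c.apex s n) (c'.apex s n) τ := by
  rw [mov_eq]; simp only [apex, lerp, hm]
  have e : (1 - τ) * c.x s n + τ * c'.x s n -
      ((1 - τ) * c.x s (c.mate s n) + τ * c'.x s (c.mate s n)) =
      (1 - τ) * (c.x s n - c.x s (c.mate s n)) + τ * (c'.x s n - c'.x s (c.mate s n)) := by ring
  rw [e, abs_convex _ h0 h1]
  · refine Prod.ext (Complex.ext ?_ ?_) ?_ <;> simp only <;> ring
  · rcases hx with ⟨a, b⟩ | ⟨a, b⟩
    · exact .inr ⟨by linarith, by linarith⟩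
    · exact .inl ⟨by linarith, by linarith⟩

/-- Configurations are isotopic if all their interpolations are valid. -/
theorem isotopic_of_lerp {c c' : Config} (h : c.Valid) (h' : c'.Valid) (hN : c'.N = c.N)
    (hm : ∀ s, ∀ n ∈ c.N, c'.mate s n = c.mate s n)
    (hx : ∀ s, ∀ n ∈ c.N, ∀ n' ∈ c.N, c.x s n < c.x s n' → c'.x s n < c'.x s n')
    (hv : ∀ τ ∈ 𝕀, (lerp c c' τ).Valid) : Isotopic (c.link h) (c'.link h') := by
  obtain ⟨col, hcol⟩ := h.exists_coloring
  have hcol' : c'.IsColoring col := by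
    intro s n hn; rw [hN] at hn; rw [hm s n hn]; exact hcol s n hn
  let e : c.N ≃ c'.N := Equiv.subtypeEquivRight fun n => by rw [hN]
  let σ := c.next h col hcol
  let P := c.vert col
  let P' : c.N × Fin 3 → 𝕊 := fun j => c'.vert col (e j.1, j.2)
  have hxm : ∀ s, ∀ n ∈ c.N, c.x s n < c.x s (c.mate s n) ∧ c'.x s n < c'.x s (c.mate s n) ∨
      c.x s (c.mate s n) < c.x s n ∧ c'.x s (c.mate s n) < c'.x s n := by
    intro s n hn; have hmem := h.mate_mem s n hn
    rcases lt_or_gt_of_ne (h.x_mate_ne hn s) with hlt | hlt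
    · exact .inl ⟨hlt, hx s n hn _ hmem hlt⟩
    · exact .inr ⟨hlt, hx s _ hmem n hn hlt⟩
  have hmov : ∀ τ ∈ 𝕀, ∀ j, mov (P j) (P' j) τ = (lerp c c' τ).vert col j := by
    rintro τ hτ ⟨n, k⟩; fin_cases k
    · exact (apex_lerp hτ.1 hτ.2 (hm _ n n.2) (hxm _ n n.2)).symm
    · exact (knee_lerp c c' τ _ n).symm
    · exact (knee_lerp c c' τ _ n).symm
  have hww : ∀ τ : ℝ, c.w + τ * (c'.w - c.w) = (lerp c c' τ).w := by
    intro τ; simp only [lerp]; ring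
  have hpoly : ∀ τ ∈ 𝕀, PolyOK σ (fun j => mov (P j) (P' j) τ)
      (c.w + τ * (c'.w - c.w)) := by
    intro τ hτ; have hp := (hv τ hτ).w_pos
    have := (hv τ hτ).polyOK (col := col) hcol (W := (lerp c c' τ).w) hp.le (by linarith); rw [hww]
    have e2 : (fun j => mov (P j) (P' j) τ) = (lerp c c' τ).vert col :=
      funext fun j => hmov τ hτ j
    have hσ : (lerp c c' τ).next (hv τ hτ) col hcol = σ := by
      ext ⟨n, k⟩ : 1; fin_cases k <;> rfl
    rw [e2, ← hσ]; exact this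
  obtain ⟨φ, hφ, -, hφw⟩ := exists_wall_isotopy (V := c.N × Fin 3) (E := c.N × Fin 3)
    (fun j => j) (fun j => σ j) P P' c.w c'.w h.w_pos h'.w_pos ∅ isCompact_empty
    (empty_subset _) (fun τ hτ j j' => (hpoly τ hτ).edgeOK j j')
    (fun j => .inr fun τ hτ => disjoint_empty _) (fun τ hτ j => (hpoly τ hτ).inside j)
  have himg : ∀ r : ℝ, r ∈ 𝕀 → φ '' (c.body (r * c.w)) = c'.body (r * c'.w) := by
    intro r hr; rw [← h.iUnion_wall hcol, ← h'.iUnion_wall hcol', image_iUnion]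
    refine iUnion_congr_of_surjective _ (e.prodCongr (Equiv.refl _)).surjective fun j => ?_
    have hvert' : P' (σ j) = c'.vert col (c'.next h' col hcol' (e j.1, j.2)) := by
      obtain ⟨n, k⟩ := j; fin_cases k
      · rfl
      · rfl
      · change c'.vert col (e ⟨c.mate (col n) n, _⟩, 0) =
          c'.vert col (⟨c'.mate (col (e n)) (e n), _⟩, 0)
        congr 2; exact Subtype.ext (hm _ n n.2).symm
    change wall (P' j) (c'.vert col (c'.next h' col hcol' (e j.1, j.2))) (r * c'.w) =
      φ '' wall (P j) (P (σ j)) (r * c.w)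
    rw [← hvert', wall_scale hr, wall_scale hr]; ext p
    have hsub : Icc (-r) r ⊆ Icc (-1 : ℝ) 1 := Icc_subset_Icc (by linarith [hr.2]) hr.2; constructor
    · rintro ⟨t, ht, u, hu, rfl⟩; exact ⟨_, ⟨t, ht, u, hu, rfl⟩, hφw j t ht u (hsub hu)⟩
    · rintro ⟨_, ⟨t, ht, u, hu, rfl⟩, rfl⟩; exact ⟨t, ht, u, hu, hφw j t ht u (hsub hu)⟩
  refine ⟨φ, hφ, ?_, ?_⟩
  · have := himg 0 (by simp); rwa [zero_mul, zero_mul] at this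
  · have := himg 1 (by simp); rwa [one_mul, one_mul] at this

end Config

/-! ### Chord diagrams

A chord diagram consists of a list of chords for the lower side (`false`) and one for the upper side
(`true`).  The ends of the chords are labels on the axis, where the punctures have the labels `32`,
`64`, `96` and `128`.  Earlier chords in a list pass above later ones. -/

/-- The chords `a` and `b` cross. -/
def cross (a b : ℕ × ℕ) : Bool :=
  (decide (a.1 < b.1) && decide (b.1 < a.2) && decide (a.2 < b.2)) ||
    (decide (b.1 < a.1) && decide (a.1 < b.2) && decide (b.2 < a.2))

/-- The ends of the chords. -/
def ends (l : Chords) : List ℕ := l.flatMap fun a => [a.1, a.2]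

theorem mem_ends {l : Chords} {n : ℕ} : n ∈ ends l ↔ ∃ a ∈ l, n = a.1 ∨ n = a.2 := by
  simp [ends]

/-- The chord `a` lies above the chord `b`. -/
def Config.ChordAbove (c : Config) (s : Bool) (a b : ℕ × ℕ) : Prop :=
  c.lev s b.1 + 3 * c.w < c.lev s a.1 ∧ c.lev s b.2 + 3 * c.w < c.lev s a.1 ∧
  c.lev s b.1 + 3 * c.w < c.lev s a.2 ∧ c.lev s b.2 + 3 * c.w < c.lev s a.2

/-- The configuration `c` realizes the chord diagram `D`. -/
structure Realizes (c : Config) (D : Diagram) : Prop where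
  w_pos : 0 < c.w
  mem_iff : ∀ s n, n ∈ c.N ↔ n ∈ ends (D s)
  mates : ∀ s, ∀ a ∈ D s, c.mate s a.1 = a.2 ∧ c.mate s a.2 = a.1 ∧ a.1 < a.2
  x_mono : ∀ s, ∀ n ∈ c.N, ∀ n' ∈ c.N, n < n' → c.x s n < c.x s n'
  gap : ∀ n ∈ c.N, ∀ k : ℕ, 1 ≤ k → k ≤ 4 → n < 32 * k ∧ c.x false n + c.x true n < 2 * k ∨
    32 * k < n ∧ 2 * k < c.x false n + c.x true n
  lev_mem : ∀ s, ∀ n ∈ c.N, 3 / 2 * c.w < c.lev s n ∧ c.lev s n + 3 / 2 * c.w < 1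
  pair : ∀ s, (D s).Pairwise fun a b => cross a b = true → c.ChordAbove s a b

namespace Realizes

variable {c c' : Config} {D : Diagram}

theorem exists_chord (h : Realizes c D) (s : Bool) {n : ℕ} (hn : n ∈ c.N) :
    ∃ a ∈ D s, (n = a.1 ∧ c.mate s n = a.2) ∨ (n = a.2 ∧ c.mate s n = a.1) := by
  obtain ⟨a, ha, hna⟩ := mem_ends.1 ((h.mem_iff s n).1 hn)
  refine ⟨a, ha, hna.imp (fun e => ⟨e, ?_⟩) (fun e => ⟨e, ?_⟩)⟩
  · rw [e, (h.mates s a ha).1]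
  · rw [e, (h.mates s a ha).2.1]

theorem mem_of_chord (h : Realizes c D) (s : Bool) {a : ℕ × ℕ} (ha : a ∈ D s) :
    a.1 ∈ c.N ∧ a.2 ∈ c.N :=
  ⟨(h.mem_iff s _).2 (mem_ends.2 ⟨a, ha, .inl rfl⟩),
    (h.mem_iff s _).2 (mem_ends.2 ⟨a, ha, .inr rfl⟩)⟩

theorem valid (h : Realizes c D) : c.Valid where
  w_pos := h.w_pos
  mate_mem s n hn := by
    obtain ⟨a, ha, ⟨-, e⟩ | ⟨-, e⟩⟩ := h.exists_chord s hn
    · rw [e]; exact (h.mem_of_chord s ha).2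
    · rw [e]; exact (h.mem_of_chord s ha).1
  mate_mate s n hn := by
    obtain ⟨a, ha, ⟨e', e⟩ | ⟨e', e⟩⟩ := h.exists_chord s hn
    · rw [e, (h.mates s a ha).2.1, e']
    · rw [e, (h.mates s a ha).1, e']
  mate_ne s n hn := by
    obtain ⟨a, ha, ⟨e', e⟩ | ⟨e', e⟩⟩ := h.exists_chord s hn
    · rw [e, e']; exact (h.mates s a ha).2.2.ne'
    · rw [e, e']; exact (h.mates s a ha).2.2.ne
  x_lt n hn n' hn' hne := by
    rcases lt_or_gt_of_ne hne with hlt | hlt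
    · exact .inl fun s => h.x_mono s n hn n' hn' hlt
    · exact .inr fun s => h.x_mono s n' hn' n hn hlt
  gap n hn k hk hk' := by
    rcases h.gap n hn k hk hk' with ⟨-, h⟩ | ⟨-, h⟩
    · exact h.ne
    · exact h.ne'
  lev_mem s n hn := ⟨(h.lev_mem s n hn).1, by linarith [(h.lev_mem s n hn).2]⟩
  sep s n hn n' hn' hne hm := by
    obtain ⟨a, ha, hna⟩ := h.exists_chord s hn; obtain ⟨b, hb, hnb⟩ := h.exists_chord s hn'
    have hab : a ≠ b := by
      rintro rfl; rcases hna with ⟨e1, e2⟩ | ⟨e1, e2⟩ <;> rcases hnb with ⟨e3, e4⟩ | ⟨e3, e4⟩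
      · exact hne (e3.trans e1.symm)
      · exact hm (e3.trans e2.symm)
      · exact hm (e3.trans e2.symm)
      · exact hne (e3.trans e1.symm)
    by_cases hc : cross a b = true
    · have hc' : cross b a = true := by
        simp only [cross, Bool.or_eq_true] at hc ⊢; exact hc.symm
      have hp := (h.pair s).imp (S := fun a b => (cross a b = true → c.ChordAbove s a b) ∨
          (cross b a = true → c.ChordAbove s b a))
          fun h => .inl h
      have : Std.Symm (fun a b => (cross a b = true → c.ChordAbove s a b) ∨
          (cross b a = true → c.ChordAbove s b a)) :=
        ⟨fun _ _ => Or.symm⟩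
      rcases hp.forall ha hb hab with hp | hp
      · left; obtain ⟨i1, i2, i3, i4⟩ := hp hc
        rcases hna with ⟨e1, e2⟩ | ⟨e1, e2⟩ <;> rcases hnb with ⟨e3, e4⟩ | ⟨e3, e4⟩ <;>
          simp only [Config.Above, e2, e4] <;> rw [e1, e3] <;>
          exact ⟨by assumption, by assumption, by assumption, by assumption⟩
      · right; left; obtain ⟨i1, i2, i3, i4⟩ := hp hc'
        rcases hna with ⟨e1, e2⟩ | ⟨e1, e2⟩ <;> rcases hnb with ⟨e3, e4⟩ | ⟨e3, e4⟩ <;>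
          simp only [Config.Above, e2, e4] <;> rw [e1, e3] <;>
          exact ⟨by assumption, by assumption, by assumption, by assumption⟩
    · right; right; rintro ⟨i1, i2, i3⟩; apply hc; have hma := h.mem_of_chord s ha
      have hmb := h.mem_of_chord s hb
      have lt_of : ∀ i ∈ c.N, ∀ j ∈ c.N, c.x s i < c.x s j → i < j := by
        intro i hi j hj hij; by_contra hle; rcases (not_lt.1 hle).eq_or_lt with e | e
        · rw [e] at hij; exact lt_irrefl _ hij
        · exact lt_asymm hij (h.x_mono s j hj i hi e)
      have hla := (h.mates s a ha).2.2; have hlb := (h.mates s b hb).2.2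
      simp only [cross, Bool.or_eq_true, Bool.and_eq_true, decide_eq_true_eq]
      rcases hna with ⟨e1, e2⟩ | ⟨e1, e2⟩ <;> rcases hnb with ⟨e3, e4⟩ | ⟨e3, e4⟩ <;>
        rw [e2] at i3 <;> rw [e4] at i1 <;> rw [e1] at i1 i2 <;> rw [e3] at i2 i3
      · have := lt_of _ hmb.2 _ hma.1 i1; have := lt_of _ hma.1 _ hmb.1 i2; omega
      · have := lt_of _ hmb.1 _ hma.1 i1; have := lt_of _ hma.1 _ hmb.2 i2
        have := lt_of _ hmb.2 _ hma.2 i3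
        right; exact ⟨⟨by assumption, by assumption⟩, by assumption⟩
      · have := lt_of _ hmb.2 _ hma.2 i1; have := lt_of _ hma.2 _ hmb.1 i2; omega
      · have := lt_of _ hma.2 _ hmb.2 i2; have := lt_of _ hmb.2 _ hma.1 i3; omega

theorem N_eq (h : Realizes c D) (h' : Realizes c' D) : c'.N = c.N := by
  ext n; rw [h.mem_iff false, h'.mem_iff false]

theorem mate_eq (h : Realizes c D) (h' : Realizes c' D) (s : Bool) {n : ℕ} (hn : n ∈ c.N) :
    c'.mate s n = c.mate s n := by
  obtain ⟨a, ha, ⟨e', e⟩ | ⟨e', e⟩⟩ := h.exists_chord s hn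
  · rw [e, e', (h'.mates s a ha).1]
  · rw [e, e', (h'.mates s a ha).2.1]

theorem lerp (h : Realizes c D) (h' : Realizes c' D) {τ : ℝ} (hτ : τ ∈ 𝕀) :
    Realizes (c.lerp c' τ) D := by
  have hN := h.N_eq h'; obtain ⟨t0, t1⟩ := hτ
  have key : ∀ {a a' b b' : ℝ}, a < a' → b < b' → (1 - τ) * a + τ * b < (1 - τ) * a' + τ * b' := by
    intro a a' b b' i j; have := lt_convex (sub_pos.2 i) (sub_pos.2 j) t0 t1; linarith
  refine ⟨?_, h.mem_iff, h.mates, ?_, ?_, ?_, ?_⟩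
  · exact lt_convex h.w_pos h'.w_pos t0 t1
  · intro s n hn n' hn' hlt
    exact key (h.x_mono s n hn n' hn' hlt) (h'.x_mono s n (hN ▸ hn) n' (hN ▸ hn') hlt)
  · intro n hn k hk hk'; simp only [Config.lerp]
    rcases h.gap n hn k hk hk' with ⟨i, i1⟩ | ⟨i, i1⟩ <;>
      rcases h'.gap n (hN ▸ hn) k hk hk' with ⟨j, j1⟩ | ⟨j, j1⟩
    · refine .inl ⟨i, ?_⟩; have := key i1 j1; linarith
    · omega
    · omega
    · refine .inr ⟨i, ?_⟩; have := key i1 j1; linarith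
  · intro s n hn; simp only [Config.lerp]; obtain ⟨i1, i2⟩ := h.lev_mem s n hn
    obtain ⟨j1, j2⟩ := h'.lev_mem s n (hN ▸ hn); have k1 := key i1 j1; have k2 := key i2 j2
    constructor <;> linarith
  · intro s; refine (List.pairwise_and_iff.2 ⟨h.pair s, h'.pair s⟩).imp ?_; rintro a b ⟨h1, h2⟩ hc
    obtain ⟨i1, i2, i3, i4⟩ := h1 hc; obtain ⟨j1, j2, j3, j4⟩ := h2 hc; have k1 := key i1 j1
    have k2 := key i2 j2; have k3 := key i3 j3; have k4 := key i4 j4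
    simp only [Config.ChordAbove, Config.lerp]; and_intros <;> linarith

/-- Any two realizations of a chord diagram are isotopic. -/
theorem isotopic (h : Realizes c D) (h' : Realizes c' D) :
    Isotopic (c.link h.valid) (c'.link h'.valid) := by
  have hN := h.N_eq h'
  refine Config.isotopic_of_lerp _ _ hN (fun s n hn => h.mate_eq h' s hn) ?_
    fun τ hτ => (h.lerp h' hτ).valid
  intro s n hn n' hn' hlt; apply h'.x_mono s n (hN ▸ hn) n' (hN ▸ hn'); by_contra hle
  rcases (not_lt.1 hle).eq_or_lt with e | e
  · rw [e] at hlt; exact lt_irrefl _ hlt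
  · exact lt_asymm hlt (h.x_mono s _ hn' _ hn e)

end Realizes

open Classical in
/-- The element of the skein algebra given by a chord diagram. -/
def sk (R : Type*) [CommRing R] (s : Rˣ) (D : Diagram) : SkeinAlgebra R s :=
  if h : ∃ c, Realizes c D then (h.choose.link h.choose_spec.valid).toSkein R s else 0

theorem Realizes.sk_eq {c : Config} {D : Diagram} (h : Realizes c D) (R : Type*)
    [CommRing R] (s : Rˣ) : sk R s D = (c.link h.valid).toSkein R s := by
  have h' : ∃ c, Realizes c D := ⟨c, h⟩
  unfold sk; rw [dif_pos h']; exact (h'.choose_spec.isotopic h).toSkein_eq R s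




/-! ### Standard realizations -/

/-- The chord with end `n`. -/
def chordOf (l : Chords) (n : ℕ) : ℕ × ℕ :=
  (l.find? fun a => a.1 == n || a.2 == n).getD (0, 0)

theorem eq_of_common_end {l : Chords} (h : (ends l).Nodup) {a b : ℕ × ℕ} (ha : a ∈ l)
    (hb : b ∈ l) {n : ℕ} (hna : n = a.1 ∨ n = a.2) (hnb : n = b.1 ∨ n = b.2) : a = b := by
  by_contra hab; have h2 := (List.nodup_flatMap.1 h).2
  have h3 := h2.imp (S := fun a b : ℕ × ℕ => (¬ ∃ n, (n = a.1 ∨ n = a.2) ∧ (n = b.1 ∨ n = b.2))) (by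
    rintro a b hd ⟨n, h1, h2⟩
    exact hd (a := n) (by simpa using h1) (by simpa using h2))
  have : Std.Symm (fun a b : ℕ × ℕ => (¬ ∃ n, (n = a.1 ∨ n = a.2) ∧ (n = b.1 ∨ n = b.2))) :=
    ⟨fun a b h ⟨n, h1, h2⟩ => h ⟨n, h2, h1⟩⟩
  exact h3.forall ha hb hab ⟨n, hna, hnb⟩

theorem chordOf_eq {l : Chords} (h : (ends l).Nodup) {a : ℕ × ℕ} (ha : a ∈ l) {n : ℕ}
    (hn : n = a.1 ∨ n = a.2) : chordOf l n = a := by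
  unfold chordOf; cases hf : l.find? fun a => a.1 == n || a.2 == n with
  | none =>
    have := List.find?_eq_none.1 hf a ha; exfalso; apply this; rcases hn with rfl | rfl <;> simp
  | some b =>
    have h1 := List.mem_of_find?_eq_some hf; have h2 := List.find?_some hf
    simp only [Bool.or_eq_true, beq_iff_eq] at h2
    exact eq_of_common_end h h1 ha (h2.imp Eq.symm Eq.symm) hn

/-- The chords are in standard form, have different ends, the same ones on both sides, and no end is
the label of a puncture. -/
def WF (D : Diagram) : Prop :=
  ∀ s, (ends (D s)).Nodup ∧ (∀ a ∈ D s, a.1 < a.2) ∧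
    ∀ n ∈ ends (D s), n ∈ ends (D (!s)) ∧ n ≠ 32 ∧ n ≠ 64 ∧ n ≠ 96 ∧ n ≠ 128

instance (D : Diagram) : Decidable (WF D) := by
  unfold WF
  infer_instance

/-- The realization of a chord diagram with strands over the points `n / 32`. -/
def stdConfig (D : Diagram) (lev : Bool → ℕ → ℝ) (w : ℝ) : Config where
  N := (ends (D false)).toFinset
  mate s n := if n = (chordOf (D s) n).1 then (chordOf (D s) n).2 else (chordOf (D s) n).1
  x _ n := n / 32
  lev := lev
  w := w

theorem WF.mem_stdConfig {D : Diagram} (h : WF D) (lev : Bool → ℕ → ℝ) (w : ℝ)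
    (s : Bool) (n : ℕ) : n ∈ (stdConfig D lev w).N ↔ n ∈ ends (D s) := by
  simp only [stdConfig, List.mem_toFinset]; cases s
  · rfl
  · exact ⟨fun hn => ((h false).2.2 n hn).1, fun hn => ((h true).2.2 n hn).1⟩

theorem WF.stdConfig_mates {D : Diagram} (h : WF D) (lev : Bool → ℕ → ℝ) (w : ℝ)
    (s : Bool) (a : ℕ × ℕ) (ha : a ∈ D s) : (stdConfig D lev w).mate s a.1 = a.2 ∧
      (stdConfig D lev w).mate s a.2 = a.1 ∧ a.1 < a.2 := by
  have hlt := (h s).2.1 a ha; refine ⟨?_, ?_, hlt⟩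
  · simp only [stdConfig, chordOf_eq (h s).1 ha (.inl rfl), if_true]
  · simp only [stdConfig, chordOf_eq (h s).1 ha (.inr rfl), if_neg hlt.ne']

theorem WF.gap {D : Diagram} (h : WF D) {s : Bool} {n : ℕ} (hn : n ∈ ends (D s)) {k : ℕ}
    (hk : 1 ≤ k) (hk' : k ≤ 4) : n < 32 * k ∨ 32 * k < n := by
  obtain ⟨-, h1, h2, h3, h4⟩ := (h s).2.2 n hn; interval_cases k <;> omega

theorem WF.realizes {D : Diagram} (h : WF D) {lev : Bool → ℕ → ℝ} {w : ℝ} (hw : 0 < w)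
    (hlev : ∀ s, ∀ n ∈ ends (D s), 3 / 2 * w < lev s n ∧ lev s n + 3 / 2 * w < 1)
    (hpair : ∀ s, (D s).Pairwise fun a b => cross a b = true →
      (stdConfig D lev w).ChordAbove s a b) : Realizes (stdConfig D lev w) D where
  w_pos := hw
  mem_iff := h.mem_stdConfig lev w
  mates := h.stdConfig_mates lev w
  x_mono s n hn n' hn' hlt := by
    simp only [stdConfig]; have : (n : ℝ) < n' := by exact_mod_cast hlt
    linarith
  gap n hn k hk hk' := by
    simp only [stdConfig]
    rcases h.gap (s := false) ((h.mem_stdConfig lev w false n).1 hn) hk hk' with h | h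
    · refine .inl ⟨h, ?_⟩; have : (n : ℝ) < 32 * k := by exact_mod_cast h
      linarith
    · refine .inr ⟨h, ?_⟩; have : (32 : ℝ) * k < n := by exact_mod_cast h
      linarith
  lev_mem s n hn := hlev s n ((h.mem_stdConfig lev w s n).1 hn)
  pair := hpair

theorem ends_nodup_chords {l : Chords} (h : (ends l).Nodup) : l.Nodup := by
  induction l with
  | nil => exact List.nodup_nil
  | cons a l ih =>
    have e : ends (a :: l) = a.1 :: a.2 :: ends l := by simp [ends]
    rw [e] at h
    refine List.nodup_cons.2 ⟨fun ha => ?_, ih (List.nodup_cons.1 (List.nodup_cons.1 h).2).2⟩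
    exact (List.nodup_cons.1 h).1 (List.mem_cons_of_mem _ (mem_ends.2 ⟨a, ha, .inl rfl⟩))

theorem pairwise_idxOf {α : Type*} [BEq α] [LawfulBEq α] {l : List α} (h : l.Nodup) :
    l.Pairwise fun a b => l.idxOf a < l.idxOf b := by
  rw [List.pairwise_iff_getElem]; intro i j hi hj hij
  rw [h.idxOf_getElem i hi, h.idxOf_getElem j hj]; exact hij

/-- The level of the chord with end `n`, in terms of its position in the list. -/
def idxLev (D : Diagram) (f : ℕ → ℝ) (s : Bool) (n : ℕ) : ℝ :=
  f ((D s).idxOf (chordOf (D s) n))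

theorem WF.idxLev_eq {D : Diagram} (h : WF D) (f : ℕ → ℝ) {s : Bool} {a : ℕ × ℕ}
    (ha : a ∈ D s) : idxLev D f s a.1 = f ((D s).idxOf a) ∧ idxLev D f s a.2 = f ((D s).idxOf a) := by
  unfold idxLev; rw [chordOf_eq (h s).1 ha (.inl rfl), chordOf_eq (h s).1 ha (.inr rfl)]
  exact ⟨rfl, rfl⟩

theorem WF.realizes_of_idx {D : Diagram} (h : WF D) {f : ℕ → ℝ} {w : ℝ} (hw : 0 < w)
    (hf : ∀ s, ∀ i < (D s).length, 3 / 2 * w < f i ∧ f i + 3 / 2 * w < 1)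
    (hmono : ∀ s, ∀ i j, i < j → j < (D s).length → f j + 3 * w < f i) :
    Realizes (stdConfig D (idxLev D f) w) D := by
  refine h.realizes hw ?_ ?_
  · intro s n hn; obtain ⟨a, ha, hna⟩ := mem_ends.1 hn
    have e : idxLev D f s n = f ((D s).idxOf a) := by
      rcases hna with rfl | rfl
      · exact (h.idxLev_eq f ha).1
      · exact (h.idxLev_eq f ha).2
    rw [e]; exact hf s _ (List.idxOf_lt_length_of_mem ha)
  · intro s; refine (pairwise_idxOf (ends_nodup_chords (h s).1)).imp_of_mem ?_
    intro a b ha hb hab _; have hb' := List.idxOf_lt_length_of_mem hb; have := hmono s _ _ hab hb'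
    simp only [Config.ChordAbove, stdConfig, (h.idxLev_eq f ha).1, (h.idxLev_eq f ha).2,
      (h.idxLev_eq f hb).1, (h.idxLev_eq f hb).2]
    exact ⟨this, this, this, this⟩

/-- A bound for the number of chords. -/
def size (D : Diagram) : ℕ := (D false).length + (D true).length + 1

theorem length_lt_size (D : Diagram) (s : Bool) : (D s).length < size D := by
  unfold size; cases s <;> omega

theorem WF.exists_realizes {D : Diagram} (h : WF D) {w : ℝ} (hw : 0 < w)
    (hw' : 4 * w * (size D + 1) ≤ 1) : ∃ lev, Realizes (stdConfig D lev w) D := by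
  have hL : (0 : ℝ) < size D + 1 := by positivity
  have hw3 : 4 * w ≤ 1 / (size D + 1) := by rwa [le_div_iff₀ hL]
  refine ⟨_, h.realizes_of_idx (f := fun i => 1 - (i + 1) / (size D + 1)) hw ?_ ?_⟩
  · intro s i hi; have hi' : i + 1 ≤ size D := by have := length_lt_size D s; omega
    have hi'' : (i : ℝ) + 1 ≤ size D := by exact_mod_cast hi'
    have h1 : ((i : ℝ) + 1) / (size D + 1) ≤ 1 - 1 / (size D + 1) := by
      rw [div_le_iff₀ hL, sub_mul, div_mul_cancel₀ _ hL.ne']; linarith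
    have h2 : 1 / ((size D : ℝ) + 1) ≤ (i + 1) / (size D + 1) :=
      div_le_div_of_nonneg_right (by linarith [(Nat.cast_nonneg i : (0 : ℝ) ≤ i)]) hL.le
    constructor <;> linarith
  · intro s i j hij hj; have : (i : ℝ) + 1 ≤ j := by exact_mod_cast hij
    have h2 : ((i : ℝ) + 1) / (size D + 1) + 1 / (size D + 1) ≤ (j + 1) / (size D + 1) := by
      rw [← add_div]; exact div_le_div_of_nonneg_right (by linarith) hL.le
    linarith

/-! ### Elementary moves -/

section Moves

variable (R : Type*) [CommRing R] (q : Rˣ)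

/-- The order of the chords matters only for crossing chords. -/
theorem sk_eq_of_realizes {D D' : Diagram} {c : Config} (h : Realizes c D)
    (h' : Realizes c D') : sk R q D = sk R q D' := by
  rw [h.sk_eq, h'.sk_eq]

theorem Realizes.of_perm {D D' : Diagram} {c : Config} (h : Realizes c D)
    (hp : ∀ s, (D s).Perm (D' s)) (hpair : ∀ s, (D' s).Pairwise fun a b => cross a b = true →
      c.ChordAbove s a b) : Realizes c D' where
  w_pos := h.w_pos
  mem_iff s n := by
    rw [h.mem_iff s n, mem_ends, mem_ends]; simp only [(hp s).mem_iff]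
  mates s a ha := h.mates s a ((hp s).mem_iff.2 ha)
  x_mono := h.x_mono
  gap := h.gap
  lev_mem := h.lev_mem
  pair := hpair

/-- No two chords on one side cross. -/
def Planar (D : Diagram) : Prop := ∀ s, ∀ a ∈ D s, ∀ b ∈ D s, cross a b = false

theorem sk_perm {D D' : Diagram} (h : WF D) (hpl : Planar D)
    (hp : ∀ s, (D s).Perm (D' s)) : sk R q D = sk R q D' := by
  obtain ⟨lev, hr⟩ := h.exists_realizes (w := 1 / (4 * (size D + 1))) (by positivity)
    (by field_simp; rfl)
  refine sk_eq_of_realizes R q hr (hr.of_perm hp fun s => ?_)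
  refine List.pairwise_iff_forall_sublist.2 fun {a b} hab hc => ?_
  have ha := (hp s).mem_iff.2 (hab.subset (by simp : a ∈ [a, b]))
  have hb := (hp s).mem_iff.2 (hab.subset (by simp : b ∈ [a, b])); rw [hpl s a ha b hb] at hc
  exact absurd hc (by simp)

/-- Chords may be relabelled. -/
theorem sk_relabel {D : Diagram} (f : ℕ → ℕ)
    (hD : WF (fun s => (D s).map (Prod.map f f)))
    (hlt : ∀ s, ∀ a ∈ D s, a.1 < a.2)
    (hends : ∀ s, ∀ n ∈ ends (D s), n ∈ ends (D (!s)))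
    (hf : ∀ n ∈ ends (D false), ∀ n' ∈ ends (D false), n < n' → f n < f n')
    (hgap : ∀ n ∈ ends (D false), ∀ k : ℕ, 1 ≤ k → k ≤ 4 → (n < 32 * k ∧ f n < 32 * k) ∨
      (32 * k < n ∧ 32 * k < f n)) :
    sk R q (fun s => (D s).map (Prod.map f f)) = sk R q D := by
  set D' : Diagram := fun s => (D s).map (Prod.map f f) with hD'
  obtain ⟨lev, hr⟩ := hD.exists_realizes (w := 1 / (4 * (size D' + 1))) (by positivity)
    (by field_simp; rfl)
  set c' := stdConfig D' lev (1 / (4 * (size D' + 1))) with hc'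
  have hends' : ∀ s n, n ∈ ends (D false) ↔ n ∈ ends (D s) := by
    intro s n; cases s
    · rfl
    · exact ⟨hends false n, hends true n⟩
  have hmem : ∀ s, ∀ a ∈ D s, a.1 ∈ ends (D false) ∧ a.2 ∈ ends (D false) := by
    intro s a ha; rw [hends' s, hends' s]
    exact ⟨mem_ends.2 ⟨a, ha, .inl rfl⟩, mem_ends.2 ⟨a, ha, .inr rfl⟩⟩
  have hfmem : ∀ n ∈ ends (D false), f n ∈ c'.N := by
    intro n hn; rw [hr.mem_iff false]; obtain ⟨a, ha, hna⟩ := mem_ends.1 hn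
    exact mem_ends.2 ⟨_, List.mem_map.2 ⟨a, ha, rfl⟩, hna.imp (congrArg f) (congrArg f)⟩
  have hinj : ∀ n ∈ ends (D false), ∀ n' ∈ ends (D false), f n = f n' → n = n' := by
    intro n hn n' hn' e; rcases lt_trichotomy n n' with h | h | h
    · exact absurd (hf n hn n' hn' h) (by omega)
    · exact h
    · exact absurd (hf n' hn' n hn h) (by omega)
  let c : Config :=
    { N := (ends (D false)).toFinset
      mate := fun s n => Function.invFunOn f {n | n ∈ ends (D false)} (c'.mate s (f n))
      x := fun s n => c'.x s (f n)
      lev := fun s n => c'.lev s (f n)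
      w := c'.w }
  have hinv : ∀ n ∈ ends (D false), Function.invFunOn f {n | n ∈ ends (D false)} (f n) = n := by
    intro n hn; have hex : ∃ a ∈ {n | n ∈ ends (D false)}, f a = f n := ⟨n, hn, rfl⟩
    exact hinj _ (Function.invFunOn_mem hex) _ hn (Function.invFunOn_eq hex)
  have hcN : ∀ n, n ∈ c.N ↔ n ∈ ends (D false) := fun n => List.mem_toFinset
  have hrc : Realizes c D :=
    { w_pos := hr.w_pos
      mem_iff := fun s n => (hcN n).trans (hends' s n)
      mates := by
        intro s a ha; obtain ⟨h1, h2, -⟩ := hr.mates s _ (List.mem_map.2 ⟨a, ha, rfl⟩)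
        obtain ⟨m1, m2⟩ := hmem s a ha; simp only [Prod.map_fst, Prod.map_snd] at h1 h2
        refine ⟨?_, ?_, hlt s a ha⟩
        · change Function.invFunOn f _ (c'.mate s (f a.1)) = _; rw [h1, hinv _ m2]
        · change Function.invFunOn f _ (c'.mate s (f a.2)) = _; rw [h2, hinv _ m1]
      x_mono := by
        intro s n hn n' hn' h; rw [hcN] at hn hn'
        exact hr.x_mono s _ (hfmem n hn) _ (hfmem n' hn') (hf n hn n' hn' h)
      gap := by
        intro n hn k hk hk'; rw [hcN] at hn
        rcases hgap n hn k hk hk' with ⟨g1, g2⟩ | ⟨g1, g2⟩ <;>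
          rcases hr.gap (f n) (hfmem n hn) k hk hk' with ⟨g3, g4⟩ | ⟨g3, g4⟩
        · exact .inl ⟨g1, g4⟩
        · omega
        · omega
        · exact .inr ⟨g1, g4⟩
      lev_mem := fun s n hn => hr.lev_mem s _ (hfmem n ((hcN n).1 hn))
      pair := by
        intro s; have := hr.pair s; simp only [hD', List.pairwise_map] at this
        refine this.imp_of_mem fun {a b} ha hb h hab => h ?_; obtain ⟨a1, a2⟩ := hmem s a ha
        obtain ⟨b1, b2⟩ := hmem s b hb
        simp only [cross, Bool.or_eq_true, Bool.and_eq_true, decide_eq_true_eq, Prod.map_fst,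
          Prod.map_snd] at hab ⊢
        rcases hab with ⟨⟨i1, i2⟩, i3⟩ | ⟨⟨i1, i2⟩, i3⟩
        · exact .inl ⟨⟨hf _ a1 _ b1 i1, hf _ b1 _ a2 i2⟩, hf _ a2 _ b2 i3⟩
        · exact .inr ⟨⟨hf _ b1 _ a1 i1, hf _ a1 _ b2 i2⟩, hf _ b2 _ a2 i3⟩ }
  have hmate : ∀ s, ∀ n ∈ c.N, f (c.mate s n) = c'.mate s (f n) := by
    intro s n hn; obtain ⟨a, ha, ⟨e, e'⟩ | ⟨e, e'⟩⟩ := hrc.exists_chord s hn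
    · rw [e', e]; exact (hr.mates s _ (List.mem_map.2 ⟨a, ha, rfl⟩)).1.symm
    · rw [e', e]; exact (hr.mates s _ (List.mem_map.2 ⟨a, ha, rfl⟩)).2.1.symm
  have hpiece : ∀ k, ∀ n ∈ c.N, ∀ W, c.piece k n W = c'.piece k (f n) W := by
    intro k n hn W; rcases k with _ | s
    · rfl
    · simp only [Config.piece, Config.knee, Config.apex, ← hmate s n hn]; rfl
  have hbody : ∀ W, c.body W = c'.body W := by
    intro W; ext p; simp only [Config.body, mem_iUnion]; refine exists_congr fun k => ⟨?_, ?_⟩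
    · rintro ⟨n, hn, hp⟩; exact ⟨f n, hfmem n ((hcN n).1 hn), by rwa [← hpiece k n hn]⟩
    · rintro ⟨m, hm, hp⟩; obtain ⟨b, hb, hmb⟩ := mem_ends.1 ((hr.mem_iff false m).1 hm)
      obtain ⟨a, ha, rfl⟩ := List.mem_map.1 hb; obtain ⟨m1, m2⟩ := hmem false a ha
      rcases hmb with rfl | rfl
      · exact ⟨a.1, (hcN _).2 m1, by rwa [hpiece k _ ((hcN _).2 m1)]⟩
      · exact ⟨a.2, (hcN _).2 m2, by rwa [hpiece k _ ((hcN _).2 m2)]⟩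
  rw [hr.sk_eq, hrc.sk_eq]; congr 1; simp only [Config.link, hbody]; rfl

end Moves




/-! ### Products of chord diagrams -/

theorem squeeze_wall (k : ℝ) (P Q : 𝕊) (w : ℝ) :
    squeeze k '' wall P Q w = wall (squeeze k P) (squeeze k Q) (w / 2) := by
  have h : ∀ t u, squeeze k (wallPt P Q w t u) = wallPt (squeeze k P) (squeeze k Q) (w / 2) t u := by
    intro t u; refine Prod.ext rfl ?_; simp only [squeeze_apply, wallPt]; ring
  ext p; constructor
  · rintro ⟨_, ⟨t, ht, u, hu, rfl⟩, rfl⟩; exact ⟨t, ht, u, hu, h t u⟩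
  · rintro ⟨t, ht, u, hu, rfl⟩; exact ⟨_, ⟨t, ht, u, hu, rfl⟩, h t u⟩

theorem toSkein_stack (R : Type*) [CommRing R] (q : Rˣ) (L L' : FramedLink) :
    (stack L L').toSkein R q = L.toSkein R q * L'.toSkein R q := by
  unfold FramedLink.toSkein; rw [← map_mul, ← map_mul]; rfl

theorem sk_mul (R : Type*) [CommRing R] (q : Rˣ) {D₁ D₂ : Diagram} (h₁ : WF D₁)
    (h₂ : WF D₂) (h : WF (fun s => D₁ s ++ D₂ s)) :
    sk R q D₁ * sk R q D₂ = sk R q (fun s => D₁ s ++ D₂ s) := by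
  set w : ℝ := min (1 / (4 * (size D₁ + 1))) (1 / (4 * (size D₂ + 1))) with hw
  have hw0 : 0 < w := lt_min (by positivity) (by positivity)
  have small : ∀ n : ℕ, w ≤ 1 / (4 * (n + 1)) → 4 * w * (n + 1) ≤ 1 := by
    intro n hn; rw [le_div_iff₀ (by positivity)] at hn; linarith
  obtain ⟨lev₁, hr₁⟩ := h₁.exists_realizes hw0 (small _ (min_le_left _ _))
  obtain ⟨lev₂, hr₂⟩ := h₂.exists_realizes hw0 (small _ (min_le_right _ _))
  set c₁ := stdConfig D₁ lev₁ w with hc₁; set c₂ := stdConfig D₂ lev₂ w with hc₂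
  set D : Diagram := fun s => D₁ s ++ D₂ s with hD
  let lev : Bool → ℕ → ℝ := fun s n =>
    if n ∈ ends (D₁ s) then (lev₁ s n + 1) / 2 else (lev₂ s n + 0) / 2
  have hends : ∀ s n, n ∈ ends (D s) ↔ n ∈ ends (D₁ s) ∨ n ∈ ends (D₂ s) := by
    intro s n; simp [hD, ends]
  have hdisj : ∀ s n, n ∈ ends (D₂ s) → n ∉ ends (D₁ s) := by
    intro s n hn hn'; have := (h s).1; simp only [hD, ends, List.flatMap_append] at this
    exact (List.nodup_append.1 this).2.2 n hn' n hn rfl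
  have hl₁ : ∀ s, ∀ n ∈ ends (D₁ s), lev s n = (lev₁ s n + 1) / 2 := fun s n hn => if_pos hn
  have hl₂ : ∀ s, ∀ n ∈ ends (D₂ s), lev s n = (lev₂ s n + 0) / 2 :=
    fun s n hn => if_neg (hdisj s n hn)
  have b₁ : ∀ s, ∀ n ∈ ends (D₁ s), 3 / 2 * w < lev₁ s n ∧ lev₁ s n + 3 / 2 * w < 1 :=
    fun s n hn => hr₁.lev_mem s n ((hr₁.mem_iff s n).2 hn)
  have b₂ : ∀ s, ∀ n ∈ ends (D₂ s), 3 / 2 * w < lev₂ s n ∧ lev₂ s n + 3 / 2 * w < 1 :=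
    fun s n hn => hr₂.lev_mem s n ((hr₂.mem_iff s n).2 hn)
  have me : ∀ {l : Chords} {a : ℕ × ℕ}, a ∈ l → a.1 ∈ ends l ∧ a.2 ∈ ends l :=
    fun ha => ⟨mem_ends.2 ⟨_, ha, .inl rfl⟩, mem_ends.2 ⟨_, ha, .inr rfl⟩⟩
  have hr : Realizes (stdConfig D lev (w / 2)) D := by
    refine h.realizes (by positivity) ?_ ?_
    · intro s n hn; rcases (hends s n).1 hn with hn | hn
      · rw [hl₁ s n hn]; have := b₁ s n hn; constructor <;> linarith
      · rw [hl₂ s n hn]; have := b₂ s n hn; constructor <;> linarith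
    · intro s; refine List.pairwise_append.2 ⟨?_, ?_, ?_⟩
      · refine (hr₁.pair s).imp_of_mem fun {a b} ha hb hab hc => ?_
        obtain ⟨i1, i2, i3, i4⟩ := hab hc
        simp only [Config.ChordAbove, stdConfig, hl₁ s _ (me ha).1, hl₁ s _ (me ha).2,
          hl₁ s _ (me hb).1, hl₁ s _ (me hb).2]
        simp only [hc₁, stdConfig] at i1 i2 i3 i4; and_intros <;> linarith
      · refine (hr₂.pair s).imp_of_mem fun {a b} ha hb hab hc => ?_
        obtain ⟨i1, i2, i3, i4⟩ := hab hc
        simp only [Config.ChordAbove, stdConfig, hl₂ s _ (me ha).1, hl₂ s _ (me ha).2,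
          hl₂ s _ (me hb).1, hl₂ s _ (me hb).2]
        simp only [hc₂, stdConfig] at i1 i2 i3 i4; and_intros <;> linarith
      · intro a ha b hb _
        simp only [Config.ChordAbove, stdConfig, hl₁ s _ (me ha).1, hl₁ s _ (me ha).2,
          hl₂ s _ (me hb).1, hl₂ s _ (me hb).2]
        have i1 := b₁ s _ (me ha).1; have i2 := b₁ s _ (me ha).2; have j1 := b₂ s _ (me hb).1
        have j2 := b₂ s _ (me hb).2; and_intros <;> linarith
  set c := stdConfig D lev (w / 2) with hc
  have cN : ∀ n, n ∈ c.N ↔ n ∈ c₁.N ∨ n ∈ c₂.N := by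
    intro n; rw [hr.mem_iff false, hr₁.mem_iff false, hr₂.mem_iff false, hends]
  have m₁ : ∀ s, ∀ n ∈ c₁.N, c.mate s n = c₁.mate s n := by
    intro s n hn; obtain ⟨a, ha, ⟨e, e'⟩ | ⟨e, e'⟩⟩ := hr₁.exists_chord s hn <;> rw [e', e]
    · exact (hr.mates s a (List.mem_append_left _ ha)).1
    · exact (hr.mates s a (List.mem_append_left _ ha)).2.1
  have m₂ : ∀ s, ∀ n ∈ c₂.N, c.mate s n = c₂.mate s n := by
    intro s n hn; obtain ⟨a, ha, ⟨e, e'⟩ | ⟨e, e'⟩⟩ := hr₂.exists_chord s hn <;> rw [e', e]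
    · exact (hr.mates s a (List.mem_append_right _ ha)).1
    · exact (hr.mates s a (List.mem_append_right _ ha)).2.1
  have k₁ : ∀ s, ∀ n ∈ c₁.N, c.knee s n = squeeze 1 (c₁.knee s n) := by
    intro s n hn; refine Prod.ext rfl ?_; exact hl₁ s n ((hr₁.mem_iff s n).1 hn)
  have k₂ : ∀ s, ∀ n ∈ c₂.N, c.knee s n = squeeze 0 (c₂.knee s n) := by
    intro s n hn; refine Prod.ext rfl ?_; exact hl₂ s n ((hr₂.mem_iff s n).1 hn)
  have a₁ : ∀ s, ∀ n ∈ c₁.N, c.apex s n = squeeze 1 (c₁.apex s n) := by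
    intro s n hn; have e1 := hl₁ s n ((hr₁.mem_iff s n).1 hn)
    have e2 := hl₁ s _ ((hr₁.mem_iff s _).1 (hr₁.valid.mate_mem s n hn))
    simp only [Config.apex, squeeze_apply, m₁ s n hn]; refine Prod.ext rfl ?_
    change (lev s n + lev s (c₁.mate s n)) / 2 = ((lev₁ s n + lev₁ s (c₁.mate s n)) / 2 + 1) / 2
    rw [e1, e2]; ring
  have a₂ : ∀ s, ∀ n ∈ c₂.N, c.apex s n = squeeze 0 (c₂.apex s n) := by
    intro s n hn; have e1 := hl₂ s n ((hr₂.mem_iff s n).1 hn)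
    have e2 := hl₂ s _ ((hr₂.mem_iff s _).1 (hr₂.valid.mate_mem s n hn))
    simp only [Config.apex, squeeze_apply, m₂ s n hn]; refine Prod.ext rfl ?_
    change (lev s n + lev s (c₂.mate s n)) / 2 = ((lev₂ s n + lev₂ s (c₂.mate s n)) / 2 + 0) / 2
    rw [e1, e2]; ring
  have p₁ : ∀ k, ∀ n ∈ c₁.N, ∀ W, c.piece k n (W / 2) = squeeze 1 '' c₁.piece k n W := by
    intro k n hn W; rcases k with _ | s
    · simp only [Config.piece, k₁ _ n hn, squeeze_wall]
    · simp only [Config.piece, k₁ _ n hn, a₁ _ n hn, squeeze_wall]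
  have p₂ : ∀ k, ∀ n ∈ c₂.N, ∀ W, c.piece k n (W / 2) = squeeze 0 '' c₂.piece k n W := by
    intro k n hn W; rcases k with _ | s
    · simp only [Config.piece, k₂ _ n hn, squeeze_wall]
    · simp only [Config.piece, k₂ _ n hn, a₂ _ n hn, squeeze_wall]
  have hbody : ∀ W, squeeze 1 '' c₁.body W ∪ squeeze 0 '' c₂.body W = c.body (W / 2) := by
    intro W; simp only [Config.body, image_iUnion]; ext p; simp only [mem_union, mem_iUnion]
    constructor
    · rintro (⟨k, n, hn, hp⟩ | ⟨k, n, hn, hp⟩)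
      · exact ⟨k, n, (cN n).2 (.inl hn), by rwa [p₁ k n hn]⟩
      · exact ⟨k, n, (cN n).2 (.inr hn), by rwa [p₂ k n hn]⟩
    · rintro ⟨k, n, hn, hp⟩; rcases (cN n).1 hn with hn | hn
      · exact .inl ⟨k, n, hn, by rwa [p₁ k n hn] at hp⟩
      · exact .inr ⟨k, n, hn, by rwa [p₂ k n hn] at hp⟩
  rw [hr₁.sk_eq, hr₂.sk_eq, hr.sk_eq, ← toSkein_stack]; congr 1; have e0 := hbody 0
  have ew := hbody w; rw [zero_div] at e0; simp only [stack, Config.link, FramedLink.mk.injEq]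
  exact ⟨e0, ew⟩

theorem sk_nil (R : Type*) [CommRing R] (q : Rˣ) : sk R q (fun _ => []) = 1 := by
  have hr : Realizes ⟨∅, fun _ n => n, fun _ _ => 0, fun _ _ => 0, 1⟩ (fun _ => []) :=
    ⟨one_pos, by simp [ends], by simp, by simp, by simp, by simp, by simp⟩
  rw [hr.sk_eq]
  have e : Config.link _ hr.valid = emptyLink := by
    simp [Config.link, emptyLink, Config.body]
  rw [e]; unfold FramedLink.toSkein; have : emptyLink.cls = (1 : LinkClass) := rfl
  rw [this, map_one, map_one]




/-! ### Moving paths -/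

/-- A linear function on the plane. -/
def lin (a b : ℝ) (p : 𝕊) : ℝ := a * p.1.re + b * p.1.im

theorem lin_mov (a b : ℝ) (P P' : 𝕊) (τ : ℝ) :
    lin a b (mov P P' τ) = (1 - τ) * lin a b P + τ * lin a b P' := by
  rw [Config.mov_eq]; simp only [lin]; ring

/-- The order of the values of a linear function at two moving points, at the start and at the end. -/
def MovLt (a b : ℝ) (v v' : ℕ → 𝕊) (i j : ℕ) : Prop :=
  lin a b (v i) < lin a b (v j) ∧ lin a b (v' i) < lin a b (v' j)

theorem MovLt.mov {a b : ℝ} {v v' : ℕ → 𝕊} {i j : ℕ} (h : MovLt a b v v' i j) {τ : ℝ}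
    (hτ : τ ∈ 𝕀) : lin a b (mov (v i) (v' i) τ) < lin a b (mov (v j) (v' j) τ) := by
  rw [lin_mov, lin_mov]; have := lt_convex (sub_pos.2 h.1) (sub_pos.2 h.2) hτ.1 hτ.2; linarith

/-- The linear motion of the path with vertices `v 0, …, v m` to the path with vertices
`v' 0, …, v' m` keeps it embedded, as witnessed by linear functions. -/
structure PathMove (m : ℕ) (v v' : ℕ → 𝕊) : Prop where
  turn : ∀ i, i + 2 ≤ m → ∃ a b, MovLt a b v v' i (i + 1) ∧ MovLt a b v v' (i + 1) (i + 2)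
  sep : ∀ i j, i + 2 ≤ j → j + 1 ≤ m → ∃ a b, MovLt a b v v' i j ∧ MovLt a b v v' i (j + 1) ∧
    MovLt a b v v' (i + 1) j ∧ MovLt a b v v' (i + 1) (j + 1)

theorem lin_wallPt (a b : ℝ) (P Q : 𝕊) (w t u : ℝ) :
    lin a b (wallPt P Q w t u) = (1 - t) * lin a b P + t * lin a b Q := by
  simp only [lin, wallPt, Complex.add_re, Complex.add_im, Complex.smul_re, Complex.smul_im,
    smul_eq_mul]
  ring

theorem wall_disjoint_of_lin (a b : ℝ) {P Q P' Q' : 𝕊} {w : ℝ} (h1 : lin a b P < lin a b P')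
    (h2 : lin a b P < lin a b Q') (h3 : lin a b Q < lin a b P') (h4 : lin a b Q < lin a b Q') :
    Disjoint (wall P Q w) (wall P' Q' w) := by
  rw [Set.disjoint_left]; rintro _ ⟨t, ht, u, hu, rfl⟩ ⟨t', ht', u', hu', heq⟩
  have h := congrArg (lin a b) heq; rw [lin_wallPt, lin_wallPt] at h
  have k1 : (1 - t) * lin a b P + t * lin a b Q < min (lin a b P') (lin a b Q') :=
    convex_lt (lt_min h1 h2) (lt_min h3 h4) ht.1 ht.2
  have k2 := min_le_left (lin a b P') (lin a b Q')
  have k3 := min_le_right (lin a b P') (lin a b Q'); nlinarith [ht'.1, ht'.2]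

theorem transv_of_lin (a b : ℝ) {P Q R : 𝕊} (h1 : lin a b P < lin a b Q)
    (h2 : lin a b Q < lin a b R) : Transv Q.1 P.1 R.1 := by
  refine transv_of_linear (-a) (-b) ?_ ?_ <;>
  · simp only [lin] at h1 h2; simp only [Complex.sub_re, Complex.sub_im]; linarith

theorem EdgeOK.symm {V : Type*} {pos : V → 𝕊} {w : ℝ} {a b a' b' : V}
    (h : EdgeOK pos w a b a' b') : EdgeOK pos w a' b' a b := by
  rcases h with h | ⟨(⟨rfl, rfl⟩ | ⟨rfl, rfl⟩), h⟩ | ⟨rfl, h⟩ | ⟨rfl, h⟩ | ⟨rfl, h⟩ | ⟨rfl, h⟩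
  · exact .inl h.symm
  · exact .inr (.inl ⟨.inl ⟨rfl, rfl⟩, h⟩)
  · exact .inr (.inl ⟨.inr ⟨rfl, rfl⟩, h.symm⟩)
  · exact .inr (.inr (.inl ⟨rfl, h.symm⟩))
  · exact .inr (.inr (.inr (.inr (.inl ⟨rfl, h.symm⟩))))
  · exact .inr (.inr (.inr (.inl ⟨rfl, h.symm⟩)))
  · exact .inr (.inr (.inr (.inr (.inr ⟨rfl, h.symm⟩))))

theorem PathMove.edgeOK {m : ℕ} (hm : 2 ≤ m) {v v' : ℕ → 𝕊} (h : PathMove m v v') {τ w : ℝ}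
    (hτ : τ ∈ 𝕀) {i j : ℕ} (hi : i < m) (hj : j < m) :
    EdgeOK (fun i => mov (v i) (v' i) τ) w i (i + 1) j (j + 1) := by
  wlog hij : i ≤ j generalizing i j
  · exact (this hj hi (by omega)).symm
  rcases hij.eq_or_lt with rfl | hij
  · refine .inr (.inl ⟨.inl ⟨rfl, rfl⟩, fun he => ?_⟩); by_cases hi2 : i + 2 ≤ m
    · obtain ⟨a, b, h1, -⟩ := h.turn i hi2; have := h1.mov hτ; simp only [lin] at this he
      rw [he] at this; exact lt_irrefl _ this
    · obtain ⟨k, rfl⟩ : ∃ k, i = k + 1 := ⟨i - 1, by omega⟩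
      obtain ⟨a, b, -, h1⟩ := h.turn k (by omega); have := h1.mov hτ; simp only [lin] at this he
      rw [he] at this; exact lt_irrefl _ this
  · by_cases hj' : j = i + 1
    · subst hj'; obtain ⟨a, b, h1, h2⟩ := h.turn i (by omega)
      exact .inr (.inr (.inr (.inr (.inl ⟨rfl, transv_of_lin a b (h1.mov hτ) (h2.mov hτ)⟩))))
    · obtain ⟨a, b, h1, h2, h3, h4⟩ := h.sep i j (by omega) (by omega)
      exact .inl (wall_disjoint_of_lin a b (h1.mov hτ) (h2.mov hτ) (h3.mov hτ) (h4.mov hτ))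

/-- The motion of a path in the complement of `K` is induced by an ambient isotopy. -/
theorem PathMove.exists_isotopy {m : ℕ} (hm : 2 ≤ m) {v v' : ℕ → 𝕊} (h : PathMove m v v')
    {w : ℝ} (hw : 0 < w) {K : Set 𝕊} (hKc : IsCompact K) (hK : K ⊆ thickened)
    (hstat : ∀ i < m, (v i = v' i ∧ v (i + 1) = v' (i + 1)) ∨ ∀ τ ∈ 𝕀,
      Disjoint (wall (mov (v i) (v' i) τ) (mov (v (i + 1)) (v' (i + 1)) τ) w) K)
    (hin : ∀ i < m, ∀ τ ∈ 𝕀,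
      wall (mov (v i) (v' i) τ) (mov (v (i + 1)) (v' (i + 1)) τ) w ⊆ thickened) :
    ∃ φ, IsotopicToId φ ∧ (∀ p ∈ K, φ p = p) ∧ ∀ i < m, ∀ r ∈ 𝕀,
      φ '' wall (v i) (v (i + 1)) (r * w) = wall (v' i) (v' (i + 1)) (r * w) := by
  obtain ⟨φ, hφ, hφK, hφw⟩ := exists_wall_isotopy (V := ℕ) (E := Fin m) (fun i => i)
    (fun i => (i : ℕ) + 1) v v' w w hw hw K hKc hK
    (fun τ hτ i j => by
      rw [sub_self, mul_zero, add_zero]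
      exact h.edgeOK hm hτ i.2 j.2)
    (fun i => by
      rw [sub_self]; simp only [mul_zero, add_zero]
      exact (hstat i i.2).imp_left fun h => ⟨h.1, h.2, trivial⟩)
    (fun τ hτ i => by
      rw [sub_self, mul_zero, add_zero]
      exact hin i i.2 τ hτ)
  refine ⟨φ, hφ, hφK, fun i hi r hr => ?_⟩
  have hsub : Icc (-r) r ⊆ Icc (-1 : ℝ) 1 := Icc_subset_Icc (by linarith [hr.2]) hr.2
  rw [wall_scale hr, wall_scale hr]; ext p; constructor
  · rintro ⟨_, ⟨t, ht, u, hu, rfl⟩, rfl⟩; exact ⟨t, ht, u, hu, hφw ⟨i, hi⟩ t ht u (hsub hu)⟩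
  · rintro ⟨t, ht, u, hu, rfl⟩; exact ⟨_, ⟨t, ht, u, hu, rfl⟩, hφw ⟨i, hi⟩ t ht u (hsub hu)⟩

/-- A wall is cut into two pieces by a point on its middle line. -/
theorem wall_split (P Q : 𝕊) (w : ℝ) {θ : ℝ} (hθ : θ ∈ 𝕀) :
    wall P Q w = wall P (mov P Q θ) w ∪ wall (mov P Q θ) Q w := by
  have e1 : ∀ t u, wallPt P (mov P Q θ) w t u = wallPt P Q w (t * θ) u := by
    intro t u; refine Prod.ext (Complex.ext ?_ ?_) ?_ <;> simp [wallPt, mov] <;> ring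
  have e2 : ∀ t u, wallPt (mov P Q θ) Q w t u = wallPt P Q w (θ + t * (1 - θ)) u := by
    intro t u; refine Prod.ext (Complex.ext ?_ ?_) ?_ <;> simp [wallPt, mov] <;> ring
  obtain ⟨h0, h1⟩ := hθ; ext p; constructor
  · rintro ⟨t, ⟨t0, t1⟩, u, hu, rfl⟩; rcases le_or_gt t θ with h | h
    · left; rcases h0.eq_or_lt with rfl | h0
      · refine ⟨0, by simp, u, hu, ?_⟩; rw [e1, zero_mul, le_antisymm h t0]
      · refine ⟨t / θ, ⟨by positivity, (div_le_one h0).2 h⟩, u, hu, ?_⟩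
        rw [e1, div_mul_cancel₀ _ h0.ne']
    · right; have h3 : 0 < 1 - θ := by linarith
      refine ⟨(t - θ) / (1 - θ), ⟨div_nonneg (by linarith) h3.le, (div_le_one h3).2 (by linarith)⟩,
        u, hu, ?_⟩
      rw [e2, div_mul_cancel₀ _ h3.ne', add_sub_cancel]
  · rintro (⟨t, ⟨t0, t1⟩, u, hu, rfl⟩ | ⟨t, ⟨t0, t1⟩, u, hu, rfl⟩)
    · rw [e1]; exact ⟨_, ⟨by positivity, by nlinarith⟩, u, hu, rfl⟩
    · rw [e2]; exact ⟨_, ⟨by nlinarith, by nlinarith⟩, u, hu, rfl⟩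




/-! ### Moving a path of a configuration -/

theorem lin_lt_of_mem_wall {a b k w : ℝ} {P Q p : 𝕊} (hP : lin a b P < k) (hQ : lin a b Q < k)
    (hp : p ∈ wall P Q w) : lin a b p < k := by
  obtain ⟨t, ht, u, -, rfl⟩ := hp; rw [lin_wallPt]; exact convex_lt hP hQ ht.1 ht.2

theorem lin_le_of_mem_wall {a b k w : ℝ} {P Q p : 𝕊} (hP : lin a b P ≤ k) (hQ : lin a b Q ≤ k)
    (hp : p ∈ wall P Q w) : lin a b p ≤ k := by
  obtain ⟨t, ht, u, -, rfl⟩ := hp; rw [lin_wallPt]; nlinarith [ht.1, ht.2]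

theorem height_of_mem_wall {z b w : ℝ} (hw : 0 ≤ w) {P Q p : 𝕊} (hP : |P.2 - z| ≤ b)
    (hQ : |Q.2 - z| ≤ b) (hp : p ∈ wall P Q w) : |p.2 - z| ≤ b + w := by
  obtain ⟨t, ⟨t0, t1⟩, -, -, h⟩ := (mem_wall hw).1 hp; rw [abs_le] at *; constructor <;> nlinarith

theorem lin_mov_lt {a b k τ : ℝ} (hτ : τ ∈ 𝕀) {P P' : 𝕊} (hP : lin a b P < k)
    (hP' : lin a b P' < k) : lin a b (mov P P' τ) < k := by
  rw [lin_mov]; exact convex_lt hP hP' hτ.1 hτ.2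

theorem lin_mov_le {a b k τ : ℝ} (hτ : τ ∈ 𝕀) {P P' : 𝕊} (hP : lin a b P ≤ k)
    (hP' : lin a b P' ≤ k) : lin a b (mov P P' τ) ≤ k := by
  rw [lin_mov]; nlinarith [hτ.1, hτ.2]

theorem height_mov {z b τ : ℝ} (hτ : τ ∈ 𝕀) {P P' : 𝕊} (hP : |P.2 - z| ≤ b)
    (hP' : |P'.2 - z| ≤ b) : |(mov P P' τ).2 - z| ≤ b := by
  obtain ⟨t0, t1⟩ := hτ; rw [Config.mov_eq]; simp only; rw [abs_le] at *; constructor <;> nlinarith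

theorem mov_self (P : 𝕊) (τ : ℝ) : mov P P τ = P := by
  simp [mov]

namespace Config

variable {c : Config}

/-- The union of the strands and arms that do not belong to `S`. -/
def rest (c : Config) (S : Set (Option Bool × ℕ)) (W : ℝ) : Set 𝕊 :=
  ⋃ k, ⋃ n ∈ c.N, ⋃ (_ : (k, n) ∉ S), c.piece k n W

theorem mem_rest {S : Set (Option Bool × ℕ)} {W : ℝ} {p : 𝕊} :
    p ∈ c.rest S W ↔ ∃ k, ∃ n ∈ c.N, (k, n) ∉ S ∧ p ∈ c.piece k n W := by
  simp only [rest, mem_iUnion, exists_prop]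

theorem isCompact_piece (k : Option Bool) (n : ℕ) (W : ℝ) : IsCompact (c.piece k n W) := by
  rcases k with _ | s <;> exact isCompact_wall _ _ _

theorem isCompact_rest (S : Set (Option Bool × ℕ)) (W : ℝ) : IsCompact (c.rest S W) := by
  classical
  refine isCompact_iUnion fun k => c.N.isCompact_biUnion fun n _ => ?_; by_cases h : (k, n) ∉ S
  · simp only [h, not_false_eq_true, iUnion_true]; exact isCompact_piece k n W
  · simp only [h, iUnion_false]; exact isCompact_empty

theorem Valid.rest_subset (h : c.Valid) (S : Set (Option Bool × ℕ)) {W : ℝ} (hW : 0 ≤ W)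
    (hWc : W ≤ 3 / 2 * c.w) : c.rest S W ⊆ thickened := by
  intro p hp; obtain ⟨k, n, hn, -, hp⟩ := mem_rest.1 hp; exact h.piece_subset hW hWc hn k hp

/-- The height of an arm lies between the levels of its ends. -/
theorem lt_height_arm {s : Bool} {n : ℕ} {W a : ℝ} (hW : 0 ≤ W) (h1 : a + W < c.lev s n)
    (h2 : a + W < c.lev s (c.mate s n)) {p : 𝕊} (hp : p ∈ c.piece (some s) n W) : a < p.2 := by
  obtain ⟨t, ⟨t0, t1⟩, -, -, h⟩ := (mem_arm hW).1 hp; have := (abs_le.1 h).1; nlinarith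

theorem height_arm_lt {s : Bool} {n : ℕ} {W a : ℝ} (hW : 0 ≤ W) (h1 : c.lev s n + W < a)
    (h2 : c.lev s (c.mate s n) + W < a) {p : 𝕊} (hp : p ∈ c.piece (some s) n W) : p.2 < a := by
  obtain ⟨t, ⟨t0, t1⟩, -, -, h⟩ := (mem_arm hW).1 hp; have := (abs_le.1 h).2; nlinarith

/-- A moving path on the side `s` which begins with the strand `e` and ends with the strand `g`. -/
structure SidePath (c : Config) (s : Bool) (z b : ℝ) (k : ℕ) (v v' : ℕ → 𝕊) (e g : ℕ) :
    Prop where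
  pos : 1 ≤ k
  move : PathMove (k + 3) v v'
  mem_left : e ∈ c.N
  mem_right : g ∈ c.N
  v0 : v 0 = c.knee (!s) e
  v1 : v 1 = c.knee s e
  v2 : v (k + 2) = c.knee s g
  v3 : v (k + 3) = c.knee (!s) g
  v0' : v' 0 = v 0
  v1' : v' 1 = v 1
  v2' : v' (k + 2) = v (k + 2)
  v3' : v' (k + 3) = v (k + 3)
  im : ∀ i, 2 ≤ i → i ≤ k + 1 → 1 < sg s * (v i).1.im ∧ 1 < sg s * (v' i).1.im
  height : ∀ i, 1 ≤ i → i ≤ k + 2 → |(v i).2 - z| ≤ b ∧ |(v' i).2 - z| ≤ b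

variable {s : Bool} {z b : ℝ} {k : ℕ} {v v' : ℕ → 𝕊} {e g : ℕ}

theorem SidePath.im_le (h : c.SidePath s z b k v v' e g) {i : ℕ} (h1 : 1 ≤ i) (h2 : i ≤ k + 2) :
    1 ≤ sg s * (v i).1.im ∧ 1 ≤ sg s * (v' i).1.im := by
  rcases h1.eq_or_lt with rfl | h1
  · rw [h.v1', h.v1]; simp only [knee, sg_mul_self, le_refl, and_self]
  rcases h2.eq_or_lt with rfl | h2
  · rw [h.v2', h.v2]; simp only [knee, sg_mul_self, le_refl, and_self]
  exact (h.im i h1 (by omega)).imp le_of_lt le_of_lt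

/-- A path on one side of a configuration, which ends with strands, moves in the complement of the
other pieces if it has a different height. -/
theorem SidePath.exists_isotopy (q : c.SidePath s z b k v v' e g) (h : c.Valid)
    (hz : b + c.w < z ∧ z + b + c.w < 1) {S : Set (Option Bool × ℕ)}
    (hSe : (none, e) ∈ S) (hSg : (none, g) ∈ S)
    (hS : ∀ n ∈ c.N, (some s, n) ∉ S →
      (z + b + 2 * c.w < c.lev s n ∧ z + b + 2 * c.w < c.lev s (c.mate s n)) ∨
      (c.lev s n + 2 * c.w < z - b ∧ c.lev s (c.mate s n) + 2 * c.w < z - b))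
    {K : Set 𝕊} (hKc : IsCompact K) (hK : K ⊆ thickened)
    (hKd : ∀ i, 1 ≤ i → i ≤ k + 1 → ∀ τ ∈ 𝕀,
      Disjoint (wall (mov (v i) (v' i) τ) (mov (v (i + 1)) (v' (i + 1)) τ) c.w) K) :
    ∃ φ, IsotopicToId φ ∧ (∀ p ∈ c.rest S c.w ∪ K, φ p = p) ∧
      ∀ i < k + 3, ∀ r ∈ 𝕀,
        φ '' wall (v i) (v (i + 1)) (r * c.w) = wall (v' i) (v' (i + 1)) (r * c.w) := by
  have im_le : ∀ {i}, _ := @q.im_le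
  obtain ⟨hk, hp, he, hg, v0, v1, v2, v3, v0', v1', v2', v3', him, hh⟩ := q; have hw := h.w_pos
  have hW2 : c.w ≤ 3 / 2 * c.w := by linarith
  have mov_im : ∀ i, ∀ τ, sg s * (mov (v i) (v' i) τ).1.im =
      (1 - τ) * (sg s * (v i).1.im) + τ * (sg s * (v' i).1.im) := by
    intro i τ; rw [mov_eq]; ring
  have wall_im : ∀ i, 1 ≤ i → i ≤ k + 1 → ∀ τ ∈ 𝕀,
      ∀ p ∈ wall (mov (v i) (v' i) τ) (mov (v (i + 1)) (v' (i + 1)) τ) c.w,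
        1 ≤ sg s * p.1.im ∧ |p.2 - z| ≤ b + c.w := by
    intro i h1 h2 τ hτ p hp; have a1 := im_le h1 (by omega)
    have a2 := im_le (i := i + 1) (by omega) (by omega); have b1 := hh i h1 (by omega)
    have b2 := hh (i + 1) (by omega) (by omega)
    have := lin_le_of_mem_wall (a := 0) (b := -sg s) (k := -1)
      (lin_mov_le hτ (P := v i) (P' := v' i) (by simp only [lin]; linarith)
        (by simp only [lin]; linarith))
      (lin_mov_le hτ (P := v (i + 1)) (P' := v' (i + 1)) (by simp only [lin]; linarith)
        (by simp only [lin]; linarith)) hp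
    simp only [lin] at this
    exact ⟨by linarith,
      height_of_mem_wall hw.le (height_mov hτ b1.1 b1.2) (height_mov hτ b2.1 b2.2) hp⟩
  have wall_re : ∀ i, 1 ≤ i → i ≤ k + 1 → ∀ τ ∈ 𝕀,
      ∀ p ∈ wall (mov (v i) (v' i) τ) (mov (v (i + 1)) (v' (i + 1)) τ) c.w, sg s * p.1.im ≤ 1 →
        p.1.re = c.x s e ∨ p.1.re = c.x s g := by
    intro i h1 h2 τ hτ p hp hpi
    have lt : ∀ j, 2 ≤ j → j ≤ k + 1 → 1 < sg s * (mov (v j) (v' j) τ).1.im := by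
      intro j j1 j2; rw [mov_im]; exact lt_convex (him j j1 j2).1 (him j j1 j2).2 hτ.1 hτ.2
    obtain ⟨t, ⟨t0, t1⟩, e1, e2, -⟩ := (mem_wall hw.le).1 hp
    have e3 : sg s * p.1.im = (1 - t) * (sg s * (mov (v i) (v' i) τ).1.im) +
        t * (sg s * (mov (v (i + 1)) (v' (i + 1)) τ).1.im) := by
      rw [e2]; ring
    rcases h1.eq_or_lt with rfl | h1
    · left; have b2 := lt (1 + 1) (by omega) (by omega); rw [v1', v1, mov_self] at e1 e3
      have e4 : sg s * (c.knee s e).1.im = 1 := by simp only [knee, sg_mul_self]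
      rw [e4] at e3
      have : t = 0 := by
        by_contra h0; have := lt_of_le_of_ne t0 (Ne.symm h0); nlinarith
      rw [e1, this]; simp [knee]
    · have b1 := lt i h1 h2; rcases h2.eq_or_lt with rfl | h2
      · right; have e4 : sg s * (c.knee s g).1.im = 1 := by simp only [knee, sg_mul_self]
        change _ = _ + _ * (sg s * (mov (v (k + 2)) (v' (k + 2)) τ).1.im) at e3
        change _ = _ + _ * (mov (v (k + 2)) (v' (k + 2)) τ).1.re at e1
        rw [v2', v2, mov_self] at e1 e3; rw [e4] at e3
        have : t = 1 := by
          by_contra h0; have := lt_of_le_of_ne t1 h0; nlinarith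
        rw [e1, this]; simp [knee]
      · have b2 := lt (i + 1) (by omega) (by omega); have := lt_convex b1 b2 t0 t1; linarith
  refine hp.exists_isotopy (by omega) hw ((c.isCompact_rest S _).union hKc)
    (union_subset (h.rest_subset S hw.le hW2) hK) ?_ ?_
  · intro i hi; rcases Nat.eq_zero_or_pos i with rfl | h1
    · exact .inl ⟨v0'.symm, v1'.symm⟩
    rcases (Nat.le_of_lt_succ hi).eq_or_lt with rfl | h2
    · exact .inl ⟨v2'.symm, v3'.symm⟩
    refine .inr fun τ hτ => ?_; have h2' : i ≤ k + 1 := by omega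
    rw [disjoint_union_right]; refine ⟨?_, hKd i h1 h2' τ hτ⟩; rw [Set.disjoint_left]
    intro p hp hpr; obtain ⟨kk, n, hn, hnS, hpp⟩ := mem_rest.1 hpr
    obtain ⟨q1, q2⟩ := wall_im i h1 h2' τ hτ p hp; rcases kk with _ | s'
    · have q3 := abs_im_of_mem_ramp hw.le hpp
      have q4 : sg s * p.1.im ≤ 1 := by
        rw [abs_le] at q3; cases s <;> simp only [sg] <;> linarith
      have hne : n ≠ e ∧ n ≠ g := by
        constructor <;> rintro rfl
        · exact hnS hSe
        · exact hnS hSg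
      have q5 : p.1.re = c.x s n := by
        obtain ⟨t, ⟨t0, t1⟩, e1, e2, -⟩ := (mem_ramp hw.le).1 hpp
        cases s <;> simp only [sg] at q1 q4
        · have : t = 0 := by linarith
          rw [e1, this]; ring
        · have : t = 1 := by linarith
          rw [e1, this]; ring
      rcases wall_re i h1 h2' τ hτ p hp q4 with q6 | q6
      · exact h.x_ne hn he hne.1 s (q5.symm.trans q6)
      · exact h.x_ne hn hg hne.2 s (q5.symm.trans q6)
    · by_cases hs : s' = s
      · subst hs; rw [abs_le] at q2; rcases hS n hn hnS with ⟨a1, a2⟩ | ⟨a1, a2⟩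
        · have := lt_height_arm hw.le (a := z + b + c.w) (by linarith) (by linarith) hpp; linarith
        · have := height_arm_lt hw.le (a := z - b - c.w) (by linarith) (by linarith) hpp; linarith
      · have q3 := im_of_mem_arm hw.le hpp; have : s' = !s := by cases s <;> cases s' <;> simp_all
        rw [this, sg_not] at q3; linarith
  · intro i hi τ hτ; rcases Nat.eq_zero_or_pos i with rfl | h1
    · have := h.piece_subset hw.le hW2 he none; rw [v0', v1', mov_self, mov_self, v0, v1]; cases s
      · change wall (c.knee true e) (c.knee false e) c.w ⊆ _; rw [wall_symm]; exact this
      · exact this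
    rcases (Nat.le_of_lt_succ hi).eq_or_lt with rfl | h2
    · have := h.piece_subset hw.le hW2 hg none
      change wall _ (mov (v (k + 3)) (v' (k + 3)) τ) c.w ⊆ _
      rw [v2', v3', mov_self, mov_self, v2, v3]; cases s
      · exact this
      · change wall (c.knee true g) (c.knee false g) c.w ⊆ _; rw [wall_symm]; exact this
    have h2' : i ≤ k + 1 := by omega
    intro p hp; obtain ⟨q1, q2⟩ := wall_im i h1 h2' τ hτ p hp; rw [abs_le] at q2
    refine mem_thickened_of_im (fun h0 => ?_) (by linarith) (by linarith); rw [h0] at q1; linarith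

end Config




/-! ### Two moving paths -/

/-- The band along the path with vertices `v 0, …, v m`. -/
def pathSet (v : ℕ → 𝕊) (W : ℝ) : ℕ → Set 𝕊
  | 0 => ∅
  | m + 1 => pathSet v W m ∪ wall (v m) (v (m + 1)) W

theorem mem_pathSet {v : ℕ → 𝕊} {W : ℝ} {m : ℕ} {p : 𝕊} :
    p ∈ pathSet v W m ↔ ∃ i < m, p ∈ wall (v i) (v (i + 1)) W := by
  induction m with
  | zero => simp [pathSet]
  | succ m ih =>
    rw [pathSet, mem_union, ih]; constructor
    · rintro (⟨i, hi, h⟩ | h)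
      · exact ⟨i, by omega, h⟩
      · exact ⟨m, by omega, h⟩
    · rintro ⟨i, hi, h⟩; rcases (Nat.le_of_lt_succ hi).eq_or_lt with rfl | hi
      · exact .inr h
      · exact .inl ⟨i, hi, h⟩

theorem image_pathSet {φ : 𝕊 → 𝕊} {v v' : ℕ → 𝕊} {W : ℝ} {m : ℕ}
    (h : ∀ i < m, φ '' wall (v i) (v (i + 1)) W = wall (v' i) (v' (i + 1)) W) :
    φ '' pathSet v W m = pathSet v' W m := by
  induction m with
  | zero => simp [pathSet]
  | succ m ih => rw [pathSet, pathSet, image_union, ih fun i hi => h i (by omega), h m (by omega)]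

theorem wall_mono {P Q : 𝕊} {W W' : ℝ} (h0 : 0 ≤ W) (h : W ≤ W') : wall P Q W ⊆ wall P Q W' := by
  intro p hp; obtain ⟨t, ht, h1, h2, h3⟩ := (mem_wall h0).1 hp
  exact (mem_wall (h0.trans h)).2 ⟨t, ht, h1, h2, h3.trans h⟩

namespace Config

theorem piece_mono {c : Config} {k : Option Bool} {n : ℕ} {W W' : ℝ} (h0 : 0 ≤ W) (h : W ≤ W') :
    c.piece k n W ⊆ c.piece k n W' := by
  rcases k with _ | s <;> exact wall_mono h0 h

/-- The inner part of a path. -/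
def innerSet (v : ℕ → 𝕊) (W : ℝ) (k : ℕ) : Set 𝕊 :=
  ⋃ i ∈ Finset.Icc 1 (k + 1), wall (v i) (v (i + 1)) W

theorem isCompact_innerSet (v : ℕ → 𝕊) (W : ℝ) (k : ℕ) : IsCompact (innerSet v W k) :=
  Finset.isCompact_biUnion _ fun _ _ => isCompact_wall _ _ _

theorem mem_innerSet {v : ℕ → 𝕊} {W : ℝ} {k : ℕ} {p : 𝕊} :
    p ∈ innerSet v W k ↔ ∃ i, 1 ≤ i ∧ i ≤ k + 1 ∧ p ∈ wall (v i) (v (i + 1)) W := by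
  simp only [innerSet, mem_iUnion, Finset.mem_Icc, exists_prop, and_assoc]

theorem SidePath.inner_subset {c : Config} {s : Bool} {z b : ℝ} {k : ℕ} {v v' : ℕ → 𝕊}
    {e g : ℕ} (h : c.SidePath s z b k v v' e g) {W : ℝ} (hW : 0 ≤ W) (hz : b + W < z)
    (hz' : z + b + W < 1) : innerSet v W k ⊆ thickened ∧ innerSet v' W k ⊆ thickened := by
  have key : ∀ P Q : 𝕊, 1 ≤ sg s * P.1.im → 1 ≤ sg s * Q.1.im → |P.2 - z| ≤ b → |Q.2 - z| ≤ b →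
      wall P Q W ⊆ thickened := by
    intro P Q h1 h2 h3 h4 p hp
    have a1 := lin_le_of_mem_wall (a := 0) (b := -sg s) (k := -1) (P := P) (Q := Q)
      (by simp only [lin]; linarith) (by simp only [lin]; linarith) hp
    have a2 := abs_le.1 (height_of_mem_wall hW h3 h4 hp)
    refine mem_thickened_of_im (fun h0 => ?_) (by linarith) (by linarith); simp only [lin, h0] at a1
    linarith
  constructor <;>
  · intro p hp; obtain ⟨i, h1, h2, hp⟩ := mem_innerSet.1 hp; have a1 := h.im_le h1 (by omega)
    have a2 := h.im_le (i := i + 1) (by omega) (by omega); have b1 := h.height i h1 (by omega)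
    have b2 := h.height (i + 1) (by omega) (by omega)
    first
      | exact key _ _ a1.1 a2.1 b1.1 b2.1 hp
      | exact key _ _ a1.2 a2.2 b1.2 b2.2 hp

/-- The pieces on the side `s` belonging to the strands in `T`, except for the strands in `T'`. -/
def pieces (s : Bool) (T' T : Set ℕ) : Set (Option Bool × ℕ) :=
  {kn | (kn.1 = none ∧ kn.2 ∈ T') ∨ (kn.1 = some s ∧ kn.2 ∈ T)}

/-- The inner parts of two moving paths are separated by lines. -/
def PathsApart (k l : ℕ) (v v' u u' : ℕ → 𝕊) : Prop :=
  ∀ i, 1 ≤ i → i ≤ k + 1 → ∀ i', 1 ≤ i' → i' ≤ l + 1 → ∃ a b d,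
    (lin a b (v i) ≤ d ∧ lin a b (v' i) ≤ d ∧ lin a b (v (i + 1)) ≤ d ∧ lin a b (v' (i + 1)) ≤ d) ∧
    (d < lin a b (u i') ∧ d < lin a b (u' i') ∧ d < lin a b (u (i' + 1)) ∧
      d < lin a b (u' (i' + 1)))

/-- Separated paths have different ends. -/
theorem ends_ne {c : Config} {s : Bool} {z b : ℝ} {k l : ℕ} {v v' u u' : ℕ → 𝕊} {e g f j : ℕ}
    (hv : c.SidePath s z b k v v' e g) (hu : c.SidePath s z b l u u' f j)
    (hd : PathsApart k l v v' u u') : f ≠ e ∧ f ≠ g ∧ j ≠ e ∧ j ≠ g := by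
  and_intros <;> rintro rfl
  · obtain ⟨a, b, d, ⟨a1, -, -, -⟩, b1, -, -, -⟩ := hd 1 le_rfl (by omega) 1 le_rfl (by omega)
    rw [hv.v1] at a1; rw [hu.v1] at b1; linarith
  · obtain ⟨a, b, d, ⟨-, -, a1, -⟩, b1, -, -, -⟩ := hd (k + 1) (by omega) le_rfl 1 le_rfl (by omega)
    rw [hv.v2] at a1; rw [hu.v1] at b1; linarith
  · obtain ⟨a, b, d, ⟨a1, -, -, -⟩, -, -, b1, -⟩ := hd 1 le_rfl (by omega) (l + 1) (by omega) le_rfl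
    rw [hv.v1] at a1; rw [hu.v2] at b1; linarith
  · obtain ⟨a, b, d, ⟨-, -, a1, -⟩, -, -, b1, -⟩ :=
      hd (k + 1) (by omega) le_rfl (l + 1) (by omega) le_rfl
    rw [hv.v2] at a1; rw [hu.v2] at b1; linarith

/-- Two paths move one after the other. -/
theorem Valid.exists_two_path_isotopy {c : Config} (h : c.Valid) {s : Bool} {z b : ℝ}
    (hz : b + c.w < z ∧ z + b + c.w < 1) {k l : ℕ} {v v' u u' : ℕ → 𝕊} {e g f j : ℕ}
    (hv : c.SidePath s z b k v v' e g) (hu : c.SidePath s z b l u u' f j) {T : Set ℕ}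
    (hS : ∀ n ∈ c.N, n ∉ T →
      (z + b + 2 * c.w < c.lev s n ∧ z + b + 2 * c.w < c.lev s (c.mate s n)) ∨
      (c.lev s n + 2 * c.w < z - b ∧ c.lev s (c.mate s n) + 2 * c.w < z - b))
    (hd : PathsApart k l v v' u u') :
    ∃ φ, IsotopicToId φ ∧ ∀ r ∈ 𝕀,
      φ '' (c.rest (pieces s {e, g, f, j} T) (r * c.w) ∪ pathSet v (r * c.w) (k + 3) ∪
        pathSet u (r * c.w) (l + 3)) =
      c.rest (pieces s {e, g, f, j} T) (r * c.w) ∪ pathSet v' (r * c.w) (k + 3) ∪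
        pathSet u' (r * c.w) (l + 3) := by
  have hw := h.w_pos
  have neg_lin : ∀ a b p, lin (-a) (-b) p = -lin a b p := by intro a b p; simp only [lin]; ring
  obtain ⟨φ, hφ, fφ, wφ⟩ := hv.exists_isotopy h hz (S := pieces s {e, g} T)
    (by simp [pieces]) (by simp [pieces])
    (fun n hn hnT => hS n hn fun hT => hnT (by simp [pieces, hT]))
    (isCompact_innerSet u c.w l) (hu.inner_subset hw.le hz.1 hz.2).1 (by
      intro i h1 h2 τ hτ; rw [Set.disjoint_left]; intro p hp hp'
      obtain ⟨i', h1', h2', hp'⟩ := mem_innerSet.1 hp'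
      obtain ⟨a, b', d, ⟨a1, a2, a3, a4⟩, b1, b2, b3, b4⟩ := hd i h1 h2 i' h1' h2'
      have q1 := lin_le_of_mem_wall (lin_mov_le hτ a1 a2) (lin_mov_le hτ a3 a4) hp
      have q2 := lin_lt_of_mem_wall (a := -a) (b := -b') (k := -d) (by rw [neg_lin]; linarith)
        (by rw [neg_lin]; linarith) hp'
      rw [neg_lin] at q2
      linarith)
  obtain ⟨ψ, hψ, fψ, wψ⟩ := hu.exists_isotopy h hz (S := pieces s {f, j} T)
    (by simp [pieces]) (by simp [pieces])
    (fun n hn hnT => hS n hn fun hT => hnT (by simp [pieces, hT]))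
    (isCompact_innerSet v' c.w k) (hv.inner_subset hw.le hz.1 hz.2).2 (by
      intro i' h1' h2' τ hτ; rw [Set.disjoint_left]; intro p hp' hp
      obtain ⟨i, h1, h2, hp⟩ := mem_innerSet.1 hp
      obtain ⟨a, b', d, ⟨a1, a2, a3, a4⟩, b1, b2, b3, b4⟩ := hd i h1 h2 i' h1' h2'
      have q1 := lin_le_of_mem_wall a2 a4 hp
      have q2 := lin_lt_of_mem_wall (a := -a) (b := -b') (k := -d)
        (lin_mov_lt hτ (P := u i') (P' := u' i') (by rw [neg_lin]; linarith)
          (by rw [neg_lin]; linarith))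
        (lin_mov_lt hτ (P := u (i' + 1)) (P' := u' (i' + 1)) (by rw [neg_lin]; linarith)
          (by rw [neg_lin]; linarith)) hp'
      rw [neg_lin] at q2
      linarith)
  refine ⟨φ.trans ψ, hφ.trans hψ, fun r hr => ?_⟩; have hr0 : 0 ≤ r * c.w := mul_nonneg hr.1 hw.le
  have hr1 : r * c.w ≤ c.w := mul_le_of_le_one_left hw.le hr.2
  have fix : ∀ (χ : 𝕊 ≃ₜ 𝕊) (A : Set 𝕊), (∀ p ∈ A, χ p = p) → χ '' A = A := by
    intro χ A hA; rw [image_congr hA, image_id']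
  have rest_mono : ∀ S S' : Set (Option Bool × ℕ), S' ⊆ S → c.rest S (r * c.w) ⊆ c.rest S' c.w := by
    intro S S' hSS p hp; obtain ⟨kk, n, hn, hnS, hp⟩ := mem_rest.1 hp
    exact mem_rest.2 ⟨kk, n, hn, fun hh => hnS (hSS hh), piece_mono hr0 hr1 hp⟩
  have ramp_eq : ∀ n, wall (c.knee (!s) n) (c.knee s n) (r * c.w) = c.piece none n (r * c.w) ∧
      wall (c.knee s n) (c.knee (!s) n) (r * c.w) = c.piece none n (r * c.w) := by
    intro n; cases s
    · exact ⟨wall_symm _ _ _, rfl⟩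
    · exact ⟨rfl, wall_symm _ _ _⟩
  have split : ∀ {k : ℕ} {v : ℕ → 𝕊} {e g : ℕ}, v 0 = c.knee (!s) e → v 1 = c.knee s e →
      v (k + 2) = c.knee s g → v (k + 3) = c.knee (!s) g →
      ∀ p ∈ pathSet v (r * c.w) (k + 3), p ∈ c.piece none e (r * c.w) ∨
        p ∈ c.piece none g (r * c.w) ∨ p ∈ innerSet v (r * c.w) k := by
    intro k v e g v0 v1 v2 v3 p hp; obtain ⟨i, hi, hp⟩ := mem_pathSet.1 hp
    rcases Nat.eq_zero_or_pos i with rfl | h1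
    · rw [zero_add, v0, v1, (ramp_eq e).1] at hp; exact .inl hp
    rcases (Nat.le_of_lt_succ hi).eq_or_lt with rfl | h2
    · rw [v2, v3, (ramp_eq g).2] at hp; exact .inr (.inl hp)
    · exact .inr (.inr (mem_innerSet.2 ⟨i, h1, by omega, hp⟩))
  have inner_mono : ∀ (v : ℕ → 𝕊) k, innerSet v (r * c.w) k ⊆ innerSet v c.w k := by
    intro v k p hp; obtain ⟨i, h1, h2, hp⟩ := mem_innerSet.1 hp
    exact mem_innerSet.2 ⟨i, h1, h2, wall_mono hr0 hr1 hp⟩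
  have rm : ∀ n ∈ c.N, ∀ T', n ∉ T' → c.piece none n (r * c.w) ⊆ c.rest (pieces s T' T) c.w := by
    intro n hn T' hnT p hp
    exact mem_rest.2 ⟨none, n, hn, by simpa [pieces] using hnT, piece_mono hr0 hr1 hp⟩
  have hcomp : ∀ A, (φ.trans ψ) '' A = ψ '' (φ '' A) := fun A => image_comp ψ φ A
  rw [image_union, image_union, hcomp, hcomp, hcomp]
  have sub : ∀ {S : Set ℕ}, S ⊆ {e, g, f, j} → pieces s S T ⊆ pieces s {e, g, f, j} T :=
    fun hS x hx => hx.imp_left (And.imp_right (@hS _))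
  have hre := fix φ _ fun p hp => fφ p (.inl (rest_mono _ _
    (sub (by simp [insert_subset_iff])) hp))
  have hre' := fix ψ _ fun p hp => fψ p (.inl (rest_mono _ _
    (sub (by simp [insert_subset_iff])) hp))
  have hue := ends_ne hv hu hd
  have h1 : φ '' pathSet u (r * c.w) (l + 3) = pathSet u (r * c.w) (l + 3) := by
    refine fix φ _ fun p hp => fφ p ?_; rcases split hu.v0 hu.v1 hu.v2 hu.v3 p hp with hp | hp | hp
    · exact .inl (rm f hu.mem_left _ (by simp [hue.1, hue.2.1]) hp)
    · exact .inl (rm j hu.mem_right _ (by simp [hue.2.2.1, hue.2.2.2]) hp)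
    · exact .inr (inner_mono _ _ hp)
  have h2 : ψ '' pathSet v' (r * c.w) (k + 3) = pathSet v' (r * c.w) (k + 3) := by
    refine fix ψ _ fun p hp => fψ p ?_
    rcases split (hv.v0'.trans hv.v0) (hv.v1'.trans hv.v1) (hv.v2'.trans hv.v2)
      (hv.v3'.trans hv.v3) p hp with hp | hp | hp
    · exact .inl (rm e hv.mem_left _ (by simp [hue.1.symm, hue.2.2.1.symm]) hp)
    · exact .inl (rm g hv.mem_right _ (by simp [hue.2.1.symm, hue.2.2.2.symm]) hp)
    · exact .inr (inner_mono _ _ hp)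
  rw [hre, hre', h1, image_pathSet (fun i hi => wφ i hi r hr),
    image_pathSet (fun i hi => wψ i hi r hr), h2]

end Config




/-! ### The paths at a crossing -/

/-- The path with the given vertices. -/
def pth (l : List 𝕊) (i : ℕ) : 𝕊 := l.getD i 0

theorem pth_zero (p : 𝕊) (l : List 𝕊) : pth (p :: l) 0 = p := rfl

theorem pth_succ (p : 𝕊) (l : List 𝕊) (i : ℕ) : pth (p :: l) (i + 1) = pth l i := rfl

/-- The reflection of the plane in the imaginary axis. -/
def mirror (p : 𝕊) : 𝕊 := (⟨-p.1.re, p.1.im⟩, p.2)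

theorem lin_mirror (a b : ℝ) (p : 𝕊) : lin a b (mirror p) = lin (-a) b p := by
  simp [lin, mirror]

theorem PathMove.of_mirror {m : ℕ} {v v' : ℕ → 𝕊}
    (h : PathMove m (fun i => mirror (v i)) (fun i => mirror (v' i))) : PathMove m v v' where
  turn i hi := by
    obtain ⟨a, b, h⟩ := h.turn i hi; simp only [MovLt, lin_mirror] at h; exact ⟨-a, b, h⟩
  sep i j hi hj := by
    obtain ⟨a, b, h⟩ := h.sep i j hi hj; simp only [MovLt, lin_mirror] at h; exact ⟨-a, b, h⟩

/-- A path that turns back to the right of its starting point is straightened. -/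
theorem pathMove_fold {e g f ρ : ℝ} (h2 : 2 * ρ < f - g) (h3 : 2 * ρ < g - e)
    (hρ : 0 < ρ) {v v' : ℕ → 𝕊} (v0 : (v 0).1 = ⟨e, 1⟩) (v1 : (v 1).1 = ⟨e, -1⟩)
    (v2 : (v 2).1 = ⟨(e + f) / 2, -1 - (f - e) / 2⟩)
    (v3 : (v 3).1 = ⟨(f + g) / 2 - ρ, -1 - (f - g) / 2 - ρ⟩)
    (v4 : (v 4).1 = ⟨(f + g) / 2 - ρ, -1 - (f - g) / 2 + ρ⟩)
    (v5 : (v 5).1 = ⟨g, -1⟩) (v6 : (v 6).1 = ⟨g, 1⟩)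
    (v0' : (v' 0).1 = ⟨e, 1⟩) (v1' : (v' 1).1 = ⟨e, -1⟩)
    (v2' : (v' 2).1 = ⟨(e + g) / 2, -1 - (g - e) / 2⟩)
    (v3' : (v' 3).1 = ⟨(e + 2 * g) / 3, -1 - (g - e) / 3⟩)
    (v4' : (v' 4).1 = ⟨(e + 5 * g) / 6, -1 - (g - e) / 6⟩)
    (v5' : (v' 5).1 = ⟨g, -1⟩) (v6' : (v' 6).1 = ⟨g, 1⟩) : PathMove 6 v v' where
  turn i hi := by
    have : i ≤ 4 := by omega
    interval_cases i <;> [refine ⟨0, -1, ?_⟩; refine ⟨1, 0, ?_⟩; refine ⟨1, 1, ?_⟩;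
      refine ⟨0, 1, ?_⟩; refine ⟨0, 1, ?_⟩] <;> simp only [MovLt, lin, Nat.reduceAdd, *] <;>
      and_intros <;> linarith
  sep i j hij hj := by
    have hj5 : j ≤ 5 := by omega
    obtain ⟨h, rfl⟩ | ⟨h, h', rfl⟩ | ⟨h, rfl⟩ | ⟨h, h'⟩ : (j ≤ 3 ∧ i = 0) ∨ (5 ≤ j ∧ j ≤ 5 ∧ i = 3) ∨
      (4 ≤ j ∧ i = 0) ∨ (1 ≤ i ∧ i ≤ 2) := by omega
    on_goal 1 => refine ⟨0, -1, ?_⟩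
    on_goal 2 => refine ⟨0, 1, ?_⟩
    on_goal 3 => refine ⟨1, 0, ?_⟩
    on_goal 4 => refine ⟨1, 1, ?_⟩; interval_cases i
    all_goals interval_cases j <;> simp only [MovLt, lin, Nat.reduceAdd, *] <;> and_intros <;> linarith

/-- A path whose real part increases stays embedded. -/
theorem pathMove_of_re {k : ℕ} (hk : 1 ≤ k) {v v' : ℕ → 𝕊}
    (h0 : (v 0).1.re = (v 1).1.re) (h0' : (v' 0).1.re = (v' 1).1.re)
    (h3 : (v (k + 3)).1.re = (v (k + 2)).1.re) (h3' : (v' (k + 3)).1.re = (v' (k + 2)).1.re)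
    (hre : ∀ i, 1 ≤ i → i ≤ k + 1 → (v i).1.re < (v (i + 1)).1.re)
    (hre' : ∀ i, 1 ≤ i → i ≤ k + 1 → (v' i).1.re < (v' (i + 1)).1.re)
    (him : (v 2).1.im < (v 1).1.im ∧ (v 1).1.im < (v 0).1.im)
    (him' : (v' 2).1.im < (v' 1).1.im ∧ (v' 1).1.im < (v' 0).1.im)
    (hj : (v (k + 1)).1.im < (v (k + 2)).1.im ∧ (v (k + 2)).1.im < (v (k + 3)).1.im)
    (hj' : (v' (k + 1)).1.im < (v' (k + 2)).1.im ∧ (v' (k + 2)).1.im < (v' (k + 3)).1.im) :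
    PathMove (k + 3) v v' := by
  have mono : ∀ u : ℕ → 𝕊, (u 0).1.re = (u 1).1.re → (u (k + 3)).1.re = (u (k + 2)).1.re →
      (∀ i, 1 ≤ i → i ≤ k + 1 → (u i).1.re < (u (i + 1)).1.re) →
      ∀ i j, i < j → j ≤ k + 3 → ¬ (i = 0 ∧ j = 1) → ¬ (i = k + 2 ∧ j = k + 3) →
        lin 1 0 (u i) < lin 1 0 (u j) := by
    intro u h0 h3 hu
    have key : ∀ i, 1 ≤ i → ∀ j, i + 1 ≤ j → j ≤ k + 2 → (u i).1.re < (u j).1.re := by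
      intro i hi j hij
      induction j, hij using Nat.le_induction with
      | base => intro h; exact hu i hi (by omega)
      | succ j hj ih => intro h; exact (ih (by omega)).trans (hu j (by omega) (by omega))
    intro i j hij hj h1 h2; simp only [lin, one_mul, zero_mul, add_zero]
    rcases Nat.eq_zero_or_pos i with rfl | hi
    · rw [h0]; rcases hj.eq_or_lt with rfl | hj
      · rw [h3]; exact key 1 le_rfl _ (by omega) (by omega)
      · exact key 1 le_rfl _ (by omega) (by omega)
    · rcases hj.eq_or_lt with rfl | hj
      · rw [h3]; exact key i hi _ (by omega) (by omega)
      · exact key i hi _ (by omega) (by omega)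
  have m1 := mono v h0 h3 hre; have m2 := mono v' h0' h3' hre'
  have mm : ∀ i j, i < j → j ≤ k + 3 → ¬ (i = 0 ∧ j = 1) → ¬ (i = k + 2 ∧ j = k + 3) →
      MovLt 1 0 v v' i j := fun i j a b c d => ⟨m1 i j a b c d, m2 i j a b c d⟩
  refine ⟨fun i hi => ?_, fun i j hij hj => ?_⟩
  · rcases Nat.eq_zero_or_pos i with rfl | h1
    · refine ⟨0, -1, ?_⟩; simp only [MovLt, lin, zero_add]; and_intros <;> linarith
    rcases (Nat.le_of_lt_succ (show i < k + 1 + 1 by omega)).eq_or_lt with rfl | h2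
    · refine ⟨0, 1, ?_⟩; simp only [MovLt, lin]; and_intros <;> linarith
    · refine ⟨1, 0, mm _ _ ?_ ?_ ?_ ?_, mm _ _ ?_ ?_ ?_ ?_⟩ <;> omega
  · refine ⟨1, 0, mm _ _ ?_ ?_ ?_ ?_, mm _ _ ?_ ?_ ?_ ?_, mm _ _ ?_ ?_ ?_ ?_, mm _ _ ?_ ?_ ?_ ?_⟩ <;>
      omega

/-! ### Coordinates at a crossing -/

/-- The coordinates in which the two strands of the crossing are the first two axes. -/
def co (g f z w ρ : ℝ) (p : 𝕊) : ℝ × ℝ × ℝ :=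
  ((-p.1.im - 1 + p.1.re - f) / (2 * ρ), (-p.1.im - 1 - p.1.re + g) / (2 * ρ), (p.2 - z) / (4 * w))

theorem mem_wall_co {g f ρ z w : ℝ} (hρ : 0 < ρ) (hw : 0 < w) {r : ℝ} (hr : 0 ≤ r)
    {P Q p : 𝕊} {M N H m n y m' n' y' : ℝ} (hp : co g f z w ρ p = (M, N, H))
    (hP : co g f z w ρ P = (m, n, y)) (hQ : co g f z w ρ Q = (m', n', y')) :
    p ∈ wall P Q (r * (4 * w)) ↔ ∃ t ∈ 𝕀, M = (1 - t) * m + t * m' ∧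
      N = (1 - t) * n + t * n' ∧ |H - ((1 - t) * y + t * y')| ≤ r := by
  simp only [co, Prod.mk.injEq] at hp hP hQ; obtain ⟨rfl, rfl, rfl⟩ := hp
  obtain ⟨rfl, rfl, rfl⟩ := hP; obtain ⟨rfl, rfl, rfl⟩ := hQ; rw [mem_wall (by positivity)]
  refine exists_congr fun t => and_congr_right fun _ => ?_
  have e1 : (p.2 - z) / (4 * w) - ((1 - t) * ((P.2 - z) / (4 * w)) + t * ((Q.2 - z) / (4 * w))) =
      (p.2 - ((1 - t) * P.2 + t * Q.2)) / (4 * w) := by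
    field_simp; ring
  rw [e1, abs_div, abs_of_pos (by positivity : 0 < 4 * w), div_le_iff₀ (by positivity)]; field_simp
  constructor
  · rintro ⟨h1, h2, h3⟩; exact ⟨by rw [h1, h2]; ring, by rw [h1, h2]; ring, h3⟩
  · rintro ⟨h1, h2, h3⟩; exact ⟨by linarith, by linarith, h3⟩

/-- A wall along an axis, in coordinates. -/
theorem mem_wall_axis {M N H m n y y' r : ℝ} (hy : m < n) :
    (∃ t ∈ 𝕀, M = (1 - t) * y + t * y ∧ N = (1 - t) * m + t * n ∧
      |H - ((1 - t) * y' + t * y')| ≤ r) ↔ M = y ∧ m ≤ N ∧ N ≤ n ∧ |H - y'| ≤ r := by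
  have e : ∀ t a : ℝ, (1 - t) * a + t * a = a := fun t a => by ring
  simp only [e]; constructor
  · rintro ⟨t, ⟨t0, t1⟩, h1, h2, h3⟩; exact ⟨h1, by nlinarith, by nlinarith, h3⟩
  · rintro ⟨h1, h2, h3, h4⟩; have hp : 0 < n - m := by linarith
    refine ⟨(N - m) / (n - m), ⟨by apply div_nonneg <;> linarith, ?_⟩, h1, ?_, h4⟩
    · rw [div_le_one hp]; linarith
    · field_simp; ring

/-- The centre of the crossing. -/
def centre (g f : ℝ) : ℂ := ⟨(f + g) / 2, -1 - (f - g) / 2⟩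

theorem mem_chart {a v : ℂ} {z w : ℝ} (hv : v ≠ 0) (hw : 0 < w) {T : Set 𝕊} {p : 𝕊} :
    p ∈ chart a v z w '' T ↔ ((p.1 - a) / v, (p.2 - z) / w) ∈ T := by
  constructor
  · rintro ⟨q, hq, rfl⟩; convert hq using 1
    refine Prod.ext ?_ ?_ <;> simp only [chart] <;> field_simp <;> ring
  · intro h; refine ⟨_, h, Prod.ext ?_ ?_⟩ <;> simp only [chart] <;> field_simp <;> ring




namespace Config

/-- The configurations differ at most in the lower arcs at the strands in `T`. -/
structure SameBut (c c' : Config) (T : Set ℕ) : Prop where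
  N_eq : c'.N = c.N
  x_eq : c'.x = c.x
  lev_eq : c'.lev = c.lev
  w_eq : c'.w = c.w
  mate_true : ∀ n ∈ c.N, c'.mate true n = c.mate true n
  mate_false : ∀ n ∈ c.N, n ∉ T → c'.mate false n = c.mate false n

theorem SameBut.knee_eq {c c' : Config} {T : Set ℕ} (h : SameBut c c' T) : c'.knee = c.knee := by
  funext s n; simp only [knee, h.x_eq, h.lev_eq]

theorem SameBut.rest_eq {c c' : Config} {T : Set ℕ} (h : SameBut c c' T) (W : ℝ) :
    c'.rest (pieces false T T) W = c.rest (pieces false T T) W := by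
  ext p; simp only [mem_rest, h.N_eq]
  refine exists_congr fun k => exists_congr fun n => and_congr_right fun hn =>
    and_congr_right fun hS => ?_
  rcases k with _ | _ | _
  · simp only [piece, h.knee_eq]
  · have : n ∉ T := fun hT => hS (by simp [pieces, hT])
    simp only [piece, h.knee_eq, apex, h.mate_false n hn this, h.x_eq, h.lev_eq]
  · simp only [piece, h.knee_eq, apex, h.mate_true n hn, h.x_eq, h.lev_eq]

theorem body_eq_rest {c : Config} {T : Set ℕ} (hT : ∀ n ∈ T, n ∈ c.N) (W : ℝ) :
    c.body W = c.rest (pieces false T T) W ∪ {p | ∃ n ∈ T, p ∈ c.piece none n W} ∪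
      {p | ∃ n ∈ T, p ∈ c.piece (some false) n W} := by
  ext p; simp only [body, mem_iUnion, mem_union, mem_rest, exists_prop, pieces, mem_ofPred_eq]
  constructor
  · rintro ⟨k, n, hn, hp⟩; by_cases h1 : k = none ∧ n ∈ T
    · obtain ⟨rfl, h1⟩ := h1; exact .inl (.inr ⟨n, h1, hp⟩)
    by_cases h2 : k = some false ∧ n ∈ T
    · obtain ⟨rfl, h2⟩ := h2; exact .inr ⟨n, h2, hp⟩
    exact .inl (.inl ⟨k, n, hn, by tauto, hp⟩)
  · rintro ((⟨k, n, hn, -, hp⟩ | ⟨n, hn, hp⟩) | ⟨n, hn, hp⟩)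
    · exact ⟨k, n, hn, hp⟩
    · exact ⟨none, n, hT n hn, hp⟩
    · exact ⟨some false, n, hT n hn, hp⟩

theorem apex_fst {c : Config} {n m : ℕ} (h : c.mate false n = m) (hx : c.x false n < c.x false m) :
    (c.apex false n).1 = ⟨(c.x false n + c.x false m) / 2, -1 - (c.x false m - c.x false n) / 2⟩ := by
  simp only [apex, h, sg]; rw [abs_of_neg (by linarith)]; exact Complex.ext rfl (by simp only; ring)

theorem apex_fst' {c : Config} {n m : ℕ} (h : c.mate false m = n)
    (hx : c.x false n < c.x false m) :
    (c.apex false m).1 = ⟨(c.x false n + c.x false m) / 2, -1 - (c.x false m - c.x false n) / 2⟩ := by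
  simp only [apex, h, sg]; rw [abs_of_pos (by linarith)]
  exact Complex.ext (by simp only; ring) (by simp only; ring)

theorem knee_false_fst (c : Config) (n : ℕ) : (c.knee false n).1 = ⟨c.x false n, -1⟩ := by
  simp [knee, sg]

end Config

/-- A configuration `c` with crossing chords `(e, f)` and `(g, h)`, where the first one is above the
second one if `ε = 1` and below it if `ε = -1`, together with the configurations `cL` and `cT` that
arise by smoothing the crossing. -/
structure CrossingData (c cL cT : Config) (e g f h : ℕ) (z ε : ℝ) : Prop where
  valid : c.Valid
  validL : cL.Valid
  validT : cT.Valid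
  sameL : c.SameBut cL {e, g, f, h}
  sameT : c.SameBut cT {e, g, f, h}
  mem : e ∈ c.N ∧ g ∈ c.N ∧ f ∈ c.N ∧ h ∈ c.N
  x_true : ∀ n, c.x true n = c.x false n
  lt : c.x false e < c.x false g ∧ c.x false g < c.x false f ∧ c.x false f < c.x false h
  mate : c.mate false e = f ∧ c.mate false f = e ∧ c.mate false g = h ∧ c.mate false h = g
  mateL : cL.mate false e = g ∧ cL.mate false g = e ∧ cL.mate false f = h ∧ cL.mate false h = f
  mateT : cT.mate false e = h ∧ cT.mate false h = e ∧ cT.mate false g = f ∧ cT.mate false f = g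
  lev : c.lev false e = z + 2 * c.w * ε ∧ c.lev false f = z + 2 * c.w * ε ∧
    c.lev false g = z - 2 * c.w * ε ∧ c.lev false h = z - 2 * c.w * ε
  height : 8 * c.w < z ∧ z + 8 * c.w < 1
  far : ∀ n ∈ c.N, n ∉ ({e, g, f, h} : Set ℕ) →
    (z + 12 * c.w < c.lev false n ∧ z + 12 * c.w < c.lev false (c.mate false n)) ∨
    (c.lev false n + 12 * c.w < z ∧ c.lev false (c.mate false n) + 12 * c.w < z)
  sign : ε = 1 ∨ ε = -1

/-- A scale `ρ` that is small compared with the distances of the strands at the crossing. -/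
structure Near (c cL cT : Config) (e g f h : ℕ) (z ε ρ : ℝ) : Prop
    extends CrossingData c cL cT e g f h z ε where
  pos : 0 < ρ
  gap : 8 * ρ < c.x false g - c.x false e ∧ 8 * ρ < c.x false f - c.x false g ∧
    8 * ρ < c.x false h - c.x false f

theorem CrossingData.exists_near {c cL cT : Config} {e g f h : ℕ} {z ε : ℝ}
    (d : CrossingData c cL cT e g f h z ε) : ∃ ρ, Near c cL cT e g f h z ε ρ := by
  obtain ⟨l1, l2, l3⟩ := d.lt
  obtain ⟨m, h0, h⟩ := exists_between
    (lt_min (sub_pos.2 l1) (lt_min (sub_pos.2 l2) (sub_pos.2 l3)))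
  simp only [lt_min_iff] at h; exact ⟨m / 8, d, by linarith, by and_intros <;> linarith⟩

namespace Near

open Config

set_option linter.unusedSimpArgs false

section Paths

variable (c : Config)

set_option hygiene false in
local notation "X" => Config.x c false
set_option hygiene false in
local notation "K" => Config.knee c
set_option hygiene false in
local notation "Ap" => Config.apex c false
set_option hygiene false in
local notation "Lv" => Config.lev c false
set_option hygiene false in
local notation "C" => corner c g f

/-- A point near the crossing. -/
def corner (g f : ℕ) (a b z : ℝ) : 𝕊 :=
  (⟨(X f + X g) / 2 + a, -1 - (X f - X g) / 2 + b⟩, z)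

def left (e g f : ℕ) (ρ : ℝ) : ℕ → 𝕊 :=
  pth [K true e, K false e, Ap e, C (-ρ) (-ρ) (Lv e), C (-ρ) ρ (Lv g), K false g, K true g]

def right (g f h : ℕ) (ρ : ℝ) : ℕ → 𝕊 :=
  pth [K true h, K false h, Ap h, C ρ (-ρ) (Lv g), C ρ ρ (Lv f), K false f, K true f]

def top (g f : ℕ) (ρ : ℝ) : ℕ → 𝕊 :=
  pth [K true g, K false g, C (-ρ) ρ (Lv g), C ρ ρ (Lv f), K false f, K true f]

def bottom (e g f h : ℕ) (ρ : ℝ) : ℕ → 𝕊 :=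
  pth [K true e, K false e, Ap e, C (-ρ) (-ρ) (Lv e), C ρ (-ρ) (Lv g), Ap h, K false h, K true h]

/-- An arm of the smoothed configuration, with two further vertices. -/
def arm' (e g : ℕ) : ℕ → 𝕊 :=
  pth [K true e, K false e, Ap e, mov (Ap e) (K false g) (1 / 3),
    mov (mov (Ap e) (K false g) (1 / 3)) (K false g) (1 / 2), K false g, K true g]

def top' (g f : ℕ) : ℕ → 𝕊 :=
  pth [K true g, K false g, mov (K false g) (Ap g) (1 / 2), Ap g, K false f, K true f]

def bottom' (e h : ℕ) (θ θ' : ℝ) : ℕ → 𝕊 :=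
  pth [K true e, K false e, mov (K false e) (Ap e) θ, Ap e,
    mov (Ap e) (mov (Ap e) (K false h) θ') (1 / 2), mov (Ap e) (K false h) θ', K false h, K true h]

variable {c} {e g f h : ℕ} {W : ℝ} {p : 𝕊}

theorem pathSet_arm' : p ∈ pathSet (arm' c e g) W 6 ↔ p ∈ c.piece none e W ∨ p ∈ c.piece none g W ∨
      p ∈ c.piece (some false) e W ∨ p ∈ wall (K false g) (Ap e) W := by
  rw [wall_symm (K false g), wall_split _ (K false g) W (θ := 1 / 3) (by norm_num),
    wall_split (mov (Ap e) (K false g) (1 / 3)) (K false g) W (θ := 1 / 2) (by norm_num)]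
  simp only [pathSet, arm', mem_union, Nat.reduceAdd, pth_zero, pth_succ, piece,
    mem_empty_iff_false, false_or]
  rw [wall_symm (K true e)]; tauto

theorem pathSet_top' : p ∈ pathSet (top' c g f) W 5 ↔ p ∈ c.piece none g W ∨ p ∈ c.piece none f W ∨
      p ∈ c.piece (some false) g W ∨ p ∈ wall (K false f) (Ap g) W := by
  rw [wall_symm (K false f)]; simp only [piece]
  rw [wall_split (K false g) (Ap g) W (θ := 1 / 2) (by norm_num)]
  simp only [pathSet, top', mem_union, Nat.reduceAdd, pth_zero, pth_succ, mem_empty_iff_false,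
    false_or]
  rw [wall_symm (K true g)]; tauto

theorem pathSet_bottom' {θ θ' : ℝ} (hθ : θ ∈ 𝕀) (hθ' : θ' ∈ 𝕀) :
    p ∈ pathSet (bottom' c e h θ θ') W 7 ↔ p ∈ c.piece none e W ∨ p ∈ c.piece none h W ∨
      p ∈ c.piece (some false) e W ∨ p ∈ wall (K false h) (Ap e) W := by
  rw [wall_symm (K false h)]; simp only [piece]
  rw [wall_split (K false e) (Ap e) W hθ, wall_split (Ap e) (K false h) W hθ',
    wall_split (Ap e) (mov (Ap e) (K false h) θ') W (θ := 1 / 2) (by norm_num)]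
  simp only [pathSet, bottom', mem_union, Nat.reduceAdd, pth_zero, pth_succ, mem_empty_iff_false,
    false_or]
  rw [wall_symm (K true e)]; tauto

end Paths

variable {c cL cT : Config} {e g f h : ℕ} {z ε ρ : ℝ}

set_option hygiene false in
local notation "X" => Config.x c false
set_option hygiene false in
local notation "Data" => Near c cL cT e g f h z ε ρ

theorem knee_true_fst (d : Data) (n : ℕ) : (c.knee true n).1 = ⟨X n, 1⟩ := by
  simp [knee, sg, d.x_true]

theorem abs_lev (d : Data) {c' : Config} (hc : c'.lev = c.lev) :
    |c'.lev false e - z| ≤ 2 * c.w ∧ |c'.lev false f - z| ≤ 2 * c.w ∧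
      |c'.lev false g - z| ≤ 2 * c.w ∧ |c'.lev false h - z| ≤ 2 * c.w := by
  have hw := d.valid.w_pos; obtain ⟨h1, h2, h3, h4⟩ := d.lev; rw [hc, h1, h2, h3, h4]
  rcases d.sign with h | h <;> rw [h] <;> and_intros <;> rw [abs_le] <;> constructor <;> linarith

theorem abs_apex {c : Config} {n m : ℕ} {b : ℝ} (h : c.mate false n = m)
    (hn : |c.lev false n - z| ≤ b) (hm : |c.lev false m - z| ≤ b) :
    |(c.apex false n).2 - z| ≤ b := by
  simp only [apex, h]; rw [abs_le] at *; constructor <;> linarith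

theorem apex_eq (d : Data) : (c.apex false e).1 = ⟨(X e + X f) / 2, -1 - (X f - X e) / 2⟩ ∧
    (c.apex false h).1 = ⟨(X g + X h) / 2, -1 - (X h - X g) / 2⟩ :=
  ⟨apex_fst d.mate.1 (by linarith [d.lt]), apex_fst' d.mate.2.2.2 (by linarith [d.lt])⟩

theorem apexL_eq (d : Data) : (cL.apex false e).1 = ⟨(X e + X g) / 2, -1 - (X g - X e) / 2⟩ ∧
    (cL.apex false h).1 = ⟨(X f + X h) / 2, -1 - (X h - X f) / 2⟩ := by
  have hx := d.sameL.x_eq; rw [← hx]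
  exact ⟨apex_fst d.mateL.1 (by rw [hx]; linarith [d.lt]),
    apex_fst' d.mateL.2.2.2 (by rw [hx]; linarith [d.lt])⟩

theorem apexT_eq (d : Data) : (cT.apex false e).1 = ⟨(X e + X h) / 2, -1 - (X h - X e) / 2⟩ ∧
    (cT.apex false g).1 = ⟨(X g + X f) / 2, -1 - (X f - X g) / 2⟩ := by
  have hx := d.sameT.x_eq; rw [← hx]
  exact ⟨apex_fst d.mateT.1 (by rw [hx]; linarith [d.lt]),
    apex_fst d.mateT.2.2.1 (by rw [hx]; linarith [d.lt])⟩

theorem sidePath_arm (d : Data) {n m : ℕ} {P Q : 𝕊} (hn : n ∈ c.N) (hm : m ∈ c.N)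
    (move : PathMove 6 (pth [c.knee true n, c.knee false n, c.apex false n, P, Q, c.knee false m,
      c.knee true m]) (arm' cL n m))
    (him : (c.apex false n).1.im < -1 ∧ (cL.apex false n).1.im < -1 ∧ P.1.im < -1 ∧ Q.1.im < -1)
    (h1 : |(c.apex false n).2 - z| ≤ 2 * c.w) (h2 : |(cL.apex false n).2 - z| ≤ 2 * c.w)
    (h3 : |P.2 - z| ≤ 2 * c.w) (h4 : |Q.2 - z| ≤ 2 * c.w) (h5 : |(c.knee false n).2 - z| ≤ 2 * c.w)
    (h6 : |(c.knee false m).2 - z| ≤ 2 * c.w) : c.SidePath false z (2 * c.w) 3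
      (pth [c.knee true n, c.knee false n, c.apex false n, P, Q, c.knee false m, c.knee true m])
      (arm' cL n m) n m := by
  have k1 := d.sameL.knee_eq; have b2 := c.knee_false_fst
  have m1 := height_mov (τ := 1 / 3) (by norm_num) h2 h6
  have m2 := height_mov (τ := 1 / 2) (by norm_num) m1 h6
  refine
    { pos := by norm_num, move := move
      mem_left := hn, mem_right := hm, v0 := rfl, v1 := rfl, v2 := rfl, v3 := rfl
      v0' := ?_, v1' := ?_, v2' := ?_, v3' := ?_
      im := fun i hi hi' => ?_
      height := fun i hi hi' => ?_ }
  iterate 4 simp only [arm', pth_zero, pth_succ, k1]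
  · interval_cases i <;> simp only [arm', pth_zero, pth_succ, k1, mov_eq, b2, sg] <;> constructor <;> linarith
  · interval_cases i <;> simp only [arm', pth_zero, pth_succ, k1] <;> exact ⟨by assumption, by assumption⟩

theorem sidePath_left (d : Data) :
    c.SidePath false z (2 * c.w) 3 (left c e g f ρ) (arm' cL e g) e g := by
  have hρ := d.pos; have hg := d.gap; have k1 := d.sameL.knee_eq; obtain ⟨a1, -⟩ := d.apex_eq
  obtain ⟨a2, -⟩ := d.apexL_eq; have b1 := d.knee_true_fst; have b2 := c.knee_false_fst
  obtain ⟨c1, c2, c3, c4⟩ := d.abs_lev rfl; obtain ⟨d1, d2, d3, d4⟩ := d.abs_lev d.sameL.lev_eq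
  refine d.sidePath_arm d.mem.1 d.mem.2.1 (pathMove_fold (e := X e) (g := X g) (f := X f) (ρ := ρ)
    (by linarith) (by linarith) hρ ?_ ?_ ?_ ?_ ?_ ?_ ?_ ?_ ?_ ?_ ?_ ?_ ?_ ?_) ?_
    (abs_apex d.mate.1 c1 c2) (abs_apex d.mateL.1 d1 d3) c1 c3 c1 c3
  iterate 14
    · refine Complex.ext ?_ ?_ <;> simp only [arm', pth_zero, pth_succ, k1, b1, b2, mov_eq, corner,
        a1, a2] <;> ring
  · simp only [corner, a1, a2]; and_intros <;> linarith

theorem sidePath_right (d : Data) :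
    c.SidePath false z (2 * c.w) 3 (right c g f h ρ) (arm' cL h f) h f := by
  have hρ := d.pos; have hg := d.gap; have k1 := d.sameL.knee_eq; obtain ⟨-, a1⟩ := d.apex_eq
  obtain ⟨-, a2⟩ := d.apexL_eq; have b1 := d.knee_true_fst; have b2 := c.knee_false_fst
  obtain ⟨c1, c2, c3, c4⟩ := d.abs_lev rfl; obtain ⟨d1, d2, d3, d4⟩ := d.abs_lev d.sameL.lev_eq
  refine d.sidePath_arm d.mem.2.2.2 d.mem.2.2.1 (.of_mirror (pathMove_fold (e := -X h) (g := -X f)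
    (f := -X g) (ρ := ρ) (by linarith) (by linarith) hρ ?_ ?_ ?_ ?_ ?_ ?_ ?_ ?_ ?_ ?_ ?_ ?_ ?_ ?_)) ?_
    (abs_apex d.mate.2.2.2 c4 c3) (abs_apex d.mateL.2.2.2 d4 d2) c3 c2 c4 c2
  iterate 14
    · refine Complex.ext ?_ ?_ <;> simp only [mirror, arm', pth_zero, pth_succ, k1, b1, b2, mov_eq,
        corner, a1, a2] <;> ring
  · simp only [corner, a1, a2]; and_intros <;> linarith

theorem sidePath_top (d : Data) :
    c.SidePath false z (2 * c.w) 2 (top c g f ρ) (top' cT g f) g f := by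
  have hρ := d.pos; have hg := d.gap; have k1 := d.sameT.knee_eq; obtain ⟨-, a2⟩ := d.apexT_eq
  have b1 := d.knee_true_fst; have b2 := c.knee_false_fst; obtain ⟨c1, c2, c3, c4⟩ := d.abs_lev rfl
  obtain ⟨d1, d2, d3, d4⟩ := d.abs_lev d.sameT.lev_eq; have hap := abs_apex d.mateT.2.2.1 d3 d2
  have m1 := height_mov (P := c.knee false g) (τ := 1 / 2) (by norm_num) c3 hap
  refine
    { pos := by norm_num
      move := pathMove_of_re (by norm_num) ?_ ?_ ?_ ?_ ?_ ?_ ?_ ?_ ?_ ?_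
      mem_left := d.mem.2.1, mem_right := d.mem.2.2.1, v0 := rfl, v1 := rfl, v2 := rfl, v3 := rfl
      v0' := ?_, v1' := ?_, v2' := ?_, v3' := ?_
      im := ?_
      height := fun i hi hi' => ?_ }
  on_goal 16 => interval_cases i <;> simp only [top, top', pth_zero, pth_succ, k1] <;>
    [exact ⟨c3, c3⟩; exact ⟨c3, m1⟩; exact ⟨c2, hap⟩; exact ⟨c2, c2⟩]
  all_goals first
    | intro i hi hi'; interval_cases i <;> simp only [top, top', pth_zero, pth_succ, b1, b2, k1,
        Nat.reduceAdd, mov_eq, a2, corner, sg] <;>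
        first | linarith | constructor <;> linarith
    | simp only [top, top', pth_zero, pth_succ, b1, b2, k1, Nat.reduceAdd]; done
    | simp only [top, top', pth_zero, pth_succ, b1, b2, k1, Nat.reduceAdd, mov_eq, a2, corner]
      constructor <;> linarith

end Near




namespace Near

open Config

variable {c cL cT : Config} {e g f h : ℕ} {z ε ρ : ℝ}

set_option hygiene false in
local notation "X" => Config.x c false
set_option hygiene false in
local notation "Data" => Near c cL cT e g f h z ε ρ
set_option hygiene false in
local notation "ApT" => Config.apex cT false e

set_option linter.unusedSimpArgs false

theorem exists_param (d : Data) : ∃ θ ∈ 𝕀, ∃ θ' ∈ 𝕀,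
    (mov (c.knee false e) ApT θ).1 = ⟨(X e + X f) / 2, -1 - (X f - X e) / 2⟩ ∧
    (mov ApT (c.knee false h) θ').1 = ⟨(X g + X h) / 2, -1 - (X h - X g) / 2⟩ ∧
    (mov ApT (mov ApT (c.knee false h) θ') (1 / 2)).1 =
      ⟨(X e + X h) / 4 + (X g + X h) / 4, -1 - (X h - X e) / 4 - (X h - X g) / 4⟩ := by
  have l1 := d.lt; have b2 := c.knee_false_fst; have hp : 0 < X h - X e := by linarith
  have e1 := div_mul_cancel₀ (X f - X e) hp.ne'; have e2 := div_mul_cancel₀ (X g - X e) hp.ne'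
  refine ⟨(X f - X e) / (X h - X e), ?_, (X g - X e) / (X h - X e), ?_, ?_, ?_, ?_⟩
  iterate 2
    · rw [mem_Icc, le_div_iff₀ hp, div_le_iff₀ hp]; constructor <;> linarith
  all_goals refine Complex.ext ?_ ?_ <;> simp only [mov_eq, b2, d.apexT_eq.1]
  · linear_combination e1 / 2
  · linear_combination -e1 / 2
  · linear_combination e2 / 2
  · linear_combination e2 / 2
  · linear_combination e2 / 4
  · linear_combination e2 / 4

theorem sidePath_bottom (d : Data) {θ θ' : ℝ} (hθ : θ ∈ 𝕀) (hθ' : θ' ∈ 𝕀)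
    (t1 : (mov (c.knee false e) ApT θ).1 = ⟨(X e + X f) / 2, -1 - (X f - X e) / 2⟩)
    (t2 : (mov ApT (c.knee false h) θ').1 = ⟨(X g + X h) / 2, -1 - (X h - X g) / 2⟩)
    (t3 : (mov ApT (mov ApT (c.knee false h) θ') (1 / 2)).1 =
      ⟨(X e + X h) / 4 + (X g + X h) / 4, -1 - (X h - X e) / 4 - (X h - X g) / 4⟩) :
    c.SidePath false z (2 * c.w) 4 (bottom c e g f h ρ) (bottom' cT e h θ θ') e h := by
  have hρ := d.pos; have hg := d.gap; have k1 := d.sameT.knee_eq; obtain ⟨a1, a3⟩ := d.apex_eq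
  obtain ⟨a2, -⟩ := d.apexT_eq; have b1 := d.knee_true_fst; have b2 := c.knee_false_fst
  obtain ⟨c1, c2, c3, c4⟩ := d.abs_lev rfl; obtain ⟨d1, d2, d3, d4⟩ := d.abs_lev d.sameT.lev_eq
  have hap := abs_apex d.mateT.1 d1 d4; have m1 := height_mov (P := c.knee false e) hθ c1 hap
  have m2 := height_mov (P' := c.knee false h) hθ' hap c4
  have m3 := height_mov (τ := 1 / 2) (by norm_num) hap m2
  refine
    { pos := by norm_num
      move := pathMove_of_re (by norm_num) ?_ ?_ ?_ ?_ ?_ ?_ ?_ ?_ ?_ ?_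
      mem_left := d.mem.1, mem_right := d.mem.2.2.2, v0 := rfl, v1 := rfl, v2 := rfl, v3 := rfl
      v0' := ?_, v1' := ?_, v2' := ?_, v3' := ?_
      im := ?_
      height := fun i hi hi' => ?_ }
  on_goal 16 => interval_cases i <;> simp only [bottom, bottom', pth_zero, pth_succ, k1] <;>
    [exact ⟨c1, c1⟩; exact ⟨abs_apex d.mate.1 c1 c2, m1⟩; exact ⟨c1, hap⟩; exact ⟨c3, m3⟩;
      exact ⟨abs_apex d.mate.2.2.2 c4 c3, m2⟩; exact ⟨c4, c4⟩]
  all_goals first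
    | intro i hi hi'; interval_cases i <;> simp only [bottom, bottom', pth_zero, pth_succ, b1, k1,
        Nat.reduceAdd, t1, t2, t3, b2, a1, a2, a3, corner, sg] <;>
        first | linarith | constructor <;> linarith
    | simp only [bottom, bottom', pth_zero, pth_succ, b1, b2, k1, Nat.reduceAdd]; done
    | simp only [bottom, bottom', pth_zero, pth_succ, k1, Nat.reduceAdd, t1, t2, b1, b2, a1, a3]
      constructor <;> linarith

/-- The pieces that belong to the crossing. -/
abbrev involved (e g f h : ℕ) : Set (Option Bool × ℕ) := pieces false {e, g, f, h} {e, g, f, h}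

/-- The link with the left-right smoothing of the crossing. -/
def setL (c : Config) (e g f h : ℕ) (ρ W : ℝ) : Set 𝕊 :=
  c.rest (involved e g f h) W ∪ pathSet (left c e g f ρ) W 6 ∪ pathSet (right c g f h ρ) W 6

/-- The link with the top-bottom smoothing of the crossing. -/
def setT (c : Config) (e g f h : ℕ) (ρ W : ℝ) : Set 𝕊 :=
  c.rest (involved e g f h) W ∪ pathSet (top c g f ρ) W 5 ∪ pathSet (bottom c e g f h ρ) W 7

theorem mem_N (d : Data) : ∀ n ∈ ({e, g, f, h} : Set ℕ), n ∈ c.N := by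
  obtain ⟨m1, m2, m3, m4⟩ := d.mem; rintro n (rfl | rfl | rfl | rfl) <;> assumption

theorem piece_mate {c : Config} (hc : c.Valid) {n m : ℕ} (hn : n ∈ c.N) (h : c.mate false n = m) :
    c.piece (some false) m = wall (c.knee false m) (c.apex false n) := by
  funext W; simp only [piece, ← h, hc.apex_mate hn false]

theorem isotopyL (d : Data) : ∃ φ, IsotopicToId φ ∧ ∀ r ∈ 𝕀,
    φ '' setL c e g f h ρ (r * c.w) = cL.body (r * c.w) := by
  have hρ := d.pos; have hg := d.gap; have hw := d.valid.w_pos; have k1 := d.sameL.knee_eq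
  obtain ⟨a1, a3⟩ := d.apex_eq; obtain ⟨a2, a4⟩ := d.apexL_eq; have b2 := c.knee_false_fst
  obtain ⟨φ, hφ, hφ'⟩ := d.valid.exists_two_path_isotopy (T := {e, g, f, h})
    ⟨by linarith [d.height.1], by linarith [d.height.2]⟩ d.sidePath_left d.sidePath_right
    (fun n hn hnT => (d.far n hn hnT).imp (fun h => ⟨by linarith, by linarith⟩)
      (fun h => ⟨by linarith, by linarith⟩)) (by
      have v : ∀ i, 1 ≤ i → i ≤ 5 → (lin 1 0 (left c e g f ρ i) ≤ (X f + X g) / 2 ∧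
          lin 1 0 (arm' cL e g i) ≤ (X f + X g) / 2) ∧
          (X f + X g) / 2 < lin 1 0 (right c g f h ρ i) ∧
          (X f + X g) / 2 < lin 1 0 (arm' cL h f i) := by
        intro i hi hi'
        interval_cases i <;> simp only [left, right, arm', pth_zero, pth_succ, lin, mov_eq, corner,
          a1, a2, a3, a4, k1, b2] <;> and_intros <;> linarith
      intro i i1 i2 j j1 j2; have q1 := (v i i1 (by omega)).1
      have q2 := (v (i + 1) (by omega) (by omega)).1; have q3 := (v j j1 (by omega)).2
      have q4 := (v (j + 1) (by omega) (by omega)).2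
      exact ⟨1, 0, _, ⟨q1.1, q1.2, q2⟩, q3.1, q3.2, q4⟩)
  refine ⟨φ, hφ, fun r hr => ?_⟩
  have hset : ({e, g, h, f} : Set ℕ) = {e, g, f, h} := by rw [pair_comm h f]
  have hTm : ∀ n ∈ ({e, g, f, h} : Set ℕ), n ∈ cL.N := d.sameL.N_eq ▸ d.mem_N; have := hφ' r hr
  rw [hset] at this; refine this.trans ?_; rw [body_eq_rest hTm, d.sameL.rest_eq]; ext p
  simp only [mem_union, Nat.reduceAdd, pathSet_arm', mem_ofPred_eq, mem_insert_iff,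
    mem_singleton_iff, exists_eq_or_imp, exists_eq_left,
    piece_mate d.validL (hTm e (by simp)) d.mateL.1,
    piece_mate d.validL (hTm h (by simp)) d.mateL.2.2.2]
  tauto

theorem isotopyT (d : Data) : ∃ φ, IsotopicToId φ ∧ ∀ r ∈ 𝕀,
    φ '' setT c e g f h ρ (r * c.w) = cT.body (r * c.w) := by
  have hρ := d.pos; have hg := d.gap; have hw := d.valid.w_pos; have k1 := d.sameT.knee_eq
  obtain ⟨a1, a3⟩ := d.apex_eq; obtain ⟨a2, a4⟩ := d.apexT_eq; have b2 := c.knee_false_fst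
  obtain ⟨θ, hθ, θ', hθ', t1, t2, t3⟩ := d.exists_param
  obtain ⟨φ, hφ, hφ'⟩ := d.valid.exists_two_path_isotopy (T := {e, g, f, h})
    ⟨by linarith [d.height.1], by linarith [d.height.2]⟩
    d.sidePath_top (d.sidePath_bottom hθ hθ' t1 t2 t3)
    (fun n hn hnT => (d.far n hn hnT).imp (fun h => ⟨by linarith, by linarith⟩)
      (fun h => ⟨by linarith, by linarith⟩)) (by
      have v : ∀ a b d, (a = -1 ∧ b = -1 ∧ d = 1 - X g) ∨ (a = 1 ∧ b = -1 ∧ d = 1 + X f) ∨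
          (a = 0 ∧ b = -1 ∧ d = 1 + (X f - X g) / 2) → ∀ i, 1 ≤ i → i ≤ 4 →
          lin a b (top c g f ρ i) ≤ d ∧ lin a b (top' cT g f i) ≤ d := by
        rintro a b d (⟨rfl, rfl, rfl⟩ | ⟨rfl, rfl, rfl⟩ | ⟨rfl, rfl, rfl⟩) i hi hi' <;>
        interval_cases i <;> simp only [top, top', pth_zero, pth_succ,
          lin, mov_eq, corner, a4, k1, b2] <;> and_intros <;> linarith
      have u : ∀ j, 1 ≤ j → j ≤ 5 → ∃ a b d, ((a = -1 ∧ b = -1 ∧ d = 1 - X g) ∨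
          (a = 1 ∧ b = -1 ∧ d = 1 + X f) ∨ (a = 0 ∧ b = -1 ∧ d = 1 + (X f - X g) / 2)) ∧
          (d < lin a b (bottom c e g f h ρ j) ∧ d < lin a b (bottom' cT e h θ θ' j) ∧
            d < lin a b (bottom c e g f h ρ (j + 1)) ∧
            d < lin a b (bottom' cT e h θ θ' (j + 1))) := by
        intro j hj hj'
        interval_cases j <;> [refine ⟨-1, -1, _, .inl ⟨rfl, rfl, rfl⟩, ?_⟩;
          refine ⟨-1, -1, _, .inl ⟨rfl, rfl, rfl⟩, ?_⟩;
          refine ⟨0, -1, _, .inr (.inr ⟨rfl, rfl, rfl⟩), ?_⟩;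
          refine ⟨1, -1, _, .inr (.inl ⟨rfl, rfl, rfl⟩), ?_⟩;
          refine ⟨1, -1, _, .inr (.inl ⟨rfl, rfl, rfl⟩), ?_⟩] <;>
        simp only [bottom, bottom', pth_zero, pth_succ, lin, corner, a1, a2, a3, k1, b2, t1, t2,
          t3] <;> and_intros <;> linarith
      intro i i1 i2 j j1 j2; obtain ⟨a, b, dd, hab, q3⟩ := u j j1 (by omega)
      have q1 := v _ _ _ hab i i1 (by omega)
      exact ⟨a, b, dd, ⟨q1.1, q1.2, v _ _ _ hab (i + 1) (by omega) (by omega)⟩, q3⟩)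
  refine ⟨φ, hφ, fun r hr => ?_⟩
  have hset : ({g, f, e, h} : Set ℕ) = {e, g, f, h} := by
    ext n; simp only [mem_insert_iff, mem_singleton_iff]; tauto
  have hTm : ∀ n ∈ ({e, g, f, h} : Set ℕ), n ∈ cT.N := d.sameT.N_eq ▸ d.mem_N; have := hφ' r hr
  rw [hset] at this; refine this.trans ?_; rw [body_eq_rest hTm, d.sameT.rest_eq]; ext p
  simp only [mem_union, Nat.reduceAdd, pathSet_top', pathSet_bottom' hθ hθ', mem_ofPred_eq,
    mem_insert_iff, mem_singleton_iff, exists_eq_or_imp, exists_eq_left,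
    piece_mate d.validT (hTm g (by simp)) d.mateT.2.2.1,
    piece_mate d.validT (hTm e (by simp)) d.mateT.1]
  tauto

end Near




/-- The walls of a smoothing, in coordinates. -/
theorem mem_wall_diag {M N H ε r σ σ' : ℝ} (hs : σ = 1 ∨ σ = -1) (hs' : σ' = 1 ∨ σ' = -1) :
    (∃ t ∈ 𝕀, M = (1 - t) * 0 + t * σ' ∧ N = (1 - t) * σ + t * 0 ∧
      |H - ((1 - t) * (ε / 2) + t * (-ε / 2))| ≤ r) ↔
    0 ≤ σ' * M ∧ 0 ≤ σ * N ∧ |M| + |N| = 1 ∧ |H - ε * (|N| - |M|) / 2| ≤ r := by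
  have hm : ∀ {τ x : ℝ}, (τ = 1 ∨ τ = -1) → 0 ≤ τ * x → |x| = τ * x := by
    rintro τ x (rfl | rfl) h
    · rw [one_mul] at h ⊢; exact abs_of_nonneg h
    · rw [abs_of_nonpos (by linarith)]; ring
  have sq : ∀ {τ : ℝ}, (τ = 1 ∨ τ = -1) → τ * τ = 1 := by rintro τ (rfl | rfl) <;> norm_num
  constructor
  · rintro ⟨t, ⟨t0, t1⟩, h1, h2, h3⟩
    have e1 : σ' * M = t := by rw [h1]; linear_combination t * sq hs'
    have e2 : σ * N = 1 - t := by rw [h2]; linear_combination (1 - t) * sq hs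
    have i1 : 0 ≤ σ' * M := by rw [e1]; exact t0
    have i2 : 0 ≤ σ * N := by rw [e2]; linarith
    refine ⟨i1, i2, ?_, ?_⟩ <;> rw [hm hs' i1, hm hs i2, e1, e2]
    · ring
    · convert h3 using 2; ring
  · rintro ⟨i1, i2, h1, h2⟩; rw [hm hs' i1, hm hs i2] at h1 h2
    have : 1 - σ' * M = σ * N := by linarith
    refine ⟨σ' * M, ⟨i1, by linarith⟩, ?_, ?_, ?_⟩
    · linear_combination -M * sq hs'
    · rw [this]; linear_combination -N * sq hs
    · rw [this]; convert h2 using 2; ring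

theorem axis_split {P Q : Prop} {A B N : ℝ} (hA : 4 < A) (hB : 4 < B) :
    (P ∧ -B ≤ N ∧ N ≤ A ∧ Q) ↔
      ((P ∧ 1 ≤ N ∧ N ≤ A ∧ Q) ∨ (P ∧ -B ≤ N ∧ N ≤ -1 ∧ Q)) ∨ (P ∧ |N| ≤ 1 ∧ Q) := by
  rw [abs_le]; constructor
  · rintro ⟨j1, j2, j3, j4⟩; rcases le_total 1 N with j | j
    · exact .inl (.inl ⟨j1, j, j3, j4⟩)
    rcases le_total N (-1) with j' | j'
    · exact .inl (.inr ⟨j1, j2, j', j4⟩)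
    · exact .inr ⟨j1, ⟨j', j⟩, j4⟩
  · rintro ((⟨j1, j2, j3, j4⟩ | ⟨j1, j2, j3, j4⟩) | ⟨j1, ⟨j2, j3⟩, j4⟩) <;>
      exact ⟨j1, by linarith, by linarith, j4⟩

namespace Near

open Config

variable {c cL cT : Config} {e g f h : ℕ} {z ε ρ W : ℝ} {p : 𝕊}

set_option hygiene false in
local notation "X" => Config.x c false
set_option hygiene false in
local notation "K" => Config.knee c
set_option hygiene false in
local notation "Ap" => Config.apex c false
set_option hygiene false in
local notation "Data" => Near c cL cT e g f h z ε ρ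
set_option hygiene false in
local notation "Co" => co (Config.x c false g) (Config.x c false f) z (Config.w c) ρ
set_option hygiene false in
local notation "Cb" => corner c g f (-ρ) (-ρ) (Config.lev c false e)
set_option hygiene false in
local notation "Ct" => corner c g f ρ ρ (Config.lev c false f)
set_option hygiene false in
local notation "Cr" => corner c g f ρ (-ρ) (Config.lev c false g)
set_option hygiene false in
local notation "Cl" => corner c g f (-ρ) ρ (Config.lev c false g)

/-- The part of the link that is far from the crossing. -/
def Distant (c : Config) (e g f h : ℕ) (W : ℝ) (p : 𝕊) : Prop :=
  p ∈ c.rest (involved e g f h) W ∨ p ∈ c.piece none e W ∨ p ∈ c.piece none g W ∨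
    p ∈ c.piece none f W ∨ p ∈ c.piece none h W

/-- The part of the link that is not changed by smoothing the crossing. -/
def Common (c : Config) (e g f h : ℕ) (ρ W : ℝ) (p : 𝕊) : Prop :=
  Distant c e g f h W p ∨ (p ∈ wall (K false e) (Ap e) W ∨ p ∈ wall (K false h) (Ap h) W) ∨
  (p ∈ wall Cb (Ap e) W ∨ p ∈ wall (K false f) Ct W) ∨
  (p ∈ wall Cr (Ap h) W ∨ p ∈ wall (K false g) Cl W)

theorem mem_setL : p ∈ setL c e g f h ρ W ↔
    Common c e g f h ρ W p ∨ p ∈ wall Cb Cl W ∨ p ∈ wall Ct Cr W := by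
  simp only [setL, pathSet, left, right, mem_union, Nat.reduceAdd, pth_zero, pth_succ,
    mem_empty_iff_false, false_or, Common, Distant, piece]
  rw [wall_symm (K true e), wall_symm (K true h), wall_symm (Ap e), wall_symm (Ap h),
    wall_symm Cr Ct, wall_symm Ct (K false f), wall_symm Cl (K false g)]
  tauto

theorem mem_setT : p ∈ setT c e g f h ρ W ↔
    Common c e g f h ρ W p ∨ p ∈ wall Cb Cr W ∨ p ∈ wall Ct Cl W := by
  simp only [setT, pathSet, top, bottom, mem_union, Nat.reduceAdd, pth_zero, pth_succ,
    mem_empty_iff_false, false_or, Common, Distant, piece]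
  rw [wall_symm (K true e), wall_symm (K true g), wall_symm (Ap e), wall_symm (Ap h),
    wall_symm Cl Ct, wall_symm Ct (K false f)]
  tauto

/-- The coordinates of the vertices. -/
theorem co_values (d : Data) : ∃ A B C : ℝ, (4 < A ∧ 4 < B ∧ 4 < C) ∧
    ((∃ x y, Co (K false e) = (x, A, y)) ∧ Co (Ap e) = (0, A, ε / 2)) ∧
    ((∃ x y, Co (K false h) = (C, x, y)) ∧ Co (Ap h) = (C, 0, -ε / 2)) ∧
    Co (K false f) = (0, -B, ε / 2) ∧ Co (K false g) = (-B, 0, -ε / 2) ∧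
    Co Cb = (0, 1, ε / 2) ∧ Co Ct = (0, -1, ε / 2) ∧ Co Cr = (1, 0, -ε / 2) ∧
    Co Cl = (-1, 0, -ε / 2) := by
  have hρ := d.pos; have hw := d.valid.w_pos; have hg := d.gap; obtain ⟨a1, a3⟩ := d.apex_eq
  have b2 := c.knee_false_fst; obtain ⟨v1, v2, v3, v4⟩ := d.lev
  have s1 : (Ap e).2 = z + 2 * c.w * ε := by
    simp only [apex, d.mate.1, v1, v2]; ring
  have s2 : (Ap h).2 = z - 2 * c.w * ε := by
    simp only [apex, d.mate.2.2.2, v3, v4]; ring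
  have s3 : (K false f).2 = z + 2 * c.w * ε := v2; have s4 : (K false g).2 = z - 2 * c.w * ε := v3
  refine ⟨(X g - X e) / (2 * ρ), (X f - X g) / (2 * ρ), (X h - X f) / (2 * ρ), ⟨?_, ?_, ?_⟩,
    ⟨⟨_, _, Prod.ext rfl (Prod.ext ?_ rfl)⟩, ?_⟩, ⟨⟨_, _, Prod.ext ?_ rfl⟩, ?_⟩, ?_⟩
  iterate 3
    · rw [lt_div_iff₀ (by positivity)]; linarith
  all_goals
    simp only [co, corner, a1, a3, b2, s1, s2, s3, s4, v1, v2, v3, Prod.mk.injEq]; and_intros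
  all_goals field_simp; ring

/-- The coordinates near the crossing. -/
theorem of_co_le (d : Data) {M N H : ℝ} (hp : Co p = (M, N, H)) (q1 : |M| ≤ 2) (q2 : |N| ≤ 2)
    (q3 : |H| ≤ 2) : p.1.im < -1 ∧ |p.2 - z| ≤ 8 * c.w := by
  have hρ := d.pos; have hw := d.valid.w_pos; simp only [co, Prod.mk.injEq] at hp
  obtain ⟨rfl, rfl, rfl⟩ := hp; constructor
  · rw [abs_le, le_div_iff₀ (by positivity), div_le_iff₀ (by positivity)] at q1 q2; linarith [d.gap]
  · rw [abs_div, abs_of_pos (by positivity : 0 < 4 * c.w), div_le_iff₀ (by positivity)] at q3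
    linarith

/-- The other pieces are far away from the crossing. -/
theorem far_away (d : Data) (hW : 0 ≤ W) (hW' : W ≤ c.w) (hp : Distant c e g f h W p)
    (him : p.1.im < -1) (hh : |p.2 - z| ≤ 8 * c.w) : False := by
  have hw := d.valid.w_pos; rw [abs_le] at hh
  have ramp : ∀ n, p ∉ c.piece none n W := by
    intro n hp; linarith [(abs_le.1 (abs_im_of_mem_ramp hW hp)).1]
  rcases hp with hp | hp | hp | hp | hp
  · obtain ⟨k, n, hn, hS, hp⟩ := mem_rest.1 hp; rcases k with _ | _ | _
    · exact ramp n hp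
    · have hT : n ∉ ({e, g, f, h} : Set ℕ) := fun hT => hS (.inr ⟨rfl, hT⟩)
      rcases d.far n hn hT with ⟨i1, i2⟩ | ⟨i1, i2⟩
      · linarith [lt_height_arm (a := z + 8 * c.w) hW (by linarith) (by linarith) hp]
      · linarith [height_arm_lt (a := z - 8 * c.w) hW (by linarith) (by linarith) hp]
    · have := im_of_mem_arm hW hp; simp only [sg, if_true] at this; linarith
  all_goals exact ramp _ hp

theorem prop_aux {a b c d e f g h i j : Prop} :
    (a ∨ b) ∨ (c ∨ ((d ∨ e) ∨ f) ∨ ((g ∨ h) ∨ i) ∨ j) ↔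
      ((a ∨ b) ∨ (c ∨ j) ∨ (g ∨ h) ∨ (d ∨ e)) ∨ i ∨ f := by
  tauto

theorem triple (d : Data) {r : ℝ} (hr : 0 ≤ r) (hr' : r ≤ 1 / 4) {M N H : ℝ}
    (hp : Co p = (M, N, H)) : ∃ Q : Prop,
    (Q → |M| ≤ 2 → |N| ≤ 2 → |H| ≤ 2 → (M = 0 ∧ 1 ≤ |N| ∧ |H - ε / 2| ≤ r) ∨
      (N = 0 ∧ 1 ≤ |M| ∧ |H - -ε / 2| ≤ r)) ∧
    ((|M| ≤ 2 ∧ |N| ≤ 2 ∧ ((M = 0 ∧ 1 ≤ |N| ∧ |H - ε / 2| ≤ r) ∨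
      (N = 0 ∧ 1 ≤ |M| ∧ |H - -ε / 2| ≤ r))) → Q) ∧
    (p ∈ c.body (r * (4 * c.w)) ↔ Q ∨ (M = 0 ∧ |N| ≤ 1 ∧ |H - ε / 2| ≤ r) ∨
      (N = 0 ∧ |M| ≤ 1 ∧ |H - -ε / 2| ≤ r)) ∧
    (p ∈ setL c e g f h ρ (r * (4 * c.w)) ↔
      Q ∨ (|M| + |N| = 1 ∧ M * N ≤ 0 ∧ |H - ε * (|N| - |M|) / 2| ≤ r)) ∧
    (p ∈ setT c e g f h ρ (r * (4 * c.w)) ↔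
      Q ∨ (|M| + |N| = 1 ∧ 0 ≤ M * N ∧ |H - ε * (|N| - |M|) / 2| ≤ r)) := by
  have hw := d.valid.w_pos
  obtain ⟨A, B, C, ⟨hA, hB, hC⟩, ⟨⟨x, y, e1⟩, e2⟩, ⟨⟨x', y', h1⟩, h2⟩, hf, hg, pb, pt, pr, pl⟩ :=
    d.co_values
  have wc : ∀ {P Q m n y m' n' y'}, Co P = (m, n, y) → Co Q = (m', n', y') →
      (p ∈ wall P Q (r * (4 * c.w)) ↔ _) := fun hP hQ => mem_wall_co d.pos hw hr hp hP hQ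
  have ax : ∀ {P Q m n y y'}, Co P = (y, m, y') → Co Q = (y, n, y') → m < n →
      (p ∈ wall P Q (r * (4 * c.w)) ↔ _) := fun hP hQ h => (wc hP hQ).trans (mem_wall_axis h)
  have ax' : ∀ {P Q m n y y'}, Co P = (m, y, y') → Co Q = (n, y, y') → m < n →
      (p ∈ wall P Q (r * (4 * c.w)) ↔ _) := fun hP hQ h => (wc hP hQ).trans
        ((exists_congr fun t => and_congr_right fun _ => and_left_comm).trans (mem_wall_axis h))
  have w1 := ax pb e2 (by linarith); have w2 := ax hf pt (by linarith)
  have w3 := ax' pr h2 (by linarith); have w4 := ax' hg pl (by linarith)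
  refine ⟨Common c e g f h ρ (r * (4 * c.w)) p, ?_, ?_, ?_, ?_, ?_⟩
  · intro hQ i1 i2 i3; rcases hQ with hQ | (hQ | hQ) | (hQ | hQ) | (hQ | hQ)
    · obtain ⟨j1, j2⟩ := d.of_co_le hp i1 i2 i3
      exact (d.far_away (by positivity) (by nlinarith) hQ j1 j2).elim
    · obtain ⟨t, -, -, i, -⟩ := (wc e1 e2).1 hQ; linarith [le_abs_self N]
    · obtain ⟨t, -, i, -⟩ := (wc h1 h2).1 hQ; linarith [le_abs_self M]
    · obtain ⟨j1, j2, j3, j4⟩ := w1.1 hQ; exact .inl ⟨j1, j2.trans (le_abs_self N), j4⟩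
    · obtain ⟨j1, j2, j3, j4⟩ := w2.1 hQ; exact .inl ⟨j1, by linarith [neg_abs_le N], j4⟩
    · obtain ⟨j1, j2, j3, j4⟩ := w3.1 hQ; exact .inr ⟨j1, j2.trans (le_abs_self M), j4⟩
    · obtain ⟨j1, j2, j3, j4⟩ := w4.1 hQ; exact .inr ⟨j1, by linarith [neg_abs_le M], j4⟩
  · rintro ⟨i1, i2, ⟨j1, j2, j3⟩ | ⟨j1, j2, j3⟩⟩ <;> rw [abs_le] at i1 i2 <;> right <;> right
    · left; rw [w1, w2]
      exact (le_abs.1 j2).imp (⟨j1, ·, by linarith, j3⟩)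
        fun j2 => ⟨j1, by linarith, by linarith, j3⟩
    · right; rw [w3, w4]
      exact (le_abs.1 j2).imp (⟨j1, ·, by linarith, j3⟩)
        fun j2 => ⟨j1, by linarith, by linarith, j3⟩
  · have s1 := (ax hf e2 (by linarith)).trans (axis_split hA hB)
    have s2 := (ax' hg h2 (by linarith)).trans (axis_split hC hB); rw [← w1, ← w2] at s1
    rw [← w3, ← w4] at s2; rw [body_eq_rest d.mem_N]
    simp only [mem_union, mem_ofPred_eq, mem_insert_iff, mem_singleton_iff, exists_eq_or_imp,
      exists_eq_left, piece_mate d.valid d.mem.1 d.mate.1,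
      piece_mate d.valid d.mem.2.2.2 d.mate.2.2.2, s1, s2, Common, Distant]
    rw [show c.piece (some false) e = wall (K false e) (Ap e) from rfl,
      show c.piece (some false) h = wall (K false h) (Ap h) from rfl]
    exact prop_aux
  · rw [mem_setL, wc pb pl, wc pt pr, mem_wall_diag (.inl rfl) (.inr rfl),
      mem_wall_diag (.inr rfl) (.inl rfl), mul_nonpos_iff, one_mul, one_mul, neg_one_mul,
      neg_one_mul, neg_nonneg, neg_nonneg]
    clear * -; tauto
  · rw [mem_setT, wc pb pr, wc pt pl, mem_wall_diag (.inl rfl) (.inl rfl),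
      mem_wall_diag (.inr rfl) (.inr rfl), mul_nonneg_iff (a := M), one_mul, one_mul, neg_one_mul,
      neg_one_mul, neg_nonneg, neg_nonneg]
    clear * -; tauto

end Near




theorem exists_link_of_isotopy {A : ℝ → Set 𝕊} {c' : Config} (hc' : c'.Valid)
    {φ : 𝕊 ≃ₜ 𝕊} (hφ : IsotopicToId φ)
    (h : ∀ r ∈ 𝕀, φ '' A (r * c'.w) = c'.body (r * c'.w)) :
    ∃ L : FramedLink, L.core = A 0 ∧ L.band = A c'.w ∧ Isotopic L (c'.link hc') := by
  have h0 := h 0 (by simp); have h1 := h 1 (by simp); rw [zero_mul] at h0; rw [one_mul] at h1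
  have inv : ∀ {X Y : Set 𝕊}, φ '' X = Y → φ.symm '' Y = X := by
    rintro X _ rfl; rw [← image_comp]; simp
  have := (c'.link hc').isFramedLink.image hφ.symm
  change IsFramedLink (φ.symm '' c'.body 0) (φ.symm '' c'.body c'.w) at this
  rw [inv h0, inv h1] at this; exact ⟨⟨_, _, this⟩, rfl, rfl, φ, hφ, h0, h1⟩

theorem crossing_rel (R : Type*) [CommRing R] (s : Rˣ) {L LA LB : FramedLink}
    (h : IsKauffmanTriple L LA LB) : L.toSkein R s =
      (s : R) • LA.toSkein R s + ((s⁻¹ : Rˣ) : R) • LB.toSkein R s := by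
  have := RingQuot.mkAlgHom_rel R (SkeinRel.crossing (R := R) (s := s) L LA LB h)
  rw [map_add, map_smul, map_smul] at this; exact this

/-- Three links which are recognized pointwise. -/
theorem isKauffmanTriple_of_mem {L L₁ L₂ : FramedLink} {a v : ℂ} {z w : ℝ} (hv : v ≠ 0) (hw : 0 < w)
    {G : 𝕊 → 𝕊} (hG : ∀ p, ((p.1 - a) / v, (p.2 - z) / w) = G p)
    (hT : ∀ p, G p ∈ cube 2 → p ∈ thickened) {S S₁ S₂ : ℝ → Set 𝕊}
    (hS : L.core = S 0 ∧ L.band = S (1 / 4)) (hS₁ : L₁.core = S₁ 0 ∧ L₁.band = S₁ (1 / 4))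
    (hS₂ : L₂.core = S₂ 0 ∧ L₂.band = S₂ (1 / 4))
    (h : ∀ r, 0 ≤ r → r ≤ 1 / 4 → ∀ p, ((p ∈ S r ∧ G p ∈ cube 2) ↔ G p ∈ crossing r) ∧
      ((p ∈ S₁ r ∧ G p ∈ cube 1) ↔ G p ∈ smoothingA r) ∧
      ((p ∈ S₂ r ∧ G p ∈ cube 1) ↔ G p ∈ smoothingB r) ∧
      (G p ∉ cube 1 → (p ∈ S r ↔ p ∈ S₁ r) ∧ (p ∈ S r ↔ p ∈ S₂ r))) : IsKauffmanTriple L L₁ L₂ := by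
  have hm : ∀ {T p}, p ∈ chart a v z w '' T ↔ G p ∈ T := by
    intro T p; rw [mem_chart hv hw, hG]
  have h0 := h 0 le_rfl (by norm_num); have h1 := h (1 / 4) (by norm_num) le_rfl
  refine ⟨a, v, z, w, hv, hw, fun p hp => hT p (hm.1 hp), ?_⟩
  simp only [LooksLike, AgreeOutside, hS, hS₁, hS₂, Set.ext_iff, mem_inter_iff, mem_sdiff, hm,
    and_congr_left_iff]
  exact ⟨⟨fun p => (h0 p).1, fun p => (h1 p).1⟩,
    ⟨fun p hp => ((h0 p).2.2.2 hp).1, fun p hp => ((h1 p).2.2.2 hp).1⟩,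
    ⟨fun p => (h0 p).2.1, fun p => (h1 p).2.1⟩,
    ⟨fun p hp => ((h0 p).2.2.2 hp).2, fun p hp => ((h1 p).2.2.2 hp).2⟩,
    ⟨fun p => (h0 p).2.2.1, fun p => (h1 p).2.2.1⟩⟩

namespace Near

open Config

variable {c cL cT : Config} {e g f h : ℕ} {z ε ρ W : ℝ} {p : 𝕊}

set_option hygiene false in
local notation "Data" => Near c cL cT e g f h z ε ρ
set_option hygiene false in
local notation "Co" => co (Config.x c false g) (Config.x c false f) z (Config.w c) ρ

/-- The three links near the crossing and away from it. -/
theorem pictures (d : Data) {r : ℝ} (hr : 0 ≤ r) (hr' : r ≤ 1 / 4) {M N H : ℝ}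
    (hp : Co p = (M, N, H)) :
    ((p ∈ c.body (r * (4 * c.w)) ∧ |M| ≤ 2 ∧ |N| ≤ 2 ∧ |H| ≤ 2) ↔
      (|M| ≤ 2 ∧ |N| ≤ 2 ∧ |H| ≤ 2) ∧ ((M = 0 ∧ |H - ε / 2| ≤ r) ∨ (N = 0 ∧ |H - -ε / 2| ≤ r))) ∧
    ((p ∈ setL c e g f h ρ (r * (4 * c.w)) ∧ |M| ≤ 1 ∧ |N| ≤ 1 ∧ |H| ≤ 1) ↔
      (|M| + |N| = 1 ∧ M * N ≤ 0 ∧ |H - ε * (|N| - |M|) / 2| ≤ r)) ∧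
    ((p ∈ setT c e g f h ρ (r * (4 * c.w)) ∧ |M| ≤ 1 ∧ |N| ≤ 1 ∧ |H| ≤ 1) ↔
      (|M| + |N| = 1 ∧ 0 ≤ M * N ∧ |H - ε * (|N| - |M|) / 2| ≤ r)) ∧
    (¬ (|M| ≤ 1 ∧ |N| ≤ 1 ∧ |H| ≤ 1) →
      ((p ∈ c.body (r * (4 * c.w)) ↔ p ∈ setL c e g f h ρ (r * (4 * c.w))) ∧
      (p ∈ c.body (r * (4 * c.w)) ↔ p ∈ setT c e g f h ρ (r * (4 * c.w))))) := by
  obtain ⟨Q, q1, q2, q3, q4, q5⟩ := d.triple hr hr' hp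
  have hε' : -1 ≤ ε ∧ ε ≤ 1 := by rcases d.sign with h | h <;> rw [h] <;> norm_num
  have hX : (M = 0 ∧ |N| ≤ 1 ∧ |H - ε / 2| ≤ r) ∨ (N = 0 ∧ |M| ≤ 1 ∧ |H - -ε / 2| ≤ r) →
      |M| ≤ 1 ∧ |N| ≤ 1 ∧ |H| ≤ 1 := by
    rintro (⟨rfl, i2, i3⟩ | ⟨rfl, i2, i3⟩) <;> rw [abs_le] at i3
    · exact ⟨by simp, i2, abs_le.2 ⟨by linarith, by linarith⟩⟩
    · exact ⟨i2, by simp, abs_le.2 ⟨by linarith, by linarith⟩⟩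
  have hD : |M| + |N| = 1 → |H - ε * (|N| - |M|) / 2| ≤ r → |M| ≤ 1 ∧ |N| ≤ 1 ∧ |H| ≤ 1 := by
    intro i1 i2; have a1 := abs_nonneg M; have a2 := abs_nonneg N
    refine ⟨by linarith, by linarith, ?_⟩; rw [abs_le] at i2 ⊢; constructor <;> nlinarith
  have hQ : Q → |M| ≤ 1 ∧ |N| ≤ 1 ∧ |H| ≤ 1 →
      |M| + |N| = 1 ∧ M * N = 0 ∧ |H - ε * (|N| - |M|) / 2| ≤ r := by
    rintro hQ ⟨i1, i2, i3⟩
    rcases q1 hQ (by linarith) (by linarith) (by linarith) with ⟨j1, j2, j3⟩ | ⟨j1, j2, j3⟩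
    · rw [le_antisymm i2 j2, j1]; exact ⟨by simp, by simp, by convert j3 using 2; simp⟩
    · rw [le_antisymm i1 j2, j1]; exact ⟨by simp, by simp, by convert j3 using 2; simp⟩
  refine ⟨?_, ?_, ?_, fun hn => ?_⟩
  · rw [q3]; constructor
    · rintro ⟨hq, i⟩; refine ⟨i, ?_⟩; rcases hq with hq | hq
      · exact (q1 hq i.1 i.2.1 i.2.2).imp (fun j => ⟨j.1, j.2.2⟩) fun j => ⟨j.1, j.2.2⟩
      · exact hq.imp (fun j => ⟨j.1, j.2.2⟩) fun j => ⟨j.1, j.2.2⟩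
    · rintro ⟨i, ⟨j1, j3⟩ | ⟨j1, j3⟩⟩ <;> refine ⟨?_, i⟩
      · rcases le_total |N| 1 with hn | hn
        · exact .inr (.inl ⟨j1, hn, j3⟩)
        · exact .inl (q2 ⟨i.1, i.2.1, .inl ⟨j1, hn, j3⟩⟩)
      · rcases le_total |M| 1 with hn | hn
        · exact .inr (.inr ⟨j1, hn, j3⟩)
        · exact .inl (q2 ⟨i.1, i.2.1, .inr ⟨j1, hn, j3⟩⟩)
  · rw [q4]
    exact ⟨fun ⟨hq, i⟩ => hq.elim (fun hq => (hQ hq i).imp_right (And.imp_left le_of_eq)) id,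
      fun hq => ⟨.inr hq, hD hq.1 hq.2.2⟩⟩
  · rw [q5]
    exact ⟨fun ⟨hq, i⟩ => hq.elim (fun hq => (hQ hq i).imp_right (And.imp_left ge_of_eq)) id,
      fun hq => ⟨.inr hq, hD hq.1 hq.2.2⟩⟩
  · rw [q3, q4, q5]
    exact ⟨or_congr_right ⟨fun i => (hn (hX i)).elim, fun i => (hn (hD i.1 i.2.2)).elim⟩,
      or_congr_right ⟨fun i => (hn (hX i)).elim, fun i => (hn (hD i.1 i.2.2)).elim⟩⟩

theorem cube_subset (d : Data) (q : |(Co p).1| ≤ 2 ∧ |(Co p).2.1| ≤ 2 ∧ |(Co p).2.2| ≤ 2) :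
    p ∈ thickened := by
  obtain ⟨h1, h2⟩ := d.of_co_le rfl q.1 q.2.1 q.2.2; rw [abs_le] at h2; have := d.height
  exact mem_thickened_of_im (by linarith) (by linarith) (by linarith)

theorem exists_links (d : Data) : ∃ LL LT : FramedLink,
    Isotopic LL (cL.link d.validL) ∧ Isotopic LT (cT.link d.validT) ∧
    (LL.core = setL c e g f h ρ (0 * (4 * c.w)) ∧ LL.band = setL c e g f h ρ (1 / 4 * (4 * c.w))) ∧
    (LT.core = setT c e g f h ρ (0 * (4 * c.w)) ∧
      LT.band = setT c e g f h ρ (1 / 4 * (4 * c.w))) := by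
  obtain ⟨φ, hφ, hφ'⟩ := d.isotopyL; obtain ⟨ψ, hψ, hψ'⟩ := d.isotopyT; rw [← d.sameL.w_eq] at hφ'
  rw [← d.sameT.w_eq] at hψ'; obtain ⟨LL, a1, a2, a3⟩ := exists_link_of_isotopy d.validL hφ hφ'
  obtain ⟨LT, b1, b2, b3⟩ := exists_link_of_isotopy d.validT hψ hψ'
  have e : 1 / 4 * (4 * c.w) = c.w := by ring
  rw [zero_mul, e]; exact ⟨LL, LT, a3, b3, ⟨a1, d.sameL.w_eq ▸ a2⟩, b1, d.sameT.w_eq ▸ b2⟩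

end Near

namespace CrossingData

open Config

variable {c cL cT : Config} {e g f h : ℕ} {z : ℝ}

theorem link_core_band {c : Config} (hc : c.Valid) : (c.link hc).core = c.body (0 * (4 * c.w)) ∧
    (c.link hc).band = c.body (1 / 4 * (4 * c.w)) := by
  rw [zero_mul, show 1 / 4 * (4 * c.w) = c.w by ring]; exact ⟨rfl, rfl⟩

/-- The skein relation at a crossing of a configuration. -/
theorem toSkein_pos (d : CrossingData c cL cT e g f h z 1) (R : Type*) [CommRing R]
    (s : Rˣ) : (c.link d.valid).toSkein R s = (s : R) • (cL.link d.validL).toSkein R s +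
      ((s⁻¹ : Rˣ) : R) • (cT.link d.validT).toSkein R s := by
  have hw := d.valid.w_pos; obtain ⟨ρ, d⟩ := d.exists_near; have hρ := d.pos
  obtain ⟨LL, LT, iL, iT, hL, hT⟩ := d.exists_links
  have hv : (⟨ρ, ρ⟩ : ℂ) ≠ 0 := fun hh => hρ.ne' (congrArg Complex.re hh)
  rw [← iL.toSkein_eq R s, ← iT.toSkein_eq R s]
  refine crossing_rel R s (isKauffmanTriple_of_mem
    (a := centre (c.x false g) (c.x false f)) (S := fun r => c.body (r * (4 * c.w)))
    (S₁ := fun r => Near.setL c e g f h ρ (r * (4 * c.w))) (S₂ := fun r => Near.setT c e g f h ρ (r * (4 * c.w)))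
    (G := fun p => let q := co (c.x false g) (c.x false f) z c.w ρ p; (⟨-q.2.1, -q.1⟩, q.2.2))
    hv (by positivity) (fun p => Prod.ext ((div_eq_iff hv).2 (Complex.ext ?_ ?_)) rfl)
    (fun p hp => d.cube_subset ?_) (link_core_band _) hL hT (fun r hr hr' p => ?_))
  iterate 2
    · simp only [centre, co, Complex.mul_re, Complex.mul_im, Complex.sub_re, Complex.sub_im]; field_simp; ring
  · simp only [cube, mem_ofPred_eq, abs_neg] at hp; exact and_left_comm.1 hp
  · have := d.pictures hr hr' (p := p) rfl
    simp only [cube, crossing, smoothingA, smoothingB, mem_ofPred_eq, abs_neg, neg_mul_neg,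
      neg_eq_zero, one_mul, neg_div, sub_neg_eq_add, and_left_comm (a := |Prod.fst (Prod.snd _)| ≤ _),
      add_comm |Prod.fst (Prod.snd _)|, mul_comm (Prod.fst (Prod.snd _))] at this ⊢
    exact this

theorem toSkein_neg (d : CrossingData c cL cT e g f h z (-1)) (R : Type*) [CommRing R]
    (s : Rˣ) : (c.link d.valid).toSkein R s = (s : R) • (cT.link d.validT).toSkein R s +
      ((s⁻¹ : Rˣ) : R) • (cL.link d.validL).toSkein R s := by
  have hw := d.valid.w_pos; obtain ⟨ρ, d⟩ := d.exists_near; have hρ := d.pos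
  obtain ⟨LL, LT, iL, iT, hL, hT⟩ := d.exists_links
  have hv : (⟨ρ, -ρ⟩ : ℂ) ≠ 0 := fun hh => hρ.ne' (congrArg Complex.re hh)
  rw [← iL.toSkein_eq R s, ← iT.toSkein_eq R s]
  refine crossing_rel R s (isKauffmanTriple_of_mem
    (a := centre (c.x false g) (c.x false f)) (S := fun r => c.body (r * (4 * c.w)))
    (S₁ := fun r => Near.setT c e g f h ρ (r * (4 * c.w))) (S₂ := fun r => Near.setL c e g f h ρ (r * (4 * c.w)))
    (G := fun p => let q := co (c.x false g) (c.x false f) z c.w ρ p; (⟨q.1, -q.2.1⟩, q.2.2))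
    hv (by positivity) (fun p => Prod.ext ((div_eq_iff hv).2 (Complex.ext ?_ ?_)) rfl)
    (fun p hp => d.cube_subset ?_) (link_core_band _) hT hL (fun r hr hr' p => ?_))
  iterate 2
    · simp only [centre, co, Complex.mul_re, Complex.mul_im, Complex.sub_re, Complex.sub_im]; field_simp; ring
  · simpa only [cube, mem_ofPred_eq, abs_neg] using hp
  · obtain ⟨h1, h2, h3, h4⟩ := d.pictures hr hr' (p := p) rfl
    have habs : ∀ M N : ℝ, -1 * (|N| - |M|) / 2 = (|M| - |N|) / 2 := fun M N => by ring
    simp only [cube, crossing, smoothingA, smoothingB, mem_ofPred_eq, abs_neg, mul_neg, neg_nonpos,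
      neg_nonneg, habs, neg_eq_zero, neg_div, sub_neg_eq_add, neg_neg] at h1 h2 h3 h4 ⊢
    exact ⟨h1.trans (and_congr_right fun _ => or_comm), h3, h2, fun h => (h4 h).symm⟩

end CrossingData




/-! ### Smoothing a crossing of a chord diagram -/

/-- The chord diagram with lower chords `l` and upper chords `u`. -/
def dg (l u : Chords) (s : Bool) : Chords := cond s u l

theorem WF.of_ends {l l' u : Chords} (h : WF (dg l u)) (hp : (ends l).Perm (ends l'))
    (hlt : ∀ a ∈ l', a.1 < a.2) : WF (dg l' u) := by
  intro s; cases s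
  · refine ⟨hp.nodup_iff.1 (h false).1, hlt, fun n hn => ?_⟩
    exact (h false).2.2 n (hp.mem_iff.2 hn)
  · refine ⟨(h true).1, (h true).2.1, fun n hn => ?_⟩; obtain ⟨h1, h2⟩ := (h true).2.2 n hn
    exact ⟨hp.mem_iff.1 h1, h2⟩

theorem ends_append (l l' : Chords) : ends (l ++ l') = ends l ++ ends l' := by
  simp [ends]

theorem ends_cons (a : ℕ × ℕ) (l : Chords) : ends (a :: l) = a.1 :: a.2 :: ends l := by
  simp [ends]

/-- Levels for the chords `A ++ γ :: δ :: Y` and `u` such that `γ` and `δ` are close to the height `z`,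
and all the other lower chords are not. -/
structure PairLevels (A Y u : Chords) (lev : Bool → ℕ → ℝ) (z w : ℝ) : Prop where
  w_pos : 0 < w
  height : 8 * w < z ∧ z + 8 * w < 1
  above : ∀ b ∈ A, (z + 12 * w < lev false b.1 ∧ lev false b.1 + 3 / 2 * w < 1) ∧
    (z + 12 * w < lev false b.2 ∧ lev false b.2 + 3 / 2 * w < 1)
  below : ∀ b ∈ Y, (3 / 2 * w < lev false b.1 ∧ lev false b.1 + 12 * w < z) ∧
    (3 / 2 * w < lev false b.2 ∧ lev false b.2 + 12 * w < z)
  upper : ∀ n ∈ ends u, 3 / 2 * w < lev true n ∧ lev true n + 3 / 2 * w < 1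
  pairA : A.Pairwise fun a b => (stdConfig (dg A u) lev w).ChordAbove false a b
  pairY : Y.Pairwise fun a b => (stdConfig (dg A u) lev w).ChordAbove false a b
  pairU : u.Pairwise fun a b => (stdConfig (dg A u) lev w).ChordAbove true a b

theorem PairLevels.realizes {A Y u : Chords} {lev : Bool → ℕ → ℝ} {z w : ℝ}
    (h : PairLevels A Y u lev z w) {γ δ : ℕ × ℕ} (hD : WF (dg (A ++ γ :: δ :: Y) u))
    (hn : ∀ n, n = γ.1 ∨ n = γ.2 ∨ n = δ.1 ∨ n = δ.2 →
      z - 2 * w ≤ lev false n ∧ lev false n ≤ z + 2 * w)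
    (hc : cross γ δ = true → (stdConfig (dg A u) lev w).ChordAbove false γ δ) :
    Realizes (stdConfig (dg (A ++ γ :: δ :: Y) u) lev w) (dg (A ++ γ :: δ :: Y) u) := by
  have hw := h.w_pos; have hz := h.height; have g1 := hn γ.1 (by simp); have g2 := hn γ.2 (by simp)
  have d1 := hn δ.1 (by simp); have d2 := hn δ.2 (by simp); refine hD.realizes hw ?_ ?_
  · rintro (_ | _) n hn'
    · obtain ⟨a, ha, e⟩ := mem_ends.1 hn'
      simp only [dg, cond_false, List.mem_append, List.mem_cons] at ha
      rcases ha with ha | rfl | rfl | ha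
      on_goal 1 => have := h.above a ha
      on_goal 4 => have := h.below a ha
      all_goals rcases e with rfl | rfl <;> constructor <;> linarith
    · exact h.upper n hn'
  · rintro (_ | _)
    · refine List.pairwise_append.2 ⟨h.pairA.imp (fun {a b} h (_ : cross a b = true) => h),
        List.pairwise_cons.2 ⟨fun b hb hcr => ?_, List.pairwise_cons.2 ⟨fun b hb _ => ?_,
          h.pairY.imp (fun {a b} h (_ : cross a b = true) => h)⟩⟩, fun a ha b hb _ => ?_⟩
      · rcases List.mem_cons.1 hb with rfl | hb
        · exact hc hcr
        have := h.below b hb; and_intros <;> simp only [stdConfig] <;> linarith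
      · have := h.below b hb; and_intros <;> simp only [stdConfig] <;> linarith
      · have := h.above a ha; simp only [List.mem_cons] at hb; rcases hb with rfl | rfl | hb
        on_goal 3 => have := h.below b hb
        all_goals and_intros <;> simp only [stdConfig] <;> linarith
    · exact h.pairU.imp (fun {a b} h (_ : cross a b = true) => h)

section Levels

variable {A Y u : Chords} {α β : ℕ × ℕ}

set_option hygiene false in
local notation "Λ" => A ++ α :: β :: Y

theorem exists_pairLevels (hD : WF (dg Λ u)) : ∃ lev z w, PairLevels A Y u lev z w ∧
      (lev false α.1 = z + 2 * w ∧ lev false α.2 = z + 2 * w) ∧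
      lev false β.1 = z - 2 * w ∧ lev false β.2 = z - 2 * w := by
  set D := dg Λ u with hDd
  obtain ⟨w, hw, hw1⟩ : ∃ w : ℝ, 0 < w ∧ 100 * w * (size D + 1) = 1 :=
    ⟨1 / (100 * (size D + 1)), by positivity, by field_simp⟩
  set a := A.length with ha; set z : ℝ := 1 - (a + 3 / 2) * (100 * w) with hz
  let f : ℕ → ℝ := fun i => if i = a then z + 2 * w else if i = a + 1 then z - 2 * w else
    1 - (i + 1) * (100 * w)
  have fa : f a = z + 2 * w := if_pos rfl; have fb : f (a + 1) = z - 2 * w := by simp [f]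
  have f1 : ∀ i, i < a ∨ a + 2 ≤ i → f i = 1 - (i + 1) * (100 * w) := by
    intro i hi; simp only [f]; rw [if_neg (by omega), if_neg (by omega)]
  have bd : ∀ i, 1 - (i + 1 + 1 / 2) * (100 * w) ≤ f i ∧ f i ≤ 1 - (i + 1 / 2) * (100 * w) := by
    intro i; simp only [f]; split_ifs with h1 h2
    · rw [h1, hz]; constructor <;> linarith
    · rw [h2, hz]; push_cast; constructor <;> linarith
    · constructor <;> linarith
  have mono : ∀ i j, i < j → f j + 3 * w < f i := by
    intro i j hij; have hij' : (i : ℝ) + 1 ≤ j := by exact_mod_cast hij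
    have cs : ∀ i : ℕ, ((i : ℝ) + 1 ≤ a ∧ f i = 1 - (i + 1) * (100 * w)) ∨
        ((i : ℝ) = a ∧ f i = z + 2 * w) ∨ ((i : ℝ) = a + 1 ∧ f i = z - 2 * w) ∨
        ((a : ℝ) + 2 ≤ i ∧ f i = 1 - (i + 1) * (100 * w)) := by
      intro i; rcases lt_trichotomy i a with h | rfl | h
      · exact .inl ⟨by exact_mod_cast h, f1 i (.inl h)⟩
      · exact .inr (.inl ⟨rfl, fa⟩)
      · rcases (Nat.succ_le_of_lt h).eq_or_lt with h | h
        · exact .inr (.inr (.inl ⟨by rw [← h]; push_cast; rfl, by rw [← h]; exact fb⟩))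
        · exact .inr (.inr (.inr ⟨by exact_mod_cast h, f1 i (.inr h)⟩))
    have key : ∀ x y : ℝ, x ≤ y → x * (100 * w) ≤ y * (100 * w) := fun x y h => by gcongr
    have kij := key _ _ hij'; rcases cs i with ⟨i1, i2⟩ | ⟨i1, i2⟩ | ⟨i1, i2⟩ | ⟨i1, i2⟩ <;>
    rcases cs j with ⟨j1, j2⟩ | ⟨j1, j2⟩ | ⟨j1, j2⟩ | ⟨j1, j2⟩ <;>
    rw [i2, j2] <;> first
      | (exfalso; linarith)
      | linarith
      | (have k1 := key _ _ i1; rw [hz]; linarith)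
      | (have k1 := key _ _ i1.le; have k2 := key _ _ j1; rw [hz]; linarith)
  have sz : ∀ i, i < size D → 3 / 2 * w < f i ∧ f i + 3 / 2 * w < 1 := by
    intro i hi; have hi' : (i : ℝ) + 1 ≤ size D := by exact_mod_cast hi
    have h0 : (0 : ℝ) ≤ i := by positivity
    have := bd i; constructor <;> nlinarith
  have hlen : (Λ).length < size D := length_lt_size D false
  simp only [List.length_append, List.length_cons] at hlen
  have hA : (a : ℝ) + 3 ≤ size D := by exact_mod_cast (by omega : a + 3 ≤ size D)
  have h0 : (0 : ℝ) ≤ a := by positivity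
  have nd : (Λ).Nodup := ends_nodup_chords (hD false).1
  have hlev : ∀ b ∈ Λ, idxLev D f false b.1 = f ((Λ).idxOf b) ∧
      idxLev D f false b.2 = f ((Λ).idxOf b) := fun b hb => hD.idxLev_eq f hb
  have hU : ∀ b ∈ u, idxLev D f true b.1 = f (u.idxOf b) ∧ idxLev D f true b.2 = f (u.idxOf b) :=
    fun b hb => hD.idxLev_eq (s := true) f hb
  have iA : ∀ b ∈ A, (Λ).idxOf b < a := fun b hb => by
    rw [List.idxOf_append_of_mem hb]; exact List.idxOf_lt_length_of_mem hb
  have nd' := List.nodup_append.1 nd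
  have i0 : ∀ b, b ∈ α :: β :: Y → (Λ).idxOf b = a + (α :: β :: Y).idxOf b := fun b hb =>
    List.idxOf_append_of_notMem fun h => nd'.2.2 _ h _ hb rfl
  have iα : (Λ).idxOf α = a := by
    simp [i0 α]
  have hαβ : α ≠ β := by
    rintro rfl; simp at nd'
  have iβ : (Λ).idxOf β = a + 1 := by
    simp [i0 β, List.idxOf_cons_ne _ hαβ]
  have iY : ∀ b ∈ Y, a + 2 ≤ (Λ).idxOf b := by
    intro b hb; have n1 : α ≠ b := by rintro rfl; simp [hb] at nd'
    have n2 : β ≠ b := by rintro rfl; simp [hb] at nd'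
    rw [i0 b (by simp [hb]), List.idxOf_cons_ne _ n1, List.idxOf_cons_ne _ n2]; omega
  have sA : ∀ b ∈ Λ, (Λ).idxOf b < size D := fun b hb =>
    (List.idxOf_lt_length_of_mem hb).trans (length_lt_size D false)
  have pw := pairwise_idxOf nd
  have ab : ∀ a ∈ Λ, ∀ b ∈ Λ,
      (Λ).idxOf a < (Λ).idxOf b →
      (stdConfig (dg A u) (idxLev D f) w).ChordAbove false a b := by
    intro a ha b hb hab; have := mono _ _ hab
    simp only [Config.ChordAbove, stdConfig, hlev a ha, hlev b hb]; exact ⟨this, this, this, this⟩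
  refine ⟨idxLev D f, z, w, ⟨hw, ⟨?_, ?_⟩, ?_, ?_, ?_, ?_, ?_, ?_⟩, ?_, ?_⟩
  iterate 2 rw [hz]; nlinarith
  · intro b hb; have hb' : b ∈ Λ := List.mem_append_left _ hb; rw [(hlev b hb').1, (hlev b hb').2]
    have k1 := (sz _ (sA b hb')).2
    have k2 : z + 12 * w < f ((Λ).idxOf b) := by
      have i1 := iA b hb; have i2 : (((Λ).idxOf b : ℕ) : ℝ) + 1 ≤ a := by exact_mod_cast i1
      rw [f1 _ (.inl i1), hz]; nlinarith
    exact ⟨⟨k2, k1⟩, k2, k1⟩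
  · intro b hb; have hb' : b ∈ Λ := by simp [hb]
    rw [(hlev b hb').1, (hlev b hb').2]; have k1 := (sz _ (sA b hb')).1
    have k2 : f ((Λ).idxOf b) + 12 * w < z := by
      have i1 := iY b hb; have i2 : (a : ℝ) + 2 ≤ ((Λ).idxOf b : ℕ) := by exact_mod_cast i1
      rw [f1 _ (.inr i1), hz]; nlinarith
    exact ⟨⟨k1, k2⟩, k1, k2⟩
  · intro n hn; obtain ⟨b, hb, e⟩ := mem_ends.1 hn; have hl := hU b hb
    rw [show idxLev D f true n = _ by rcases e with rfl | rfl; exacts [hl.1, hl.2]]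
    exact sz _ ((List.idxOf_lt_length_of_mem hb).trans (length_lt_size D true))
  · exact (List.pairwise_append.1 pw).1.imp_of_mem fun ha hb hab =>
      ab _ (List.mem_append_left _ ha) _ (List.mem_append_left _ hb) hab
  · exact (List.pairwise_cons.1 (List.pairwise_cons.1 (List.pairwise_append.1 pw).2.1).2).2.imp_of_mem
      fun ha hb hab => ab _ (by simp [ha]) _ (by simp [hb]) hab
  · refine (pairwise_idxOf (ends_nodup_chords (hD true).1)).imp_of_mem fun {a b} ha hb hab => ?_
    have := mono _ _ hab; simp only [Config.ChordAbove, stdConfig, hU a ha, hU b hb]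
    exact ⟨this, this, this, this⟩
  · simp [hlev α, iα, fa]
  · simp [hlev β, iβ, fb]

end Levels




/-- The mates are given by the chords. -/
theorem WF.mate_cases {D : Diagram} (h : WF D) (lev : Bool → ℕ → ℝ) (w : ℝ) {s : Bool}
    {n : ℕ} (hn : n ∈ ends (D s)) : ∃ a ∈ D s, (n = a.1 ∧ (stdConfig D lev w).mate s n = a.2) ∨
      (n = a.2 ∧ (stdConfig D lev w).mate s n = a.1) := by
  obtain ⟨a, ha, e⟩ := mem_ends.1 hn; obtain ⟨m1, m2, -⟩ := h.stdConfig_mates lev w s a ha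
  exact ⟨a, ha, e.imp (fun e => ⟨e, e ▸ m1⟩) fun e => ⟨e, e ▸ m2⟩⟩

theorem stdConfig_sameBut {A Y u : Chords} {α β γ δ : ℕ × ℕ}
    (hD : WF (dg (A ++ α :: β :: Y) u)) (hD' : WF (dg (A ++ γ :: δ :: Y) u)) {T : Set ℕ}
    (hT : α.1 ∈ T ∧ α.2 ∈ T ∧ β.1 ∈ T ∧ β.2 ∈ T)
    (hp : (ends (A ++ α :: β :: Y)).Perm (ends (A ++ γ :: δ :: Y))) (lev : Bool → ℕ → ℝ) (w : ℝ) :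
    (stdConfig (dg (A ++ α :: β :: Y) u) lev w).SameBut
      (stdConfig (dg (A ++ γ :: δ :: Y) u) lev w) T where
  N_eq := by
    ext n; simp only [stdConfig, List.mem_toFinset]; exact hp.mem_iff.symm
  x_eq := rfl
  lev_eq := rfl
  w_eq := rfl
  mate_true _ _ := rfl
  mate_false n hn hT' := by
    obtain ⟨a, ha, e⟩ := hD.mate_cases lev w ((hD.mem_stdConfig lev w false n).1 hn)
    have ha' : a ∈ A ++ γ :: δ :: Y := by
      simp only [dg, cond_false, List.mem_append, List.mem_cons] at ha ⊢
      rcases ha with ha | rfl | rfl | ha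
      · exact .inl ha
      · rcases e with ⟨rfl, -⟩ | ⟨rfl, -⟩
        · exact absurd hT.1 hT'
        · exact absurd hT.2.1 hT'
      · rcases e with ⟨rfl, -⟩ | ⟨rfl, -⟩
        · exact absurd hT.2.2.1 hT'
        · exact absurd hT.2.2.2 hT'
      · exact .inr (.inr (.inr ha))
    obtain ⟨m1, m2, -⟩ := hD'.stdConfig_mates lev w false a ha'; rcases e with ⟨rfl, e⟩ | ⟨rfl, e⟩
    · rw [e, m1]
    · rw [e, m2]

theorem exists_crossingData {A Y u : Chords} {α β : ℕ × ℕ} {e g f h : ℕ} {ε : ℝ}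
    (hD : WF (dg (A ++ α :: β :: Y) u)) (hlt : e < g ∧ g < f ∧ f < h)
    (hαβ : (α = (e, f) ∧ β = (g, h) ∧ ε = 1) ∨ (α = (g, h) ∧ β = (e, f) ∧ ε = -1)) :
    ∃ c cL cT z, CrossingData c cL cT e g f h z ε ∧ Realizes c (dg (A ++ α :: β :: Y) u) ∧
      Realizes cL (dg (A ++ (e, g) :: (f, h) :: Y) u) ∧
      Realizes cT (dg (A ++ (g, f) :: (e, h) :: Y) u) := by
  obtain ⟨i1, i2, i3⟩ := hlt
  have perm : ∀ {a b : List ℕ}, a.Perm b → ((ends A) ++ (a ++ ends Y)).Perm (ends A ++ (b ++ ends Y)) :=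
    fun h => (h.append_right _).append_left _
  have pL : (ends (A ++ α :: β :: Y)).Perm (ends (A ++ (e, g) :: (f, h) :: Y)) := by
    simp only [ends_append, ends_cons]
    refine perm (a := [α.1, α.2, β.1, β.2]) (b := [e, g, f, h]) ?_
    rcases hαβ with ⟨rfl, rfl, -⟩ | ⟨rfl, rfl, -⟩
    · exact (List.Perm.swap g f [h]).cons e
    · exact ((List.Perm.swap e h [f]).cons g).trans ((List.Perm.swap e g [h, f]).trans
        (((List.Perm.swap f h []).cons g).cons e))
  have pT : (ends (A ++ α :: β :: Y)).Perm (ends (A ++ (g, f) :: (e, h) :: Y)) := by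
    refine pL.trans ?_; simp only [ends_append, ends_cons]
    exact perm (a := [e, g, f, h]) (b := [g, f, e, h])
      ((List.Perm.swap g e [f, h]).trans ((List.Perm.swap f e [h]).cons g))
  have hAY : ∀ a ∈ A ++ α :: β :: Y, a.1 < a.2 := (hD false).2.1
  have hltD : ∀ γ δ : ℕ × ℕ, γ.1 < γ.2 → δ.1 < δ.2 → ∀ a ∈ A ++ γ :: δ :: Y, a.1 < a.2 := by
    intro γ δ h1 h2 a ha; simp only [List.mem_append, List.mem_cons] at ha
    rcases ha with ha | rfl | rfl | ha
    · exact hAY a (by simp [ha])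
    · exact h1
    · exact h2
    · exact hAY a (by simp [ha])
  have wL := hD.of_ends pL (hltD _ _ i1 i3)
  have wT := hD.of_ends pT (hltD _ _ i2 (by simp only; omega))
  obtain ⟨lev, z, w, hl, ⟨a1, a2⟩, b1, b2⟩ := exists_pairLevels hD; have hw := hl.w_pos
  have hlev : lev false e = z + 2 * w * ε ∧ lev false f = z + 2 * w * ε ∧
      lev false g = z - 2 * w * ε ∧ lev false h = z - 2 * w * ε := by
    rcases hαβ with ⟨rfl, rfl, rfl⟩ | ⟨rfl, rfl, rfl⟩
    · simp only [mul_one]; exact ⟨a1, a2, b1, b2⟩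
    · simp only [mul_neg, mul_one, sub_neg_eq_add, ← sub_eq_add_neg]; exact ⟨b1, b2, a1, a2⟩
  have hε : -1 ≤ ε ∧ ε ≤ 1 := by rcases hαβ with ⟨-, -, rfl⟩ | ⟨-, -, rfl⟩ <;> norm_num
  have near : ∀ n, n = e ∨ n = g ∨ n = f ∨ n = h →
      z - 2 * w ≤ lev false n ∧ lev false n ≤ z + 2 * w := by
    obtain ⟨l1, l2, l3, l4⟩ := hlev; rintro n (rfl | rfl | rfl | rfl)
    · rw [l1]; constructor <;> nlinarith
    · rw [l3]; constructor <;> nlinarith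
    · rw [l2]; constructor <;> nlinarith
    · rw [l4]; constructor <;> nlinarith
  have r : Realizes (stdConfig (dg (A ++ α :: β :: Y) u) lev w)
      (dg (A ++ α :: β :: Y) u) := by
    refine hl.realizes hD (fun n hn => near n ?_) fun _ => ?_
    · rcases hαβ with ⟨rfl, rfl, -⟩ | ⟨rfl, rfl, -⟩ <;> simp only at hn <;> tauto
    · simp only [Config.ChordAbove, stdConfig, a1, a2, b1, b2]; and_intros <;> linarith
  have rL : Realizes (stdConfig (dg (A ++ (e, g) :: (f, h) :: Y) u) lev w)
      (dg (A ++ (e, g) :: (f, h) :: Y) u) := by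
    refine hl.realizes wL (fun n hn => near n ?_) fun hc => ?_
    · simp only at hn; tauto
    · simp only [cross, Bool.or_eq_true, Bool.and_eq_true, decide_eq_true_eq] at hc; omega
  have rT : Realizes (stdConfig (dg (A ++ (g, f) :: (e, h) :: Y) u) lev w)
      (dg (A ++ (g, f) :: (e, h) :: Y) u) := by
    refine hl.realizes wT (fun n hn => near n ?_) fun hc => ?_
    · simp only at hn; tauto
    · simp only [cross, Bool.or_eq_true, Bool.and_eq_true, decide_eq_true_eq] at hc; omega
  have hT : α.1 ∈ ({e, g, f, h} : Set ℕ) ∧ α.2 ∈ ({e, g, f, h} : Set ℕ) ∧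
      β.1 ∈ ({e, g, f, h} : Set ℕ) ∧ β.2 ∈ ({e, g, f, h} : Set ℕ) := by
    rcases hαβ with ⟨rfl, rfl, -⟩ | ⟨rfl, rfl, -⟩ <;> simp
  have mL1 := wL.stdConfig_mates lev w false (e, g) (by simp [dg])
  have mL2 := wL.stdConfig_mates lev w false (f, h) (by simp [dg])
  have mT1 := wT.stdConfig_mates lev w false (g, f) (by simp [dg])
  have mT2 := wT.stdConfig_mates lev w false (e, h) (by simp [dg])
  have mα := hD.stdConfig_mates lev w false α (by simp [dg])
  have mβ := hD.stdConfig_mates lev w false β (by simp [dg])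
  have memα := r.mem_of_chord false (a := α) (by simp [dg])
  have memβ := r.mem_of_chord false (a := β) (by simp [dg]); refine ⟨_, _, _, z, ?_, r, rL, rT⟩
  have cast : ∀ {i j : ℕ}, i < j → (i : ℝ) / 32 < j / 32 := fun h => by
    have : ((_ : ℕ) : ℝ) < _ := Nat.cast_lt.2 h; linarith
  exact
    { valid := r.valid
      validL := rL.valid
      validT := rT.valid
      sameL := stdConfig_sameBut hD wL hT pL lev w
      sameT := stdConfig_sameBut hD wT hT pT lev w
      mem := by
        rcases hαβ with ⟨rfl, rfl, -⟩ | ⟨rfl, rfl, -⟩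
        · exact ⟨memα.1, memβ.1, memα.2, memβ.2⟩
        · exact ⟨memβ.1, memα.1, memβ.2, memα.2⟩
      x_true := fun _ => rfl
      lt := ⟨cast i1, cast i2, cast i3⟩
      mate := by
        rcases hαβ with ⟨rfl, rfl, -⟩ | ⟨rfl, rfl, -⟩
        · exact ⟨mα.1, mα.2.1, mβ.1, mβ.2.1⟩
        · exact ⟨mβ.1, mβ.2.1, mα.1, mα.2.1⟩
      mateL := ⟨mL1.1, mL1.2.1, mL2.1, mL2.2.1⟩
      mateT := ⟨mT2.1, mT2.2.1, mT1.1, mT1.2.1⟩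
      lev := hlev
      height := hl.height
      far := by
        intro n hn hnT
        obtain ⟨a, ha, e⟩ := hD.mate_cases lev w ((hD.mem_stdConfig lev w false n).1 hn)
        simp only [dg, cond_false, List.mem_append, List.mem_cons] at ha
        rcases ha with ha | rfl | rfl | ha
        · left; have := hl.above a ha; rcases e with ⟨rfl, e⟩ | ⟨rfl, e⟩ <;> rw [e]
          · exact ⟨this.1.1, this.2.1⟩
          · exact ⟨this.2.1, this.1.1⟩
        · rcases e with ⟨rfl, -⟩ | ⟨rfl, -⟩
          · exact absurd hT.1 hnT
          · exact absurd hT.2.1 hnT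
        · rcases e with ⟨rfl, -⟩ | ⟨rfl, -⟩
          · exact absurd hT.2.2.1 hnT
          · exact absurd hT.2.2.2 hnT
        · right; have := hl.below a ha; rcases e with ⟨rfl, e⟩ | ⟨rfl, e⟩ <;> rw [e]
          · exact ⟨this.1.2, this.2.2⟩
          · exact ⟨this.2.2, this.1.2⟩
      sign := by rcases hαβ with ⟨-, -, rfl⟩ | ⟨-, -, rfl⟩ <;> simp }

section Crossing

variable (R : Type*) [CommRing R] (q : Rˣ)

theorem sk_crossing_pos {A Y u : Chords} {e g f h : ℕ}
    (hD : WF (dg (A ++ (e, f) :: (g, h) :: Y) u)) (hlt : e < g ∧ g < f ∧ f < h) :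
    sk R q (dg (A ++ (e, f) :: (g, h) :: Y) u) =
      (q : R) • sk R q (dg (A ++ (e, g) :: (f, h) :: Y) u) +
      ((q⁻¹ : Rˣ) : R) • sk R q (dg (A ++ (g, f) :: (e, h) :: Y) u) := by
  obtain ⟨c, cL, cT, z, d, r, rL, rT⟩ := exists_crossingData hD hlt (.inl ⟨rfl, rfl, rfl⟩)
  rw [r.sk_eq, rL.sk_eq, rT.sk_eq]; exact d.toSkein_pos R q

theorem sk_crossing_neg {A Y u : Chords} {e g f h : ℕ}
    (hD : WF (dg (A ++ (g, h) :: (e, f) :: Y) u)) (hlt : e < g ∧ g < f ∧ f < h) :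
    sk R q (dg (A ++ (g, h) :: (e, f) :: Y) u) =
      (q : R) • sk R q (dg (A ++ (g, f) :: (e, h) :: Y) u) +
      ((q⁻¹ : Rˣ) : R) • sk R q (dg (A ++ (e, g) :: (f, h) :: Y) u) := by
  obtain ⟨c, cL, cT, z, d, r, rL, rT⟩ := exists_crossingData hD hlt (.inr ⟨rfl, rfl, rfl⟩)
  rw [r.sk_eq, rL.sk_eq, rT.sk_eq]; exact d.toSkein_neg R q

/-- A chord may be moved past chords that it does not cross. -/
theorem sk_commute {X M Y u : Chords} {α : ℕ × ℕ} (hD : WF (dg (X ++ α :: (M ++ Y)) u))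
    (hM : ∀ b ∈ M, cross α b = false) :
    sk R q (dg (X ++ α :: (M ++ Y)) u) = sk R q (dg (X ++ (M ++ α :: Y)) u) := by
  obtain ⟨lev, hr⟩ := hD.exists_realizes (w := 1 / (4 * (size (dg (X ++ α :: (M ++ Y)) u) + 1)))
    (by positivity) (by field_simp; rfl)
  refine sk_eq_of_realizes R q hr (hr.of_perm ?_ ?_)
  · rintro (_ | _)
    · exact List.perm_middle.symm.append_left X
    · exact List.Perm.refl _
  · rintro (_ | _)
    · have h := hr.pair false
      simp only [dg, cond_false, List.pairwise_append, List.pairwise_cons, List.mem_append,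
        List.mem_cons] at h ⊢
      obtain ⟨h1, ⟨h2, h3, h4, h5⟩, h6⟩ := h
      refine ⟨h1, ⟨h3, ⟨fun b hb => h2 b (.inr hb), h4⟩, ?_⟩, ?_⟩
      · rintro a ha b (rfl | hb)
        · intro hc
          have : cross b a = true := by
            simp only [cross, Bool.or_eq_true, Bool.and_eq_true, decide_eq_true_eq] at hc ⊢; tauto
          rw [hM a ha] at this; exact absurd this (by simp)
        · exact h5 a ha b hb
      · intro a ha b hb; exact h6 a ha b (by tauto)
    · exact hr.pair true

end Crossing




/-! ### Moving paths in coordinates -/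

/-- The point with coordinate `x` along the axis and distance `t` from the ends of the strands on the
side `σ`. -/
def pt (σ : Bool) (μ x t : ℝ) : ℂ := ⟨μ * x, sg σ * (1 + t)⟩

/-- The order of the values of a linear function at two vertices of two paths. -/
def CoordLt (l l' : List (ℝ × ℝ)) (k : ℝ × ℝ) (i j : ℕ) : Prop :=
  k.1 * (l.getD i 0).1 + k.2 * (l.getD i 0).2 < k.1 * (l.getD j 0).1 + k.2 * (l.getD j 0).2 ∧
  k.1 * (l'.getD i 0).1 + k.2 * (l'.getD i 0).2 < k.1 * (l'.getD j 0).1 + k.2 * (l'.getD j 0).2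

/-- The vertices up to `m` of a path have the coordinates given by a list. -/
def HasCoords (σ : Bool) (μ : ℝ) (m : ℕ) (l : List (ℝ × ℝ)) (v : ℕ → 𝕊) : Prop :=
  ∀ i ≤ m, (v i).1 = pt σ μ (l.getD i 0).1 (l.getD i 0).2

theorem lin_pt (σ : Bool) {μ : ℝ} (hμ : μ * μ = 1) {v : 𝕊} {x t : ℝ} (hv : v.1 = pt σ μ x t)
    (a b : ℝ) : lin (μ * a) (sg σ * b) v = a * x + b * t + b := by
  simp only [lin, hv, pt]
  linear_combination (a * x) * hμ + (b * (1 + t)) * sg_mul_self σ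

theorem pathMove_of_coord {σ : Bool} {μ : ℝ} (hμ : μ * μ = 1) {m : ℕ} {l l' : List (ℝ × ℝ)}
    {v v' : ℕ → 𝕊} (hv : HasCoords σ μ m l v) (hv' : HasCoords σ μ m l' v')
    (T : List (ℝ × ℝ)) (S : ℕ → List (ℝ × ℝ))
    (turn : ∀ i, i + 2 ≤ m → CoordLt l l' (T.getD i 0) i (i + 1) ∧
      CoordLt l l' (T.getD i 0) (i + 1) (i + 2))
    (sep : ∀ i j, i + 2 ≤ j → j < m → let C := CoordLt l l' ((S i).getD j 0)
      C i j ∧ C i (j + 1) ∧ C (i + 1) j ∧ C (i + 1) (j + 1)) :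
    PathMove m v v' := by
  have key : ∀ {k : ℝ × ℝ} {i j : ℕ}, i ≤ m → j ≤ m → CoordLt l l' k i j →
      MovLt (μ * k.1) (sg σ * k.2) v v' i j := by
    intro k i j hi hj h
    simp only [MovLt, lin_pt σ hμ (hv i hi), lin_pt σ hμ (hv j hj), lin_pt σ hμ (hv' i hi),
      lin_pt σ hμ (hv' j hj)]
    exact ⟨by linarith [h.1], by linarith [h.2]⟩
  refine ⟨fun i hi => ?_, fun i j hi hj => ?_⟩
  · obtain ⟨h1, h2⟩ := turn i hi
    exact ⟨_, _, key (by omega) (by omega) h1, key (by omega) (by omega) h2⟩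
  · obtain ⟨h1, h2, h3, h4⟩ := sep i j hi hj
    exact ⟨_, _, key (by omega) (by omega) h1, key (by omega) (by omega) h2,
      key (by omega) (by omega) h3, key (by omega) (by omega) h4⟩

section Moves

open List (getD_cons_zero getD_cons_succ)

variable {σ : Bool} {μ : ℝ} {v v' : ℕ → 𝕊} {a p r b : ℝ}

/-- The coordinates of a path that crosses the axis at `p` and comes back at `r`. -/
def fingerList (a p r b : ℝ) : List (ℝ × ℝ) :=
  [((a + p) / 2, (p - a) / 2), (p, 0), (p, -2), ((p + r) / 2, -2 - (r - p) / 2), (r, -2), (r, 0),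
    ((r + b) / 2, |r - b| / 2)]

def fingerList' (a p r b : ℝ) : List (ℝ × ℝ) :=
  [((a + p) / 2, (p - a) / 2), (p, 0), ((3 * p + r) / 4, 0), ((p + r) / 2, 0), ((p + 3 * r) / 4, 0),
    (r, 0), ((r + b) / 2, |r - b| / 2)]

theorem pathMove_finger (hμ : μ * μ = 1) (h1 : a < p) (h2 : p < r)
    (hv : HasCoords σ μ 6 (fingerList a p r b) v) (hv' : HasCoords σ μ 6 (fingerList' a p r b) v')
    (h4 : b ≠ r) : PathMove 6 v v' := by
  have k1 := le_abs_self (r - b); have k3 : 0 < |r - b| := abs_pos.2 (sub_ne_zero.2 h4.symm)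
  refine pathMove_of_coord hμ hv hv' [(1 / 2, -1), (1 / 2, -1), (1, 0), (1 / 2, 1), (1 / 2, 1)]
    (fun
      | 0 => [0, 0, (1 / 2, -1), (1 / 2, -1), (1 / 2, -1), (1, 1)]
      | _ + 1 => [0, 0, 0, (1, 0), (1, 0), (1 / 2, 1)]) (fun i hi => ?_) fun i j hi hj => ?_
  · have : i ≤ 4 := by omega
    interval_cases i <;> simp only [CoordLt, fingerList, fingerList', getD_cons_zero, getD_cons_succ] <;>
      and_intros <;> linarith
  · have : i ≤ 3 := by omega
    interval_cases i <;> interval_cases j <;>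
      simp only [CoordLt, fingerList, fingerList', getD_cons_zero, getD_cons_succ] <;>
      and_intros <;> linarith

/-- A path with ends over `a` and `b` and an edge from `p` to `r` on the axis. -/
def flatList (a p r b : ℝ) : List (ℝ × ℝ) :=
  [(a, -2), (a, 0), ((a + p) / 2, (p - a) / 2), (p, 0), (r, 0), ((r + b) / 2, |r - b| / 2), (b, 0),
    (b, -2)]

/-- A path with ends over `a` and `b` that goes through `(x, t)` and `(x', t')`. -/
def bentList (a b x t x' t' : ℝ) : List (ℝ × ℝ) :=
  [(a, -2), (a, 0), ((3 * a + x) / 4, t / 4), ((a + x) / 2, t / 2), (x, t), (x', t'), (b, 0), (b, -2)]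

/-- The bent path that runs along the arms of an arc from `a` to `b`. -/
abbrev arcList (a b : ℝ) : List (ℝ × ℝ) :=
  bentList a b ((3 * a + b) / 4) (|a - b| / 4) ((a + b) / 2) (|a - b| / 2)

/-- The bent path that first goes to an arc from `a` to `r`. -/
abbrev nestList (a r b : ℝ) : List (ℝ × ℝ) :=
  bentList a b ((a + r) / 2) ((r - a) / 2) ((r + b) / 2) (|r - b| / 2)

theorem pathMove_straddle (hμ : μ * μ = 1) (h1 : a < p) (h2 : p < r) (h3 : r < b)
    (hv : HasCoords σ μ 7 (flatList a p r b) v) (hv' : HasCoords σ μ 7 (arcList a b) v') :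
    PathMove 7 v v' := by
  have k1 : |a - b| = b - a := by rw [abs_of_neg (by linarith)]; ring
  have k2 : |r - b| = b - r := by rw [abs_of_neg (by linarith)]; ring
  refine pathMove_of_coord hμ hv hv' [(0, 1), (1, 0), (1, 0), (1, 0), (1, 0), (0, -1)]
    (fun _ => [0, 0, (1, 0), (1, 0), (1, 0), (1, 0), (1, 0)]) (fun i hi => ?_) fun i j hi hj => ?_
  · have : i ≤ 5 := by omega
    interval_cases i <;> simp only [CoordLt, flatList, bentList, k1, k2, getD_cons_zero, getD_cons_succ] <;>
      and_intros <;> linarith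
  · have : i ≤ 4 := by omega
    interval_cases i <;> interval_cases j <;>
      simp only [CoordLt, flatList, bentList, k1, k2, getD_cons_zero, getD_cons_succ] <;>
      and_intros <;> linarith

theorem pathMove_nested (hμ : μ * μ = 1) (h0 : b < a) (h1 : a < p) (h2 : p < r)
    (hv : HasCoords σ μ 7 (flatList a p r b) v) (hv' : HasCoords σ μ 7 (nestList a r b) v') :
    PathMove 7 v v' := by
  have k2 : |r - b| = r - b := abs_of_pos (by linarith)
  refine pathMove_of_coord hμ hv hv' [(0, 1), (1, 0), (1, 0), (1 / 2, 1), (-1, 0), (0, -1)]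
    (fun _ => [0, 0, (1, 0), (1, 0), (1, 1), (-1, 1), (-1, 0)]) (fun i hi => ?_) fun i j hi hj => ?_
  · have : i ≤ 5 := by omega
    interval_cases i <;> simp only [CoordLt, flatList, bentList, k2, getD_cons_zero, getD_cons_succ] <;>
      and_intros <;> linarith
  · have : i ≤ 4 := by omega
    interval_cases i <;> interval_cases j <;>
      simp only [CoordLt, flatList, bentList, k2, getD_cons_zero, getD_cons_succ] <;>
      and_intros <;> linarith

theorem pathMove_unnest (hμ : μ * μ = 1) (h0 : b < a) (h1 : a < r)
    (hv : HasCoords σ μ 7 (nestList a r b) v) (hv' : HasCoords σ μ 7 (arcList a b) v') :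
    PathMove 7 v v' := by
  have k1 : |a - b| = a - b := abs_of_pos (by linarith)
  have k2 : |r - b| = r - b := abs_of_pos (by linarith)
  refine pathMove_of_coord hμ hv hv' [(0, 1), (0, 1), (0, 1), (0, 1), (-1, 0), (0, -1)]
    (fun _ => [0, 0, (0, 1), (0, 1), (0, 1), (-1, 1), (-1, 0)]) (fun i hi => ?_) fun i j hi hj => ?_
  · have : i ≤ 5 := by omega
    interval_cases i <;> simp only [CoordLt, bentList, k1, k2, getD_cons_zero, getD_cons_succ] <;>
      and_intros <;> linarith
  · have : i ≤ 4 := by omega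
    interval_cases i <;> interval_cases j <;>
      simp only [CoordLt, bentList, k1, k2, getD_cons_zero, getD_cons_succ] <;>
      and_intros <;> linarith

end Moves




/-! ### Removing a turn -/

/-- A path at height `1 / 2` that moves on one side of the axis, with fixed ends. -/
theorem exists_side_isotopy {σ : Bool} {v v' : ℕ → 𝕊} (hp : PathMove 7 v v')
    {K : Set 𝕊} (hKc : IsCompact K) (hK : K ⊆ thickened) (hlow : ∀ p ∈ K, p.2 < 3 / 8)
    (h0 : v' 0 = v 0) (h1 : v' 1 = v 1) (h6 : v' 6 = v 6) (h7 : v' 7 = v 7)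
    (hh : ∀ i, 1 ≤ i → i ≤ 6 → (v i).2 = 1 / 2 ∧ (v' i).2 = 1 / 2)
    (him : ∀ i, 1 ≤ i → i ≤ 6 → 1 ≤ sg σ * (v i).1.im ∧ 1 ≤ sg σ * (v' i).1.im)
    (t0 : wall (v 0) (v 1) (1 / 64) ⊆ thickened) (t6 : wall (v 6) (v 7) (1 / 64) ⊆ thickened) :
    ∃ φ, IsotopicToId φ ∧ (∀ p ∈ K, φ p = p) ∧ ∀ r ∈ 𝕀,
      φ '' pathSet v (r * (1 / 64)) 7 = pathSet v' (r * (1 / 64)) 7 := by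
  have ht : ∀ i, 1 ≤ i → i ≤ 5 → ∀ τ ∈ 𝕀,
      ∀ p ∈ wall (mov (v i) (v' i) τ) (mov (v (i + 1)) (v' (i + 1)) τ) (1 / 64),
        |p.2 - 1 / 2| ≤ 0 + 1 / 64 := by
    intro i i1 i2 τ hτ p hp; obtain ⟨a1, a2⟩ := hh i i1 (by omega)
    obtain ⟨b1, b2⟩ := hh (i + 1) (by omega) (by omega)
    exact height_of_mem_wall (by norm_num) (height_mov hτ (by simp [a1]) (by simp [a2]))
      (height_mov hτ (by simp [b1]) (by simp [b2])) hp
  obtain ⟨φ, hφ, hφK, hφw⟩ := hp.exists_isotopy (by norm_num) (w := 1 / 64) (by norm_num) hKc hK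
    (by
      intro i hi; rcases Nat.eq_zero_or_pos i with rfl | i1
      · exact .inl ⟨h0.symm, h1.symm⟩
      rcases (Nat.le_of_lt_succ hi).eq_or_lt with rfl | i2
      · exact .inl ⟨h6.symm, h7.symm⟩
      refine .inr fun τ hτ => Set.disjoint_left.2 fun p hp hpK => ?_; have := hlow p hpK
      have := (abs_le.1 (ht i i1 (by omega) τ hτ p hp)).1
      linarith)
    (by
      intro i hi τ hτ; rcases Nat.eq_zero_or_pos i with rfl | i1
      · rw [h0, h1, mov_self, mov_self]; exact t0
      rcases (Nat.le_of_lt_succ hi).eq_or_lt with rfl | i2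
      · rw [h6, h7, mov_self, mov_self]; exact t6
      intro p hp; obtain ⟨a1, a2⟩ := him i i1 (by omega)
      obtain ⟨b1, b2⟩ := him (i + 1) (by omega) (by omega)
      have := lin_le_of_mem_wall (a := 0) (b := -sg σ) (k := -1)
        (lin_mov_le hτ (P := v i) (P' := v' i) (by simp only [lin]; linarith)
          (by simp only [lin]; linarith))
        (lin_mov_le hτ (P := v (i + 1)) (P' := v' (i + 1)) (by simp only [lin]; linarith)
          (by simp only [lin]; linarith)) hp
      have hz := abs_le.1 (ht i i1 (by omega) τ hτ p hp)
      refine mem_thickened_of_im (fun h0 => ?_) (by linarith) (by linarith)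
      simp only [lin, h0] at this
      linarith)
  exact ⟨φ, hφ, hφK, fun r hr => image_pathSet fun i hi => hφw i hi r hr⟩

/-- The strands `p` and `r` of `c` are joined by an arc on one side, and to the strands `a` and `b` on
the other side `σ`.  In `c'` these arcs are replaced by one that joins `a` and `b`. -/
structure Turnback (c c' : Config) (σ : Bool) (μ : ℝ) (a p r b : ℕ) : Prop where
  valid : c.Valid
  valid' : c'.Valid
  sign : μ * μ = 1
  mem_iff : ∀ n, n ∈ c'.N ↔ n ∈ c.N ∧ n ≠ p ∧ n ≠ r
  mem : a ∈ c.N ∧ p ∈ c.N ∧ r ∈ c.N ∧ b ∈ c.N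
  x_eq : c'.x = c.x
  lev_eq : c'.lev = c.lev
  w_eq : c'.w = c.w
  w : c.w = 1 / 64
  x_side : ∀ s n, c.x s n = c.x σ n
  mate : c.mate σ a = p ∧ c.mate σ p = a ∧ c.mate σ r = b ∧ c.mate σ b = r
  mate_not : c.mate (!σ) p = r ∧ c.mate (!σ) r = p
  mate' : c'.mate σ a = b ∧ c'.mate σ b = a
  mate_eq : ∀ n ∈ c'.N, c'.mate (!σ) n = c.mate (!σ) n ∧
    (n ≠ a → n ≠ b → c'.mate σ n = c.mate σ n)
  lt : μ * c.x σ a < μ * c.x σ p ∧ μ * c.x σ p < μ * c.x σ r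
  outside : μ * c.x σ b < μ * c.x σ a ∨ μ * c.x σ r < μ * c.x σ b
  gap : ∀ k : ℕ, 1 ≤ k → k ≤ 4 → ∀ y, μ * c.x σ p ≤ μ * y → μ * y ≤ μ * c.x σ r → y ≠ k
  lev : c.lev σ a = 1 / 2 ∧ c.lev σ p = 1 / 2 ∧ c.lev σ r = 1 / 2 ∧ c.lev σ b = 1 / 2
  lev_not : c.lev (!σ) p = 1 / 2 ∧ c.lev (!σ) r = 1 / 2
  low : ∀ n ∈ c.N, n ≠ a → n ≠ p → n ≠ r → n ≠ b → c.lev σ n = 1 / 4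
  low_not : ∀ n ∈ c.N, n ≠ p → n ≠ r → c.lev (!σ) n = 1 / 4

namespace Turnback

open Config

variable {c c' : Config} {σ : Bool} {μ : ℝ} {a p r b : ℕ}

/-- The pieces at the strands `p` and `r`. -/
def turnPieces (p r : ℕ) : Set (Option Bool × ℕ) := {k | k.2 = p ∨ k.2 = r}

/-- The pieces that are affected. -/
def allPieces (σ : Bool) (a p r b : ℕ) : Set (Option Bool × ℕ) :=
  {k | (k.2 = p ∨ k.2 = r) ∨ ((k.1 = none ∨ k.1 = some σ) ∧ (k.2 = a ∨ k.2 = b))}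

theorem mem_body (c : Config) (S : Set (Option Bool × ℕ)) {W : ℝ} {q : 𝕊} :
    q ∈ c.body W ↔ q ∈ c.rest S W ∨ ∃ k n, n ∈ c.N ∧ (k, n) ∈ S ∧ q ∈ c.piece k n W := by
  simp only [body, mem_iUnion, mem_rest, exists_prop]; constructor
  · rintro ⟨k, n, hn, h⟩; by_cases hS : (k, n) ∈ S
    · exact .inr ⟨k, n, hn, hS, h⟩
    · exact .inl ⟨k, n, hn, hS, h⟩
  · rintro (⟨k, n, hn, -, h⟩ | ⟨k, n, hn, -, h⟩) <;> exact ⟨k, n, hn, h⟩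

theorem ne (h : Turnback c c' σ μ a p r b) : a ≠ p ∧ a ≠ r ∧ p ≠ r ∧ b ≠ p ∧ b ≠ r ∧ a ≠ b := by
  obtain ⟨h1, h2⟩ := h.lt; and_intros <;> rintro rfl <;> rcases h.outside with h3 | h3 <;> linarith

theorem coords (h : Turnback c c' σ μ a p r b) (n : ℕ) :
    (c.knee σ n).1 = pt σ μ (μ * c.x σ n) 0 ∧ (c.knee (!σ) n).1 = pt σ μ (μ * c.x σ n) (-2) := by
  have hx := h.x_side (!σ) n; simp only [knee, pt, hx, sg_not]
  constructor <;> refine Complex.ext ?_ ?_ <;> simp only <;>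
    first | linear_combination -(c.x σ n) * h.sign | ring

theorem abs_mul_sub (h : Turnback c c' σ μ a p r b) (x y : ℝ) : |μ * x - μ * y| = |x - y| := by
  rw [← mul_sub, abs_mul]
  have : |μ| = 1 := by
    have := abs_mul_abs_self μ; rw [h.sign] at this; nlinarith [abs_nonneg μ]
  rw [this, one_mul]

theorem apex_coord (h : Turnback c c' σ μ a p r b) {d : Config} (hd : d.x = c.x) {n m : ℕ}
    (hm : d.mate σ n = m) : (d.apex σ n).1 =
      pt σ μ ((μ * c.x σ n + μ * c.x σ m) / 2) (|μ * c.x σ n - μ * c.x σ m| / 2) := by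
  rw [h.abs_mul_sub]; simp only [apex, pt, hm, hd]; refine Complex.ext ?_ rfl; simp only
  linear_combination -((c.x σ n + c.x σ m) / 2) * h.sign

theorem apex_not_coord (h : Turnback c c' σ μ a p r b) : (c.apex (!σ) p).1 =
    pt σ μ ((μ * c.x σ p + μ * c.x σ r) / 2) (-2 - (μ * c.x σ r - μ * c.x σ p) / 2) := by
  have e : μ * c.x σ r - μ * c.x σ p = |c.x σ p - c.x σ r| := by
    rw [← h.abs_mul_sub, abs_of_neg (by linarith [h.lt.2])]; ring
  rw [e]; simp only [apex, pt, h.mate_not.1, h.x_side (!σ), sg_not]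
  refine Complex.ext ?_ ?_ <;> simp only
  · linear_combination -((c.x σ p + c.x σ r) / 2) * h.sign
  · ring

theorem height_of_mem_rest (h : Turnback c c' σ μ a p r b) {q : 𝕊}
    (hq : q ∈ c.rest (allPieces σ a p r b) (1 / 64)) : q.2 < 3 / 8 := by
  obtain ⟨k, n, hn, hS, hk⟩ := mem_rest.1 hq
  simp only [allPieces, mem_ofPred_eq, not_or, not_and] at hS; obtain ⟨⟨np, nr⟩, hS⟩ := hS
  have lown := h.low_not n hn np nr; have mm := h.valid.mate_mem
  have mate_ne : ∀ s m, m ∈ c.N → n ≠ c.mate s m → c.mate s n ≠ m := by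
    intro s m hm hne e; rw [← e, h.valid.mate_mate s n hn] at hne; exact hne rfl
  have key : ∀ s, c.lev s n = 1 / 4 → c.lev s (c.mate s n) = 1 / 4 →
      q ∈ c.piece (some s) n (1 / 64) → q.2 < 3 / 8 := by
    intro s h1 h2 hq
    exact height_arm_lt (by norm_num) (by rw [h1]; norm_num) (by rw [h2]; norm_num) hq
  rcases k with _ | s
  · obtain ⟨na, nb⟩ := hS (.inl rfl)
    have hl : ∀ s, c.lev s n = 1 / 4 := by
      intro s; by_cases hs : s = σ
      · rw [hs]; exact h.low n hn na np nr nb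
      · have : s = !σ := by cases s <;> cases σ <;> simp_all
        rw [this]; exact lown
    obtain ⟨t, ⟨t0, t1⟩, -, -, e⟩ := (mem_ramp (by norm_num)).1 hk; rw [hl, hl, abs_le] at e
    linarith [e.2]
  · by_cases hs : s = σ
    · subst hs; obtain ⟨na, nb⟩ := hS (.inr rfl)
      refine key s (h.low n hn na np nr nb) (h.low _ (mm s n hn) ?_ ?_ ?_ ?_) hk
      · exact mate_ne s a h.mem.1 (by rw [h.mate.1]; exact np)
      · exact mate_ne s p h.mem.2.1 (by rw [h.mate.2.1]; exact na)
      · exact mate_ne s r h.mem.2.2.1 (by rw [h.mate.2.2.1]; exact nb)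
      · exact mate_ne s b h.mem.2.2.2 (by rw [h.mate.2.2.2]; exact nr)
    · have : s = !σ := by cases s <;> cases σ <;> simp_all
      subst this; refine key _ lown (h.low_not _ (mm _ n hn) ?_ ?_) hk
      · exact mate_ne _ p h.mem.2.1 (by rw [h.mate_not.1]; exact nr)
      · exact mate_ne _ r h.mem.2.2.1 (by rw [h.mate_not.2]; exact np)

theorem rest_eq (h : Turnback c c' σ μ a p r b) (W : ℝ) :
    c'.rest (allPieces σ a p r b) W = c.rest (allPieces σ a p r b) W := by
  have hk : c'.knee = c.knee := by funext s n; simp only [knee, h.x_eq, h.lev_eq]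
  ext q; simp only [mem_rest]; refine exists_congr fun k => exists_congr fun n => ?_; rw [h.mem_iff]
  have key : n ∈ c'.N → (k, n) ∉ allPieces σ a p r b → c'.piece k n W = c.piece k n W := by
    intro hn hS; simp only [allPieces, mem_ofPred_eq, not_or, not_and] at hS; rcases k with _ | s
    · simp only [piece, hk]
    · have : c'.mate s n = c.mate s n := by
        by_cases hs : s = σ
        · subst hs; exact (h.mate_eq n hn).2 (hS.2 (.inr rfl)).1 (hS.2 (.inr rfl)).2
        · have : s = !σ := by cases s <;> cases σ <;> simp_all
          rw [this]; exact (h.mate_eq n hn).1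
      simp only [piece, hk, apex, this, h.x_eq, h.lev_eq]
  constructor
  · rintro ⟨hn, hS, hq⟩; exact ⟨hn.1, hS, by rwa [← key ((h.mem_iff n).2 hn) hS]⟩
  · rintro ⟨hn, hS, hq⟩
    have hn' : n ∈ c.N ∧ n ≠ p ∧ n ≠ r := by
      simp only [allPieces, mem_ofPred_eq, not_or] at hS; exact ⟨hn, hS.1⟩
    exact ⟨hn', hS, by rwa [key ((h.mem_iff n).2 hn') hS]⟩

end Turnback




theorem mov_pt {σ : Bool} {μ x t x' t' : ℝ} {P Q : 𝕊} (hP : P.1 = pt σ μ x t)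
    (hQ : Q.1 = pt σ μ x' t') :
    (mov P Q (1 / 2)).1 = pt σ μ ((x + x') / 2) ((t + t') / 2) := by
  rw [Config.mov_eq, hP, hQ]; simp only [pt]; refine Complex.ext ?_ ?_ <;> simp only <;> ring

theorem pt_congr {σ : Bool} {μ x t x' t' : ℝ} {z : ℂ} (h : z = pt σ μ x t) (hx : x = x')
    (ht : t = t') : z = pt σ μ x' t' :=
  hx ▸ ht ▸ h

theorem mov_half_snd {P Q : 𝕊} {z : ℝ} (hP : P.2 = z) (hQ : Q.2 = z) :
    (mov P Q (1 / 2)).2 = z := by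
  rw [Config.mov_eq, hP, hQ]; ring

namespace Turnback

open Config

variable {c c' : Config} {σ : Bool} {μ : ℝ} {a p r b : ℕ}

set_option hygiene false in
local notation "Data" => Turnback c c' σ μ a p r b

/-- The path that crosses the axis at `p` and `r`. -/
def finger (c : Config) (σ : Bool) (a p r : ℕ) : ℕ → 𝕊 :=
  pth [c.apex σ a, c.knee σ p, c.knee (!σ) p, c.apex (!σ) p, c.knee (!σ) r, c.knee σ r, c.apex σ r]

def finger' (c : Config) (σ : Bool) (a p r : ℕ) : ℕ → 𝕊 :=
  pth [c.apex σ a, c.knee σ p, mov (c.knee σ p) (mov (c.knee σ p) (c.knee σ r) (1 / 2)) (1 / 2),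
    mov (c.knee σ p) (c.knee σ r) (1 / 2),
    mov (mov (c.knee σ p) (c.knee σ r) (1 / 2)) (c.knee σ r) (1 / 2), c.knee σ r, c.apex σ r]

theorem heights (h : Data) :
    (c.apex σ a).2 = 1 / 2 ∧ (c.apex (!σ) p).2 = 1 / 2 ∧ (c.apex σ r).2 = 1 / 2 ∧
      (c'.apex σ a).2 = 1 / 2 := by
  obtain ⟨l1, l2, l3, l4⟩ := h.lev
  simp only [apex, h.mate.1, h.mate_not.1, h.mate.2.2.1, h.mate'.1, h.lev_eq, l1, l2, l3, l4,
    h.lev_not.1, h.lev_not.2]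
  norm_num

theorem finger_coord (h : Data) :
    HasCoords σ μ 6 (fingerList (μ * c.x σ a) (μ * c.x σ p) (μ * c.x σ r) (μ * c.x σ b))
      (finger c σ a p r) := by
  intro i hi
  have e : |μ * c.x σ a - μ * c.x σ p| = μ * c.x σ p - μ * c.x σ a := by
    rw [abs_of_neg (by linarith [h.lt.1])]; ring
  interval_cases i
  exacts [(h.apex_coord rfl h.mate.1).trans (by rw [e]; rfl), (h.coords p).1, (h.coords p).2,
    h.apex_not_coord, (h.coords r).2, (h.coords r).1, h.apex_coord rfl h.mate.2.2.1]

theorem finger'_coord (h : Data) :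
    HasCoords σ μ 6 (fingerList' (μ * c.x σ a) (μ * c.x σ p) (μ * c.x σ r) (μ * c.x σ b))
      (finger' c σ a p r) := by
  intro i hi; have m := mov_pt (h.coords p).1 (h.coords r).1
  interval_cases i <;> simp only [fingerList', List.getD_cons_zero, List.getD_cons_succ]
  exacts [h.finger_coord 0 (by norm_num), (h.coords p).1,
    pt_congr (mov_pt (h.coords p).1 m) (by ring) (by ring), pt_congr m rfl (by ring),
    pt_congr (mov_pt m (h.coords r).1) (by ring) (by ring), (h.coords r).1,
    h.finger_coord 6 (by norm_num)]

theorem finger_height (h : Data) (i : ℕ) (hi : i ≤ 6) :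
    (finger c σ a p r i).2 = 1 / 2 ∧ (finger' c σ a p r i).2 = 1 / 2 := by
  obtain ⟨h1, h2, h3, -⟩ := h.heights; obtain ⟨-, l2, l3, -⟩ := h.lev
  have m : (mov (c.knee σ p) (c.knee σ r) (1 / 2)).2 = 1 / 2 := mov_half_snd l2 l3; interval_cases i
  exacts [⟨h1, h1⟩, ⟨l2, l2⟩, ⟨h.lev_not.1, mov_half_snd l2 m⟩, ⟨h2, m⟩,
    ⟨h.lev_not.2, mov_half_snd m l3⟩, ⟨l3, l3⟩, ⟨h3, h3⟩]

theorem exists_finger_isotopy (h : Data) :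
    ∃ φ, IsotopicToId φ ∧ (∀ q ∈ c.rest (turnPieces p r) (1 / 64), φ q = q) ∧
      ∀ t ∈ 𝕀, φ '' pathSet (finger c σ a p r) (t * (1 / 64)) 6 =
        pathSet (finger' c σ a p r) (t * (1 / 64)) 6 := by
  have hw := h.w; obtain ⟨i1, i2⟩ := h.lt
  have hbr : μ * c.x σ b ≠ μ * c.x σ r := by rcases h.outside with h3 | h3 <;> intro e <;> linarith
  have hc := h.finger_coord; have hc' := h.finger'_coord; have hh := h.finger_height
  have box : ∀ i, 1 ≤ i → i ≤ 5 → ∀ v : 𝕊, v = finger c σ a p r i ∨ v = finger' c σ a p r i →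
      lin μ 0 v ≤ μ * c.x σ r ∧ lin (-μ) 0 v ≤ -(μ * c.x σ p) ∧ lin 0 (sg σ) v ≤ 1 := by
    intro i j1 j2 v hv
    have key : ∀ x t, v.1 = pt σ μ x t → μ * c.x σ p ≤ x → x ≤ μ * c.x σ r → t ≤ 0 →
        lin μ 0 v ≤ μ * c.x σ r ∧ lin (-μ) 0 v ≤ -(μ * c.x σ p) ∧ lin 0 (sg σ) v ≤ 1 := by
      intro x t e k1 k2 k3; simp only [lin, e, pt]
      have e1 : μ * (μ * x) = x := by rw [← mul_assoc, h.sign, one_mul]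
      have e2 : sg σ * (sg σ * (1 + t)) = 1 + t := by rw [← mul_assoc, sg_mul_self, one_mul]
      and_intros <;> linarith
    rcases hv with rfl | rfl
    · refine key _ _ (hc i (by omega)) ?_ ?_ ?_ <;> interval_cases i <;>
        simp only [fingerList, List.getD_cons_zero, List.getD_cons_succ] <;> linarith
    · refine key _ _ (hc' i (by omega)) ?_ ?_ ?_ <;> interval_cases i <;>
        simp only [fingerList', List.getD_cons_zero, List.getD_cons_succ] <;> linarith
  have inbox : ∀ i, 1 ≤ i → i ≤ 4 → ∀ τ ∈ 𝕀,
      ∀ q ∈ wall (mov (finger c σ a p r i) (finger' c σ a p r i) τ)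
        (mov (finger c σ a p r (i + 1)) (finger' c σ a p r (i + 1)) τ) (1 / 64),
      μ * q.1.re ≤ μ * c.x σ r ∧ μ * c.x σ p ≤ μ * q.1.re ∧ sg σ * q.1.im ≤ 1 ∧
        |q.2 - 1 / 2| ≤ 0 + 1 / 64 := by
    intro i j1 j2 τ hτ q hq; have b1 := box i j1 (by omega) _ (.inl rfl)
    have b2 := box i j1 (by omega) _ (.inr rfl)
    have b3 := box (i + 1) (by omega) (by omega) _ (.inl rfl)
    have b4 := box (i + 1) (by omega) (by omega) _ (.inr rfl)
    have g1 := lin_le_of_mem_wall (lin_mov_le hτ b1.1 b2.1) (lin_mov_le hτ b3.1 b4.1) hq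
    have g2 := lin_le_of_mem_wall (lin_mov_le hτ b1.2.1 b2.2.1) (lin_mov_le hτ b3.2.1 b4.2.1) hq
    have g3 := lin_le_of_mem_wall (lin_mov_le hτ b1.2.2 b2.2.2) (lin_mov_le hτ b3.2.2 b4.2.2) hq
    simp only [lin] at g1 g2 g3; refine ⟨by linarith, by linarith, by linarith, ?_⟩
    obtain ⟨k1, k2⟩ := hh i (by omega); obtain ⟨k3, k4⟩ := hh (i + 1) (by omega)
    exact height_of_mem_wall (by norm_num) (height_mov hτ (by simp [k1]) (by simp [k2]))
      (height_mov hτ (by simp [k3]) (by simp [k4])) hq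
  have out : ∀ n, n = a ∨ n = b → ∀ q : 𝕊, q.1.re = c.x σ n → μ * q.1.re ≤ μ * c.x σ r →
      μ * c.x σ p ≤ μ * q.1.re → False := by
    rintro n (rfl | rfl) q e k1 k2 <;> rw [e] at k1 k2
    · linarith
    · rcases h.outside with h3 | h3 <;> linarith
  have harm : ∀ n ∈ c.N, c.piece (some σ) n (1 / 64) ⊆ thickened := fun n hn =>
    h.valid.piece_subset (by norm_num) (by rw [hw]; norm_num) hn _
  obtain ⟨φ, hφ, hφK, hφw⟩ := (pathMove_finger h.sign i1 i2 hc hc' hbr).exists_isotopy (by norm_num)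
    (w := 1 / 64) (by norm_num) (c.isCompact_rest (turnPieces p r) (1 / 64))
    (h.valid.rest_subset _ (by norm_num) (by rw [hw]; norm_num))
    (by
      intro i hi; rcases Nat.eq_zero_or_pos i with rfl | j1
      · exact .inl ⟨rfl, rfl⟩
      rcases (Nat.le_of_lt_succ hi).eq_or_lt with rfl | j2
      · exact .inl ⟨rfl, rfl⟩
      refine .inr fun τ hτ => Set.disjoint_left.2 fun q hq hqK => ?_
      obtain ⟨g1, g2, g3, g4⟩ := inbox i j1 (by omega) τ hτ q hq
      obtain ⟨k, n, hn, hS, hk⟩ := mem_rest.1 hqK; by_cases hA : (k, n) ∈ allPieces σ a p r b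
      · obtain ⟨hk', hn'⟩ := hA.resolve_left hS; simp only at hk' hn'; rcases hk' with rfl | rfl
        · obtain ⟨t, -, e, -, -⟩ := (mem_ramp (by norm_num)).1 hk
          rw [h.x_side false, h.x_side true] at e; exact out n hn' q (by rw [e]; ring) g1 g2
        · obtain ⟨t, ⟨t0, -⟩, e, e', -⟩ := (mem_arm (by norm_num)).1 hk
          rw [e', ← mul_assoc, sg_mul_self, one_mul] at g3
          have hpos : 0 < |c.x σ n - c.x σ (c.mate σ n)| / 2 :=
            half_pos (abs_pos.2 (sub_ne_zero.2 (h.valid.x_mate_ne hn σ)))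
          have : t = 0 := by
            by_contra h0; have := mul_pos (lt_of_le_of_ne t0 (Ne.symm h0)) hpos; linarith
          exact out n hn' q (by rw [e, this]; ring) g1 g2
      · have := h.height_of_mem_rest (mem_rest.2 ⟨k, n, hn, hA, hk⟩); rw [abs_le] at g4
        linarith [g4.1])
    (by
      intro i hi τ hτ; rcases Nat.eq_zero_or_pos i with rfl | j1
      · change wall (mov (c.apex σ a) (c.apex σ a) τ) (mov (c.knee σ p) (c.knee σ p) τ) _ ⊆ _
        rw [mov_self, mov_self, wall_symm, ← h.mate.2.1, h.valid.apex_mate h.mem.2.1]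
        exact harm p h.mem.2.1
      rcases (Nat.le_of_lt_succ hi).eq_or_lt with rfl | j2
      · change wall (mov (c.knee σ r) (c.knee σ r) τ) (mov (c.apex σ r) (c.apex σ r) τ) _ ⊆ _
        rw [mov_self, mov_self]; exact harm r h.mem.2.2.1
      intro q hq; obtain ⟨g1, g2, g3, g4⟩ := inbox i j1 (by omega) τ hτ q hq; rw [abs_le] at g4
      exact mem_thickened_of_re (fun k k1 k2 => h.gap k k1 k2 _ g2 g1) (by linarith) (by linarith))
  exact ⟨φ, hφ, hφK, fun t ht => image_pathSet fun i hi => hφw i hi t ht⟩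

end Turnback




namespace Turnback

open Config

variable {c c' : Config} {σ : Bool} {μ : ℝ} {a p r b : ℕ}

set_option hygiene false in
local notation "Data" => Turnback c c' σ μ a p r b

set_option hygiene false in
local notation "Mid" => mov (c.knee σ a) (c'.apex σ a) (1 / 2)

/-- The path after the first move. -/
def flat (c : Config) (σ : Bool) (a p r b : ℕ) : ℕ → 𝕊 :=
  pth [c.knee (!σ) a, c.knee σ a, c.apex σ a, c.knee σ p, c.knee σ r, c.apex σ r, c.knee σ b,
    c.knee (!σ) b]

/-- A path from `a` to `b` through `P` and `Q`. -/
def bent (c : Config) (σ : Bool) (a b : ℕ) (P Q : 𝕊) : ℕ → 𝕊 :=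
  pth [c.knee (!σ) a, c.knee σ a, mov (c.knee σ a) (mov (c.knee σ a) P (1 / 2)) (1 / 2),
    mov (c.knee σ a) P (1 / 2), P, Q, c.knee σ b, c.knee (!σ) b]

theorem flat_coord (h : Data) :
    HasCoords σ μ 7 (flatList (μ * c.x σ a) (μ * c.x σ p) (μ * c.x σ r) (μ * c.x σ b))
      (flat c σ a p r b) := by
  intro i hi; interval_cases i
  exacts [(h.coords a).2, (h.coords a).1, h.finger_coord 0 (by norm_num), (h.coords p).1,
    (h.coords r).1, h.finger_coord 6 (by norm_num), (h.coords b).1, (h.coords b).2]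

theorem bent_coord (h : Data) {P Q : 𝕊} {x t x' t' : ℝ}
    (hP : P.1 = pt σ μ x t) (hQ : Q.1 = pt σ μ x' t') :
    HasCoords σ μ 7 (bentList (μ * c.x σ a) (μ * c.x σ b) x t x' t')
      (bent c σ a b P Q) := by
  intro i hi; have m := mov_pt (h.coords a).1 hP
  interval_cases i <;> simp only [bentList, List.getD_cons_zero, List.getD_cons_succ]
  exacts [(h.coords a).2, (h.coords a).1, pt_congr (mov_pt (h.coords a).1 m) (by ring) (by ring),
    pt_congr m rfl (by ring), hP, hQ, (h.coords b).1, (h.coords b).2]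

theorem bent_height (h : Data) {P Q : 𝕊} (hP : P.2 = 1 / 2)
    (hQ : Q.2 = 1 / 2) (i : ℕ) (h1 : 1 ≤ i) (h6 : i ≤ 6) : (bent c σ a b P Q i).2 = 1 / 2 := by
  have m : (mov (c.knee σ a) P (1 / 2)).2 = 1 / 2 := mov_half_snd h.lev.1 hP; interval_cases i
  exacts [h.lev.1, mov_half_snd h.lev.1 m, m, hP, hQ, h.lev.2.2.2]

theorem one_le_of_pt {x t : ℝ} {v : 𝕊} (hv : v.1 = pt σ μ x t) (ht : 0 ≤ t) :
    1 ≤ sg σ * v.1.im := by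
  rw [hv]; simp only [pt]; rw [← mul_assoc, sg_mul_self]; linarith

theorem bent_im (h : Data) {P Q : 𝕊} {x t x' t' : ℝ}
    (hP : P.1 = pt σ μ x t) (hQ : Q.1 = pt σ μ x' t') (ht : 0 ≤ t) (ht' : 0 ≤ t') (i : ℕ)
    (h1 : 1 ≤ i) (h6 : i ≤ 6) : 1 ≤ sg σ * (bent c σ a b P Q i).1.im := by
  refine one_le_of_pt (h.bent_coord hP hQ i (by omega)) ?_
  interval_cases i <;> simp only [bentList, List.getD_cons_zero, List.getD_cons_succ] <;> linarith

theorem flat_height (h : Data) (i : ℕ) (h1 : 1 ≤ i) (h6 : i ≤ 6) :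
    (flat c σ a p r b i).2 = 1 / 2 := by
  obtain ⟨k1, -, k3, -⟩ := h.heights; obtain ⟨l1, l2, l3, l4⟩ := h.lev; interval_cases i
  exacts [l1, k1, l2, l3, k3, l4]

theorem flat_im (h : Data) (i : ℕ) (h1 : 1 ≤ i) (h6 : i ≤ 6) :
    1 ≤ sg σ * (flat c σ a p r b i).1.im := by
  refine one_le_of_pt (h.flat_coord i (by omega)) ?_; have := h.lt.1
  interval_cases i <;> simp only [flatList, List.getD_cons_zero, List.getD_cons_succ] <;>
    positivity

theorem mem_ramp_side (c : Config) (σ : Bool) (n : ℕ) (W : ℝ) :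
    wall (c.knee (!σ) n) (c.knee σ n) W = c.piece none n W ∧
      wall (c.knee σ n) (c.knee (!σ) n) W = c.piece none n W := by
  cases σ
  · exact ⟨wall_symm _ _ _, rfl⟩
  · exact ⟨rfl, wall_symm _ _ _⟩

theorem exists_flat_isotopy (h : Data) :
    ∃ φ, IsotopicToId φ ∧ (∀ q ∈ c.rest (allPieces σ a p r b) (1 / 64), φ q = q) ∧
      ∀ t ∈ 𝕀, φ '' pathSet (flat c σ a p r b) (t * (1 / 64)) 7 =
        pathSet (bent c σ a b Mid (c'.apex σ a))
          (t * (1 / 64)) 7 := by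
  have hw := h.w; obtain ⟨i1, i2⟩ := h.lt
  have ramp : ∀ n ∈ c.N, c.piece none n (1 / 64) ⊆ thickened := fun n hn =>
    h.valid.piece_subset (by norm_num) (by rw [hw]; norm_num) hn _
  have t0 := (mem_ramp_side c σ a (1 / 64)).1.trans_subset (ramp a h.mem.1)
  have t6 := (mem_ramp_side c σ b (1 / 64)).2.trans_subset (ramp b h.mem.2.2.2)
  have hKc := c.isCompact_rest (allPieces σ a p r b) (1 / 64)
  have hK : c.rest (allPieces σ a p r b) (1 / 64) ⊆ thickened :=
    h.valid.rest_subset _ (by norm_num) (by rw [hw]; norm_num)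
  have eA := h.apex_coord h.x_eq h.mate'.1
  have eC : Mid.1 = pt σ μ ((3 * (μ * c.x σ a) + μ * c.x σ b) / 4)
      (|μ * c.x σ a - μ * c.x σ b| / 4) := by
    exact pt_congr (mov_pt (h.coords a).1 eA) (by ring) (by ring)
  have hA := h.heights.2.2.2; have hC : Mid.2 = 1 / 2 := mov_half_snd h.lev.1 hA
  rcases h.outside with hb | hb
  · have eR := h.apex_coord rfl h.mate.2.2.1
    set P : 𝕊 := (pt σ μ ((μ * c.x σ a + μ * c.x σ r) / 2) ((μ * c.x σ r - μ * c.x σ a) / 2),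
      1 / 2) with hP
    obtain ⟨φ, hφ, φK, φw⟩ := exists_side_isotopy (σ := σ)
      (pathMove_nested h.sign hb i1 i2 h.flat_coord (h.bent_coord (P := P) rfl eR)) hKc hK
      (fun q => h.height_of_mem_rest) rfl rfl rfl rfl
      (fun i k1 k2 => ⟨h.flat_height i k1 k2, h.bent_height rfl h.heights.2.2.1 i k1 k2⟩)
      (fun i k1 k2 => ⟨h.flat_im i k1 k2, h.bent_im rfl eR (by linarith) (by positivity) i k1 k2⟩)
      t0 t6
    obtain ⟨ψ, hψ, ψK, ψw⟩ := exists_side_isotopy (σ := σ)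
      (pathMove_unnest h.sign hb (by linarith) (h.bent_coord (P := P) rfl eR) (h.bent_coord eC eA))
      hKc hK (fun q => h.height_of_mem_rest) rfl rfl rfl rfl
      (fun i k1 k2 => ⟨h.bent_height rfl h.heights.2.2.1 i k1 k2, h.bent_height hC hA i k1 k2⟩)
      (fun i k1 k2 => ⟨h.bent_im rfl eR (by linarith) (by positivity) i k1 k2,
        h.bent_im eC eA (by positivity) (by positivity) i k1 k2⟩) t0 t6
    refine ⟨φ.trans ψ, hφ.trans hψ, fun q hq => ?_, fun t ht => ?_⟩
    · rw [Homeomorph.trans_apply, φK q hq, ψK q hq]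
    · rw [← ψw t ht, ← φw t ht, ← image_comp]; rfl
  · exact exists_side_isotopy (σ := σ)
      (pathMove_straddle h.sign i1 i2 hb h.flat_coord (h.bent_coord eC eA)) hKc hK
      (fun q => h.height_of_mem_rest) rfl rfl rfl rfl
      (fun i k1 k2 => ⟨h.flat_height i k1 k2, h.bent_height hC hA i k1 k2⟩)
      (fun i k1 k2 => ⟨h.flat_im i k1 k2, h.bent_im eC eA (by positivity) (by positivity) i k1 k2⟩)
      t0 t6

theorem wall_half (P Q : 𝕊) (W : ℝ) :
    wall P (mov P Q (1 / 2)) W ∪ wall (mov P Q (1 / 2)) Q W = wall P Q W :=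
  (wall_split P Q W (by norm_num)).symm

theorem exists_kind (σ : Bool) {P : Option Bool → Prop} :
    (∃ k, P k) ↔ P none ∨ P (some σ) ∨ P (some !σ) := by
  constructor
  · rintro ⟨_ | s, h⟩
    · exact .inl h
    · by_cases hs : s = σ
      · exact .inr (.inl (hs ▸ h))
      · have : s = !σ := by cases s <;> cases σ <;> simp_all
        exact .inr (.inr (this ▸ h))
  · rintro (h | h | h) <;> exact ⟨_, h⟩

theorem body_finger (h : Data) (W : ℝ) :
    c.body W = c.rest (turnPieces p r) W ∪ pathSet (finger c σ a p r) W 6 := by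
  ext q; obtain ⟨-, mp, mr, -⟩ := h.mem
  have e1 : c.apex σ a = c.apex σ p := by rw [← h.mate.2.1, h.valid.apex_mate mp]
  have e2 : c.apex (!σ) p = c.apex (!σ) r := by rw [← h.mate_not.2, h.valid.apex_mate mr]
  have hp : pathSet (finger c σ a p r) W 6 = c.piece (some σ) p W ∪ c.piece none p W ∪
      c.piece (some !σ) p W ∪ c.piece (some !σ) r W ∪ c.piece none r W ∪ c.piece (some σ) r W := by
    rw [← (mem_ramp_side c σ p W).2, ← (mem_ramp_side c σ r W).1]
    simp only [pathSet, finger, pth_zero, pth_succ, empty_union, piece]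
    rw [e1, wall_symm (c.apex σ p), e2, wall_symm (c.apex (!σ) r)]
  rw [mem_body c (turnPieces p r), mem_union, hp]; refine or_congr_right ?_; rw [exists_kind σ]
  have : ∀ k, (∃ n, n ∈ c.N ∧ (k, n) ∈ turnPieces p r ∧ q ∈ c.piece k n W) ↔
      q ∈ c.piece k p W ∨ q ∈ c.piece k r W := by
    intro k; constructor
    · rintro ⟨n, -, rfl | rfl, hq⟩
      · exact .inl hq
      · exact .inr hq
    · rintro (hq | hq)
      · exact ⟨p, mp, .inl rfl, hq⟩
      · exact ⟨r, mr, .inr rfl, hq⟩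
  simp only [this, mem_union]; tauto

theorem rest_flat (h : Data) (W : ℝ) :
    c.rest (turnPieces p r) W ∪ pathSet (finger' c σ a p r) W 6 =
      c.rest (allPieces σ a p r b) W ∪ pathSet (flat c σ a p r b) W 7 := by
  ext q; obtain ⟨ma, mp, mr, mb⟩ := h.mem; obtain ⟨n1, n2, -, n4, n5, -⟩ := h.ne
  have e1 : c.apex σ r = c.apex σ b := by rw [← h.mate.2.2.2, h.valid.apex_mate mb]
  have hp : pathSet (finger' c σ a p r) W 6 = wall (c.apex σ a) (c.knee σ p) W ∪
      wall (c.knee σ p) (c.knee σ r) W ∪ wall (c.knee σ r) (c.apex σ r) W := by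
    rw [← wall_half (c.knee σ p) (c.knee σ r), ← wall_half (c.knee σ p) (mov _ _ _),
      ← wall_half (mov (c.knee σ p) (c.knee σ r) (1 / 2)) (c.knee σ r)]
    simp only [pathSet, finger', pth_zero, pth_succ, empty_union, union_assoc]
  have hf : pathSet (flat c σ a p r b) W 7 = c.piece none a W ∪ c.piece (some σ) a W ∪
      wall (c.apex σ a) (c.knee σ p) W ∪ wall (c.knee σ p) (c.knee σ r) W ∪
      wall (c.knee σ r) (c.apex σ r) W ∪ c.piece (some σ) b W ∪ c.piece none b W := by
    rw [← (mem_ramp_side c σ a W).1, ← (mem_ramp_side c σ b W).2]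
    simp only [pathSet, flat, pth_zero, pth_succ, empty_union, piece]
    rw [e1, wall_symm (c.apex σ b)]
  have hr : q ∈ c.rest (turnPieces p r) W ↔ q ∈ c.rest (allPieces σ a p r b) W ∨
      (q ∈ c.piece none a W ∨ q ∈ c.piece (some σ) a W) ∨
      (q ∈ c.piece none b W ∨ q ∈ c.piece (some σ) b W) := by
    simp only [mem_rest]; constructor
    · rintro ⟨k, n, hn, hS, hq⟩; by_cases hA : (k, n) ∈ allPieces σ a p r b
      · obtain ⟨hk, hn'⟩ := hA.resolve_left hS; simp only at hk hn'
        rcases hk with rfl | rfl <;> rcases hn' with rfl | rfl <;> tauto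
      · exact .inl ⟨k, n, hn, hA, hq⟩
    · rintro (⟨k, n, hn, hS, hq⟩ | (hq | hq) | hq | hq)
      · exact ⟨k, n, hn, fun h => hS (.inl h), hq⟩
      on_goal 1 => exact ⟨_, a, ma, by simp [turnPieces, n1, n2], hq⟩
      on_goal 1 => exact ⟨_, a, ma, by simp [turnPieces, n1, n2], hq⟩
      all_goals exact ⟨_, b, mb, by simp [turnPieces, n4, n5], hq⟩
  simp only [mem_union, hp, hf, hr]; tauto

theorem body_bent (h : Data) (W : ℝ) :
    c'.body W = c.rest (allPieces σ a p r b) W ∪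
      pathSet (bent c σ a b Mid (c'.apex σ a)) W 7 := by
  ext q; obtain ⟨ma, mp, mr, mb⟩ := h.mem; obtain ⟨n1, n2, -, n4, n5, -⟩ := h.ne
  have ma' := (h.mem_iff a).2 ⟨ma, n1, n2⟩; have mb' := (h.mem_iff b).2 ⟨mb, n4, n5⟩
  have hk : c'.knee = c.knee := by funext s n; simp only [knee, h.x_eq, h.lev_eq]
  have e1 : c'.apex σ a = c'.apex σ b := by rw [← h.mate'.2, h.valid'.apex_mate mb']
  have hp : pathSet (bent c σ a b Mid (c'.apex σ a)) W 7 =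
      c'.piece none a W ∪ c'.piece (some σ) a W ∪ c'.piece (some σ) b W ∪ c'.piece none b W := by
    rw [← (mem_ramp_side c' σ a W).1, ← (mem_ramp_side c' σ b W).2]; simp only [piece, hk]
    rw [← wall_half (c.knee σ a) (c'.apex σ a), ← wall_half (c.knee σ a) (mov _ _ _),
      ← wall_half (c.knee σ a) (mov (c.knee σ a) (mov _ _ _) _)]
    rw [wall_symm (c.knee σ b) (c'.apex σ b), ← e1]
    simp only [pathSet, bent, pth_zero, pth_succ, empty_union, union_assoc]
  rw [mem_body c' (allPieces σ a p r b), mem_union, hp, h.rest_eq]; refine or_congr_right ?_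
  simp only [mem_union]; constructor
  · rintro ⟨k, n, hn, hS, hq⟩; have hn' := (h.mem_iff n).1 hn
    obtain ⟨hk, hn'⟩ := hS.resolve_left (by simp [hn'.2.1, hn'.2.2]); simp only at hk hn'
    rcases hk with rfl | rfl <;> rcases hn' with rfl | rfl <;> tauto
  · rintro (((hq | hq) | hq) | hq)
    · exact ⟨_, a, ma', .inr ⟨.inl rfl, .inl rfl⟩, hq⟩
    · exact ⟨_, a, ma', .inr ⟨.inr rfl, .inl rfl⟩, hq⟩
    · exact ⟨_, b, mb', .inr ⟨.inr rfl, .inr rfl⟩, hq⟩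
    · exact ⟨_, b, mb', .inr ⟨.inl rfl, .inr rfl⟩, hq⟩

theorem isotopic (h : Data) :
    Isotopic (c.link h.valid) (c'.link h.valid') := by
  obtain ⟨φ, hφ, φK, φw⟩ := h.exists_finger_isotopy; obtain ⟨ψ, hψ, ψK, ψw⟩ := h.exists_flat_isotopy
  have fix : ∀ {χ : 𝕊 ≃ₜ 𝕊} {S : Set (Option Bool × ℕ)},
      (∀ q ∈ c.rest S (1 / 64), χ q = q) → ∀ t ∈ 𝕀,
        χ '' c.rest S (t * (1 / 64)) = c.rest S (t * (1 / 64)) := by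
    intro χ S hχ t ht; refine (image_congr fun q hq => hχ q ?_).trans (image_id' _)
    obtain ⟨k, n, hn, hS, hk⟩ := mem_rest.1 hq
    exact mem_rest.2 ⟨k, n, hn, hS, piece_mono (by have := ht.1; positivity)
      (by linarith [ht.2]) hk⟩
  have key : ∀ t ∈ 𝕀, (φ.trans ψ) '' c.body (t * (1 / 64)) = c'.body (t * (1 / 64)) := by
    intro t ht; have : (φ.trans ψ : 𝕊 → 𝕊) = ψ ∘ φ := rfl
    rw [this, image_comp, h.body_finger, image_union, fix φK t ht, φw t ht, h.rest_flat, image_union,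
      fix ψK t ht, ψw t ht, h.body_bent]
  refine ⟨φ.trans ψ, hφ.trans hψ, ?_, ?_⟩
  · have := key 0 (by simp); rwa [zero_mul] at this
  · have := key 1 (by simp); rw [one_mul, ← h.w] at this; simp only [link]; rw [h.w_eq]; exact this

end Turnback




/-! ### Removing a turn of a chord diagram -/

/-- The chord with ends `m` and `n`. -/
def ch (m n : ℕ) : ℕ × ℕ := if m < n then (m, n) else (n, m)

theorem ch_ends (m n : ℕ) : (ch m n).1 = m ∧ (ch m n).2 = n ∨ (ch m n).1 = n ∧ (ch m n).2 = m := by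
  unfold ch; split_ifs
  · exact .inl ⟨rfl, rfl⟩
  · exact .inr ⟨rfl, rfl⟩

/-- The chord diagram with the chords `L` on the side `σ` and `U` on the other side. -/
def sided (σ : Bool) (L U : Chords) (s : Bool) : Chords := if s = σ then L else U

theorem sided_self (σ : Bool) (L U : Chords) : sided σ L U σ = L := if_pos rfl

theorem sided_not (σ : Bool) (L U : Chords) : sided σ L U (!σ) = U := if_neg (by simp)

theorem ends_ch (m n : ℕ) (l : Chords) : (ends (ch m n :: l)).Perm (m :: n :: ends l) := by
  rw [ends_cons]; rcases ch_ends m n with ⟨h1, h2⟩ | ⟨h1, h2⟩ <;> rw [h1, h2]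
  exact List.Perm.swap _ _ _

theorem WF.sided_iff {σ : Bool} {L U : Chords} : WF (sided σ L U) ↔
    ((ends L).Nodup ∧ ∀ a ∈ L, a.1 < a.2) ∧ ((ends U).Nodup ∧ ∀ a ∈ U, a.1 < a.2) ∧
      (∀ n, n ∈ ends L ↔ n ∈ ends U) ∧ ∀ n ∈ ends L, n ≠ 32 ∧ n ≠ 64 ∧ n ≠ 96 ∧ n ≠ 128 := by
  have key : ∀ L U : Chords, (((ends L).Nodup ∧ (∀ a ∈ L, a.1 < a.2) ∧
      ∀ n ∈ ends L, n ∈ ends U ∧ n ≠ 32 ∧ n ≠ 64 ∧ n ≠ 96 ∧ n ≠ 128) ∧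
      ((ends U).Nodup ∧ (∀ a ∈ U, a.1 < a.2) ∧
      ∀ n ∈ ends U, n ∈ ends L ∧ n ≠ 32 ∧ n ≠ 64 ∧ n ≠ 96 ∧ n ≠ 128)) ↔
    ((ends L).Nodup ∧ ∀ a ∈ L, a.1 < a.2) ∧ ((ends U).Nodup ∧ ∀ a ∈ U, a.1 < a.2) ∧
      (∀ n, n ∈ ends L ↔ n ∈ ends U) ∧ ∀ n ∈ ends L, n ≠ 32 ∧ n ≠ 64 ∧ n ≠ 96 ∧ n ≠ 128 := by
    intro L U; constructor
    · rintro ⟨⟨a1, a2, a3⟩, b1, b2, b3⟩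
      exact ⟨⟨a1, a2⟩, ⟨b1, b2⟩, fun n => ⟨fun h => (a3 n h).1, fun h => (b3 n h).1⟩,
        fun n h => (a3 n h).2⟩
    · rintro ⟨⟨a1, a2⟩, ⟨b1, b2⟩, h1, h2⟩
      exact ⟨⟨a1, a2, fun n h => ⟨(h1 n).1 h, h2 n h⟩⟩, b1, b2,
        fun n h => ⟨(h1 n).2 h, h2 n ((h1 n).2 h)⟩⟩
  rw [← key]; unfold WF; constructor
  · intro h; have h1 := h σ; have h2 := h (!σ); rw [Bool.not_not, sided_self, sided_not] at h2
    rw [sided_self, sided_not] at h1; exact ⟨h1, h2⟩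
  · rintro ⟨h1, h2⟩ s; by_cases hs : s = σ
    · rw [hs, sided_self, sided_not]; exact h1
    · have : s = !σ := by cases s <;> cases σ <;> simp_all
      rw [this, Bool.not_not, sided_self, sided_not]; exact h2

theorem Planar.sided_iff {σ : Bool} {L U : Chords} : Planar (sided σ L U) ↔
    (∀ a ∈ L, ∀ b ∈ L, cross a b = false) ∧ ∀ a ∈ U, ∀ b ∈ U, cross a b = false := by
  constructor
  · intro h; have h1 := h σ; have h2 := h (!σ); rw [sided_self] at h1; rw [sided_not] at h2
    exact ⟨h1, h2⟩
  · rintro ⟨h1, h2⟩ s; by_cases hs : s = σ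
    · rw [hs, sided_self]; exact h1
    · have : s = !σ := by cases s <;> cases σ <;> simp_all
      rw [this, sided_not]; exact h2

theorem cross_eq_false {a b : ℕ × ℕ} : cross a b = false ↔
    ¬ (a.1 < b.1 ∧ b.1 < a.2 ∧ a.2 < b.2) ∧ ¬ (b.1 < a.1 ∧ a.1 < b.2 ∧ b.2 < a.2) := by
  rw [← Bool.not_eq_true]; simp only [cross, Bool.or_eq_true, Bool.and_eq_true, decide_eq_true_eq]
  tauto

theorem cross_comm (a b : ℕ × ℕ) : cross a b = cross b a := by
  unfold cross; rw [Bool.or_comm]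

/-- The ends `p` and `r` of a turn and the ends `a` and `b` of the adjacent chords are in one of the
orders that are possible in a planar diagram. -/
def TurnOrder (a p r b : ℕ) : Prop :=
  (a < p ∧ p < r ∧ (b < a ∨ r < b)) ∨ (r < p ∧ p < a ∧ (a < b ∨ b < r))

variable {σ : Bool} {L U : Chords} {a p r b : ℕ}

theorem WF.turn (h : WF (sided σ (ch a p :: ch b r :: L) (ch p r :: U))) :
    WF (sided σ (ch a b :: L) U) := by
  rw [WF.sided_iff] at h ⊢; obtain ⟨⟨n1, l1⟩, ⟨n2, l2⟩, h3, h4⟩ := h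
  have p1 : (ends (ch a p :: ch b r :: L)).Perm (a :: p :: b :: r :: ends L) :=
    (ends_ch _ _ _).trans (((ends_ch _ _ _).cons _).cons _)
  have p2 := ends_ch p r U; have p3 := ends_ch a b L; rw [p1.nodup_iff] at n1
  rw [p2.nodup_iff] at n2; simp only [List.nodup_cons, List.mem_cons, not_or] at n1 n2
  have h3' : ∀ n, (n = a ∨ n = p ∨ n = b ∨ n = r ∨ n ∈ ends L) ↔ (n = p ∨ n = r ∨ n ∈ ends U) := by
    intro n; have := h3 n; rw [p1.mem_iff, p2.mem_iff] at this
    simpa only [List.mem_cons] using this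
  obtain ⟨⟨a1, a2, a3, a4⟩, ⟨a5, a6, a7⟩, ⟨a8, a9⟩, a10, a11⟩ := n1
  refine ⟨⟨?_, ?_⟩, ⟨n2.2.2, fun c hc => l2 c (by simp [hc])⟩, fun n => ?_, fun n hn => h4 n ?_⟩
  · rw [p3.nodup_iff]; simp only [List.nodup_cons, List.mem_cons, not_or]; exact ⟨⟨a2, a4⟩, a9, a11⟩
  · intro c hc; rcases List.mem_cons.1 hc with rfl | hc
    · unfold ch; split_ifs <;> simp only <;> omega
    · exact l1 c (by simp [hc])
  · rw [p3.mem_iff]; simp only [List.mem_cons]; have k := h3' n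
    have kp : n ∈ ends U → n ≠ p ∧ n ≠ r := fun h => ⟨fun e => n2.1.2 (e ▸ h), fun e => n2.2.1 (e ▸ h)⟩
    have kL : n ∈ ends L → n ≠ p ∧ n ≠ r := fun h => ⟨fun e => a7 (e ▸ h), fun e => a10 (e ▸ h)⟩
    constructor
    · rintro (rfl | rfl | h)
      · exact (k.1 (.inl rfl)).resolve_left a1 |>.resolve_left a3
      · exact (k.1 (.inr (.inr (.inl rfl)))).resolve_left (Ne.symm a5) |>.resolve_left a8
      · exact (k.1 (.inr (.inr (.inr (.inr h))))).resolve_left (kL h).1 |>.resolve_left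
          (kL h).2
    · intro h; rcases k.2 (.inr (.inr h)) with e | e | e | e | e
      · exact .inl e
      · exact absurd e (kp h).1
      · exact .inr (.inl e)
      · exact absurd e (kp h).2
      · exact .inr (.inr e)
  · rw [p3.mem_iff] at hn; rw [p1.mem_iff]; simp only [List.mem_cons] at hn ⊢
    rcases hn with hn | hn | hn <;> simp [hn]

theorem Planar.turn (hw : WF (sided σ (ch a p :: ch b r :: L) (ch p r :: U)))
    (h : Planar (sided σ (ch a p :: ch b r :: L) (ch p r :: U))) (ho : TurnOrder a p r b)
    (hn : ∀ n ∈ ends L, (n < p ↔ n < r)) : Planar (sided σ (ch a b :: L) U) := by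
  rw [Planar.sided_iff] at h ⊢; obtain ⟨h1, h2⟩ := h; rw [WF.sided_iff] at hw; have nd := hw.1.1
  rw [((ends_ch _ _ _).trans (((ends_ch _ _ _).cons _).cons _)).nodup_iff] at nd
  simp only [List.nodup_cons, List.mem_cons, not_or] at nd
  have key : ∀ d ∈ L, cross (ch a b) d = false := by
    intro d hd; have c1 := h1 (ch a p) (by simp) d (by simp [hd])
    have c2 := h1 (ch b r) (by simp) d (by simp [hd])
    have m1 : d.1 ∈ ends L := mem_ends.2 ⟨d, hd, .inl rfl⟩
    have m2 : d.2 ∈ ends L := mem_ends.2 ⟨d, hd, .inr rfl⟩; have n1 := hn _ m1; have n2 := hn _ m2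
    have k : ∀ n ∈ ends L, n ≠ a ∧ n ≠ p ∧ n ≠ b ∧ n ≠ r := fun n hn =>
      ⟨fun e => nd.1.2.2.2 (e ▸ hn), fun e => nd.2.1.2.2 (e ▸ hn), fun e => nd.2.2.1.2 (e ▸ hn),
        fun e => nd.2.2.2.1 (e ▸ hn)⟩
    obtain ⟨k1, k2, k3, k4⟩ := k _ m1; obtain ⟨k5, k6, k7, k8⟩ := k _ m2
    have dl := hw.1.2 d (by simp [hd]); rw [cross_eq_false] at c1 c2 ⊢; unfold ch at *
    rcases ho with ⟨o1, o2, o3 | o3⟩ | ⟨o1, o2, o3 | o3⟩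
    · rw [if_pos o1] at c1; rw [if_pos (by omega)] at c2; rw [if_neg (by omega)]; simp only at *
      omega
    · rw [if_pos o1] at c1; rw [if_neg (by omega)] at c2; rw [if_pos (by omega)]; simp only at *
      omega
    · rw [if_neg (by omega)] at c1; rw [if_neg (by omega)] at c2; rw [if_pos (by omega)]
      simp only at *; omega
    · rw [if_neg (by omega)] at c1; rw [if_pos (by omega)] at c2; rw [if_neg (by omega)]
      simp only at *; omega
  refine ⟨fun c hc d hd => ?_, fun c hc d hd => h2 c (by simp [hc]) d (by simp [hd])⟩
  rcases List.mem_cons.1 hc with rfl | hc <;> rcases List.mem_cons.1 hd with rfl | hd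
  · rw [cross_eq_false]; omega
  · exact key d hd
  · rw [cross_comm]; exact key c hc
  · exact h1 c (by simp [hc]) d (by simp [hd])




variable {σ : Bool} {L U : Chords} {a p r b : ℕ}

/-- The levels at which a turn is removed. -/
def turnLev (σ : Bool) (a p r b : ℕ) (s : Bool) (n : ℕ) : ℝ :=
  if n = p ∨ n = r ∨ (s = σ ∧ (n = a ∨ n = b)) then 1 / 2 else 1 / 4

theorem WF.realizes_of_planar {D : Diagram} (h : WF D) (hp : Planar D)
    {lev : Bool → ℕ → ℝ} (hl : ∀ s n, lev s n = 1 / 2 ∨ lev s n = 1 / 4) :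
    Realizes (stdConfig D lev (1 / 64)) D := by
  refine h.realizes (by norm_num) (fun s n _ => ?_) fun s => ?_
  · rcases hl s n with e | e <;> rw [e] <;> norm_num
  · refine List.pairwise_iff_forall_sublist.2 fun {a b} hab hc => ?_
    rw [hp s a (hab.subset (by simp)) b (hab.subset (by simp))] at hc; exact absurd hc (by simp)

theorem stdConfig_mate_ch {D : Diagram} (h : WF D) (lev : Bool → ℕ → ℝ) (w : ℝ)
    {s : Bool} {m n : ℕ} (hm : ch m n ∈ D s) :
    (stdConfig D lev w).mate s m = n ∧ (stdConfig D lev w).mate s n = m := by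
  obtain ⟨h1, h2, -⟩ := h.stdConfig_mates lev w s _ hm
  rcases ch_ends m n with ⟨e1, e2⟩ | ⟨e1, e2⟩ <;> rw [e1, e2] at h1 h2
  · exact ⟨h1, h2⟩
  · exact ⟨h2, h1⟩

theorem turnback (hD : WF (sided σ (ch a p :: ch b r :: L) (ch p r :: U)))
    (hD' : WF (sided σ (ch a b :: L) U)) (hp : Planar (sided σ (ch a p :: ch b r :: L) (ch p r :: U)))
    (hp' : Planar (sided σ (ch a b :: L) U)) (ho : TurnOrder a p r b)
    (hk : ∀ k : ℕ, 1 ≤ k → k ≤ 4 → (p < 32 * k ∧ r < 32 * k) ∨ (32 * k < p ∧ 32 * k < r)) :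
    ∃ μ, Turnback (stdConfig (sided σ (ch a p :: ch b r :: L) (ch p r :: U)) (turnLev σ a p r b)
      (1 / 64)) (stdConfig (sided σ (ch a b :: L) U) (turnLev σ a p r b) (1 / 64)) σ μ a p r b := by
  set D := sided σ (ch a p :: ch b r :: L) (ch p r :: U) with hDd
  set D' := sided σ (ch a b :: L) U with hDd'; set lev := turnLev σ a p r b with hlev
  have hl : ∀ s n, lev s n = 1 / 2 ∨ lev s n = 1 / 4 := fun s n => by
    rw [hlev]; unfold turnLev; split_ifs <;> simp
  have R := hD.realizes_of_planar hp hl; have R' := hD'.realizes_of_planar hp' hl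
  have Dσ : D σ = ch a p :: ch b r :: L := sided_self _ _ _
  have Dn : D (!σ) = ch p r :: U := sided_not _ _ _
  have Dσ' : D' σ = ch a b :: L := sided_self _ _ _; have Dn' : D' (!σ) = U := sided_not _ _ _
  have nd := (hD σ).1
  rw [Dσ, ((ends_ch _ _ _).trans (((ends_ch _ _ _).cons _).cons _)).nodup_iff] at nd
  simp only [List.nodup_cons, List.mem_cons, not_or] at nd
  have m1 := stdConfig_mate_ch hD lev (1 / 64) (s := σ) (m := a) (n := p) (by rw [Dσ]; simp)
  have m2 := stdConfig_mate_ch hD lev (1 / 64) (s := σ) (m := b) (n := r) (by rw [Dσ]; simp)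
  have m3 := stdConfig_mate_ch hD lev (1 / 64) (s := !σ) (m := p) (n := r) (by rw [Dn]; simp)
  have m4 := stdConfig_mate_ch hD' lev (1 / 64) (s := σ) (m := a) (n := b) (by rw [Dσ']; simp)
  have memD : ∀ n, n ∈ (stdConfig D lev (1 / 64)).N ↔ (n = a ∨ n = p ∨ n = b ∨ n = r ∨ n ∈ ends L) := by
    intro n
    rw [hD.mem_stdConfig lev _ σ, Dσ,
      ((ends_ch _ _ _).trans (((ends_ch _ _ _).cons _).cons _)).mem_iff]
    simp only [List.mem_cons]
  have memD' : ∀ n, n ∈ (stdConfig D' lev (1 / 64)).N ↔ (n = a ∨ n = b ∨ n ∈ ends L) := by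
    intro n; rw [hD'.mem_stdConfig lev _ σ, Dσ', (ends_ch _ _ _).mem_iff]; simp only [List.mem_cons]
  obtain ⟨⟨a1, a2, a3, a4⟩, ⟨a5, a6, a7⟩, ⟨a8, a9⟩, a10, a11⟩ := nd
  have common : ∀ s, ∀ c ∈ D s, c ∈ D' s → ∀ n, n = c.1 ∨ n = c.2 →
      (stdConfig D' lev (1 / 64)).mate s n = (stdConfig D lev (1 / 64)).mate s n := by
    intro s c hc hc' n hn; obtain ⟨e1, e2, -⟩ := hD.stdConfig_mates lev (1 / 64) s c hc
    obtain ⟨f1, f2, -⟩ := hD'.stdConfig_mates lev (1 / 64) s c hc'; rcases hn with rfl | rfl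
    · rw [e1, f1]
    · rw [e2, f2]
  have cast : ∀ {i j : ℕ}, i < j → (i : ℝ) / 32 < j / 32 := fun h => by
    have : ((_ : ℕ) : ℝ) < _ := Nat.cast_lt.2 h; linarith
  have gapc : ∀ k : ℕ, 1 ≤ k → k ≤ 4 → ((p : ℝ) / 32 < k ∧ (r : ℝ) / 32 < k) ∨
      ((k : ℝ) < p / 32 ∧ (k : ℝ) < r / 32) := by
    intro k k1 k2; rcases hk k k1 k2 with ⟨h1, h2⟩ | ⟨h1, h2⟩
    · left; have h1' : (p : ℝ) < 32 * k := by exact_mod_cast h1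
      have h2' : (r : ℝ) < 32 * k := by exact_mod_cast h2
      constructor <;> linarith
    · right; have h1' : (32 : ℝ) * k < p := by exact_mod_cast h1
      have h2' : (32 : ℝ) * k < r := by exact_mod_cast h2
      constructor <;> linarith
  obtain ⟨μ, hμ, ho1, ho2, ho3, hg⟩ : ∃ μ : ℝ, μ * μ = 1 ∧ μ * (a / 32) < μ * (p / 32) ∧
      μ * (p / 32) < μ * (r / 32) ∧ (μ * (b / 32) < μ * (a / 32) ∨ μ * (r / 32) < μ * (b / 32)) ∧
      ∀ k : ℕ, 1 ≤ k → k ≤ 4 → ∀ y : ℝ, μ * (p / 32) ≤ μ * y → μ * y ≤ μ * (r / 32) → y ≠ k := by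
    rcases ho with ⟨o1, o2, o3⟩ | ⟨o1, o2, o3⟩
    · refine ⟨1, by norm_num, ?_, ?_, ?_, fun k k1 k2 y y1 y2 e => ?_⟩
      · linarith [cast o1]
      · linarith [cast o2]
      · exact o3.imp (fun o => by linarith [cast o]) fun o => by linarith [cast o]
      · rcases gapc k k1 k2 with ⟨h1, h2⟩ | ⟨h1, h2⟩ <;> linarith
    · refine ⟨-1, by norm_num, ?_, ?_, ?_, fun k k1 k2 y y1 y2 e => ?_⟩
      · linarith [cast o2]
      · linarith [cast o1]
      · exact o3.imp (fun o => by linarith [cast o]) fun o => by linarith [cast o]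
      · rcases gapc k k1 k2 with ⟨h1, h2⟩ | ⟨h1, h2⟩ <;> linarith
  have hne : σ ≠ !σ := by simp
  refine ⟨μ, R.valid, R'.valid, hμ, fun n => ?_, ?_, rfl, rfl, rfl, rfl, fun _ _ => rfl,
    ⟨m1.1, m1.2, m2.2, m2.1⟩, m3, m4, fun n hn => ⟨?_, fun na nb => ?_⟩, ⟨ho1, ho2⟩, ho3, hg, ?_, ?_,
    fun n _ h1 h2 h3 h4 => ?_, fun n _ h1 h2 => ?_⟩
  · rw [memD, memD']; constructor
    · rintro (rfl | rfl | h)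
      · exact ⟨.inl rfl, a1, a3⟩
      · exact ⟨.inr (.inr (.inl rfl)), Ne.symm a5, a8⟩
      · exact ⟨.inr (.inr (.inr (.inr h))), fun e => a7 (e ▸ h), fun e => a10 (e ▸ h)⟩
    · rintro ⟨h | h | h | h | h, h1, h2⟩
      · exact .inl h
      · exact absurd h h1
      · exact .inr (.inl h)
      · exact absurd h h2
      · exact .inr (.inr h)
  · simp only [memD, or_true, true_or, and_self]
  · obtain ⟨c, hc, hnc⟩ := mem_ends.1 ((hD'.mem_stdConfig lev _ (!σ) n).1 hn)
    exact common _ c (by rw [Dn]; rw [Dn'] at hc; simp [hc]) hc n hnc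
  · obtain ⟨c, hc, hnc⟩ := mem_ends.1 (((memD' n).1 hn).resolve_left na |>.resolve_left nb)
    exact common _ c (by rw [Dσ]; simp [hc]) (by rw [Dσ']; simp [hc]) n hnc
  · simp [stdConfig, hlev, turnLev]
  · simp [stdConfig, hlev, turnLev]
  · simp only [stdConfig, hlev, turnLev]; rw [if_neg]; rintro (h | h | ⟨-, h | h⟩) <;> contradiction
  · simp only [stdConfig, hlev, turnLev]; rw [if_neg]; rintro (h | h | ⟨h, -⟩)
    · contradiction
    · contradiction
    · exact hne h.symm

/-- A turn may be removed from a planar diagram. -/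
theorem sk_turn (R : Type*) [CommRing R] (q : Rˣ)
    (hD : WF (sided σ (ch a p :: ch b r :: L) (ch p r :: U)))
    (hp : Planar (sided σ (ch a p :: ch b r :: L) (ch p r :: U))) (ho : TurnOrder a p r b)
    (hn : ∀ n ∈ ends L, (n < p ↔ n < r))
    (hk : ∀ k : ℕ, 1 ≤ k → k ≤ 4 → (p < 32 * k ∧ r < 32 * k) ∨ (32 * k < p ∧ 32 * k < r)) :
    sk R q (sided σ (ch a p :: ch b r :: L) (ch p r :: U)) = sk R q (sided σ (ch a b :: L) U) := by
  have hD' := hD.turn; have hp' := hp.turn hD ho hn; obtain ⟨μ, h⟩ := turnback hD hD' hp hp' ho hk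
  have hl : ∀ s n, turnLev σ a p r b s n = 1 / 2 ∨ turnLev σ a p r b s n = 1 / 4 := fun s n => by
    unfold turnLev; split_ifs <;> simp
  rw [(hD.realizes_of_planar hp hl).sk_eq, (hD'.realizes_of_planar hp' hl).sk_eq]
  exact h.isotopic.toSkein_eq R q




/-! ### Links in a horizontal plane -/

/-- The points over `S` whose distance from the height `1/2` is at most `W`. -/
def slab (S : Set ℂ) (W : ℝ) : Set 𝕊 := {p | p.1 ∈ S ∧ |p.2 - 1 / 2| ≤ W}

/-- An isotopy of the plane along straight lines. -/
theorem exists_planar_isotopy {X : Type*} [TopologicalSpace X] [CompactSpace X] {F G : X → ℂ}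
    (hF : Continuous F) (hG : Continuous G)
    (hlip : ∀ τ ∈ 𝕀, ∃ C : ℝ, 0 ≤ C ∧ ∀ a b, ‖G a - G b‖ ≤ C * ‖(F a + τ • G a) - (F b + τ • G b)‖)
    (hin : ∀ τ ∈ 𝕀, ∀ a, F a + τ • G a ∉ punctures) {w : ℝ} (hw : w < 1 / 2) :
    ∃ φ, IsotopicToId φ ∧
      ∀ W ≤ w, φ '' slab (range F) W = slab (range fun a => F a + G a) W := by
  obtain ⟨φ, hφ, hφF⟩ := exists_linear_isotopy
    (fun a : X × Icc (1 / 2 - w) (1 / 2 + w) => (F a.1, (a.2 : ℝ)))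
    (fun a => (G a.1, 0)) (by fun_prop) (by fun_prop) (by
      intro τ hτ; obtain ⟨C, hC, h⟩ := hlip τ hτ; refine ⟨C, fun a b => ?_⟩
      have e : ‖((G a.1, 0) : 𝕊) - (G b.1, 0)‖ = ‖G a.1 - G b.1‖ := by simp [Prod.norm_def]
      rw [e]; exact (h a.1 b.1).trans (mul_le_mul_of_nonneg_left (le_max_left _ _) hC)) (by
      intro τ hτ a; have h := a.2.2
      refine ⟨hin τ hτ a.1, ?_, ?_⟩ <;> simp <;> linarith [h.1, h.2])
  refine ⟨φ, hφ, fun W hW => ?_⟩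
  have key : ∀ a : X, ∀ z : ℝ, |z - 1 / 2| ≤ W → φ (F a, z) = (F a + G a, z) := by
    intro a z hz; have hz' := abs_le.1 hz; simpa using hφF (a, ⟨z, by linarith, by linarith⟩)
  ext ⟨y, z⟩; constructor
  · rintro ⟨⟨_, z'⟩, ⟨⟨a, rfl⟩, hz⟩, e⟩; rw [key a z' hz] at e; obtain ⟨rfl, rfl⟩ := Prod.mk.inj e
    exact ⟨⟨a, rfl⟩, hz⟩
  · rintro ⟨⟨a, rfl⟩, hz⟩; exact ⟨(F a, z), ⟨⟨a, rfl⟩, hz⟩, key a z hz⟩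

/-- A configuration in a horizontal plane. -/
theorem Realizes.body_eq_slab {c : Config} {D : Diagram} (h : Realizes c D)
    (hlev : ∀ s n, c.lev s n = 1 / 2) {W : ℝ} (hW : 0 ≤ W) : c.body W =
      slab {z | (∃ n ∈ c.N, |z.im| ≤ 1 ∧
          z.re = (c.x false n + c.x true n + z.im * (c.x true n - c.x false n)) / 2) ∨
        ∃ s, ∃ a ∈ D s, c.x s a.1 ≤ z.re ∧ z.re ≤ c.x s a.2 ∧
          sg s * z.im = 1 + min (z.re - c.x s a.1) (c.x s a.2 - z.re)} W := by
  ext ⟨z, y⟩; simp only [Config.body, mem_iUnion]; constructor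
  · rintro ⟨_ | s, n, hn, hp⟩
    · obtain ⟨t, ⟨t0, t1⟩, e1, e2, e3⟩ := (Config.mem_ramp hW).1 hp; simp only [hlev] at e1 e2 e3
      refine ⟨.inl ⟨n, hn, abs_le.2 ⟨by linarith, by linarith⟩, ?_⟩, by convert e3 using 2; ring⟩
      rw [e2, e1]; ring
    · obtain ⟨t, ⟨t0, t1⟩, e1, e2, e3⟩ := (Config.mem_arm hW).1 hp; simp only [hlev] at e1 e2 e3
      refine ⟨.inr ⟨s, ?_⟩, by convert e3 using 2; ring⟩; obtain ⟨a, ha, hna⟩ := h.exists_chord s hn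
      obtain ⟨m1, m2⟩ := h.mem_of_chord s ha; have lt := h.x_mono s _ m1 _ m2 (h.mates s a ha).2.2
      refine ⟨a, ha, ?_⟩
      have e2' : sg s * z.im = 1 + t * (|c.x s n - c.x s (c.mate s n)| / 2) := by
        rw [e2, ← mul_assoc, sg_mul_self, one_mul]
      rcases hna with ⟨rfl, hm⟩ | ⟨rfl, hm⟩ <;> rw [hm] at e1 e2'
      · rw [abs_of_neg (by linarith)] at e2'; refine ⟨by nlinarith, by nlinarith, ?_⟩
        rw [e2', min_eq_left (by nlinarith), e1]; ring
      · rw [abs_of_pos (by linarith)] at e2'; refine ⟨by nlinarith, by nlinarith, ?_⟩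
        rw [e2', min_eq_right (by nlinarith), e1]; ring
  · rintro ⟨⟨n, hn, e1, e2⟩ | ⟨s, a, ha, e1, e2, e3⟩, hy⟩
    · obtain ⟨i1, i2⟩ := abs_le.1 e1
      refine ⟨none, n, hn, (Config.mem_ramp hW).2 ⟨(z.im + 1) / 2, ⟨by linarith, by linarith⟩, ?_,
        by ring, ?_⟩⟩
      · refine e2.trans ?_; simp only; ring
      · simp only [hlev]; convert hy using 2; ring
    · obtain ⟨m1, m2⟩ := h.mem_of_chord s ha; obtain ⟨c1, c2, hlt⟩ := h.mates s a ha
      have lt := h.x_mono s _ m1 _ m2 hlt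
      have e3' : z.im = sg s * (1 + min (z.re - c.x s a.1) (c.x s a.2 - z.re)) := by
        rw [← e3, ← mul_assoc, sg_mul_self, one_mul]
      set ℓ := (c.x s a.2 - c.x s a.1) / 2 with hℓ; have hℓ0 : 0 < ℓ := by linarith
      rcases le_total (z.re - c.x s a.1) (c.x s a.2 - z.re) with hle | hle
      · rw [min_eq_left hle] at e3'
        refine ⟨some s, a.1, m1, (Config.mem_arm hW).2 ⟨(z.re - c.x s a.1) / ℓ,
          ⟨by apply div_nonneg <;> linarith, by rw [div_le_one hℓ0]; linarith⟩, ?_, ?_, ?_⟩⟩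
        · simp only [c1, ← hℓ]; field_simp; ring
        · simp only [c1, abs_of_neg (by linarith : c.x s a.1 - c.x s a.2 < 0), neg_sub, ← hℓ, e3']
          field_simp
        · simp only [hlev]; convert hy using 2; ring
      · rw [min_eq_right hle] at e3'
        refine ⟨some s, a.2, m2, (Config.mem_arm hW).2 ⟨(c.x s a.2 - z.re) / ℓ,
          ⟨by apply div_nonneg <;> linarith, by rw [div_le_one hℓ0]; linarith⟩, ?_, ?_, ?_⟩⟩
        · rw [c2, show (c.x s a.1 - c.x s a.2) / 2 = -ℓ by rw [hℓ]; ring]; field_simp; ring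
        · simp only [c2, abs_of_pos (by linarith : 0 < c.x s a.2 - c.x s a.1), ← hℓ, e3']
          field_simp
        · simp only [hlev]; convert hy using 2; ring




/-! ### The trivial circle -/

/-- Rescaling unit vectors by factors bounded below does not bring them much closer. -/
theorem mul_norm_circle_sub_le {m R R' : ℝ} (hm : 0 ≤ m) (hR : m ≤ R) (hR' : m ≤ R')
    (θ θ' : Circle) : m * ‖(θ : ℂ) - θ'‖ ≤ ‖R • (θ : ℂ) - R' • (θ' : ℂ)‖ := by
  refine le_of_sq_le_sq ?_ (norm_nonneg _); have h1 := Circle.normSq_coe θ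
  have h2 := Circle.normSq_coe θ'
  rw [mul_pow, ← Complex.normSq_eq_norm_sq, ← Complex.normSq_eq_norm_sq]
  rw [Complex.normSq_apply] at *; rw [Complex.normSq_apply]
  simp only [Complex.sub_re, Complex.sub_im, Complex.smul_re, Complex.smul_im, smul_eq_mul]
  set a := (θ : ℂ).re; set b := (θ : ℂ).im; set a' := (θ' : ℂ).re; set b' := (θ' : ℂ).im
  have e : (R * a - R' * a') * (R * a - R' * a') + (R * b - R' * b') * (R * b - R' * b') =
      (R - R') ^ 2 + R * R' * ((a - a') * (a - a') + (b - b') * (b - b')) := by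
    linear_combination (R ^ 2 - R * R') * h1 + (R' ^ 2 - R * R') * h2
  rw [e]; have i1 : m ^ 2 ≤ R * R' := by nlinarith
  have i2 : 0 ≤ (a - a') * (a - a') + (b - b') * (b - b') :=
    add_nonneg (mul_self_nonneg _) (mul_self_nonneg _)
  nlinarith [mul_le_mul_of_nonneg_right i1 i2, sq_nonneg (R - R')]

/-- The gauge of a hexagon. -/
def hexGauge (h : ℝ) (z : ℂ) : ℝ := max (|z.re| / h) ((|z.re| + |z.im|) / (1 + h))

theorem abs_hexGauge_sub_le {h : ℝ} (hh : 0 < h) (z z' : ℂ) :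
    |hexGauge h z - hexGauge h z'| ≤ (1 / h + 2) * ‖z - z'‖ := by
  have h1 := Complex.abs_re_le_norm (z - z'); have h2 := Complex.abs_im_le_norm (z - z')
  have h3 := abs_abs_sub_abs_le_abs_sub z.re z'.re; have h4 := abs_abs_sub_abs_le_abs_sub z.im z'.im
  rw [Complex.sub_re] at h1; rw [Complex.sub_im] at h2; have hn := norm_nonneg (z - z')
  have hi : 0 < 1 / h := by positivity
  refine (abs_max_sub_max_le_max _ _ _ _).trans (max_le ?_ ?_)
  · rw [← sub_div, abs_div, abs_of_pos hh, div_eq_mul_one_div, mul_comm]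
    nlinarith [mul_le_mul_of_nonneg_left (h3.trans h1) hi.le]
  · rw [← sub_div, abs_div, abs_of_pos (by linarith : 0 < 1 + h), div_le_iff₀ (by linarith)]
    have : |(|z.re| + |z.im|) - (|z'.re| + |z'.im|)| ≤ 2 * ‖z - z'‖ := by
      rw [add_sub_add_comm]; exact (abs_add_le _ _).trans (by linarith)
    have : 0 ≤ 1 / h * ‖z - z'‖ := by positivity
    nlinarith

theorem norm_le_hexGauge {h : ℝ} (hh : 0 < h) (z : ℂ) : ‖z‖ ≤ (1 + h) * hexGauge h z := by
  have h1 : (|z.re| + |z.im|) / (1 + h) ≤ hexGauge h z := le_max_right _ _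
  rw [div_le_iff₀ (by linarith)] at h1; linarith [Complex.norm_le_abs_re_add_abs_im z]

theorem hexGauge_smul {h t : ℝ} (ht : 0 ≤ t) (z : ℂ) : hexGauge h (t • z) = t * hexGauge h z := by
  simp only [hexGauge, Complex.smul_re, Complex.smul_im, smul_eq_mul, abs_mul, abs_of_nonneg ht]
  rw [mul_max_of_nonneg _ _ ht, ← mul_add, mul_div_assoc, mul_div_assoc]

/-- A hexagon may be deformed into a circle. -/
theorem exists_hexagon_isotopy {h x₀ : ℝ} (hh : 0 < h)
    (hx : ∀ k : ℕ, 1 ≤ k → k ≤ 4 → ∀ x : ℝ, |x| ≤ h → x₀ + x ≠ k) {w : ℝ} (hw : w < 1 / 2) :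
    ∃ φ, IsotopicToId φ ∧ ∀ W ≤ w, φ '' slab {z | hexGauge h (z - x₀) = 1} W =
      slab {z | ‖z - x₀‖ = h / 2} W := by
  let g : Circle → ℝ := fun θ => hexGauge h θ
  have pos : ∀ θ : Circle, 1 / (1 + h) ≤ g θ := fun θ => by
    have := norm_le_hexGauge hh θ; rw [Circle.norm_coe] at this; rwa [div_le_iff₀' (by linarith)]
  have hm : 0 < 1 / (1 + h) := by positivity
  have pos' : ∀ θ : Circle, 0 < g θ := fun θ => hm.trans_le (pos θ)
  have inv_le : ∀ θ : Circle, (g θ)⁻¹ ≤ 1 + h := fun θ => by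
    rw [inv_le_comm₀ (pos' θ) (by linarith), inv_eq_one_div]; exact pos θ
  have bd : ∀ θ : Circle, g θ ≤ 1 / h + 2 := fun θ => by
    have := abs_hexGauge_sub_le hh θ 0; have h0 : hexGauge h 0 = 0 := by simp [hexGauge]
    rw [h0, sub_zero, sub_zero, Circle.norm_coe, mul_one] at this; exact (le_abs_self _).trans this
  set M := 1 / h + 2 with hM; have hM0 : 0 < M := by positivity
  have cont : Continuous fun θ : Circle => (g θ)⁻¹ := by
    refine Continuous.inv₀ ?_ fun θ => (pos' θ).ne'; simp only [g, hexGauge]; fun_prop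
  have dir : ∀ z : ℂ, z ≠ 0 → ∃ θ : Circle, z = ‖z‖ • (θ : ℂ) := fun z hz => by
    have hz' := norm_ne_zero_iff.2 hz
    refine ⟨⟨(‖z‖⁻¹ : ℝ) • z, by simp [Submonoid.unitSphere, norm_smul, hz']⟩, ?_⟩
    change z = ‖z‖ • (‖z‖⁻¹ : ℝ) • z; rw [smul_smul, mul_inv_cancel₀ hz', one_smul]
  have rad : ∀ (τ : ℝ) (θ : Circle), ((x₀ : ℂ) + (g θ)⁻¹ • (θ : ℂ)) +
      τ • ((h / 2 - (g θ)⁻¹) • (θ : ℂ)) =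
      x₀ + ((1 - τ) * (g θ)⁻¹ + τ * (h / 2)) • (θ : ℂ) := fun τ θ => by module
  obtain ⟨φ, hφ, h1⟩ := exists_planar_isotopy
    (F := fun θ : Circle => (x₀ : ℂ) + (g θ)⁻¹ • (θ : ℂ))
    (G := fun θ : Circle => (h / 2 - (g θ)⁻¹) • (θ : ℂ)) (by fun_prop) (by fun_prop) (by
      rintro τ ⟨t0, t1⟩; set m := min M⁻¹ (h / 2)
      have m0 : 0 < m := lt_min (by positivity) (by linarith)
      refine ⟨((1 + h) ^ 2 * M + (h + (1 + h))) * m⁻¹, by positivity, fun a b => ?_⟩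
      have low : ∀ θ : Circle, m ≤ (1 - τ) * (g θ)⁻¹ + τ * (h / 2) := fun θ => by
        have i1 : m ≤ (g θ)⁻¹ :=
          (min_le_left _ _).trans (inv_anti₀ (pos' θ) (bd θ))
        nlinarith [min_le_right M⁻¹ (h / 2), i1]
      have k1 := mul_norm_circle_sub_le m0.le (low a) (low b) a b
      rw [rad, rad, add_sub_add_left_eq_sub, mul_assoc]; rw [← le_inv_mul_iff₀ m0] at k1
      have k2 : |(g b)⁻¹ - (g a)⁻¹| ≤ (1 + h) ^ 2 * M * ‖(a : ℂ) - b‖ := by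
        rw [inv_sub_inv (pos' b).ne' (pos' a).ne', abs_div, abs_of_pos (mul_pos (pos' b) (pos' a)),
          div_eq_mul_inv, mul_inv, mul_comm]
        have j := abs_hexGauge_sub_le hh a b
        have j1 : (g b)⁻¹ * (g a)⁻¹ ≤ (1 + h) ^ 2 := by
          rw [sq]; exact mul_le_mul (inv_le b) (inv_le a) (inv_pos.2 (pos' a)).le (by linarith)
        rw [mul_assoc ((1 + h) ^ 2)]; exact mul_le_mul j1 j (abs_nonneg _) (by positivity)
      have e : (h / 2 - (g a)⁻¹) • (a : ℂ) - (h / 2 - (g b)⁻¹) • (b : ℂ) =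
          ((g b)⁻¹ - (g a)⁻¹) • (b : ℂ) +
            (h / 2 - (g a)⁻¹) • ((a : ℂ) - b) := by module
      have k3 : |h / 2 - (g a)⁻¹| ≤ h + (1 + h) := by
        rw [abs_le]; constructor <;> linarith [inv_le a, inv_pos.2 (pos' a)]
      refine le_trans ?_ (mul_le_mul_of_nonneg_left k1 (by positivity)); rw [e, add_mul]
      refine (norm_add_le _ _).trans (add_le_add ?_ ?_) <;> rw [norm_smul, Real.norm_eq_abs]
      · rwa [Circle.norm_coe, mul_one]
      · exact mul_le_mul_of_nonneg_right k3 (norm_nonneg _)) (by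
      rintro τ ⟨t0, t1⟩ θ hp; rw [rad] at hp; have i1 : |(θ : ℂ).re| / h ≤ g θ := le_max_left _ _
      have i2 : (g θ)⁻¹ * |(θ : ℂ).re| ≤ h := by
        rw [inv_mul_le_iff₀ (pos' θ)]; rwa [div_le_iff₀ hh] at i1
      have i3 : |(θ : ℂ).re| ≤ 1 := by
        have := Complex.abs_re_le_norm (θ : ℂ); rwa [Circle.norm_coe] at this
      have i4 := inv_pos.2 (pos' θ)
      have key : |((1 - τ) * (g θ)⁻¹ + τ * (h / 2)) * (θ : ℂ).re| ≤ h := by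
        rw [abs_mul, abs_of_nonneg (add_nonneg (mul_nonneg (by linarith) i4.le) (by positivity)),
          add_mul]
        nlinarith [mul_le_mul_of_nonneg_left i2 (sub_nonneg.2 t1),
          mul_le_mul_of_nonneg_left i3 (mul_nonneg t0 hh.le)]
      refine (mem_thickened_of_re (p := (_, 1 / 2)) (fun k k1 k2 => ?_) (by norm_num)
        (by norm_num)).1 hp
      simpa using hx k k1 k2 _ key) hw
  refine ⟨φ, hφ, fun W hW => ?_⟩; convert h1 W hW using 2
  · congr 1; ext z; constructor
    · intro (hz : hexGauge h (z - x₀) = 1)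
      obtain ⟨θ, hθ⟩ := dir (z - x₀) fun h0 => by simp [h0, hexGauge] at hz
      have hn := norm_nonneg (z - x₀); rw [hθ, hexGauge_smul hn] at hz; change _ * g θ = 1 at hz
      exact ⟨θ, by simp only [← eq_inv_of_mul_eq_one_left hz, ← hθ]; ring⟩
    · rintro ⟨θ, rfl⟩; change hexGauge h _ = 1
      rw [add_sub_cancel_left, hexGauge_smul (inv_pos.2 (pos' θ)).le, inv_mul_cancel₀ (pos' θ).ne']
  · ext z; constructor
    · intro (hz : ‖z - x₀‖ = h / 2)
      obtain ⟨θ, hθ⟩ := dir (z - x₀) fun h0 => by simp [h0] at hz; linarith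
      refine ⟨θ, ?_⟩; have := rad 1 θ
      simp only [one_smul, sub_self, zero_mul, zero_add, one_mul] at this; rw [hz] at hθ
      exact this.trans (by rw [← hθ]; ring)
    · rintro ⟨θ, rfl⟩; have := rad 1 θ
      simp only [one_smul, sub_self, zero_mul, zero_add, one_mul] at this; change ‖_ - (x₀ : ℂ)‖ = _
      simp only [this, add_sub_cancel_left, norm_smul, Circle.norm_coe, mul_one, Real.norm_eq_abs]
      exact abs_of_pos (by linarith)

theorem min_sub_sub {x a b m r : ℝ} (ha : a = m - r) (hb : b = m + r) :
    min (x - a) (b - x) = r - |x - m| := by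
  rcases abs_cases (x - m) with ⟨e, _⟩ | ⟨e, _⟩ <;> rw [e]
  · rw [min_eq_right] <;> linarith
  · rw [min_eq_left] <;> linarith

/-- A circle that encloses no puncture is a scalar. -/
theorem sk_loop (R : Type*) [CommRing R] (q : Rˣ) {p r : ℕ} (hpr : p < r)
    (hk : ∀ k : ℕ, 1 ≤ k → k ≤ 4 → (p < 32 * k ∧ r < 32 * k) ∨ (32 * k < p ∧ 32 * k < r)) :
    sk R q (dg [(p, r)] [(p, r)]) =
      (-((q : R) ^ 2 + ((q⁻¹ : Rˣ) : R) ^ 2)) • (1 : SkeinAlgebra R q) := by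
  have hpr' : (p : ℝ) < r := Nat.cast_lt.2 hpr; set D := dg [(p, r)] [(p, r)] with hD
  have Ds : ∀ s, D s = [(p, r)] := fun s => by cases s <;> rfl
  have wf : WF D := fun s => by
    rw [Ds, Ds]; have k1 := hk 1 (by norm_num) (by norm_num)
    have k2 := hk 2 (by norm_num) (by norm_num); have k3 := hk 3 (by norm_num) (by norm_num)
    have k4 := hk 4 (by norm_num) (by norm_num); simp [ends]; omega
  have pl : Planar D := fun s => by rw [Ds]; simp [cross]
  have rz := wf.realizes_of_planar pl (lev := fun _ _ => 1 / 2) fun _ _ => .inl rfl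
  set h : ℝ := (r - p) / 64 with hh; set x₀ : ℝ := (r + p) / 64 with hx₀
  have h0 : 0 < h := by linarith
  set Ch := chart x₀ h (1 / 2) (1 / 16); set Sl := slab {z | ‖z - x₀‖ = h / 2}
  set Cf := stdConfig D (fun _ _ => 1 / 2) (1 / 64)
  have shape : ∀ W, 0 ≤ W → Cf.body W =
      slab {z | hexGauge h (z - x₀) = 1} W := by
    intro W hW; rw [rz.body_eq_slab (fun _ _ => rfl) hW]; congr 1; ext z
    simp only [mem_ofPred_eq, Ds, List.mem_singleton, exists_eq_left, Bool.exists_bool, rz.mem_iff true,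
      mem_ends, Cf, stdConfig, sg, hexGauge, Complex.sub_re,
      Complex.sub_im, Complex.ofReal_re, Complex.ofReal_im, sub_zero, sub_self, mul_zero, add_zero]
    have ep : (p : ℝ) / 32 = x₀ - h := by rw [hh, hx₀]; ring
    have er : (r : ℝ) / 32 = x₀ + h := by rw [hh, hx₀]; ring
    rw [ep, er, min_sub_sub rfl rfl, max_eq_iff, div_eq_one_iff_eq h0.ne', div_eq_one_iff_eq (by linarith)]
    constructor
    · rintro (⟨n, hn, e1, e2⟩ | ⟨e1, e2, e3⟩ | ⟨e1, e2, e3⟩)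
      · have e : |z.re - x₀| = h := by
          simp only [ends, List.flatMap_cons, List.flatMap_nil, List.append_nil, List.toFinset_cons,
            List.toFinset_nil, Finset.mem_insert, insert_empty_eq, Finset.mem_singleton] at hn
          rcases hn with rfl | rfl
          · rw [abs_of_neg] <;> linarith
          · rw [abs_of_pos] <;> linarith
        refine .inl ⟨e, ?_⟩; rw [e, div_self h0.ne', div_le_one (by linarith)]; linarith
      all_goals
        have i1 : |z.re - x₀| ≤ h := abs_le.2 ⟨by linarith, by linarith⟩
        have i2 : |z.re - x₀| + |z.im| = 1 + h := by
          first
          | rw [abs_of_pos (a := z.im) (by linarith)]; linarith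
          | rw [abs_of_neg (a := z.im) (by linarith)]; linarith
        refine .inr ⟨i2, ?_⟩; rwa [i2, div_self (by linarith), div_le_one h0]
    · rintro (⟨e1, e2⟩ | ⟨e1, e2⟩)
      · rw [e1, div_self h0.ne', div_le_one (by linarith)] at e2
        have hy : |z.im| ≤ 1 := by linarith
        rcases abs_cases (z.re - x₀) with ⟨e, _⟩ | ⟨e, _⟩
        · exact .inl ⟨r, by simp [ends], hy, by linarith⟩
        · exact .inl ⟨p, by simp [ends], hy, by linarith⟩
      · rw [e1, div_self (by linarith), div_le_one h0] at e2; obtain ⟨i1, i2⟩ := abs_le.1 e2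
        rcases abs_cases z.im with ⟨e, _⟩ | ⟨e, _⟩
        · exact .inr (.inr ⟨by linarith, by linarith, by linarith⟩)
        · exact .inr (.inl ⟨by linarith, by linarith, by linarith⟩)
  have hxk : ∀ k : ℕ, 1 ≤ k → k ≤ 4 → ∀ x : ℝ, |x| ≤ h → x₀ + x ≠ k := by
    intro k k1 k2 x hx e; obtain ⟨i1, i2⟩ := abs_le.1 hx; rcases hk k k1 k2 with ⟨j1, j2⟩ | ⟨j1, j2⟩
    · have : (r : ℝ) < 32 * k := by exact_mod_cast j2
      linarith
    · have : (32 : ℝ) * k < p := by exact_mod_cast j1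
      linarith
  obtain ⟨φ, hφ, hφs⟩ := exists_hexagon_isotopy h0 hxk (w := 1 / 64) (by norm_num)
  change ∀ W ≤ _, _ = Sl W at hφs; set L := Cf.link rz.valid with hL
  let L' : FramedLink := ⟨_, _, L.isFramedLink.image hφ⟩
  have c' : L'.core = Sl 0 := by
    rw [← hφs 0 (by norm_num), ← shape 0 le_rfl]; rfl
  have b' : L'.band = Sl (1 / 64) := by
    rw [← hφs _ le_rfl, ← shape _ (by norm_num)]; rfl
  have iso : Isotopic L L' := ⟨φ, hφ, rfl, rfl⟩
  rw [rz.sk_eq R q, ← hL, iso.toSkein_eq R q]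
  have img : ∀ W, Ch '' smallCircle W =
      Sl (W / 16) := by
    intro W; ext p; rw [mem_chart (by exact_mod_cast h0.ne') (by norm_num)]
    refine and_congr ?_ ?_ <;> simp only [mem_ofPred_eq]
    · rw [norm_div, Complex.norm_real, Real.norm_of_nonneg h0.le, div_eq_iff h0.ne']
      exact ⟨fun e => e.trans (by ring), fun e => e.trans (by ring)⟩
    · rw [abs_div, abs_of_pos (by norm_num : (0 : ℝ) < 1 / 16), div_le_iff₀ (by norm_num)]; ring_nf
  have sub : ∀ W ≤ 1 / 4, Ch '' smallCircle W ⊆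
      Ch '' cube 1 := by
    intro W hW; refine image_mono fun p hp => ⟨?_, ?_, hp.2.trans (by linarith)⟩
    · exact (Complex.abs_re_le_norm _).trans (by rw [hp.1]; norm_num)
    · exact (Complex.abs_im_le_norm _).trans (by rw [hp.1]; norm_num)
  have pair : IsLoopPair L' emptyLink := by
    have e0 : L'.core = Ch '' smallCircle 0 := by rw [img, c']; norm_num
    have e1 : L'.band = Ch '' smallCircle (1 / 4) := by
      rw [img, b']; norm_num
    refine ⟨x₀, h, 1 / 2, 1 / 16, by exact_mod_cast h0.ne', by norm_num, ?_, ⟨?_, ?_⟩, ⟨?_, ?_⟩, ?_, ?_⟩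
    · rintro _ ⟨⟨z, y⟩, ⟨e1, e2, e3⟩, rfl⟩; obtain ⟨i1, i2⟩ := abs_le.1 e3; simp only at e1 i1 i2
      refine mem_thickened_of_re (fun k k1 k2 => ?_) ?_ ?_ <;> simp only [chart]
      · have := hxk k k1 k2 (h * z.re) (by rw [abs_mul, abs_of_pos h0]; nlinarith); simpa using this
      · linarith
      · linarith
    · rw [e0]; exact inter_eq_left.2 (sub 0 (by norm_num))
    · rw [e1]; exact inter_eq_left.2 (sub _ le_rfl)
    · simp [emptyLink]
    · simp [emptyLink]
    · rw [e0, sdiff_eq_empty.2 (sub 0 (by norm_num))]; simp [emptyLink]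
    · rw [e1, sdiff_eq_empty.2 (sub _ le_rfl)]; simp [emptyLink]
  have := RingQuot.mkAlgHom_rel R (SkeinRel.loop (s := q) L' emptyLink pair); rw [map_smul] at this
  refine this.trans ?_; congr 1; exact map_one _




/-! ### The generators as chord diagrams -/

/-- A function on the real line is Lipschitz, with some constant. -/
def Lip (f : ℝ → ℝ) : Prop := ∃ K, 0 ≤ K ∧ ∀ x y, |f x - f y| ≤ K * |x - y|

theorem lip_const (a : ℝ) : Lip fun _ => a := ⟨0, le_rfl, fun x y => by simp⟩

theorem lip_add {f g : ℝ → ℝ} : Lip f → Lip g → Lip fun x => f x + g x := by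
  rintro ⟨K, hK, h⟩ ⟨K', hK', h'⟩; refine ⟨K + K', by positivity, fun x y => ?_⟩
  rw [add_sub_add_comm, add_mul]; exact (abs_add_le _ _).trans (add_le_add (h x y) (h' x y))

theorem lip_const_mul {f : ℝ → ℝ} (a : ℝ) : Lip f → Lip fun x => a * f x := by
  rintro ⟨K, hK, h⟩; refine ⟨|a| * K, by positivity, fun x y => ?_⟩
  rw [← mul_sub, abs_mul, mul_assoc]; exact mul_le_mul_of_nonneg_left (h x y) (abs_nonneg a)

theorem lip_max {f g : ℝ → ℝ} : Lip f → Lip g → Lip fun x => max (f x) (g x) := by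
  rintro ⟨K, hK, h⟩ ⟨K', hK', h'⟩; refine ⟨K + K', by positivity, fun x y => ?_⟩
  have := abs_nonneg (x - y)
  refine (abs_max_sub_max_le_max _ _ _ _).trans (max_le ((h x y).trans ?_) ((h' x y).trans ?_)) <;>
    nlinarith

theorem lip_min {f g : ℝ → ℝ} (hf : Lip f) (hg : Lip g) : Lip fun x => min (f x) (g x) := by
  have := lip_const_mul (-1) (lip_max (lip_const_mul (-1) hf) (lip_const_mul (-1) hg))
  simpa [max_neg_neg] using this

theorem lip_abs_sub (a : ℝ) : Lip fun x => |x - a| := ⟨1, zero_le_one, fun x y => by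
  simpa using abs_abs_sub_abs_le_abs_sub (x - a) (y - a)⟩

theorem lip_dip (I : Finset ℕ) : Lip (dip I) := by
  have : ∀ J : Finset ℕ, Lip fun x => ∑ j ∈ J, max 0 (1 - |x - (j : ℝ)|) := by
    intro J
    induction J using Finset.induction_on with
    | empty => simpa using lip_const 0
    | insert j J hj ih =>
      simp only [Finset.sum_insert hj, sub_eq_add_neg (1 : ℝ)]
      refine lip_add (lip_max (lip_const 0) (lip_add (lip_const 1) ?_)) ih
      simpa using lip_const_mul (-1) (lip_abs_sub j)
  have e : dip I = fun x => -∑ j ∈ Finset.Icc 1 4 \ I, max 0 (1 - |x - (j : ℝ)|) := rfl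
  simpa [e] using lip_const_mul (-1) (this (Finset.Icc 1 4 \ I))

theorem Lip.continuous {f : ℝ → ℝ} : Lip f → Continuous f := fun ⟨K, hK, h⟩ =>
  (LipschitzWith.of_dist_le_mul (K := ⟨K, hK⟩) fun x y => h x y).continuous

/-- The boundary of a rectangle. -/
def rim : Set (ℝ × ℝ) := {p | |p.1 - 5 / 2| ≤ 2 ∧ |p.2| ≤ 1 ∧ (|p.1 - 5 / 2| = 2 ∨ |p.2| = 1)}

/-- The boundary of the region between the graphs of `m - g` and `m + g`. -/
def rimPt (m g : ℝ → ℝ) (p : ℝ × ℝ) : ℂ := ⟨p.1, m p.1 + p.2 * g p.1⟩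

/-- An isotopy that moves points vertically. -/
theorem exists_rim_isotopy {m g m' g' : ℝ → ℝ} (hm : Lip m) (hg : Lip g) (hm' : Lip m')
    (hg' : Lip g') {ε : ℝ} (hε : 0 < ε) (h : ∀ x, |x - 5 / 2| ≤ 2 → ε ≤ g x ∧ ε ≤ g' x)
    (hp : ∀ k : ℕ, 1 ≤ k → k ≤ 4 → ∀ s, s = 1 ∨ s = -1 →
      0 < (m k + s * g k) * (m' k + s * g' k)) {w : ℝ} (hw : w < 1 / 2) :
    ∃ φ, IsotopicToId φ ∧ ∀ W ≤ w, φ '' slab (rimPt m g '' rim) W = slab (rimPt m' g' '' rim) W := by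
  have cpt : CompactSpace rim := by
    refine isCompact_iff_compactSpace.1 ((isCompact_Icc (a := ((1 / 2, -1) : ℝ × ℝ))
      (b := (9 / 2, 1))).of_isClosed_subset ?_ ?_)
    · have c1 : Continuous fun p : ℝ × ℝ => |p.1 - 5 / 2| := by fun_prop
      have c2 : Continuous fun p : ℝ × ℝ => |p.2| := by fun_prop
      exact (isClosed_le c1 continuous_const).inter ((isClosed_le c2 continuous_const).inter
        ((isClosed_eq c1 continuous_const).union (isClosed_eq c2 continuous_const)))
    · rintro p ⟨h1, h2, -⟩; obtain ⟨i1, i2⟩ := abs_le.1 h1; obtain ⟨i3, i4⟩ := abs_le.1 h2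
      exact ⟨⟨by simp only; linarith, i3⟩, ⟨by simp only; linarith, i4⟩⟩
  have cF : ∀ {m g : ℝ → ℝ}, Lip m → Lip g → Continuous fun a : rim => rimPt m g a := by
    intro m g hm hg; have c1 := hm.continuous; have c2 := hg.continuous
    exact Complex.equivRealProdCLM.symm.continuous.comp (f := fun a : rim =>
      ((a : ℝ × ℝ).1, m (a : ℝ × ℝ).1 + (a : ℝ × ℝ).2 * g (a : ℝ × ℝ).1)) (by fun_prop)
  have mix : ∀ (τ : ℝ) (a : ℝ × ℝ), rimPt m g a + τ • (rimPt m' g' a - rimPt m g a) =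
      rimPt (fun x => (1 - τ) * m x + τ * m' x) (fun x => (1 - τ) * g x + τ * g' x) a := by
    intro τ a; apply Complex.ext <;> simp [rimPt]; ring
  have lmix : ∀ {f f' : ℝ → ℝ} (τ τ' : ℝ), Lip f → Lip f' → Lip fun x => τ * f x + τ' * f' x :=
    fun τ τ' h h' => lip_add (lip_const_mul τ h) (lip_const_mul τ' h')
  obtain ⟨φ, hφ, h1⟩ := exists_planar_isotopy (F := fun a : rim => rimPt m g a)
    (G := fun a : rim => rimPt m' g' a - rimPt m g a) (cF hm hg) ((cF hm' hg').sub (cF hm hg)) (by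
      rintro τ ⟨t0, t1⟩; obtain ⟨K₁, k1, l1⟩ := lmix 1 (-1) hm' hm
      obtain ⟨K₂, k2, l2⟩ := lmix 1 (-1) hg' hg; obtain ⟨K₃, k3, l3⟩ := lmix (1 - τ) τ hm hm'
      obtain ⟨K₄, k4, l4⟩ := lmix (1 - τ) τ hg hg'
      set B := |1 * g' (5 / 2) + -1 * g (5 / 2)| + K₂ * 2
      refine ⟨K₁ + K₂ + B * ((1 + K₃ + K₄) / ε), by positivity, ?_⟩
      rintro ⟨⟨x, s⟩, hx, hs, -⟩ ⟨⟨y, t⟩, hy, ht, -⟩; simp only at hx hs hy ht; simp only [mix]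
      have n1 := Complex.abs_re_le_norm
        (rimPt (fun x => (1 - τ) * m x + τ * m' x) (fun x => (1 - τ) * g x + τ * g' x) (x, s) -
        rimPt (fun x => (1 - τ) * m x + τ * m' x) (fun x => (1 - τ) * g x + τ * g' x) (y, t))
      have n2 := Complex.abs_im_le_norm
        (rimPt (fun x => (1 - τ) * m x + τ * m' x) (fun x => (1 - τ) * g x + τ * g' x) (x, s) -
        rimPt (fun x => (1 - τ) * m x + τ * m' x) (fun x => (1 - τ) * g x + τ * g' x) (y, t))
      set n := ‖rimPt (fun x => (1 - τ) * m x + τ * m' x) (fun x => (1 - τ) * g x + τ * g' x) (x, s) -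
        rimPt (fun x => (1 - τ) * m x + τ * m' x) (fun x => (1 - τ) * g x + τ * g' x) (y, t)‖
      simp only [rimPt, Complex.sub_re, Complex.sub_im] at n1 n2; replace l1 := l1 x y
      have l5 := l2 x (5 / 2); replace l2 := l2 x y; replace l3 := l3 x y; replace l4 := l4 x y
      have low : ε ≤ (1 - τ) * g x + τ * g' x := by nlinarith [h x hx]
      set Γ := (1 - τ) * g x + τ * g' x; set Γ' := (1 - τ) * g y + τ * g' y
      set P := (1 - τ) * m x + τ * m' x; set P' := (1 - τ) * m y + τ * m' y
      have hB : |1 * g' x + -1 * g x| ≤ B := by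
        have i1 := abs_sub_abs_le_abs_sub (1 * g' x + -1 * g x) (1 * g' (5 / 2) + -1 * g (5 / 2))
        have i2 := mul_le_mul_of_nonneg_left hx k2; linarith
      have hst : |s - t| ≤ (1 + K₃ + K₄) / ε * n := by
        rw [div_mul_eq_mul_div, le_div_iff₀ hε]
        have e : (s - t) * Γ = (P + s * Γ - (P' + t * Γ')) - (P - P') - t * (Γ - Γ') := by ring
        have i1 : |s - t| * ε ≤ |(s - t) * Γ| := by
          rw [abs_mul]; exact mul_le_mul_of_nonneg_left (low.trans (le_abs_self _)) (abs_nonneg _)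
        rw [e] at i1; have i2 := abs_sub (P + s * Γ - (P' + t * Γ') - (P - P')) (t * (Γ - Γ'))
        have i3 := abs_sub (P + s * Γ - (P' + t * Γ')) (P - P')
        have i4 : |t * (Γ - Γ')| ≤ |Γ - Γ'| := by
          rw [abs_mul]; exact mul_le_of_le_one_left (abs_nonneg _) ht
        nlinarith [mul_le_mul_of_nonneg_left n1 k3, mul_le_mul_of_nonneg_left n1 k4]
      have e : rimPt m' g' (x, s) - rimPt m g (x, s) - (rimPt m' g' (y, t) - rimPt m g (y, t)) =
          (⟨0, ((1 * m' x + -1 * m x) - (1 * m' y + -1 * m y)) + (s - t) * (1 * g' x + -1 * g x) +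
            t * ((1 * g' x + -1 * g x) - (1 * g' y + -1 * g y))⟩ : ℂ) := by
        apply Complex.ext <;> simp [rimPt]; ring
      rw [e]; refine (Complex.norm_le_abs_re_add_abs_im _).trans ?_; simp only [abs_zero, zero_add]
      refine (abs_add_three _ _ _).trans ?_; rw [abs_mul, abs_mul]
      have j1 := mul_le_mul hst hB (abs_nonneg _) (by positivity)
      have j2 : |t| * |1 * g' x + -1 * g x - (1 * g' y + -1 * g y)| ≤ K₂ * |x - y| :=
        (mul_le_of_le_one_left (abs_nonneg _) ht).trans l2
      nlinarith [mul_le_mul_of_nonneg_left n1 k1, mul_le_mul_of_nonneg_left n1 k2]) (by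
      rintro τ ⟨t0, t1⟩ ⟨⟨x, s⟩, hx, hs, hb⟩ hz; simp only at hx hs hb hz; rw [mix] at hz
      refine (show ∀ {z : ℂ}, (∀ k : ℕ, 1 ≤ k → k ≤ 4 → z.re = k → z.im ≠ 0) → z ∉ punctures by
        intro z hz hz'; by_cases hi : z.im = 0
        · exact (mem_thickened_of_re (p := (z, 1 / 2)) (fun k k1 k2 e => hz k k1 k2 e hi)
            (by norm_num) (by norm_num)).1 hz'
        · exact (mem_thickened_of_im (p := (z, 1 / 2)) hi (by norm_num) (by norm_num)).1 hz')
        (fun k k1 k2 e => ?_) hz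
      simp only [rimPt] at e ⊢; subst e; have i1 : (1 : ℝ) ≤ k := by exact_mod_cast k1
      have i2 : (k : ℝ) ≤ 4 := by exact_mod_cast k2
      have hs1 : |s| = 1 := hb.resolve_left fun e => by
        rcases abs_cases ((k : ℝ) - 5 / 2) with ⟨e', _⟩ | ⟨e', _⟩ <;> linarith
      have := hp k k1 k2 s ((abs_eq one_pos.le).1 hs1); intro e
      rcases pos_and_pos_or_neg_and_neg_of_mul_pos this with ⟨j1, j2⟩ | ⟨j1, j2⟩
      · linarith [lt_convex j1 j2 t0 t1]
      · linarith [convex_lt j1 j2 t0 t1]) hw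
  refine ⟨φ, hφ, fun W hW => ?_⟩; have := h1 W hW; simp only [add_sub_cancel] at this
  rwa [image_eq_range (rimPt m g), image_eq_range (rimPt m' g')]




theorem mem_rimPt_image {m g : ℝ → ℝ} {z : ℂ} (hg : |z.re - 5 / 2| ≤ 2 → 0 < g z.re) :
    z ∈ rimPt m g '' rim ↔ |z.re - 5 / 2| ≤ 2 ∧ |z.im - m z.re| ≤ g z.re ∧
      (|z.re - 5 / 2| = 2 ∨ |z.im - m z.re| = g z.re) := by
  constructor
  · rintro ⟨⟨x, s⟩, ⟨h1, h2, h3⟩, rfl⟩; have h0 := hg h1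
    simp only [rimPt, add_sub_cancel_left, abs_mul] at h0 h1 h2 h3 ⊢; rw [abs_of_pos h0]
    exact ⟨h1, mul_le_of_le_one_left h0.le h2, h3.imp_right fun e => by rw [e, one_mul]⟩
  · rintro ⟨h1, h2, h3⟩; have h0 := hg h1
    refine ⟨(z.re, (z.im - m z.re) / g z.re), ⟨h1, ?_, ?_⟩, Complex.ext rfl ?_⟩
    · simp only [abs_div, abs_of_pos h0]; exact (div_le_one h0).2 h2
    · simp only [abs_div, abs_of_pos h0]; exact h3.imp_right (div_eq_one_iff_eq h0.ne').2
    · simp only [rimPt]; field_simp; ring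

/-- The places, in units of `1/32`, where the curve around the punctures in `I` passes below the axis;
the first and the last one stand for its ends. -/
def dipPos (I : Finset ℕ) (j : ℕ) : ℕ :=
  if j = 0 then 12 else if j = 5 then 148 else if j ∈ I then 32 * j + 6 else 32 * j

/-- The chord diagram of the curve around the punctures in `I`. -/
def genDiag (I : Finset ℕ) : Diagram :=
  dg ((16, 144) :: [1, 2, 3, 4].map fun j => (dipPos I j - 4, dipPos I j + 4))
    ([0, 1, 2, 3, 4].map fun j => (dipPos I j + 4, dipPos I (j + 1) - 4))

theorem dipPos_lt (I : Finset ℕ) {i j : ℕ} (h : i < j) (hj : j ≤ 5) :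
    dipPos I i + 8 < dipPos I j := by
  unfold dipPos; split_ifs <;> omega

theorem genDiag_spec (I : Finset ℕ) : WF (genDiag I) ∧ Planar (genDiag I) ∧
    ∀ n ∈ ends (genDiag I false), (n % 32 ≠ 31 ∧ n % 32 ≠ 0 ∧ n % 32 ≠ 1) ∧
      ∀ n' ∈ ends (genDiag I false), n < n' → n + 4 < n' := by
  by_cases h1 : 1 ∈ I <;> by_cases h2 : 2 ∈ I <;> by_cases h3 : 3 ∈ I <;> by_cases h4 : 4 ∈ I <;>
  · simp only [genDiag, dipPos, h1, h2, h3, h4, List.map_cons, List.map_nil, if_true, if_false,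
      OfNat.ofNat_ne_zero, OfNat.ofNat_ne_one, one_ne_zero, Nat.reduceEqDiff, Nat.reduceAdd,
      Nat.reduceMul, Nat.reduceSub, zero_add]
    unfold Planar; decide +kernel

/-- The slant of the strands of the curve. -/
def bend (n : ℕ) : ℝ :=
  if n % 32 = 28 ∨ n % 32 = 2 then 1 / 16 else if n % 32 = 4 ∨ n % 32 = 10 then -1 / 16 else 0

/-- A configuration of the shape of the curve around the punctures in `I`. -/
def genConfig (I : Finset ℕ) : Config where
  __ := stdConfig (genDiag I) (fun _ _ => 1 / 2) (1 / 8)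
  x s n := n / 32 + if s then 0 else bend n

theorem genConfig_realizes (I : Finset ℕ) : Realizes (genConfig I) (genDiag I) := by
  obtain ⟨wf, pl, h⟩ := genDiag_spec I
  have hb : ∀ n, |bend n| ≤ 1 / 16 := fun n => by
    unfold bend; split_ifs <;> norm_num [abs_of_pos, abs_of_neg]
  have mem := wf.mem_stdConfig (fun _ _ => 1 / 2) (1 / 8)
  refine ⟨by simp [genConfig, stdConfig], mem, wf.stdConfig_mates (fun _ _ => 1 / 2) (1 / 8), ?_, ?_, ?_, ?_⟩
  · intro s n hn n' hn' hlt; have := (h n ((mem false n).1 hn)).2 n' ((mem false n').1 hn') hlt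
    have h1 : (n : ℝ) + 4 < n' := by exact_mod_cast this
    have h2 := abs_le.1 (hb n); have h3 := abs_le.1 (hb n'); simp only [genConfig]
    cases s <;> simp <;> linarith
  · intro n hn k _ _; have hm := (h n ((mem false n).1 hn)).1; have h2 := abs_le.1 (hb n)
    simp only [genConfig]; rcases lt_or_ge n (32 * k) with hk | hk
    · left; have : (n : ℝ) + 1 < 32 * k := by exact_mod_cast (by omega : n + 1 < 32 * k)
      refine ⟨hk, ?_⟩; simp; linarith
    · right; have : (32 * k : ℝ) + 1 < n := by exact_mod_cast (by omega : 32 * k + 1 < n)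
      refine ⟨by omega, ?_⟩; simp; linarith
  · intro s n _; simp only [genConfig, stdConfig]; norm_num
  · intro s; refine List.pairwise_of_forall_mem_list fun a ha b hb hc => ?_
    rw [pl s a ha b hb] at hc; cases hc

/-- The distance to the nearest of the first places, less `1/8`. -/
def lowGap (a : ℕ → ℝ) : ℕ → ℝ → ℝ
  | 0, x => |x - a 0| - 1 / 8
  | n + 1, x => min (lowGap a n x) (|x - a (n + 1)| - 1 / 8)

theorem le_lowGap {a : ℕ → ℝ} {c x : ℝ} {n : ℕ} :
    c ≤ lowGap a n x ↔ ∀ j ≤ n, c ≤ |x - a j| - 1 / 8 := by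
  induction n with
  | zero => simp [lowGap]
  | succ n ih => simp only [lowGap, le_min_iff, ih, Nat.le_succ_iff, or_imp, forall_and, forall_eq]

theorem lip_lowGap (a : ℕ → ℝ) (n : ℕ) : Lip (lowGap a n) := by
  induction n with
  | zero => exact lip_add (lip_abs_sub _) (lip_const (-(1 / 8)))
  | succ n ih => exact lip_min ih (lip_add (lip_abs_sub _) (lip_const (-(1 / 8))))

/-- The profile of the upper part of the curve. -/
def profile (u : ℝ) : ℝ := max (-15 / 16 + u) (min (1 + 32 * u) (1 + u))

theorem profile_high {u : ℝ} (h : 0 ≤ u) : profile u = 1 + u := by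
  rw [profile, min_eq_right, max_eq_right] <;> linarith

theorem profile_mid {u : ℝ} (h : -1 / 16 ≤ u) (h' : u ≤ 0) : profile u = 1 + 32 * u := by
  rw [profile, min_eq_left, max_eq_right] <;> linarith

theorem profile_low {u : ℝ} (h : u ≤ -1 / 16) : profile u = -15 / 16 + u := by
  rw [profile, min_eq_left, max_eq_left] <;> linarith

/-- The upper part of the curve. -/
def topFun (I : Finset ℕ) (x : ℝ) : ℝ := profile (lowGap (fun j => dipPos I j / 32) 5 x)

/-- The lower part of the curve. -/
def botFun (x : ℝ) : ℝ := -3 + |x - 5 / 2|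

theorem lip_topFun (I : Finset ℕ) : Lip (topFun I) := by
  have h := lip_lowGap (fun j => dipPos I j / 32) 5
  exact lip_max (lip_add (lip_const _) h)
    (lip_min (lip_add (lip_const _) (lip_const_mul _ h)) (lip_add (lip_const _) h))

section Dip

variable (I : Finset ℕ)

theorem pos_lt {i j : ℕ} (h : i < j) (hj : j ≤ 5) :
    (dipPos I i : ℝ) / 32 + 1 / 4 < dipPos I j / 32 := by
  have : (dipPos I i : ℝ) + 8 < dipPos I j := by exact_mod_cast dipPos_lt I h hj
  linarith

theorem topFun_of_ge {x : ℝ} (h : ∀ j ≤ 5, 1 / 8 ≤ |x - dipPos I j / 32|) : 1 ≤ topFun I x := by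
  have h0 : 0 ≤ lowGap (fun j => (dipPos I j : ℝ) / 32) 5 x :=
    le_lowGap.2 fun j hj => by linarith [h j hj]
  exact le_max_of_le_right (le_min (by linarith) (by linarith))

theorem topFun_dip {j : ℕ} (hj : j ≤ 5) {x : ℝ} (hx : |x - dipPos I j / 32| ≤ 1 / 8) :
    topFun I x = profile (|x - dipPos I j / 32| - 1 / 8) := by
  unfold topFun; congr 1; refine le_antisymm (le_lowGap.1 le_rfl j hj) (le_lowGap.2 fun i hi => ?_)
  obtain ⟨h1, h2⟩ := abs_le.1 hx; rcases lt_trichotomy i j with h | rfl | h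
  · have := pos_lt I h hj; linarith [le_abs_self (x - (dipPos I i : ℝ) / 32)]
  · exact le_rfl
  · have := pos_lt I h hi; linarith [neg_abs_le (x - (dipPos I i : ℝ) / 32)]

theorem topFun_tent {j : ℕ} (hj : j ≤ 4) {x : ℝ} (h1 : dipPos I j / 32 + 1 / 8 ≤ x)
    (h2 : x ≤ dipPos I (j + 1) / 32 - 1 / 8) : topFun I x =
      1 + min (x - (dipPos I j / 32 + 1 / 8)) (dipPos I (j + 1) / 32 - 1 / 8 - x) := by
  have e : lowGap (fun j => (dipPos I j : ℝ) / 32) 5 x =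
      min (x - (dipPos I j / 32 + 1 / 8)) (dipPos I (j + 1) / 32 - 1 / 8 - x) := by
    refine le_antisymm (le_min ?_ ?_) (le_lowGap.2 fun i hi => ?_)
    · have := le_lowGap.1 (le_refl (lowGap (fun j => (dipPos I j : ℝ) / 32) 5 x)) j (by omega)
      rw [abs_of_nonneg (by linarith)] at this; linarith
    · have := le_lowGap.1 (le_refl (lowGap (fun j => (dipPos I j : ℝ) / 32) 5 x)) (j + 1) (by omega)
      rw [abs_of_nonpos (by linarith)] at this; linarith
    · rcases lt_trichotomy i j with h | rfl | h
      · have := pos_lt I h (by omega)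
        exact (min_le_left _ _).trans (by linarith [le_abs_self (x - (dipPos I i : ℝ) / 32)])
      · exact (min_le_left _ _).trans (by linarith [le_abs_self (x - (dipPos I i : ℝ) / 32)])
      · refine (min_le_right _ _).trans ?_
        have : (dipPos I (j + 1) : ℝ) / 32 ≤ dipPos I i / 32 := by
          rcases (show j + 1 = i ∨ j + 1 < i by omega) with rfl | h
          · exact le_rfl
          · linarith [pos_lt I h hi]
        linarith [neg_abs_le (x - (dipPos I i : ℝ) / 32)]
  have h0 : 0 ≤ min (x - (dipPos I j / 32 + 1 / 8)) (dipPos I (j + 1) / 32 - 1 / 8 - x) :=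
    le_min (by linarith) (by linarith)
  rw [topFun, e, profile_high h0]

theorem dipPos_bounds {j : ℕ} (h1 : 1 ≤ j) (h4 : j ≤ 4) :
    1 ≤ (dipPos I j : ℝ) / 32 ∧ (dipPos I j : ℝ) / 32 ≤ 134 / 32 := by
  have : 32 ≤ dipPos I j ∧ dipPos I j ≤ 134 := by
    unfold dipPos; split_ifs <;> omega
  have i1 : (32 : ℝ) ≤ dipPos I j := by exact_mod_cast this.1
  have i2 : (dipPos I j : ℝ) ≤ 134 := by exact_mod_cast this.2
  constructor <;> linarith

theorem gap_pos {x : ℝ} (hx : |x - 5 / 2| ≤ 2) : 1 / 32 ≤ (topFun I x - botFun x) / 2 := by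
  have hT : -17 / 16 ≤ topFun I x := by
    have : -1 / 8 ≤ lowGap (fun j => (dipPos I j : ℝ) / 32) 5 x :=
      le_lowGap.2 fun j _ => by linarith [abs_nonneg (x - (dipPos I j : ℝ) / 32)]
    exact le_max_of_le_left (by linarith)
  unfold botFun; by_cases h : |x - 5 / 2| ≤ 15 / 8
  · linarith
  · have : 1 ≤ topFun I x := topFun_of_ge I fun j hj => by
      obtain ⟨h1, h2⟩ := abs_le.1 hx
      rcases (show j = 0 ∨ j = 5 ∨ 1 ≤ j ∧ j ≤ 4 by omega) with rfl | rfl | ⟨j1, j4⟩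
      · norm_num [dipPos]; exact le_abs.2 (.inl (by linarith))
      · norm_num [dipPos]; exact le_abs.2 (.inr (by linarith))
      · obtain ⟨b1, b2⟩ := dipPos_bounds I j1 j4
        rcases abs_cases (x - 5 / 2) with ⟨e, _⟩ | ⟨e, _⟩ <;> rw [e] at h
        · exact le_abs.2 (.inl (by linarith))
        · exact le_abs.2 (.inr (by linarith))
    linarith

end Dip




theorem genConfig_x (I : Finset ℕ) {j : ℕ} :
    (1 ≤ j → (genConfig I).x true (dipPos I j - 4) = dipPos I j / 32 - 1 / 8) ∧
    (genConfig I).x true (dipPos I j + 4) = dipPos I j / 32 + 1 / 8 ∧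
    (1 ≤ j → j ≤ 4 → (genConfig I).x false (dipPos I j - 4) = dipPos I j / 32 - 1 / 16) ∧
    (1 ≤ j → j ≤ 4 → (genConfig I).x false (dipPos I j + 4) = dipPos I j / 32 + 1 / 16) := by
  have h4 : 1 ≤ j → ((dipPos I j - 4 : ℕ) : ℝ) = dipPos I j - 4 := fun h => by
    rw [Nat.cast_sub]
    · norm_num
    · unfold dipPos; split_ifs <;> omega
  have hm : 1 ≤ j → j ≤ 4 → bend (dipPos I j - 4) = 1 / 16 ∧ bend (dipPos I j + 4) = -1 / 16 :=
    fun h1 h2 => by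
      unfold bend dipPos; split_ifs <;> first | omega | norm_num
  refine ⟨fun h => ?_, ?_, fun h1 h2 => ?_, fun h1 h2 => ?_⟩
  · simp [genConfig, h4 h]; ring
  · simp [genConfig]; ring
  · simp [genConfig, h4 h1, (hm h1 h2).1]; ring
  · simp [genConfig, (hm h1 h2).2]; ring

theorem genConfig_x_end (I : Finset ℕ) (s : Bool) :
    (genConfig I).x s 16 = 1 / 2 ∧ (genConfig I).x s 144 = 9 / 2 := by
  cases s <;> norm_num [genConfig, bend]

section Body

variable (I : Finset ℕ)

set_option hygiene false in
local notation "Cf" => genConfig I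
set_option hygiene false in
local notation "Top" => topFun I z.re
set_option hygiene false in
local notation "Bot" => botFun z.re
set_option hygiene false in
local notation "Gap" => (topFun I z.re - botFun z.re) / 2
set_option hygiene false in
local notation "Dev" => |z.im - (topFun I z.re + botFun z.re) / 2|

/-- The configuration is the region between two graphs. -/
theorem genConfig_body {W : ℝ} (hW : 0 ≤ W) : (Cf).body W =
    slab (rimPt (fun x => (topFun I x + botFun x) / 2) (fun x => (topFun I x - botFun x) / 2) '' rim)
      W := by
  rw [(genConfig_realizes I).body_eq_slab (fun _ _ => rfl) hW]; congr 1; ext z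
  have hg : |z.re - 5 / 2| ≤ 2 → 0 < Gap := fun h => by
    linarith [gap_pos I h]
  rw [mem_rimPt_image hg]; have d0 : dipPos I 0 = 12 := rfl; have d5 : dipPos I 5 = 148 := rfl
  have ea : ∀ {a b c : ℝ}, |a - (b + c) / 2| ≤ (b - c) / 2 ↔ c ≤ a ∧ a ≤ b := by
    intro a b c; rw [abs_le]; constructor <;> rintro ⟨h1, h2⟩ <;> constructor <;> linarith
  have onTop : |z.re - 5 / 2| ≤ 2 → z.im = Top → |z.re - 5 / 2| ≤ 2 ∧
      Dev ≤ Gap ∧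
      (|z.re - 5 / 2| = 2 ∨ Dev = Gap) := by
    intro h1 h2; have := hg h1
    have e : Dev = Gap := by
      rw [h2, abs_of_nonneg] <;> linarith
    exact ⟨h1, e.le, .inr e⟩
  have endL : z.re = 1 / 2 → Top = 1 := fun e => by
    rw [topFun_dip I (j := 0) (by norm_num), profile_high] <;> rw [e, d0] <;> norm_num [abs_of_pos]
  have endR : z.re = 9 / 2 → Top = 1 := fun e => by
    rw [topFun_dip I (j := 5) (by norm_num), profile_high] <;> rw [e, d5] <;>
      norm_num [abs_of_neg, abs_of_pos]
  have dipB : ∀ {j}, 1 ≤ j → j ≤ 4 → |z.re - dipPos I j / 32| ≤ 1 / 8 → |z.re - 5 / 2| ≤ 2 := by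
    intro j j1 j4 h; obtain ⟨b1, b2⟩ := dipPos_bounds I j1 j4; obtain ⟨i1, i2⟩ := abs_le.1 h
    exact abs_le.2 ⟨by linarith, by linarith⟩
  have pm : ∀ j ≤ 5, 12 / 32 ≤ (dipPos I j : ℝ) / 32 ∧ (dipPos I j : ℝ) / 32 ≤ 148 / 32 := by
    intro j hj; have : 12 ≤ dipPos I j ∧ dipPos I j ≤ 148 := by unfold dipPos; split_ifs <;> omega
    have i1 : (12 : ℝ) ≤ dipPos I j := by exact_mod_cast this.1
    have i2 : (dipPos I j : ℝ) ≤ 148 := by exact_mod_cast this.2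
    constructor <;> linarith
  have mE : min (z.re - 1 / 2) (9 / 2 - z.re) = 2 - |z.re - 5 / 2| :=
    min_sub_sub (by norm_num) (by norm_num)
  have hR := genConfig_realizes I; have xE := genConfig_x_end I
  have x := fun j => genConfig_x I (j := j)
  have mem : ∀ j, 1 ≤ j → j ≤ 4 → (dipPos I j - 4, dipPos I j + 4) ∈ genDiag I false := by
    intro j h1 h2; refine List.mem_cons_of_mem _ (List.mem_map.2 ⟨j, ?_, rfl⟩); simp; omega
  constructor
  · rintro (⟨n, hn, h1, h2⟩ | ⟨_ | _, a, ha, h1, h2, h3⟩)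
    · obtain ⟨i1, i2⟩ := abs_le.1 h1; obtain ⟨a, ha, hna⟩ := mem_ends.1 ((hR.mem_iff false n).1 hn)
      rcases List.mem_cons.1 ha with rfl | ha
      · have : z.re = 1 / 2 ∨ z.re = 9 / 2 := by
          rcases hna with rfl | rfl
          · left; rw [h2, (xE _).1, (xE _).1]; ring
          · right; rw [h2, (xE _).2, (xE _).2]; ring
        have hT : Top = 1 := this.elim endL endR
        have hx : |z.re - 5 / 2| = 2 := by rcases this with e | e <;> rw [e] <;> norm_num [abs_of_neg, abs_of_pos]
        refine ⟨hx.le, ea.2 ⟨?_, by rw [hT]; exact i2⟩, .inl hx⟩; rw [botFun, hx]; linarith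
      · obtain ⟨j, hj, rfl⟩ := List.mem_map.1 ha; have hj' : 1 ≤ j ∧ j ≤ 4 := by simp at hj; omega
        have e : |z.re - dipPos I j / 32| = 3 / 32 + z.im / 32 := by
          rcases hna with rfl | rfl
          · simp only [(x j).1 hj'.1, (x j).2.2.1 hj'.1 hj'.2] at h2
            rw [h2, abs_of_neg] <;> linarith
          · simp only [(x j).2.1, (x j).2.2.2 hj'.1 hj'.2] at h2; rw [h2, abs_of_pos] <;> linarith
        refine onTop (dipB hj'.1 hj'.2 (by rw [e]; linarith)) ?_
        rw [topFun_dip I (j := j) (by omega) (by rw [e]; linarith), e, profile_mid] <;> linarith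
    · rcases List.mem_cons.1 ha with rfl | ha
      · rw [(xE _).1] at h1 h3; rw [(xE _).2] at h2 h3
        have hx : |z.re - 5 / 2| ≤ 2 := abs_le.2 ⟨by linarith, by linarith⟩
        have e : z.im = Bot := by
          simp only [sg, botFun, mE] at h3 ⊢; linarith
        have := hg hx
        have e' : Dev = Gap := by
          rw [e, abs_of_nonpos] <;> linarith
        exact ⟨hx, e'.le, .inr e'⟩
      · obtain ⟨j, hj, rfl⟩ := List.mem_map.1 ha; have hj' : 1 ≤ j ∧ j ≤ 4 := by simp at hj; omega
        simp only [(x j).2.2.1 hj'.1 hj'.2, (x j).2.2.2 hj'.1 hj'.2] at h1 h2 h3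
        have hd : |z.re - dipPos I j / 32| ≤ 1 / 16 := abs_le.2 ⟨by linarith, by linarith⟩
        refine onTop (dipB hj'.1 hj'.2 (by linarith)) ?_
        rw [topFun_dip I (j := j) (by omega) (by linarith), profile_low (by linarith)]
        simp only [sg, min_sub_sub rfl rfl] at h3; linarith
    · obtain ⟨j, hj, rfl⟩ := List.mem_map.1 ha; have hj' : j ≤ 4 := by simp at hj; omega
      simp only [(x j).2.1, (x (j + 1)).1 (by omega)] at h1 h2 h3; have b1 := pm j (by omega)
      have b2 := pm (j + 1) (by omega); refine onTop (abs_le.2 ⟨by linarith, by linarith⟩) ?_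
      rw [topFun_tent I hj' h1 h2, ← h3]; simp [sg]
  · rintro ⟨h1, h2, h3⟩; obtain ⟨i1, i2⟩ := ea.1 h2; obtain ⟨r1, r2⟩ := abs_le.1 h1
    have nodes : 16 ∈ (Cf).N ∧ 144 ∈ (Cf).N :=
      hR.mem_of_chord false List.mem_cons_self
    rcases h3 with h3 | h3
    · have hB : Bot = -1 := by rw [botFun, h3]; norm_num
      rcases (abs_eq two_pos.le).1 h3 with e | e
      · have e' : z.re = 9 / 2 := by linarith
        rw [endR e'] at i2; refine .inl ⟨144, nodes.2, abs_le.2 ⟨by linarith, i2⟩, ?_⟩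
        rw [e', (xE _).2, (xE _).2]; ring
      · have e' : z.re = 1 / 2 := by linarith
        rw [endL e'] at i2; refine .inl ⟨16, nodes.1, abs_le.2 ⟨by linarith, i2⟩, ?_⟩
        rw [e', (xE _).1, (xE _).1]; ring
    · rcases (abs_eq (hg h1).le).1 h3 with e | e
      · have e : z.im = Top := by linarith
        have tent : ∀ j ≤ 4, dipPos I j / 32 + 1 / 8 ≤ z.re → z.re ≤ dipPos I (j + 1) / 32 - 1 / 8 →
            ∃ s, ∃ a ∈ genDiag I s, (Cf).x s a.1 ≤ z.re ∧ z.re ≤ (Cf).x s a.2 ∧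
              sg s * z.im = 1 + min (z.re - (Cf).x s a.1) ((Cf).x s a.2 - z.re) := by
          intro j hj k1 k2
          refine ⟨true, (dipPos I j + 4, dipPos I (j + 1) - 4), List.mem_map.2 ⟨j, ?_, rfl⟩, ?_⟩
          · simp; omega
          · simp only [(x j).2.1, (x (j + 1)).1 (by omega)]
            exact ⟨k1, k2, by rw [e, topFun_tent I hj k1 k2]; simp [sg]⟩
        by_cases hd : ∃ j, 1 ≤ j ∧ j ≤ 4 ∧ |z.re - dipPos I j / 32| ≤ 1 / 8
        · obtain ⟨j, j1, j4, hd⟩ := hd; have nd := hR.mem_of_chord false (mem j j1 j4)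
          rw [topFun_dip I (by omega) hd] at e
          rcases le_total (|z.re - dipPos I j / 32| - 1 / 8) (-1 / 16) with hu | hu
          · rw [profile_low hu] at e
            obtain ⟨k1, k2⟩ := abs_le.1 (by linarith : |z.re - dipPos I j / 32| ≤ 1 / 16)
            refine .inr ⟨false, _, mem j j1 j4, ?_⟩
            simp only [(x j).2.2.1 j1 j4, (x j).2.2.2 j1 j4, sg]
            exact ⟨by linarith, by linarith, by rw [min_sub_sub rfl rfl]; linarith⟩
          · rw [profile_mid hu (by linarith)] at e
            have him : |z.im| ≤ 1 := abs_le.2 ⟨by linarith, by linarith⟩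
            rcases abs_cases (z.re - dipPos I j / 32) with ⟨e', _⟩ | ⟨e', _⟩ <;> rw [e'] at e
            · refine .inl ⟨_, nd.2, him, ?_⟩; simp only [(x j).2.1, (x j).2.2.2 j1 j4]; linarith
            · refine .inl ⟨_, nd.1, him, ?_⟩; simp only [(x j).1 j1, (x j).2.2.1 j1 j4]; linarith
        · right
          have nd : ∀ j, 1 ≤ j → j ≤ 4 → dipPos I j / 32 - 1 / 8 ≤ z.re →
              dipPos I j / 32 + 1 / 8 ≤ z.re := by
            intro j j1 j4 k; by_contra k'; exact hd ⟨j, j1, j4, abs_le.2 ⟨by linarith, by linarith⟩⟩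
          have loc : ∀ n ≤ 4, (∃ j ≤ n, dipPos I j / 32 + 1 / 8 ≤ z.re ∧
              z.re ≤ dipPos I (j + 1) / 32 - 1 / 8) ∨ dipPos I (n + 1) / 32 - 1 / 8 ≤ z.re := by
            intro n hn
            induction n with
            | zero =>
              rcases le_total z.re (dipPos I 1 / 32 - 1 / 8) with k | k
              · exact .inl ⟨0, le_rfl, by rw [d0]; norm_num; linarith, k⟩
              · exact .inr k
            | succ n ih =>
              rcases ih (by omega) with ⟨j, j1, j2⟩ | k
              · exact .inl ⟨j, by omega, j2⟩
              · rcases le_total z.re (dipPos I (n + 1 + 1) / 32 - 1 / 8) with k' | k'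
                · exact .inl ⟨n + 1, le_rfl, nd _ (by omega) hn k, k'⟩
                · exact .inr k'
          rcases loc 4 le_rfl with ⟨j, j4, k1, k2⟩ | k
          · exact tent j j4 k1 k2
          · refine tent 4 le_rfl (nd 4 (by norm_num) le_rfl ?_) ?_
            · linarith [pos_lt I (by norm_num : 4 < 5) le_rfl]
            · rw [d5]; norm_num; linarith
      · refine .inr ⟨false, (16, 144), List.mem_cons_self, ?_⟩; rw [(xE _).1, (xE _).2]
        have e : z.im = -3 + |z.re - 5 / 2| := by unfold botFun at e; linarith
        simp only [sg, e, mE]; and_intros <;> linarith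

end Body

/-- The generators are given by chord diagrams. -/
theorem gen_eq_sk (R : Type*) [CommRing R] (q : Rˣ) (I : Finset ℕ) :
    gen R q I = sk R q (genDiag I) := by
  rw [(genConfig_realizes I).sk_eq R q]; refine Isotopic.toSkein_eq ?_ R q; have lT := lip_topFun I
  have lB : Lip botFun := lip_add (lip_const _) (lip_abs_sub _)
  have lm : Lip fun x => (topFun I x + botFun x) / 2 := by
    simpa only [one_div, inv_mul_eq_div] using lip_const_mul (1 / 2) (lip_add lT lB)
  have lg : Lip fun x => (topFun I x - botFun x) / 2 := by
    simpa only [one_div, inv_mul_eq_div, neg_one_mul, ← sub_eq_add_neg] using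
      lip_const_mul (1 / 2) (lip_add lT (lip_const_mul (-1) lB))
  have sign : ∀ k : ℕ, 1 ≤ k → k ≤ 4 → ∀ s : ℝ, s = 1 ∨ s = -1 → 0 < (dip I k + s * (1 / 2)) *
      ((topFun I k + botFun k) / 2 + s * ((topFun I k - botFun k) / 2)) := by
    intro k k1 k4 s hs; have kR1 : (1 : ℝ) ≤ k := by exact_mod_cast k1
    have kR4 : (k : ℝ) ≤ 4 := by exact_mod_cast k4
    have hB : botFun k < 0 := by
      unfold botFun
      linarith [abs_le.2 (⟨by linarith, by linarith⟩ : -(3 / 2) ≤ (k : ℝ) - 5 / 2 ∧ (k : ℝ) - 5 / 2 ≤ 3 / 2)]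
    by_cases hk : k ∈ I
    · have hT : 1 ≤ topFun I k := topFun_of_ge I fun j hj => by
        have : 32 * k + 4 ≤ dipPos I j ∨ dipPos I j + 4 ≤ 32 * k := by
          unfold dipPos; split_ifs with c1 c2 c3
          iterate 3 omega
          · have : j ≠ k := by rintro rfl; exact c3 hk
            omega
        rcases this with t | t
        · have : (32 * k + 4 : ℝ) ≤ dipPos I j := by exact_mod_cast t
          exact le_abs.2 (.inr (by linarith))
        · have : (dipPos I j + 4 : ℝ) ≤ 32 * k := by exact_mod_cast t
          exact le_abs.2 (.inl (by linarith))
      rw [dip_of_mem hk]; rcases hs with rfl | rfl <;> nlinarith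
    · have hT : topFun I k < 0 := by
        have e : (dipPos I k : ℝ) / 32 = k := by
          rw [dipPos, if_neg (by omega), if_neg (by omega), if_neg hk]; push_cast; ring
        rw [topFun_dip I (j := k) (by omega) (by rw [e]; norm_num), e, profile_low] <;> norm_num
      rw [dip_of_notMem k1 k4 hk]; rcases hs with rfl | rfl <;> nlinarith
  obtain ⟨φ, hφ, h⟩ := exists_rim_isotopy (g := fun _ => 1 / 2) (ε := 1 / 32) (w := 1 / 8)
    (lip_dip I) (lip_const _) lm lg (by norm_num) (fun x hx => ⟨by norm_num, gap_pos I hx⟩) sign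
    (by norm_num)
  have hc : rimPt (dip I) (fun _ => 1 / 2) '' rim = curve I := by
    ext z; rw [mem_rimPt_image fun _ => by norm_num]; simp only [curve, mem_ofPred_eq, max_eq_iff]
    constructor
    · rintro ⟨h1, h2, h3 | h3⟩
      · exact .inl ⟨by linarith, by linarith⟩
      · exact .inr ⟨by linarith, by linarith⟩
    · rintro (⟨h1, h2⟩ | ⟨h1, h2⟩)
      · exact ⟨by linarith, by linarith, .inl (by linarith)⟩
      · exact ⟨by linarith, by linarith, .inr (by linarith)⟩
  refine ⟨φ, hφ, ?_, ?_⟩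
  · have := h 0 (by norm_num); rw [hc, ← genConfig_body I le_rfl] at this; refine Eq.trans ?_ this
    congr 1; ext p; simp [curveLink, slab, sub_eq_zero]
  · have := h _ le_rfl; rw [hc, ← genConfig_body I (by norm_num)] at this; exact this




/-! ### Evaluation of chord diagrams -/

/-- A term `c • s ^ e • D` of a linear combination of chord diagrams `D = dg l u`. -/
abbrev Term := ℤ × ℤ × Chords × Chords

/-- Whether a chord contains none of the points `E` and no puncture. -/
def adjacent (E : List ℕ) (c : ℕ × ℕ) : Bool :=
  E.all (fun n => n.ble c.1 || c.2.ble n) && [32, 64, 96, 128].all fun n => n.ble c.1 || c.2.ble n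

/-- Remove the chord with end `p`. -/
def pull (p : ℕ) : Chords → Option (ℕ × Chords)
  | [] => none
  | c :: t => if c.1 == p then some (c.2, t) else if c.2 == p then some (c.1, t) else
    (pull p t).map fun x => (x.1, c :: x.2)

instance (a p r b : ℕ) : Decidable (TurnOrder a p r b) := by unfold TurnOrder; infer_instance

/-- Remove a trivial circle (then the first entry is `true`) or a turn. -/
def step (L U : Chords) : Option (Bool × Chords × Chords) :=
  (U.find? (adjacent (ends U))).bind fun c => (pull c.1 L).bind fun x =>
    if x.1 == c.2 then some (true, x.2, U.erase c) else (pull c.2 x.2).bind fun y =>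
      if TurnOrder x.1 c.1 c.2 y.1 ∨ TurnOrder y.1 c.2 c.1 x.1 then
        some (false, ch x.1 y.1 :: y.2, U.erase c) else none

/-- The relabelling that numbers the points of `E` between two punctures. -/
def label (E : List ℕ) (n : ℕ) : ℕ :=
  32 * (n / 32) + (E.filter fun m => m / 32 == n / 32 && m.ble n).length

/-- The function `f` is increasing on `E` and respects the punctures. -/
def GoodLabel (E : List ℕ) (f : ℕ → ℕ) : Prop :=
  ∀ n ∈ E, (∀ n' ∈ E, n < n' → f n < f n') ∧
    ∀ k ∈ [1, 2, 3, 4], (n < 32 * k ∧ f n < 32 * k) ∨ (32 * k < n ∧ 32 * k < f n)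

instance (E : List ℕ) (f : ℕ → ℕ) : Decidable (GoodLabel E f) := by
  unfold GoodLabel; infer_instance

instance (D : Diagram) : Decidable (Planar D) := by unfold Planar; infer_instance

/-- Sort chords. -/
def sortChords (l : Chords) : Chords := l.insertionSort fun a b => a.1 ≤ b.1

/-- The diagram with standard labels and sorted chords. -/
def canon (l u : Chords) : Chords × Chords :=
  let f := label (ends l)
  let l' := l.map (Prod.map f f)
  let u' := u.map (Prod.map f f)
  if WF (dg l' u') ∧ Planar (dg l' u') ∧ GoodLabel (ends l) f
  then (sortChords l', sortChords u') else (l, u)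

/-- The normal form of a planar diagram. -/
def reduce : ℕ → ℤ → ℤ → Chords → Chords → List Term
  | 0, c, e, l, u => [(c, e, l, u)]
  | n + 1, c, e, l, u => match step l u with
    | some (true, l', u') => reduce n (-c) (e + 2) l' u' ++ reduce n (-c) (e - 2) l' u'
    | some (false, l', u') => reduce n c e l' u'
    | none => match step u l with
      | some (true, u', l') => reduce n (-c) (e + 2) l' u' ++ reduce n (-c) (e - 2) l' u'
      | some (false, u', l') => reduce n c e l' u'
      | none => [(c, e, canon l u)]

/-- Resolve the crossings of the lower chords `X ++ t`, where the chords `X` are already done. -/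
def resolve : ℕ → ℤ → ℤ → Chords → Chords → Chords → List Term
  | 0, c, e, X, t, u => [(c, e, X ++ t, u)]
  | _ + 1, c, e, X, [], u =>
    if Planar (dg X u) then reduce 64 c e X u else [(c, e, X, u)]
  | n + 1, c, e, X, α :: t, u => match t.dropWhile fun b => !cross α b with
    | [] => resolve n c e (X ++ [α]) t u
    | β :: Y =>
      let M := t.takeWhile fun b => !cross α b
      if α.1 < β.1 ∧ β.1 < α.2 ∧ α.2 < β.2 then
        resolve n c (e + 1) X (M ++ (α.1, β.1) :: (α.2, β.2) :: Y) u ++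
          resolve n c (e - 1) X (M ++ (β.1, α.2) :: (α.1, β.2) :: Y) u
      else if β.1 < α.1 ∧ α.1 < β.2 ∧ β.2 < α.2 then
        resolve n c (e + 1) X (M ++ (α.1, β.2) :: (β.1, α.2) :: Y) u ++
          resolve n c (e - 1) X (M ++ (β.1, α.1) :: (β.2, α.2) :: Y) u
      else [(c, e, X ++ α :: t, u)]

/-- Add a term to a linear combination. -/
def collect (t : Term) : List Term → List Term
  | [] => [t]
  | t' :: T => if t.2 == t'.2 then (t.1 + t'.1, t'.2) :: T else t' :: collect t T

/-- The lower chords of a standard curve. -/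
def lowChords (m i : ℕ) : ℕ → List ℕ → Chords
  | j, [] => [(32 * i - m, 32 * j + m)]
  | j, k :: t => (32 * j + m, 32 * k - m) :: lowChords m i k t

/-- The standard diagram of the curve around the punctures in `I`, with width given by `m`. -/
def stdLow (m : ℕ) (I : Finset ℕ) : Chords :=
  match [1, 2, 3, 4].filter (· ∈ I) with
  | [] => []
  | i :: t => lowChords m i i t

/-- The upper chords of the standard diagram of a curve. -/
def stdUp (m : ℕ) (I : Finset ℕ) : Chords :=
  ([1, 2, 3, 4].filter (· ∈ I)).map fun i => (32 * i - m, 32 * i + m)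

/-- The lower chords of a product of generators. -/
def wordLow : ℕ → List (Finset ℕ) → Chords
  | _, [] => []
  | m, I :: w => stdLow m I ++ wordLow (m + 1) w

/-- The upper chords of a product of generators. -/
def wordUp : ℕ → List (Finset ℕ) → Chords
  | _, [] => []
  | m, I :: w => stdUp m I ++ wordUp (m + 1) w

/-- Check that the diagram of a product of generators is well-formed and that its factors are right. -/
def checkWord : ℕ → List (Finset ℕ) → Bool
  | _, [] => true
  | m, I :: w => decide (WF (dg (stdLow m I) (stdUp m I))) &&
    decide (WF (dg (wordLow m (I :: w)) (wordUp m (I :: w)))) &&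
    (resolve 64 1 0 [] (stdLow m I) (stdUp m I) ==
      resolve 64 1 0 [] (genDiag I false) (genDiag I true)) && checkWord (m + 1) w

/-- Check a linear relation between products of generators. -/
def checkRel (T : List (ℤ × ℤ × List (Finset ℕ))) : Bool :=
  T.all (fun t => checkWord 1 t.2.2) &&
  ((T.flatMap fun t => resolve 64 t.1 (2 * t.2.1) [] (wordLow 1 t.2.2) (wordUp 1 t.2.2)).foldr
    collect []).all fun t => t.1 == 0




theorem pull_perm {p a : ℕ} {l t : Chords} (h : pull p l = some (a, t))
    (hl : ∀ c ∈ l, c.1 < c.2) : l.Perm (ch a p :: t) := by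
  induction l generalizing t with
  | nil => cases h
  | cons c l ih =>
    have hc := hl c List.mem_cons_self; simp only [pull, beq_iff_eq] at h; split_ifs at h with h1 h2
    · obtain ⟨rfl, rfl⟩ := Prod.mk.inj (Option.some.inj h); rw [ch, if_neg (by omega), ← h1]
    · obtain ⟨rfl, rfl⟩ := Prod.mk.inj (Option.some.inj h); rw [ch, if_pos (by omega), ← h2]
    · obtain ⟨⟨a', t'⟩, h3, h4⟩ := Option.map_eq_some_iff.1 h; obtain ⟨rfl, rfl⟩ := Prod.mk.inj h4
      exact ((ih h3 fun c hc => hl c (List.mem_cons_of_mem _ hc)).cons c).trans (.swap _ _ _)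

theorem ends_perm {l l' : Chords} (h : l.Perm l') : (ends l).Perm (ends l') :=
  h.flatMap_right _

theorem WF.sided_perm {σ : Bool} {L U L' U' : Chords} (h : WF (sided σ L U)) (h1 : L.Perm L')
    (h2 : U.Perm U') : WF (sided σ L' U') := by
  rw [WF.sided_iff] at h ⊢; have e1 := ends_perm h1; have e2 := ends_perm h2
  simpa only [← e1.nodup_iff, ← e2.nodup_iff, ← h1.mem_iff, ← h2.mem_iff, ← e1.mem_iff,
    ← e2.mem_iff] using h

theorem Planar.sided_perm {σ : Bool} {L U L' U' : Chords} (h : Planar (sided σ L U))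
    (h1 : L.Perm L') (h2 : U.Perm U') : Planar (sided σ L' U') := by
  rw [Planar.sided_iff] at h ⊢; simpa only [← h1.mem_iff, ← h2.mem_iff] using h

theorem WF.loop {σ : Bool} {L U : Chords} {c : ℕ × ℕ} (h : WF (sided σ (c :: L) (c :: U))) :
    WF (sided σ L U) := by
  rw [WF.sided_iff] at h ⊢
  simp only [ends_cons, List.nodup_cons, List.mem_cons, not_or, forall_eq_or_imp] at h
  obtain ⟨⟨⟨⟨-, a1⟩, a2, a3⟩, -, a4⟩, ⟨⟨⟨-, b1⟩, b2, b3⟩, -, b4⟩, h3, -, -, h4⟩ := h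
  refine ⟨⟨a3, a4⟩, ⟨b3, b4⟩, fun n => ⟨fun hn => ?_, fun hn => ?_⟩, h4⟩
  · refine ((h3 n).1 (.inr (.inr hn))).resolve_left ?_ |>.resolve_left ?_ <;> rintro rfl
    exacts [a1 hn, a2 hn]
  · refine ((h3 n).2 (.inr (.inr hn))).resolve_left ?_ |>.resolve_left ?_ <;> rintro rfl
    exacts [b1 hn, b2 hn]

variable (R : Type*) [CommRing R] (q : Rˣ)

theorem step_spec {σ b : Bool} {L U L' U' : Chords} (h : step L U = some (b, L', U'))
    (hD : WF (sided σ L U)) (hp : Planar (sided σ L U)) :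
    WF (sided σ L' U') ∧ Planar (sided σ L' U') ∧ sk R q (sided σ L U) =
      (if b then -((q : R) ^ 2 + ((q⁻¹ : Rˣ) : R) ^ 2) else 1) • sk R q (sided σ L' U') := by
  simp only [step, Option.bind_eq_some_iff] at h; obtain ⟨⟨p, r⟩, h1, ⟨a, L₁⟩, h2, h⟩ := h
  have hU := List.mem_of_find?_eq_some h1; have hadj := List.find?_some h1
  have hs := WF.sided_iff.1 hD; have hpr : p < r := hs.2.1.2 _ hU
  have pU := List.perm_cons_erase hU; have pL := pull_perm h2 hs.1.2
  simp only [adjacent, Bool.and_eq_true, List.all_eq_true, Bool.or_eq_true, Nat.ble_eq] at hadj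
  have hk : ∀ k : ℕ, 1 ≤ k → k ≤ 4 → (p < 32 * k ∧ r < 32 * k) ∨ (32 * k < p ∧ 32 * k < r) := by
    intro k k1 k4; have i1 := hadj.2 (32 * k) (by interval_cases k <;> simp)
    have i2 := hD.gap (s := !σ) (n := p) (mem_ends.2 ⟨_, by rw [sided_not]; exact hU, .inl rfl⟩) k1 k4
    have i3 := hD.gap (s := !σ) (n := r) (mem_ends.2 ⟨_, by rw [sided_not]; exact hU, .inr rfl⟩) k1 k4
    omega
  have perm : ∀ {L₂ U₂ : Chords}, L.Perm L₂ → U.Perm U₂ →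
      sk R q (sided σ L U) = sk R q (sided σ L₂ U₂) := fun e1 e2 =>
    sk_perm R q hD hp fun s => by unfold sided; split_ifs <;> assumption
  simp only [beq_iff_eq] at h; split_ifs at h with har
  · obtain ⟨rfl, rfl, rfl⟩ : true = b ∧ L₁ = L' ∧ U.erase (p, r) = U' := by simpa using h
    rw [har, ch, if_neg (by omega)] at pL; have wf := hD.sided_perm pL pU
    have pl := hp.sided_perm pL pU; refine ⟨wf.loop, ?_, ?_⟩
    · rw [Planar.sided_iff] at pl ⊢
      exact ⟨fun a ha b hb => pl.1 a (.tail _ ha) b (.tail _ hb),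
        fun a ha b hb => pl.2 a (.tail _ ha) b (.tail _ hb)⟩
    · have e : (fun s => dg [(p, r)] [(p, r)] s ++ sided σ L₁ (U.erase (p, r)) s) =
          sided σ ((p, r) :: L₁) ((p, r) :: U.erase (p, r)) := by
        ext1 s; unfold sided; cases s <;> cases σ <;> rfl
      have w0 : WF (dg [(p, r)] [(p, r)]) := fun s => by
        have n1 := (WF.sided_iff.1 wf).2.2.2 p (by simp [ends_cons])
        have n2 := (WF.sided_iff.1 wf).2.2.2 r (by simp [ends_cons])
        cases s <;> simp [dg, ends, hpr, hpr.ne, n1, n2]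
      rw [perm pL pU, ← e, ← sk_mul R q w0 wf.loop (e ▸ wf), sk_loop R q hpr hk, smul_one_mul]; rfl
  · obtain ⟨⟨b', L₂⟩, h3, h⟩ := Option.bind_eq_some_iff.1 h; split_ifs at h with ho
    obtain ⟨rfl, rfl, rfl⟩ : false = b ∧ ch a b' :: L₂ = L' ∧ U.erase (p, r) = U' := by simpa using h
    have lt₁ : ∀ c ∈ L₁, c.1 < c.2 := fun c hc => hs.1.2 c (pL.mem_iff.2 (.tail _ hc))
    replace pL := pL.trans ((pull_perm h3 lt₁).cons _); have nd := (ends_perm pL).nodup_iff.1 hs.1.1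
    rw [((ends_ch _ _ _).trans (((ends_ch _ _ _).cons _).cons _)).nodup_iff] at nd
    simp only [List.nodup_cons, List.mem_cons, not_or] at nd
    have hn : ∀ n ∈ ends L₂, (n < p ↔ n < r) := by
      intro n hn
      have i1 := hadj.1 n ((hs.2.2.1 n).1 ((ends_perm pL).mem_iff.2 (by
        rw [((ends_ch _ _ _).trans (((ends_ch _ _ _).cons _).cons _)).mem_iff]; simp [hn])))
      have i2 : n ≠ p := by rintro rfl; exact nd.2.1.2.2 hn
      have i3 : n ≠ r := by rintro rfl; exact nd.2.2.2.1 hn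
      omega
    rcases ho with ho | ho
    · have e : ch p r = (p, r) := if_pos hpr
      replace pU : U.Perm (ch p r :: U.erase (p, r)) := by rw [e]; exact pU
      have wf := hD.sided_perm pL pU; have pl := hp.sided_perm pL pU
      exact ⟨wf.turn, pl.turn wf ho hn, by
        rw [perm pL pU, sk_turn R q wf pl ho hn hk]; simp⟩
    · have e : ch r p = (p, r) := if_neg (by omega)
      have e' : ch b' a = ch a b' := by
        have : a ≠ b' := nd.1.2.1; unfold ch; split_ifs <;> first | rfl | omega
      replace pU : U.Perm (ch r p :: U.erase (p, r)) := by rw [e]; exact pU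
      replace pL := pL.trans (.swap _ _ _); have wf := hD.sided_perm pL pU
      have pl := hp.sided_perm pL pU; rw [← e']
      exact ⟨wf.turn, pl.turn wf ho fun n h => (hn n h).symm, by
        rw [perm pL pU, sk_turn R q wf pl ho (fun n h => (hn n h).symm) fun k k1 k4 =>
          (hk k k1 k4).imp And.symm And.symm]; simp⟩

/-- The value of a term. -/
def Term.val (t : Term) : SkeinAlgebra R q :=
  ((t.1 : R) * (q ^ t.2.1 : Rˣ)) • sk R q (dg t.2.2.1 t.2.2.2)

/-- The value of a linear combination. -/
def value (T : List Term) : SkeinAlgebra R q := (T.map (Term.val R q)).sum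

variable {R q}

theorem value_append (T T' : List Term) : value R q (T ++ T') = value R q T + value R q T' := by
  simp [value]

theorem value_singleton (t : Term) : value R q [t] = t.val R q := by simp [value]

theorem val_loop {c e : ℤ} {l u l' u' : Chords} (h : sk R q (dg l u) =
    (-((q : R) ^ 2 + ((q⁻¹ : Rˣ) : R) ^ 2)) • sk R q (dg l' u')) : Term.val R q (c, e, l, u) =
      Term.val R q (-c, e + 2, l', u') + Term.val R q (-c, e - 2, l', u') := by
  simp only [Term.val, h, zpow_add, zpow_sub, Units.val_mul, zpow_ofNat, inv_pow, Units.val_pow_eq_pow_val,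
    ← Units.val_pow_eq_pow_val q⁻¹, Int.cast_neg]
  module

theorem val_crossing {c e : ℤ} {l u l' u' l'' u'' : Chords} (h : sk R q (dg l u) =
    (q : R) • sk R q (dg l' u') + ((q⁻¹ : Rˣ) : R) • sk R q (dg l'' u'')) :
    Term.val R q (c, e, l, u) =
      Term.val R q (c, e + 1, l', u') + Term.val R q (c, e - 1, l'', u'') := by
  simp only [Term.val, h, zpow_add, zpow_sub, zpow_one, Units.val_mul]; module

theorem dg_eq_sided (l u : Chords) : dg l u = sided false l u ∧ dg l u = sided true u l := by
  constructor <;> ext1 s <;> cases s <;> rfl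

theorem sk_canon {l u : Chords} (hD : WF (dg l u)) :
    sk R q (dg (canon l u).1 (canon l u).2) = sk R q (dg l u) := by
  simp only [canon]; split_ifs with h
  · obtain ⟨h1, h2, h3⟩ := h; set f := label (ends l)
    have e : (fun s => (dg l u s).map (Prod.map f f)) =
        dg (l.map (Prod.map f f)) (u.map (Prod.map f f)) := by ext1 s; cases s <;> rfl
    rw [← sk_relabel R q f (e ▸ h1) (fun s => (hD s).2.1) (fun s n hn => ((hD s).2.2 n hn).1)
      (fun n hn => (h3 n hn).1)
      (fun n hn k k1 k4 => (h3 n hn).2 k (by interval_cases k <;> simp)), e]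
    refine (sk_perm R q h1 h2 fun s => ?_).symm
    cases s <;> exact (List.perm_insertionSort _ _).symm
  · rfl

theorem value_reduce (n : ℕ) (c e : ℤ) {l u : Chords} (hD : WF (dg l u))
    (hp : Planar (dg l u)) : value R q (reduce n c e l u) = Term.val R q (c, e, l, u) := by
  induction n generalizing c e l u with
  | zero => simp [reduce, value]
  | succ n ih =>
    have k1 := fun b l' u' (h : step l u = some (b, l', u')) => by
      have := step_spec R q (σ := false) h; simp only [← (dg_eq_sided _ _).1] at this
      exact this hD hp
    have k2 := fun b l' u' (h : step u l = some (b, u', l')) => by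
      have := step_spec R q (σ := true) h; simp only [← (dg_eq_sided _ _).2] at this
      exact this hD hp
    simp only [reduce]
    split
    · next h =>
      obtain ⟨w, p, e⟩ := k1 _ _ _ h; rw [value_append, ih _ _ w p, ih _ _ w p, val_loop e]
    · next h =>
      obtain ⟨w, p, e⟩ := k1 _ _ _ h; rw [ih _ _ w p]; simp [Term.val, e]
    · split
      · next h =>
        obtain ⟨w, p, e⟩ := k2 _ _ _ h; rw [value_append, ih _ _ w p, ih _ _ w p, val_loop e]
      · next h =>
        obtain ⟨w, p, e⟩ := k2 _ _ _ h; rw [ih _ _ w p]; simp [Term.val, e]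
      · simp [value_singleton, Term.val, sk_canon hD]

theorem value_resolve (n : ℕ) (c e : ℤ) {X t u : Chords} (hD : WF (dg (X ++ t) u)) :
    value R q (resolve n c e X t u) = Term.val R q (c, e, X ++ t, u) := by
  induction n generalizing c e X t with
  | zero => simp [resolve, value]
  | succ n ih =>
    match t with
    | [] =>
      rw [List.append_nil] at hD ⊢; simp only [resolve]; split_ifs with h
      · exact value_reduce _ _ _ hD h
      · exact value_singleton _
    | α :: t =>
      simp only [resolve]
      have ht := List.takeWhile_append_dropWhile (p := fun b => !cross α b) (l := t)
      have hM : ∀ b ∈ t.takeWhile (fun b => !cross α b), cross α b = false := fun b hb => by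
        simpa using List.mem_takeWhile_imp hb
      split
      · rw [ih _ _ (by simpa using hD)]; simp
      · next β Y hY =>
        rw [hY] at ht; set M := t.takeWhile fun b => !cross α b; rw [← ht] at hD ⊢
        have hc := sk_commute R q hD hM
        have hw : WF (dg ((X ++ M) ++ α :: β :: Y) u) := hD.of_ends (List.perm_iff_count.2 fun n => by
          simp only [ends_append, ends_cons, List.count_append, List.count_cons]; omega) fun a ha =>
            (hD false).2.1 a (by
              simp only [dg, cond, List.mem_append, List.mem_cons] at ha ⊢; tauto)
        rw [← List.append_assoc] at hc
        have new : ∀ γ δ : ℕ × ℕ, γ.1 < γ.2 → δ.1 < δ.2 →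
            (∀ n, [α.1, α.2, β.1, β.2].count n = [γ.1, γ.2, δ.1, δ.2].count n) → WF (dg (X ++ (M ++ γ :: δ :: Y)) u) := by
          intro γ δ hγ hδ hp; refine hw.of_ends ?_ fun a ha => ?_
          · simpa [ends_append, ends_cons] using
              List.Perm.append_left _ (List.Perm.append_left _ ((List.perm_iff_count.2 hp).append_right _))
          · simp only [List.mem_append, List.mem_cons] at ha; rcases ha with h | h | rfl | rfl | h
            exacts [(hw false).2.1 a (by simp [dg, h]), (hw false).2.1 a (by simp [dg, h]), hγ, hδ,
              (hw false).2.1 a (by simp [dg, h])]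
        split_ifs with h1 h2
        · have hx := sk_crossing_pos R q (e := α.1) (f := α.2) (g := β.1) (h := β.2) hw h1
          rw [← hc, List.append_assoc, List.append_assoc] at hx
          rw [value_append, ih _ _ (new (α.1, β.1) (α.2, β.2) h1.1 h1.2.2 fun n => by simp only [List.count_cons]; omega),
            ih _ _ (new (β.1, α.2) (α.1, β.2) h1.2.1 (by simp only; omega) fun n => by
              simp only [List.count_cons]; omega), ← val_crossing hx]
        · have hx := sk_crossing_neg R q (e := β.1) (f := β.2) (g := α.1) (h := α.2) hw h2
          rw [← hc, List.append_assoc, List.append_assoc] at hx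
          rw [value_append, ih _ _ (new (α.1, β.2) (β.1, α.2) h2.2.1 (by simp only; omega) fun n => by
              simp only [List.count_cons]; omega),
            ih _ _ (new (β.1, α.1) (β.2, α.2) h2.1 h2.2.2 fun n => by simp only [List.count_cons]; omega), ← val_crossing hx]
        · rw [value_singleton, ht]

theorem value_collect (t : Term) (T : List Term) :
    value R q (collect t T) = t.val R q + value R q T := by
  induction T with
  | nil => simp [collect, value]
  | cons t' T ih =>
    have e : ∀ t T, value R q (t :: T) = t.val R q + value R q T := fun _ _ => by simp [value]
    simp only [collect, beq_iff_eq]; split_ifs with h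
    · simp only [e, ← add_assoc, Term.val, h, Int.cast_add, add_mul, add_smul]
    · rw [e, e, ih]; abel

theorem sk_word {m : ℕ} {w : List (Finset ℕ)} (h : checkWord m w = true) :
    (w.map (gen R q)).prod = sk R q (dg (wordLow m w) (wordUp m w)) ∧
      WF (dg (wordLow m w) (wordUp m w)) := by
  induction w generalizing m with
  | nil =>
    have e : dg [] [] = fun _ => [] := by ext1 s; cases s <;> rfl
    refine ⟨?_, by unfold wordLow wordUp; decide⟩
    simp only [List.map_nil, List.prod_nil, wordLow, wordUp, e, sk_nil]
  | cons I w ih =>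
    simp only [checkWord, Bool.and_eq_true, decide_eq_true_eq, beq_iff_eq] at h
    obtain ⟨⟨⟨h1, h2⟩, h3⟩, h4⟩ := h; obtain ⟨h5, h6⟩ := ih h4
    have v : ∀ l u, WF (dg l u) → value R q (resolve 64 1 0 [] l u) = sk R q (dg l u) := by
      intro l u hD; rw [value_resolve (X := []) _ _ _ hD]; simp [Term.val]
    have hg : dg (genDiag I false) (genDiag I true) = genDiag I := by ext1 s; cases s <;> rfl
    have e : (fun s => dg (stdLow m I) (stdUp m I) s ++ dg (wordLow (m + 1) w) (wordUp (m + 1) w) s) =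
        dg (wordLow m (I :: w)) (wordUp m (I :: w)) := by ext1 s; cases s <;> rfl
    refine ⟨?_, h2⟩
    rw [List.map_cons, List.prod_cons, h5, gen_eq_sk, ← hg, ← v _ _ (hg ▸ (genDiag_spec I).1), ← h3,
      v _ _ h1, sk_mul R q h1 h6 (e ▸ h2), e]

/-- Relations between products of generators may be checked by evaluating chord diagrams. -/
theorem rel_of_checkRel (R : Type*) [CommRing R] (q : Rˣ) (T : List (ℤ × ℤ × List (Finset ℕ)))
    (h : checkRel T = true) :
    (T.map fun t => ((t.1 : R) * (q ^ (2 * t.2.1) : Rˣ)) • (t.2.2.map (gen R q)).prod).sum = 0 := by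
  simp only [checkRel, Bool.and_eq_true] at h; obtain ⟨h1, h2⟩ := h
  have e : ∀ T : List Term, value R q (T.foldr collect []) = value R q T := by
    intro T
    induction T with
    | nil => rfl
    | cons t T ih => rw [List.foldr_cons, value_collect, ih]; simp [value]
  have z : ∀ T : List Term, (T.all fun t => t.1 == 0) = true → value R q T = 0 := by
    intro T hT; refine List.sum_eq_zero fun x hx => ?_; obtain ⟨t, ht, rfl⟩ := List.mem_map.1 hx
    have := List.all_eq_true.1 hT t ht
    rw [Term.val, beq_iff_eq.1 this, Int.cast_zero, zero_mul, zero_smul]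
  rw [← z _ h2, e]; clear h2
  induction T with
  | nil => rfl
  | cons t T ih =>
    simp only [List.all_cons, Bool.and_eq_true] at h1
    obtain ⟨k1, k2⟩ := sk_word (R := R) (q := q) h1.1
    rw [List.map_cons, List.sum_cons, List.flatMap_cons, value_append, ih h1.2,
      value_resolve _ _ _ (by simpa using k2), k1]
    rfl


end Skein
end

set_option maxHeartbeats 1000000 in
theorem mainTheorem2 (R : Type*) [CommRing R] (s : Rˣ) (q q' α : R) (hq : q = (s : R) ^ 2)
    (hq' : q' = ((s⁻¹ : Rˣ) : R) ^ 2) (hα : α = q + q')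
    (t : Finset ℕ → Skein.SkeinAlgebra R s) (ht : t = Skein.gen R s) :
    -- the product `t₁₃ t₂₄`
    (t {1, 3} * t {2, 4} =
      α • t {1, 2, 3, 4} + t {1} * t {2, 3, 4} + t {2} * t {1, 3, 4} + t {3} * t {1, 2, 4}
        + t {4} * t {1, 2, 3} + q ^ 2 • (t {1, 2} * t {3, 4}) + q' ^ 2 • (t {1, 4} * t {2, 3})
        + q • (t {3} * t {4} * t {1, 2}) + q' • (t {1} * t {4} * t {2, 3})
        + q • (t {1} * t {2} * t {3, 4}) + q' • (t {2} * t {3} * t {1, 4})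
        + t {1} * t {2} * t {3} * t {4}) ∧
    -- the product `t₂₄ t₁₃₄`
    (t {2, 4} * t {1, 3, 4} =
      q ^ 2 • (t {1, 4} * t {2, 3, 4}) + q' ^ 2 • (t {3, 4} * t {1, 2, 4})
        + (1 - q ^ 2 - q' ^ 2) • (t {4} * t {1, 2, 3, 4}) - (q ^ 3 + q' ^ 3) • t {1, 2, 3}
        - q ^ 2 • (t {1} * t {2, 3}) - q' ^ 2 • (t {3} * t {1, 2})
        + t {2} * (q • (t {1, 4} * t {3, 4}) - q ^ 2 • t {1, 3} - q • (t {4} * t {1, 3, 4}))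
        - q • (t {1} * t {2} * t {3})) ∧
    -- the square `t₁₂₃ ^ 2`
    (t {1, 2, 3} ^ 2 =
      q' • (t {1, 2} * t {2, 3} * t {1, 3})
        - (t {1} * t {2} * t {3} + q • (t {1} * t {2, 3}) + q' • (t {2} * t {1, 3})
            + q' • (t {3} * t {1, 2})) * t {1, 2, 3}
        - (t {1} ^ 2 + t {2} ^ 2 + t {3} ^ 2) + α ^ 2 • (1 : Skein.SkeinAlgebra R s)
        - (q • (t {2} * t {3} * t {2, 3}) + q' • (t {1} * t {3} * t {1, 3})
            + q' • (t {1} * t {2} * t {1, 2}))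
        - (q ^ 2 • t {2, 3} ^ 2 + q' ^ 2 • t {1, 3} ^ 2 + q' ^ 2 • t {1, 2} ^ 2)) ∧
    -- the product `t₁₂₃ t₂₃₄`
    (t {1, 2, 3} * t {2, 3, 4} =
      (t {2, 3} + q • (t {2} * t {3})) * t {1, 2, 3, 4} + q' • (t {1, 2} * t {2, 3} * t {3, 4})
        - q' • (t {3} * t {1, 2} * t {2, 3, 4}) - q • (t {2} * t {3, 4} * t {1, 2, 3})
        + q ^ 2 • (t {2} * t {1, 2, 4}) + q' ^ 2 • (t {3} * t {1, 3, 4})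
        - q' ^ 2 • (t {1, 2} * t {2, 4}) - q' ^ 2 • (t {1, 3} * t {3, 4})
        + (q - q') • (t {2} * t {4} * t {1, 2})
        + q' ^ 2 • (α • t {1, 4} + t {1} * t {4})) ∧
    -- the product `t₁₂₃ t₁₃₄`
    (t {1, 2, 3} * t {1, 3, 4} =
      t {1, 3} * t {1, 2, 3, 4} + t {1, 2} * t {1, 4} + t {2, 3} * t {3, 4} - t {1} * t {1, 2, 4}
        - t {3} * t {2, 3, 4} - α • t {2, 4} - t {2} * t {4}) ∧
    -- the product `t₂₃ t₃₄ t₁₂₄`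
    (t {2, 3} * t {3, 4} * t {1, 2, 4} =
      (q • t {2, 3, 4} + q ^ 2 • (t {2} * t {3, 4}) + t {3} * t {2, 4} + t {4} * t {2, 3}
          + q • (t {2} * t {3} * t {4})) * t {1, 2, 3, 4}
        + (t {2} * t {4} + q' • t {2, 4}) * t {1, 2, 4} + q ^ 3 • (t {3, 4} * t {1, 3, 4})
        + q' • (t {2, 3} * t {1, 2, 3}) + t {3} * t {2, 3} * t {1, 2}
        + q ^ 2 • (t {3} * t {1, 4} * t {3, 4}) + q • (t {2} * t {1, 2})
        - q ^ 3 • (t {3} * t {1, 3}) + q • (t {4} * t {1, 4}) - q ^ 2 • (t {1} * t {3} ^ 2)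
        + (q * α) • t {1}) ∧
    -- the product `t₁₄ t₁₂ t₂₃ t₃₄`
    (t {1, 4} * t {1, 2} * t {2, 3} * t {3, 4} =
      q ^ 2 • t {1, 2, 3, 4} ^ 2
        + q ^ 2 • ((q' • (t {1} * t {2, 3, 4}) + q • (t {4} * t {1, 2, 3})
            + t {1} * t {4} * t {2, 3} - t {2} * t {3} * t {1, 4}) * t {1, 2, 3, 4})
        + t {2, 3, 4} ^ 2 + q ^ 4 • t {1, 2, 3} ^ 2
        + t {3} * t {1, 4} * t {1, 2} * t {2, 3, 4}
        + q ^ 2 • (t {2} * t {1, 4} * t {3, 4} * t {1, 2, 3})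
        + q • (t {4} * t {2, 3} * t {2, 3, 4}) - q' • (t {3} * t {1, 4} * t {1, 3, 4})
        + q ^ 3 • (t {1} * t {2, 3} * t {1, 2, 3}) - q ^ 3 • (t {2} * t {1, 4} * t {1, 2, 4})
        + q' • (t {1, 4} * t {1, 2} * t {2, 4}) + q' • (t {1, 4} * t {1, 3} * t {3, 4})
        + (1 - q ^ 2) • (t {2} * t {4} * t {1, 4} * t {1, 2})
        - q' ^ 2 • t {1, 4} ^ 2 + q ^ 2 • t {2, 3} ^ 2
        + (q - q') • (t {1} * t {4} * t {1, 4})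
        + q ^ 2 • (t {1} ^ 2 + t {4} ^ 2 - α ^ 2 • (1 : Skein.SkeinAlgebra R s))) := by
  have z : ∀ k : ℕ, ((s ^ (2 * (k : ℤ)) : Rˣ) : R) = q ^ k := fun k => by
    rw [hq, zpow_mul, zpow_natCast, Units.val_pow_eq_pow_val, ← Units.val_pow_eq_pow_val s 2]; rfl
  have z' : ∀ k : ℕ, ((s ^ (2 * -(k : ℤ)) : Rˣ) : R) = q' ^ k := fun k => by
    rw [hq', mul_neg, ← inv_zpow', zpow_mul, zpow_natCast, Units.val_pow_eq_pow_val,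
      ← Units.val_pow_eq_pow_val s⁻¹ 2]; rfl
  have z0 := z 0
  have z1 := z 1
  have z2 := z 2
  have z3 := z 3
  have z4 := z 4
  have y1 := z' 1
  have y2 := z' 2
  have y3 := z' 3
  simp only [Nat.cast_zero, Nat.cast_one, Nat.cast_ofNat, pow_zero] at z0 z1 z2 z3 z4 y1 y2 y3
  have hqq : q * q' = 1 := by rw [hq, hq', ← mul_pow, Units.mul_inv, one_pow]
  subst ht hα
  clear hq hq' z z'
  have key : ∀ (T) (_ : Skein.checkRel T = true) {x y : Skein.SkeinAlgebra R s}, (_ : _ = _) → x = y :=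
    fun T h x y e => sub_eq_zero.1 (e.trans (neg_eq_zero.2 (Skein.rel_of_checkRel R s T h)))
  refine ⟨key [(-1, 0, [{1, 3}, {2, 4}]), (1, 1, [{1, 2, 3, 4}]), (1, -1, [{1, 2, 3, 4}]), (1, 0,
      [{1}, {2, 3, 4}]), (1, 0, [{2}, {1, 3, 4}]), (1, 0, [{3}, {1, 2, 4}]), (1, 0, [{4}, {1, 2,
      3}]), (1, 2, [{1, 2}, {3, 4}]), (1, -2, [{1, 4}, {2, 3}]), (1, 1, [{3}, {4}, {1, 2}]), (1,
      -1, [{1}, {4}, {2, 3}]), (1, 1, [{1}, {2}, {3, 4}]), (1, -1, [{2}, {3}, {1, 4}]), (1, 0,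
      [{1}, {2}, {3}, {4}])] (by decide +kernel) ?_,
    key [(-1, 0, [{2, 4}, {1, 3, 4}]), (1, 2, [{1, 4}, {2, 3, 4}]), (1, -2, [{3, 4}, {1, 2, 4}]),
      (-1, 2, [{4}, {1, 2, 3, 4}]), (1, 0, [{4}, {1, 2, 3, 4}]), (-1, -2, [{4}, {1, 2, 3, 4}]),
      (-1, 3, [{1, 2, 3}]), (-1, -3, [{1, 2, 3}]), (-1, 2, [{1}, {2, 3}]), (-1, -2, [{3}, {1,
      2}]), (1, 1, [{2}, {1, 4}, {3, 4}]), (-1, 2, [{2}, {1, 3}]), (-1, 1, [{2}, {4}, {1, 3, 4}]),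
      (-1, 1, [{1}, {2}, {3}])] (by decide +kernel) ?_,
    key [(-1, 0, [{1, 2, 3}, {1, 2, 3}]), (1, -1, [{1, 2}, {2, 3}, {1, 3}]), (-1, 0, [{1}, {2},
      {3}, {1, 2, 3}]), (-1, 1, [{1}, {2, 3}, {1, 2, 3}]), (-1, -1, [{2}, {1, 3}, {1, 2, 3}]),
      (-1, -1, [{3}, {1, 2}, {1, 2, 3}]), (-1, 0, [{1}, {1}]), (-1, 0, [{2}, {2}]), (-1, 0, [{3},
      {3}]), (1, 2, []), (2, 0, []), (1, -2, []), (-1, 1, [{2}, {3}, {2, 3}]), (-1, -1, [{1}, {3},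
      {1, 3}]), (-1, -1, [{1}, {2}, {1, 2}]), (-1, 2, [{2, 3}, {2, 3}]), (-1, -2, [{1, 3}, {1,
      3}]), (-1, -2, [{1, 2}, {1, 2}])] (by decide +kernel) ?_,
    key [(-1, 0, [{1, 2, 3}, {2, 3, 4}]), (1, 0, [{2, 3}, {1, 2, 3, 4}]), (1, 1, [{2}, {3}, {1, 2,
      3, 4}]), (1, -1, [{1, 2}, {2, 3}, {3, 4}]), (-1, -1, [{3}, {1, 2}, {2, 3, 4}]), (-1, 1,
      [{2}, {3, 4}, {1, 2, 3}]), (1, 2, [{2}, {1, 2, 4}]), (1, -2, [{3}, {1, 3, 4}]), (-1, -2,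
      [{1, 2}, {2, 4}]), (-1, -2, [{1, 3}, {3, 4}]), (1, 1, [{2}, {4}, {1, 2}]), (-1, -1, [{2},
      {4}, {1, 2}]), (1, -1, [{1, 4}]), (1, -3, [{1, 4}]), (1, -2, [{1}, {4}])]
      (by decide +kernel) ?_,
    key [(-1, 0, [{1, 2, 3}, {1, 3, 4}]), (1, 0, [{1, 3}, {1, 2, 3, 4}]), (1, 0, [{1, 2}, {1,
      4}]), (1, 0, [{2, 3}, {3, 4}]), (-1, 0, [{1}, {1, 2, 4}]), (-1, 0, [{3}, {2, 3, 4}]), (-1,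
      1, [{2, 4}]), (-1, -1, [{2, 4}]), (-1, 0, [{2}, {4}])] (by decide +kernel) ?_,
    key [(-1, 0, [{2, 3}, {3, 4}, {1, 2, 4}]), (1, 1, [{2, 3, 4}, {1, 2, 3, 4}]), (1, 2, [{2}, {3,
      4}, {1, 2, 3, 4}]), (1, 0, [{3}, {2, 4}, {1, 2, 3, 4}]), (1, 0, [{4}, {2, 3}, {1, 2, 3,
      4}]), (1, 1, [{2}, {3}, {4}, {1, 2, 3, 4}]), (1, 0, [{2}, {4}, {1, 2, 4}]), (1, -1, [{2, 4},
      {1, 2, 4}]), (1, 3, [{3, 4}, {1, 3, 4}]), (1, -1, [{2, 3}, {1, 2, 3}]), (1, 0, [{3}, {2, 3},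
      {1, 2}]), (1, 2, [{3}, {1, 4}, {3, 4}]), (1, 1, [{2}, {1, 2}]), (-1, 3, [{3}, {1, 3}]), (1,
      1, [{4}, {1, 4}]), (-1, 2, [{1}, {3}, {3}]), (1, 2, [{1}]), (1, 0, [{1}])]
      (by decide +kernel) ?_,
    key [(-1, 0, [{1, 4}, {1, 2}, {2, 3}, {3, 4}]), (1, 2, [{1, 2, 3, 4}, {1, 2, 3, 4}]), (1, 1,
      [{1}, {2, 3, 4}, {1, 2, 3, 4}]), (1, 3, [{4}, {1, 2, 3}, {1, 2, 3, 4}]), (1, 2, [{1}, {4},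
      {2, 3}, {1, 2, 3, 4}]), (-1, 2, [{2}, {3}, {1, 4}, {1, 2, 3, 4}]), (1, 0, [{2, 3, 4}, {2, 3,
      4}]), (1, 4, [{1, 2, 3}, {1, 2, 3}]), (1, 0, [{3}, {1, 4}, {1, 2}, {2, 3, 4}]), (1, 2, [{2},
      {1, 4}, {3, 4}, {1, 2, 3}]), (1, 1, [{4}, {2, 3}, {2, 3, 4}]), (-1, -1, [{3}, {1, 4}, {1, 3,
      4}]), (1, 3, [{1}, {2, 3}, {1, 2, 3}]), (-1, 3, [{2}, {1, 4}, {1, 2, 4}]), (1, -1, [{1, 4},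
      {1, 2}, {2, 4}]), (1, -1, [{1, 4}, {1, 3}, {3, 4}]), (-1, 2, [{2}, {4}, {1, 4}, {1, 2}]),
      (1, 0, [{2}, {4}, {1, 4}, {1, 2}]), (-1, -2, [{1, 4}, {1, 4}]), (1, 2, [{2, 3}, {2, 3}]),
      (1, 1, [{1}, {4}, {1, 4}]), (-1, -1, [{1}, {4}, {1, 4}]), (1, 2, [{1}, {1}]), (1, 2, [{4},
      {4}]), (-1, 4, []), (-2, 2, []), (-1, 0, [])] (by decide +kernel) ?_⟩
  all_goals
    simp only [List.map_cons, List.map_nil, List.sum_cons, List.sum_nil, List.prod_cons,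
      List.prod_nil, z0, z1, z2, z3, z4, y1, y2, y3]
    simp only [mul_add, add_mul, mul_sub, sub_mul, smul_add, smul_sub, smul_smul, smul_mul_assoc,
      mul_smul_comm, pow_two, mul_assoc, mul_one]
    match_scalars <;> push_cast <;> first
      | ring1
      | linear_combination -hqq
      | linear_combination -2 * hqq
      | linear_combination -q * hqq
      | linear_combination -q' * hqq
      | linear_combination (2 * q ^ 2 + q * q' + 1) * hqq
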